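/- Let $k\in\mathbb N$ and let $\mathbf d\in\mathbb N^{k\times k}$ be an expanding degree matrix: (1) $\mathbf d_{ij}>0$ implies $\mathbf d_{ji}>0$; (2) $\frac{\mathbf d_{ij}}{\mathbf d_{ji}}\cdot\frac{\mathbf d_{j\ell}}{\mathbf d_{\ell j}}=\frac{\mathbf d_{i\ell}}{\mathbf d_{\ell i}}$ whenever $\mathbf d_{ji},\mathbf d_{\ell j},\mathbf d_{\ell i}\ne0$; (3) $\mathbf d$ is irreducible; (4) $\max_i\sum_j\mathbf d_{ij}\ge3$ and $\min_i\sum_j\mathbf d_{ij}\ge2$. Let $\mathcal G(N,\mathbf d)$ be a uniformly random simple graph on $N$ vertices $V_1\sqcup\dots\sqcup V_k$ in which every vertex of $V_i$ has exactly $\mathbf d_{ij}$ neighbours in $V_j$ (the sizes $|V_i|=q_iN$ are forced: $q_i\mathbf d_{ij}=q_j\mathbf d_{ji}$, $q_i\ge 0$, $\sum_iq_i=1$). Let $\mathcal T_{\mathbf d}$ be its universal cover, the infinite tree with vertices of types $1,\dots,k$ in which each vertex of type $i$ has $\mathbf d_{ij}$ neighbours of type $j$. For a separable metrizable space $Y$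 and a labelling $f:V(\mathcal G)\to Y$, let $\mathrm{distr}^*(f)$ be the law on $Y^{V(\mathcal T_{\mathbf d})}$ of $f\circ\pi$, where $\pi:\mathcal T_{\mathbf d}\to\mathcal G$ is a uniformly random type-preserving covering map. A Borel probability measure $\mu$ on $Y^{V(\mathcal T_{\mathbf d})}$ is typical if there is an increasing sequence of sizes $N$ such that, for independent $\mathcal G_N\sim\mathcal G(N,\mathbf d)$, almost surely there are labellings $f_N:V(\mathcal G_N)\to Y$ for which $\mathrm{distr}^*(f_N)$ converges weakly to $\mu$. For a vertex $o$ let $C_o$ be $o$ together with its neighbours, and for $v\sim o$ let $e_{ov}=\{o,v\}$. Let $\mathbb E_o$ be the average over a root $o$ that is of type $i$ with probability $q_i$ (any vertex of type $i$ may be used as representative). Let $\mathbb H$ be the Shannon entropy, and let $\mu_\Gamma$ be the marginal of $\mu$ on $\Gamma$. If $\mu$ is typical, then $\Delta_0(\mu)\ge0$, in the following sense. (a) For every separable metrizable $Y$, every typical $\mu$ on $Y^{V(\mathcal T_{\mathbf d})}$ and every partition of $Y$ into countably many Borel sets for which the discretized label of each vertex has finite entropy, $$\mathbb E_o\Big[\mathbb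 H(\bar\mu_{C_o})-\tfrac12\sum_{v\sim o}\mathbb H(\bar\mu_{e_{ov}})\Big]\ge0,$$ where $\bar\mu$ is the law of the process in which each label is replaced by the partition cell that contains it. (In particular, for countable discrete $Y$ this holds with $\bar\mu=\mu$.) (b) Let $Y=\mathbb R$, $\lambda\in\mathbb R$, and let $\mu$ be a typical process with finite second moments such that $\lambda X_u=\sum_{v\sim u}X_v$ almost surely for every vertex $u$. For finite $\Gamma$ fix an orthonormal basis $\chi_1,\dots,\chi_n$ of the orthogonal complement in $\mathbb R^\Gamma$ of the vectors $\lambda\delta_u-\sum_{v\sim u}\delta_v$, for the $u\in\Gamma$ all of whose neighbours lie in $\Gamma$, and let $\mu_{\Gamma,a}$ be the law of $\frac1a(\lfloor a\langle X,\chi_1\rangle\rfloor,\dots,\lfloor a\langle X,\chi_n\rangle\rfloor)$. Suppose that either for every root type the law of $(\langle X,\chi_j\rangle)_j$ on the star $C_o$ has a density $g$ with $g\log g$ integrable, or for every root type this law is discrete with finite Shannon entropy. Then the limit $$\Delta_0(\mu)=\lim_{a\to\infty}\mathbb E_o\Big[\mathbb H(\mu_{C_o,a})-\tfrac12\sum_{v\sim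 o}\mathbb H(\mu_{e_{ov},a})\Big]$$ exists, for every choice of the orthonormal bases, and is at least $0$. -/

import Mathlib

open MeasureTheory ProbabilityTheory Filter Topology
open scoped ENNReal

namespace ConfigModel

variable {k : ℕ}

/-! ### Degree matrices and the random graph model -/

/-- Expanding degree matrices: `d i j` is the number of neighbours of type `j` of a vertex of
type `i`. -/
structure IsExpandingDegreeMatrix (d : Matrix (Fin k) (Fin k) ℕ) : Prop where
  pos_symm : ∀ i j, 0 < d i j → 0 < d j i
  cocycle : ∀ i j l, d j i ≠ 0 → d l j ≠ 0 → d l i ≠ 0 →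
    ((d i j : ℚ) / d j i) * ((d j l : ℚ) / d l j) = (d i l : ℚ) / d l i
  irreducible : (d.map (Nat.cast : ℕ → ℤ)).IsIrreducible
  exists_three_le : ∃ i, 3 ≤ ∑ j, d i j
  two_le : ∀ i, 2 ≤ ∑ j, d i j

/-- The vertex set `V₁ ⊔ ⋯ ⊔ V_k` with `|V_i| = n i`; the type of `x` is `x.1`. -/
abbrev GraphVertex (n : Fin k → ℕ) : Type := Σ i : Fin k, Fin (n i)

/-- The simple graphs on `V₁ ⊔ ⋯ ⊔ V_k`, `|V_i| = n i`, in which every vertex of type `i` has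
exactly `d i j` neighbours of type `j`. -/
abbrev ConfigGraph (d : Matrix (Fin k) (Fin k) ℕ) (n : Fin k → ℕ) : Type :=
  {G : SimpleGraph (GraphVertex n) //
    ∀ (x : GraphVertex n) (j : Fin k), {y | G.Adj x y ∧ y.1 = j}.ncard = d x.1 j}

instance (d : Matrix (Fin k) (Fin k) ℕ) (n : Fin k → ℕ) : MeasurableSpace (ConfigGraph d n) := ⊤

/-- The law of the random graph: uniform on `ConfigGraph d n` (if that set is nonempty). -/
noncomputable def configLaw (d : Matrix (Fin k) (Fin k) ℕ) (n : Fin k → ℕ) :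
    Measure (ConfigGraph d n) :=
  uniformOn Set.univ

/-- The root law of the unimodular tree: the limiting (and exact) proportions `|V_i| / N`.
For irreducible `d` there is at most one such `q`. -/
structure IsRootLaw (d : Matrix (Fin k) (Fin k) ℕ) (q : Fin k → ℝ) : Prop where
  nonneg : ∀ i, 0 ≤ q i
  sum_eq_one : ∑ i, q i = 1
  balance : ∀ i j, q i * d i j = q j * d j i

/-! ### The universal cover -/

/-- The type of the vertex with address `w`. An address lists the steps from the base vertex (of
type `r`), the last step first; a step `(j, m)` goes to the `m`-th child of type `j`. -/
def wordType (r : Fin k) : List (Fin k × ℕ) → Fin k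
  | [] => r
  | s :: _ => s.1

/-- The number of parents of type `j` of the vertex with address `w` (at most one). -/
def parentCount (r : Fin k) : List (Fin k × ℕ) → Fin k → ℕ
  | [], _ => 0
  | _ :: w, j => if wordType r w = j then 1 else 0

/-- A word is an address when every step `(j, m)` from a vertex of type `i` satisfies
`m < d i j - (number of parents of type j)`. -/
def IsAddress (d : Matrix (Fin k) (Fin k) ℕ) (r : Fin k) : List (Fin k × ℕ) → Prop
  | [] => True
  | s :: w => IsAddress d r w ∧ s.2 + parentCount r w s.1 < d (wordType r w) s.1

/-- The vertices of the universal cover, with a base vertex of type `r`. -/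
abbrev TreeVertex (d : Matrix (Fin k) (Fin k) ℕ) (r : Fin k) : Type :=
  {w : List (Fin k × ℕ) // IsAddress d r w}

variable {d : Matrix (Fin k) (Fin k) ℕ} {r : Fin k}

/-- The type of a vertex of the universal cover. -/
def TreeVertex.type (u : TreeVertex d r) : Fin k := wordType r u.1

/-- The universal cover: a vertex is joined to its children and to its parent. Every vertex of
type `i` has `d i j` neighbours of type `j`. -/
def coverTree (d : Matrix (Fin k) (Fin k) ℕ) (r : Fin k) : SimpleGraph (TreeVertex d r) where
  Adj u v := (∃ s, v.1 = s :: u.1) ∨ (∃ s, u.1 = s :: v.1)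
  symm := ⟨fun _ _ h => h.symm⟩
  loopless := ⟨fun u h => by
    rcases h with ⟨s, h⟩ | ⟨s, h⟩ <;> simpa using congrArg List.length h⟩

theorem finite_neighborSet (u : TreeVertex d r) : ((coverTree d r).neighborSet u).Finite := by
  have h1 : {w : List (Fin k × ℕ) | IsAddress d r w ∧ ∃ s, w = s :: u.1}.Finite := by
    refine Set.Finite.subset (Set.Finite.image (fun s => s :: u.1)
      (s := ⋃ j : Fin k, (fun m => (j, m)) '' Set.Iio (d (wordType r u.1) j)) ?_) ?_
    · exact Set.finite_iUnion fun j => (Set.finite_Iio _).image _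
    · rintro w ⟨hw, s, rfl⟩
      refine ⟨s, Set.mem_iUnion.2 ⟨s.1, s.2, ?_, rfl⟩, rfl⟩
      have := hw.2
      simp only [Set.mem_Iio]
      omega
  have h2 : {w : List (Fin k × ℕ) | ∃ s, u.1 = s :: w}.Finite := by
    refine (Set.finite_singleton u.1.tail).subset ?_
    rintro w ⟨s, hs⟩
    simp [hs]
  refine Set.Finite.of_finite_image (f := Subtype.val) ((h1.union h2).subset ?_)
    Subtype.val_injective.injOn
  rintro _ ⟨v, hv, rfl⟩
  rcases hv with h | h
  · exact Or.inl ⟨v.2, h⟩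
  · exact Or.inr h

/-- The neighbours of `u` in the universal cover. -/
noncomputable def nbrs (u : TreeVertex d r) : Finset (TreeVertex d r) :=
  (finite_neighborSet u).toFinset

open Classical in
/-- The star `C_u`: the vertex `u` with its neighbours. -/
noncomputable def star (u : TreeVertex d r) : Finset (TreeVertex d r) := insert u (nbrs u)

open Classical in
/-- The two endpoints of the edge `e_{uv}`. -/
noncomputable def edge (u v : TreeVertex d r) : Finset (TreeVertex d r) := {u, v}

/-! ### The empirical process of a labelled graph, and typical processes -/

/-- `p` is a covering of the subtree on `Γ` into `G`: it preserves types and adjacency, and it is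
injective on the neighbours of each vertex. -/
def IsCovering {n : Fin k → ℕ} (G : SimpleGraph (GraphVertex n)) (Γ : Finset (TreeVertex d r))
    (p : Γ → GraphVertex n) : Prop :=
  (∀ u, (p u).1 = u.1.type) ∧
  (∀ u v : Γ, (coverTree d r).Adj u v → G.Adj (p u) (p v)) ∧
  (∀ w u v : Γ, (coverTree d r).Adj w u → (coverTree d r).Adj w v → p u = p v → u = v)

/-- The coverings of the subtree on `Γ` into `G`. -/
noncomputable def coverings {n : Fin k → ℕ} (G : SimpleGraph (GraphVertex n))
    (Γ : Finset (TreeVertex d r)) : Finset (Γ → GraphVertex n) :=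
  (Set.toFinite {p | IsCovering G Γ p}).toFinset

/-- The marginal on `Γ → Y`, for a finite subtree `Γ`, of the process `distr*(f)`: the labelling
`f` of `G` is pulled back along a uniformly random covering of `G` by the tree. The restriction of
that covering to `Γ` is a uniformly random covering of the subtree `Γ` into `G`, because the number
of ways to extend a covering by one more vertex does not depend on the covering. -/
noncomputable def distrStar {Y : Type*} [MeasurableSpace Y] {n : Fin k → ℕ}
    (G : SimpleGraph (GraphVertex n)) (f : GraphVertex n → Y) (Γ : Finset (TreeVertex d r)) :
    Measure (Γ → Y) :=
  ((coverings G Γ).card : ℝ≥0∞)⁻¹ • ∑ p ∈ coverings G Γ, Measure.dirac (fun u => f (p u))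

/-- Typical processes: along some sequence of sizes, for independent random graphs, almost surely
there are labellings `f m` such that `distr*(f m)` converges weakly to `μ`. As the tree is
countable, weak convergence on the product space `TreeVertex d r → Y` is weak convergence of the
marginals on all finite subtrees. -/
def IsTypical {Y : Type*} [TopologicalSpace Y] [MeasurableSpace Y]
    (μ : Measure (TreeVertex d r → Y)) : Prop :=
  ∃ n : ℕ → Fin k → ℕ, StrictMono (fun m => ∑ i, n m i) ∧
    (∀ m, Nonempty (ConfigGraph d (n m))) ∧
    ∀ᵐ G ∂(Measure.infinitePi fun m => configLaw d (n m)),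
      ∃ f : ∀ m, GraphVertex (n m) → Y,
        ∀ Γ : Finset (TreeVertex d r), ((coverTree d r).induce (Γ : Set (TreeVertex d r))).Connected →
          ∀ φ : BoundedContinuousFunction (Γ → Y) ℝ,
            Tendsto (fun m => ∫ x, φ x ∂(distrStar (G m).1 (f m) Γ)) atTop
              (𝓝 (∫ X, φ (fun u => X u) ∂μ))

/-! ### Entropy -/

/-- The Shannon entropy `-∑ ν(s) log ν(s)`, in `[0, ∞]`, of a discrete probability measure. -/
noncomputable def shannon {S : Type*} [MeasurableSpace S] (ν : Measure S) : ℝ≥0∞ :=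
  ∑' s, ENNReal.ofReal (Real.negMulLog (ν.real {s}))

/-- `E_o [ H(C_o) - (1/2) ∑_{v ∼ o} H(e_{ov}) ]`, where `H Γ` is the entropy of the marginal on `Γ`
and the root `o` has type `i` with probability `q i`; `o i` is a vertex of type `i`. -/
noncomputable def entropyDefect (q : Fin k → ℝ) (o : Fin k → TreeVertex d r)
    (H : Finset (TreeVertex d r) → ℝ≥0∞) : ℝ :=
  ∑ i, q i * ((H (star (o i))).toReal - 1 / 2 * ∑ v ∈ nbrs (o i), (H (edge (o i) v)).toReal)

/-- The law on `Γ` of the process discretized by `c : Y → ℕ` (a countable partition of `Y`). -/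
noncomputable def partitionMarginal {Y : Type*} [MeasurableSpace Y] (c : Y → ℕ)
    (μ : Measure (TreeVertex d r → Y)) (Γ : Finset (TreeVertex d r)) : Measure (Γ → ℕ) :=
  μ.map (fun X u => c (X u))

/-! ### Discretization of eigenvector processes at scale `a` -/

open Classical in
/-- The vector `lam • δ_u - ∑_{v ∼ u} δ_v`, on `Γ`. -/
noncomputable def eigenConstraint (lam : ℝ) (Γ : Finset (TreeVertex d r)) (u : TreeVertex d r) :
    EuclideanSpace ℝ Γ :=
  WithLp.toLp 2 fun w =>
    (if w.1 = u then lam else 0) - (if (coverTree d r).Adj u w.1 then 1 else 0)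

/-- The orthogonal complement in `ℝ^Γ` of the vectors `lam • δ_u - ∑_{v ∼ u} δ_v`, where `u` ranges
over the vertices of `Γ` that are not in the boundary of `Γ`, i.e. all of whose neighbours are in
`Γ`. -/
noncomputable def eigenSpace (lam : ℝ) (Γ : Finset (TreeVertex d r)) :
    Submodule ℝ (EuclideanSpace ℝ Γ) :=
  (Submodule.span ℝ (eigenConstraint lam Γ ''
    {u | u ∈ Γ ∧ ∀ v, (coverTree d r).Adj u v → v ∈ Γ}))ᗮ

/-- A choice of an orthonormal basis of `eigenSpace lam Γ`, for every `Γ`. -/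
abbrev EigenBases (d : Matrix (Fin k) (Fin k) ℕ) (r : Fin k) (lam : ℝ) : Type :=
  ∀ Γ : Finset (TreeVertex d r),
    OrthonormalBasis (Fin (Module.finrank ℝ (eigenSpace lam Γ))) ℝ (eigenSpace lam Γ)

/-- The coordinates `⟨X, χ_j⟩` of the restriction of `X` to `Γ`. -/
noncomputable def eigenCoords {lam : ℝ} (b : EigenBases d r lam) (Γ : Finset (TreeVertex d r))
    (X : TreeVertex d r → ℝ) : Fin (Module.finrank ℝ (eigenSpace lam Γ)) → ℝ :=
  fun j => inner ℝ ((b Γ j : eigenSpace lam Γ) : EuclideanSpace ℝ Γ)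
    (WithLp.toLp 2 fun u : Γ => X u)

/-- The discretization `μ_{Γ,a}`: the law of `(1/a) (⌊a ⟨X, χ_1⟩⌋, …, ⌊a ⟨X, χ_n⟩⌋)`. -/
noncomputable def scaleMarginal {lam : ℝ} (b : EigenBases d r lam) (a : ℝ)
    (μ : Measure (TreeVertex d r → ℝ)) (Γ : Finset (TreeVertex d r)) :
    Measure (Fin (Module.finrank ℝ (eigenSpace lam Γ)) → ℝ) :=
  μ.map (fun X j => 1 / a * (⌊a * eigenCoords b Γ X j⌋ : ℝ))

/-- Real processes that almost surely solve the eigenvector equation `A X = lam X` on the tree and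
have finite second moments. -/
structure IsEigenvectorLaw (lam : ℝ) (μ : Measure (TreeVertex d r → ℝ)) : Prop where
  memLp : ∀ u, MemLp (fun X : TreeVertex d r → ℝ => X u) 2 μ
  equation : ∀ u, ∀ᵐ X ∂μ, lam * X u = ∑ v ∈ nbrs u, X v

/-- `ν` has a density `g` with `∫ |g log g| < ∞`, i.e. a finite differential entropy. -/
def HasFiniteDifferentialEntropy {m : ℕ} (ν : Measure (Fin m → ℝ)) : Prop :=
  ν ≪ volume ∧ Integrable (fun x => Real.negMulLog (ν.rnDeriv volume x).toReal) volume

/-- `ν` is carried by a countable set and has finite Shannon entropy. -/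
def IsDiscreteWithFiniteEntropy {S : Type*} [MeasurableSpace S] (ν : Measure S) : Prop :=
  (∃ A : Set S, A.Countable ∧ ν Aᶜ = 0) ∧ shannon ν ≠ ⊤

end ConfigModel

/-!
The proof is a first moment computation. Let each label of a labelled graph pass independently
through a channel `W` with finitely many output symbols. If `distrStar f` is close to `μ`, then by
Chebyshev's inequality (`prodWeight_chebyshev`) the outputs have, with probability at least `1 / 2`,
the star statistics predicted by `μ` and `W`. Hence a graph with such an `f` carries about
`exp (N h)` labellings with these statistics, where `h` is the mean entropy of the channel given
its input (`exp_le_card_labels`). On the other hand, labelled graphs with ordered neighbourhoods are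
pairings of half-edges that respect the labels at both ends. There are at most
`exp (N ∑ i, q i * H(star i))` choices of star labels, and by the count of pairings
(`card_pairings_sq_le`, `prod_factorial_le_card_pairings_sq`) such star labels cost a factor
`exp (-(N / 2) ∑ H(edge))`. A polynomial fraction of all pairings is simple
(`card_pairings_le_simple`), so that the same bound holds for simple graphs
(`card_mul_le_first_moment`). If the resulting inequality

  `E_o [h + (1/2) ∑ v, H(edge o v)] ≤ E_o [H(star o)]`

failed for the outputs of `W`, then the graphs with a labelling close to `μ` would be exponentially
rare, contrary to typicality (`IsTypical.core_continuous`). By approximation the inequality holds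
for measurable channels, and for countably many symbols (`IsTypical.core_countable`).

A countable partition is a deterministic channel, for which `h = 0`; this is the inequality for
general labels. A discrete eigenvector process has labels in a countable set; an injective encoding
of this set is a partition with the same entropies as the coordinates on stars and edges, and the
cells at scale `a` have entropies that converge to these (`tendsto_shannon_cellOf`).

For an eigenvector process with densities, the cells at scale `a` have entropy
`dim * log a + (differential entropy) + o(1)` (`tendsto_shannon_cellOf_sub`). A star with `D`
neighbours has a space of local solutions of dimension `D`, and an edge one of dimension `2`, so
that the terms with `log a` cancel, and the limit is the defect of the differential entropies. The
deterministic cells of the labels do not give its sign, because on a star the labels satisfy a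
linear equation which the cells see only up to the scale `1 / a`. Therefore the labels pass through
a channel with Gaussian noise of size `η` before they are rounded at scale `a`. The channel entropy
is at least `log (a η)` plus the entropy `g` of a standard Gaussian (`le_shannon_noisyCell`); on an
edge the noise does not decrease the entropy (`le_shannon_randomizedMarginal`); and on a star, a
code for the local solution together with a Gaussian code in the direction normal to the equation
shows that the entropy is at most `(D + 1) log a + log η + g` plus the differential entropy, up to
small errors (`shannon_randomizedMarginal_le`). The code comes from a density that is nearly optimal
and whose logarithm is nearly Lipschitz (`HasFiniteEntropy.exists_code`). All terms with `a`, `η`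
and `g` cancel, and `a = η⁻²`, `η → 0` gives the claim (`IsTypical.exists_tendsto_of_density`).
-/

set_option linter.unusedSectionVars false

namespace ConfigModel

/-! ### Pairings of half-edges -/

section Pairings

variable {H K : Type*} [Fintype H] [DecidableEq H] [DecidableEq K]

/-- `σ` is a fixed-point-free involution of `s` (extended by the identity) that sends each class `c`
of `κ` to the class `bar c`. -/
def IsPairing (κ : H → K) (bar : K → K) (s : Finset H) (σ : Equiv.Perm H) : Prop :=
  (∀ h, σ (σ h) = h) ∧ (∀ h ∈ s, σ h ≠ h ∧ σ h ∈ s ∧ κ (σ h) = bar (κ h)) ∧ ∀ h ∉ s, σ h = h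

open Classical in
/-- The finite set of all pairings of `s`. -/
noncomputable def pairings (κ : H → K) (bar : K → K) (s : Finset H) : Finset (Equiv.Perm H) :=
  Finset.univ.filter (IsPairing κ bar s)

/-- The number of elements of `s` in class `c`. -/
def classCard (κ : H → K) (s : Finset H) (c : K) : ℕ := (s.filter (fun h => κ h = c)).card

variable {κ : H → K} {bar : K → K} {s : Finset H}

theorem mem_pairings {σ : Equiv.Perm H} : σ ∈ pairings κ bar s ↔ IsPairing κ bar s σ := by
  simp [pairings]

theorem classCard_bar (hbar : Function.Involutive bar) {σ : Equiv.Perm H}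
    (hσ : IsPairing κ bar s σ) (c : K) : classCard κ s (bar c) = classCard κ s c := by
  unfold classCard
  refine Finset.card_nbij' σ σ ?_ ?_ ?_ ?_
  · intro h hh
    simp only [Finset.mem_coe, Finset.mem_filter] at hh ⊢
    refine ⟨(hσ.2.1 h hh.1).2.1, ?_⟩
    rw [(hσ.2.1 h hh.1).2.2, hh.2, hbar]
  · intro h hh
    simp only [Finset.mem_coe, Finset.mem_filter] at hh ⊢
    refine ⟨(hσ.2.1 h hh.1).2.1, ?_⟩
    rw [(hσ.2.1 h hh.1).2.2, hh.2]
  · intro h _; exact hσ.1 h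
  · intro h _; exact hσ.1 h

/-- Conjugating a pairing by the transposition of two half-edges of one class gives a pairing. -/
theorem IsPairing.conj_swap {σ : Equiv.Perm H} (hσ : IsPairing κ bar s σ) {a b : H}
    (ha : a ∈ s) (hb : b ∈ s) (hab : κ a = κ b) :
    IsPairing κ bar s (Equiv.swap a b * σ * Equiv.swap a b) := by
  have hκ : ∀ h, κ (Equiv.swap a b h) = κ h := by
    intro h
    rw [Equiv.swap_apply_def]
    split_ifs with h1 h2
    · rw [h1, hab]
    · rw [h2, hab]
    · rfl
  have hs : ∀ h, Equiv.swap a b h ∈ s ↔ h ∈ s := by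
    intro h
    rw [Equiv.swap_apply_def]
    split_ifs with h1 h2
    · simp [h1, ha, hb]
    · simp [h2, ha, hb]
    · rfl
  refine ⟨fun h => by simp [hσ.1], fun h hh => ?_, fun h hh => ?_⟩
  · obtain ⟨h1, h2, h3⟩ := hσ.2.1 (Equiv.swap a b h) ((hs h).2 hh)
    refine ⟨?_, ?_, ?_⟩
    · simp only [Equiv.Perm.mul_apply]
      intro h4
      apply h1
      rw [← Equiv.swap_apply_self a b (σ _), h4]
    · simpa [hs] using h2
    · simp only [Equiv.Perm.mul_apply, hκ, h3]
  · have := hσ.2.2 (Equiv.swap a b h) (by rwa [hs])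
    simp [this]

/-- Removing `h` and its partner from a pairing. -/
theorem IsPairing.remove {σ : Equiv.Perm H} (hσ : IsPairing κ bar s σ) {h : H} (hh : h ∈ s) :
    IsPairing κ bar ((s.erase h).erase (σ h)) (Equiv.swap h (σ h) * σ) := by
  have h0 := (hσ.2.1 h hh).1
  have key : ∀ x, x ≠ h → x ≠ σ h → Equiv.swap h (σ h) (σ x) = σ x := by
    intro x h1 h2
    apply Equiv.swap_apply_of_ne_of_ne
    · intro h3; apply h2; rw [← h3, hσ.1]
    · intro h3; exact h1 (σ.injective h3)
  have e1 : (Equiv.swap h (σ h) * σ) h = h := by simp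
  have e2 : (Equiv.swap h (σ h) * σ) (σ h) = σ h := by simp [hσ.1]
  have e3 : ∀ x, x ≠ h → x ≠ σ h → (Equiv.swap h (σ h) * σ) x = σ x := key
  refine ⟨fun x => ?_, fun x hx => ?_, fun x hx => ?_⟩
  · by_cases h1 : x = h
    · subst h1; rw [e1, e1]
    by_cases h2 : x = σ h
    · subst h2; rw [e2, e2]
    rw [e3 x h1 h2, e3, hσ.1]
    · intro h3; apply h2; rw [← h3, hσ.1]
    · intro h3; exact h1 (σ.injective h3)
  · simp only [Finset.mem_erase] at hx
    rw [e3 x hx.2.1 hx.1]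
    obtain ⟨h1, h2, h3⟩ := hσ.2.1 x hx.2.2
    refine ⟨h1, ?_, h3⟩
    simp only [Finset.mem_erase]
    refine ⟨fun h4 => hx.2.1 (σ.injective h4), fun h4 => hx.1 ?_, h2⟩
    rw [← h4, hσ.1]
  · by_cases h1 : x = h
    · subst h1; exact e1
    by_cases h2 : x = σ h
    · subst h2; exact e2
    rw [e3 x h1 h2]
    apply hσ.2.2
    simpa [h1, h2] using hx

/-- Adding the pair `{h, k}` to a pairing of the other elements. -/
theorem IsPairing.insert (hbar : Function.Involutive bar) {σ : Equiv.Perm H} {h k : H}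
    (hσ : IsPairing κ bar ((s.erase h).erase k) σ) (hh : h ∈ s) (hk : k ∈ s) (hkh : k ≠ h)
    (hκ : κ k = bar (κ h)) :
    IsPairing κ bar s (Equiv.swap h k * σ) ∧ (Equiv.swap h k * σ) h = k := by
  have f1 : σ h = h := hσ.2.2 h (by simp)
  have f2 : σ k = k := hσ.2.2 k (by simp)
  have e1 : (Equiv.swap h k * σ) h = k := by simp [f1]
  have e2 : (Equiv.swap h k * σ) k = h := by simp [f2]
  have n1 : ∀ x, x ≠ h → σ x ≠ h := fun x hx h3 => hx (σ.injective (h3.trans f1.symm))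
  have n2 : ∀ x, x ≠ k → σ x ≠ k := fun x hx h3 => hx (σ.injective (h3.trans f2.symm))
  have e3 : ∀ x, x ≠ h → x ≠ k → (Equiv.swap h k * σ) x = σ x := fun x h1 h2 =>
    Equiv.swap_apply_of_ne_of_ne (n1 x h1) (n2 x h2)
  refine ⟨⟨fun x => ?_, fun x hx => ?_, fun x hx => ?_⟩, e1⟩
  · by_cases h1 : x = h
    · subst h1; rw [e1, e2]
    by_cases h2 : x = k
    · subst h2; rw [e2, e1]
    rw [e3 x h1 h2, e3 _ (n1 x h1) (n2 x h2), hσ.1]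
  · by_cases h1 : x = h
    · subst h1; rw [e1]; exact ⟨hkh, hk, hκ⟩
    by_cases h2 : x = k
    · subst h2; rw [e2]; exact ⟨hkh.symm, hh, by rw [hκ, hbar]⟩
    rw [e3 x h1 h2]
    obtain ⟨h3, h4, h5⟩ := hσ.2.1 x (by simp [h1, h2, hx])
    simp only [Finset.mem_erase] at h4
    exact ⟨h3, h4.2.2, h5⟩
  · have h1 : x ≠ h := fun h => hx (h ▸ hh)
    have h2 : x ≠ k := fun h => hx (h ▸ hk)
    rw [e3 x h1 h2]
    exact hσ.2.2 x (by simp [hx])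

/-- The pairings of `s` in which `h` is paired with `k` correspond to the pairings of the rest. -/
theorem card_pairings_filter_eq (hbar : Function.Involutive bar) {h k : H} (hh : h ∈ s)
    (hk : k ∈ s) (hkh : k ≠ h) (hκ : κ k = bar (κ h)) :
    ((pairings κ bar s).filter (fun σ => σ h = k)).card
      = (pairings κ bar ((s.erase h).erase k)).card := by
  refine Finset.card_nbij' (fun σ => Equiv.swap h k * σ) (fun σ => Equiv.swap h k * σ) ?_ ?_ ?_ ?_
  · intro σ hσ
    simp only [Finset.mem_coe, Finset.mem_filter, mem_pairings] at hσ
    obtain ⟨h1, rfl⟩ := hσ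
    simpa [mem_pairings] using h1.remove hh
  · intro σ hσ
    simp only [Finset.mem_coe, mem_pairings] at hσ
    simp only [Finset.mem_coe, Finset.mem_filter, mem_pairings]
    exact hσ.insert hbar hh hk hkh hκ
  · intro σ _
    simp [← mul_assoc]
  · intro σ _
    simp [← mul_assoc]

/-- The recursion for the number of pairings, over the possible partners of `h`. -/
theorem card_pairings_eq_sum (hbar : Function.Involutive bar) {h : H} (hh : h ∈ s) :
    (pairings κ bar s).card = ∑ k ∈ (s.erase h).filter (fun k => κ k = bar (κ h)),
      (pairings κ bar ((s.erase h).erase k)).card := by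
  rw [Finset.card_eq_sum_card_fiberwise (f := fun σ : Equiv.Perm H => σ h)
    (t := (s.erase h).filter (fun k => κ k = bar (κ h)))]
  · refine Finset.sum_congr rfl fun k hk => ?_
    simp only [Finset.mem_filter, Finset.mem_erase] at hk
    exact card_pairings_filter_eq hbar hh hk.1.2 hk.1.1 hk.2
  · intro σ hσ
    have := (mem_pairings.1 hσ).2.1 h hh
    simp [this]

/-- If there is a pairing, then there is one that pairs `h` with `k`: conjugate by the transposition
of `k` and the partner of `h`. -/
theorem exists_pairing_remove (hP : (pairings κ bar s).Nonempty) {h k : H} (hh : h ∈ s)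
    (hk : k ∈ s) (hkh : k ≠ h) (hκ : κ k = bar (κ h)) : (pairings κ bar ((s.erase h).erase k)).Nonempty := by
  obtain ⟨σ, hσ⟩ := hP
  rw [mem_pairings] at hσ
  obtain ⟨h1, h2, h3⟩ := hσ.2.1 h hh
  have h4 := hσ.conj_swap h2 hk (h3.trans hκ.symm)
  have h5 : (Equiv.swap (σ h) k * σ * Equiv.swap (σ h) k) h = k := by
    simp [Equiv.swap_apply_of_ne_of_ne h1.symm hkh.symm]
  have h6 := h4.remove hh
  rw [h5] at h6
  exact ⟨_, mem_pairings.2 h6⟩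

theorem classCard_erase {h : H} (c : K) (hh : h ∈ s) :
    classCard κ s c = classCard κ (s.erase h) c + if κ h = c then 1 else 0 := by
  unfold classCard
  rw [Finset.filter_erase]
  split_ifs with h1
  · rw [Finset.card_erase_of_mem (by simp [hh, h1])]
    have : 0 < (s.filter (fun h => κ h = c)).card := Finset.card_pos.2 ⟨h, by simp [hh, h1]⟩
    omega
  · rw [Finset.erase_eq_of_notMem (by simp [h1])]; rfl

variable [Fintype K]

theorem prod_factorial_erase {h : H} (hh : h ∈ s) :
    ∏ c, (classCard κ s c).factorial
      = classCard κ s (κ h) * ∏ c, (classCard κ (s.erase h) c).factorial := by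
  rw [← Finset.mul_prod_erase Finset.univ _ (Finset.mem_univ (κ h)),
    ← Finset.mul_prod_erase Finset.univ (fun c => (classCard κ (s.erase h) c).factorial)
      (Finset.mem_univ (κ h)), ← mul_assoc]
  congr 1
  · rw [classCard_erase (κ h) hh]
    simp [Nat.factorial_succ]
  · refine Finset.prod_congr rfl fun c hc => ?_
    rw [classCard_erase c hh, if_neg (Finset.ne_of_mem_erase hc).symm]
    rfl

theorem prod_succ_erase {h : H} (hh : h ∈ s) :
    classCard κ s (κ h) * ∏ c, (classCard κ s c + 1)
      = (classCard κ s (κ h) + 1) * ∏ c, (classCard κ (s.erase h) c + 1) := by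
  rw [← Finset.mul_prod_erase Finset.univ _ (Finset.mem_univ (κ h)),
    ← Finset.mul_prod_erase Finset.univ (fun c => (classCard κ (s.erase h) c + 1))
      (Finset.mem_univ (κ h)), ← mul_assoc, ← mul_assoc]
  congr 1
  · rw [classCard_erase (κ h) hh]
    simp only [if_true]
    ring
  · refine Finset.prod_congr rfl fun c hc => ?_
    rw [classCard_erase c hh, if_neg (Finset.ne_of_mem_erase hc).symm]

/-- The number of pairings of classes of sizes `m c` is about `√(∏ c, (m c)!)`: upper bound. The
square treats uniformly the bijections between `c` and `bar c ≠ c`, of which there are `(m c)!`, and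
the perfect matchings inside `c = bar c`, of which there are `(m c - 1)!!`. -/
theorem card_pairings_sq_le (hbar : Function.Involutive bar) :
    (pairings κ bar s).card ^ 2 ≤ ∏ c, (classCard κ s c).factorial := by
  induction hn : s.card using Nat.strong_induction_on generalizing s with
  | _ n ih =>
  subst hn
  rcases s.eq_empty_or_nonempty with rfl | ⟨h, hh⟩
  · have : (pairings κ bar (∅ : Finset H)).card ≤ 1 := by
      rw [Finset.card_le_one]
      intro a ha b hb
      rw [mem_pairings] at ha hb
      ext x
      rw [ha.2.2 x (by simp), hb.2.2 x (by simp)]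
    calc (pairings κ bar (∅ : Finset H)).card ^ 2 ≤ 1 ^ 2 := Nat.pow_le_pow_left this 2
      _ ≤ _ := by simp [classCard]
  rcases (pairings κ bar s).eq_empty_or_nonempty with h0 | hP
  · simp [h0]
  obtain ⟨σ, hσ⟩ := hP
  rw [mem_pairings] at hσ
  set v := classCard κ (s.erase h) (bar (κ h)) with hv
  set m := classCard κ s (κ h) with hm
  have hvm : v ≤ m := by
    have := classCard_erase (κ := κ) (bar (κ h)) hh
    rw [classCard_bar hbar hσ, ← hm, ← hv] at this
    omega
  have hk1 : ∀ k ∈ (s.erase h).filter (fun k => κ k = bar (κ h)),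
      v * (pairings κ bar ((s.erase h).erase k)).card ^ 2
        ≤ ∏ c, (classCard κ (s.erase h) c).factorial := by
    intro k hk
    simp only [Finset.mem_filter] at hk
    have h1 := ih _ (by
      exact (Finset.card_erase_lt_of_mem hk.1).trans (Finset.card_erase_lt_of_mem hh))
      (s := (s.erase h).erase k) rfl
    rw [prod_factorial_erase hk.1, hk.2]
    exact Nat.mul_le_mul_left _ h1
  have hcard : ((s.erase h).filter (fun k => κ k = bar (κ h))).card = v := rfl
  rw [prod_factorial_erase hh, card_pairings_eq_sum hbar hh]
  calc _ ≤ ((s.erase h).filter (fun k => κ k = bar (κ h))).card *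
        ∑ k ∈ (s.erase h).filter (fun k => κ k = bar (κ h)),
          (pairings κ bar ((s.erase h).erase k)).card ^ 2 := sq_sum_le_card_mul_sum_sq
    _ = ∑ k ∈ (s.erase h).filter (fun k => κ k = bar (κ h)),
          v * (pairings κ bar ((s.erase h).erase k)).card ^ 2 := by rw [hcard, Finset.mul_sum]
    _ ≤ v * ∏ c, (classCard κ (s.erase h) c).factorial := by
        rw [← hcard, ← smul_eq_mul]
        exact Finset.sum_le_card_nsmul _ _ _ hk1
    _ ≤ _ := Nat.mul_le_mul_right _ hvm

/-- Lower bound for the number of pairings, up to a polynomial factor. Parity can rule out all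
pairings, so that one of them has to be given. -/
theorem prod_factorial_le_card_pairings_sq (hbar : Function.Involutive bar)
    (hP : (pairings κ bar s).Nonempty) :
    ∏ c, (classCard κ s c).factorial
      ≤ (pairings κ bar s).card ^ 2 * ∏ c, (classCard κ s c + 1) := by
  induction hn : s.card using Nat.strong_induction_on generalizing s with
  | _ n ih =>
  subst hn
  rcases s.eq_empty_or_nonempty with rfl | ⟨h, hh⟩
  · have : 0 < (pairings κ bar (∅ : Finset H)).card := Finset.card_pos.2 hP
    simp only [classCard, Finset.filter_empty, Finset.card_empty, Nat.factorial_zero,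
      Finset.prod_const_one, zero_add, mul_one]
    exact Nat.one_le_pow _ _ this
  obtain ⟨σ, hσ⟩ := id hP
  rw [mem_pairings] at hσ
  set v := classCard κ (s.erase h) (bar (κ h)) with hv
  set m := classCard κ s (κ h) with hm
  have hmv : m ≤ v + 1 := by
    have := classCard_erase (κ := κ) (bar (κ h)) hh
    rw [classCard_bar hbar hσ, ← hm, ← hv] at this
    split_ifs at this <;> omega
  have hmpos : 0 < m := Finset.card_pos.2 ⟨h, by simp [hh]⟩
  set T := (s.erase h).filter (fun k => κ k = bar (κ h)) with hT
  have hcard : T.card = v := rfl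
  have hTne : T.Nonempty := by
    have := hσ.2.1 h hh
    exact ⟨σ h, by simp [hT, this]⟩
  -- the partner of `h` that leaves the fewest pairings of the rest
  obtain ⟨k, hkT, hkmin⟩ := Finset.exists_min_image T
    (fun k => (pairings κ bar ((s.erase h).erase k)).card) hTne
  have hk := hkT
  simp only [hT, Finset.mem_filter] at hk
  have hk' := Finset.mem_erase.1 hk.1
  set N := (pairings κ bar ((s.erase h).erase k)).card with hN
  have h1 := ih _ (by
      exact (Finset.card_erase_lt_of_mem hk.1).trans (Finset.card_erase_lt_of_mem hh))
      (exists_pairing_remove hP hh hk'.2 hk'.1 hk.2) rfl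
  have h2 : v * N ≤ (pairings κ bar s).card := by
    rw [card_pairings_eq_sum hbar hh, ← hcard, ← smul_eq_mul]
    exact Finset.card_nsmul_le_sum _ _ _ hkmin
  have e1 := prod_factorial_erase (κ := κ) hh
  have e2 := prod_factorial_erase (κ := κ) hk.1
  have e3 := prod_succ_erase (κ := κ) hh
  have e4 := prod_succ_erase (κ := κ) hk.1
  rw [hk.2, ← hv] at e2 e4
  rw [← hm] at e1 e3
  set Φ := ∏ c, (classCard κ ((s.erase h).erase k) c).factorial
  set Ψ := ∏ c, (classCard κ ((s.erase h).erase k) c + 1)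
  set Ψ0 := ∏ c, (classCard κ s c + 1)
  set Ψ1 := ∏ c, (classCard κ (s.erase h) c + 1)
  rw [e1, e2]
  have h3 : m * Ψ ≤ v * Ψ0 := by
    refine Nat.le_of_mul_le_mul_left ?_ hmpos
    calc m * (m * Ψ) ≤ (m + 1) * ((v + 1) * Ψ) := by gcongr; omega
      _ = m * (v * Ψ0) := by rw [← e4, mul_left_comm m v, e3]; ring
  calc m * (v * Φ) ≤ m * (v * (N ^ 2 * Ψ)) := by gcongr
    _ = v * N ^ 2 * (m * Ψ) := by ring
    _ ≤ v * N ^ 2 * (v * Ψ0) := by gcongr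
    _ = (v * N) ^ 2 * Ψ0 := by ring
    _ ≤ _ := by gcongr

end Pairings

/-! ### Most pairings are nearly simple, and few switchings make them simple -/

section Switching

variable {H V T : Type*} [Fintype H] [DecidableEq H] [DecidableEq V] [DecidableEq T]

/-- The class of a half-edge: the type of its vertex and the type of the vertex it points to. -/
def halfEdgeClass (vtx : H → V) (τ : V → T) (t : H → T) (h : H) : T × T := (τ (vtx h), t h)

/-- The half-edge `h` belongs to a loop or to a multiple edge of the multigraph defined by `σ`. -/
def IsBad (vtx : H → V) (σ : Equiv.Perm H) (h : H) : Prop :=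
  vtx (σ h) = vtx h ∨ ∃ h', h' ≠ h ∧ vtx h' = vtx h ∧ vtx (σ h') = vtx (σ h)

open Classical in
/-- The half-edges in loops and multiple edges. -/
noncomputable def badSet (vtx : H → V) (σ : Equiv.Perm H) : Finset H :=
  Finset.univ.filter (IsBad vtx σ)

/-- The half-edges at a vertex. -/
def halfEdgesAt (vtx : H → V) (v : V) : Finset H := Finset.univ.filter (fun h => vtx h = v)

variable {vtx : H → V} {τ : V → T} {t : H → T}

theorem mem_badSet {σ : Equiv.Perm H} {h : H} : h ∈ badSet vtx σ ↔ IsBad vtx σ h := by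
  simp [badSet]

theorem mem_halfEdgesAt {v : V} {h : H} : h ∈ halfEdgesAt vtx v ↔ vtx h = v := by
  simp [halfEdgesAt]

theorem isBad_apply {σ : Equiv.Perm H} (hσ : ∀ h, σ (σ h) = h) {h : H} (hb : IsBad vtx σ h) :
    IsBad vtx σ (σ h) := by
  rcases hb with hb | ⟨h', h1, h2, h3⟩
  · left; rw [hσ, hb]
  · right
    exact ⟨σ h', fun e => h1 (σ.injective e), h3, by rw [hσ, hσ, h2]⟩

/-- Double counting: re-pairing `x` from `a` to the elements of `D` one by one. -/
theorem card_mul_le_of_conj {A A' : Finset (Equiv.Perm H)} {D : Finset H} {x a : H}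
    (hA : ∀ σ ∈ A, ∀ b ∈ D, Equiv.swap a b * σ * Equiv.swap a b ∈ A' ∧
      (Equiv.swap a b * σ * Equiv.swap a b) x = b) :
    A.card * D.card ≤ A'.card := by
  rw [← Finset.card_product]
  refine Finset.card_le_card_of_injOn
    (fun p => Equiv.swap a p.2 * p.1 * Equiv.swap a p.2) ?_ ?_
  · rintro ⟨σ, b⟩ hp
    simp only [Finset.coe_product, Set.mem_prod, Finset.mem_coe] at hp
    exact (hA σ hp.1 b hp.2).1
  · rintro ⟨σ, b⟩ hp ⟨σ', b'⟩ hp' he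
    simp only [Finset.coe_product, Set.mem_prod, Finset.mem_coe] at hp hp'
    have h1 := (hA σ hp.1 b hp.2).2
    have h2 := (hA σ' hp'.1 b' hp'.2).2
    simp only at he
    rw [he, h2] at h1
    subst h1
    simpa using he

variable {K : Type*} [DecidableEq K] {κ : H → K} {bar : K → K}

/-- The probability that `h` is paired with a given `k`. The term `-3` is the loss from the excluded
partners, kept equal to the one in `card_partner_eq_eq_le`. -/
theorem card_partner_eq_le (h k : H) :
    ((pairings κ bar Finset.univ).filter (fun σ => σ h = k)).card
      * (classCard κ Finset.univ (bar (κ h)) - 3) ≤ (pairings κ bar Finset.univ).card := by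
  set D := (Finset.univ.filter (fun z => κ z = bar (κ h))) \ {h} with hD
  have hDc : classCard κ Finset.univ (bar (κ h)) - 3 ≤ D.card := by
    have := Finset.le_card_sdiff {h} (Finset.univ.filter (fun z => κ z = bar (κ h)))
    rw [Finset.card_singleton, ← hD] at this
    unfold classCard
    omega
  refine (Nat.mul_le_mul_left _ hDc).trans (card_mul_le_of_conj (x := h) (a := k) ?_)
  intro σ hσ b hb
  simp only [Finset.mem_filter, mem_pairings] at hσ
  obtain ⟨hσ, rfl⟩ := hσ
  simp only [hD, Finset.mem_sdiff, Finset.mem_filter, Finset.mem_univ, true_and,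
    Finset.mem_singleton] at hb
  obtain ⟨h1, -, h3⟩ := hσ.2.1 h (Finset.mem_univ _)
  refine ⟨mem_pairings.2 (hσ.conj_swap (Finset.mem_univ _) (Finset.mem_univ _)
    (h3.trans hb.1.symm)), ?_⟩
  simp [Equiv.swap_apply_of_ne_of_ne h1.symm (Ne.symm hb.2)]

/-- The conditional probability that `h'` is paired with `k'`, given the partner of `h`. -/
theorem card_partner_eq_eq_le {h h' k k' : H} (hh : h' ≠ h) (hk : k' ≠ h) :
    ((pairings κ bar Finset.univ).filter (fun σ => σ h = k ∧ σ h' = k')).card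
      * (classCard κ Finset.univ (bar (κ h')) - 3)
      ≤ ((pairings κ bar Finset.univ).filter (fun σ => σ h = k)).card := by
  set D := (Finset.univ.filter (fun z => κ z = bar (κ h'))) \ {h, h', k} with hD
  have hDc : classCard κ Finset.univ (bar (κ h')) - 3 ≤ D.card := by
    have := Finset.le_card_sdiff {h, h', k} (Finset.univ.filter (fun z => κ z = bar (κ h')))
    have h3 : ({h, h', k} : Finset H).card ≤ 3 := Finset.card_le_three
    rw [← hD] at this
    unfold classCard
    omega
  refine (Nat.mul_le_mul_left _ hDc).trans (card_mul_le_of_conj (x := h') (a := k') ?_)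
  intro σ hσ b hb
  simp only [Finset.mem_filter, mem_pairings] at hσ
  obtain ⟨hσ, rfl, rfl⟩ := hσ
  simp only [hD, Finset.mem_sdiff, Finset.mem_filter, Finset.mem_univ, true_and,
    Finset.mem_insert, Finset.mem_singleton, not_or] at hb
  obtain ⟨h1, -, h3⟩ := hσ.2.1 h' (Finset.mem_univ _)
  have e1 : Equiv.swap (σ h') b h = h :=
    Equiv.swap_apply_of_ne_of_ne hk.symm (Ne.symm hb.2.1)
  have e2 : Equiv.swap (σ h') b h' = h' :=
    Equiv.swap_apply_of_ne_of_ne h1.symm (Ne.symm hb.2.2.1)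
  have e3 : Equiv.swap (σ h') b (σ h) = σ h :=
    Equiv.swap_apply_of_ne_of_ne (fun e => hh (σ.injective e).symm) (Ne.symm hb.2.2.2)
  simp only [Finset.mem_filter, mem_pairings, Equiv.Perm.mul_apply, e1, e2, e3]
  exact ⟨⟨hσ.conj_swap (Finset.mem_univ _) (Finset.mem_univ _) (h3.trans hb.1.symm), trivial⟩,
    by simp⟩

/-- The probability that a given half-edge of a random pairing is bad is small: it is in a loop when
its partner is one of at most `D` half-edges, and in a multiple edge when one of at most `D` other
half-edges at its vertex goes to the same vertex. -/
theorem card_bad_mul_le {D : ℕ} (hD : ∀ v, (halfEdgesAt vtx v).card ≤ D) (h : H) :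
    ((pairings (halfEdgeClass vtx τ t) Prod.swap Finset.univ).filter
        (fun σ => h ∈ badSet vtx σ)).card
      * (classCard (halfEdgeClass vtx τ t) Finset.univ (halfEdgeClass vtx τ t h).swap - 3)
      ≤ (D + D * D) * (pairings (halfEdgeClass vtx τ t) Prod.swap Finset.univ).card := by
  set κ := halfEdgeClass vtx τ t with hκ
  set P := pairings κ Prod.swap Finset.univ with hP
  set M := classCard κ Finset.univ (κ h).swap - 3 with hM
  have hsub : P.filter (fun σ => h ∈ badSet vtx σ) ⊆
      ((halfEdgesAt vtx (vtx h)).biUnion fun k => P.filter (fun σ => σ h = k)) ∪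
      (((halfEdgesAt vtx (vtx h)).filter (fun h' => h' ≠ h ∧ κ h' = κ h)).biUnion fun h' =>
        Finset.univ.biUnion fun k => ((halfEdgesAt vtx (vtx k)).filter (fun k' => k' ≠ h)).biUnion
          fun k' => P.filter (fun σ => σ h = k ∧ σ h' = k')) := by
    intro σ hσ
    simp only [Finset.mem_filter, mem_badSet] at hσ
    obtain ⟨hσP, hb⟩ := hσ
    have hσ' := mem_pairings.1 hσP
    simp only [Finset.mem_union, Finset.mem_biUnion, Finset.mem_filter, mem_halfEdgesAt,
      Finset.mem_univ, true_and]
    by_cases hl : vtx (σ h) = vtx h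
    · left; exact ⟨σ h, hl, hσP, rfl⟩
    · right
      rcases hb with hb | ⟨h', h1, h2, h3⟩
      · exact absurd hb hl
      refine ⟨h', ⟨h2, h1, ?_⟩, σ h, σ h', ⟨h3, ?_⟩, hσP, rfl, rfl⟩
      · have e1 := (hσ'.2.1 h (Finset.mem_univ _)).2.2
        have e2 := (hσ'.2.1 h' (Finset.mem_univ _)).2.2
        simp only [hκ, halfEdgeClass, Prod.swap_prod_mk, Prod.mk.injEq] at e1 e2 ⊢
        exact ⟨by rw [h2], by rw [← e1.1, ← e2.1, h3]⟩
      · intro e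
        apply hl
        rw [← h3, e]
  have hc1 : ∀ h', (κ h' = κ h) → h' ≠ h →
      (Finset.univ.biUnion fun k => ((halfEdgesAt vtx (vtx k)).filter (fun k' => k' ≠ h)).biUnion
          fun k' => P.filter (fun σ => σ h = k ∧ σ h' = k')).card * M ≤ D * P.card := by
    intro h' e hne
    calc _ ≤ (∑ k, ∑ k' ∈ (halfEdgesAt vtx (vtx k)).filter (fun k' => k' ≠ h),
            (P.filter (fun σ => σ h = k ∧ σ h' = k')).card) * M := by
          gcongr
          exact Finset.card_biUnion_le.trans (Finset.sum_le_sum fun k _ => Finset.card_biUnion_le)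
      _ = ∑ k, ∑ k' ∈ (halfEdgesAt vtx (vtx k)).filter (fun k' => k' ≠ h),
            (P.filter (fun σ => σ h = k ∧ σ h' = k')).card * M := by
          rw [Finset.sum_mul]
          exact Finset.sum_congr rfl fun _ _ => Finset.sum_mul _ _ _
      _ ≤ ∑ k, ∑ k' ∈ (halfEdgesAt vtx (vtx k)).filter (fun k' => k' ≠ h),
            (P.filter (fun σ => σ h = k)).card := by
          refine Finset.sum_le_sum fun k _ => Finset.sum_le_sum fun k' hk' => ?_
          rw [hM, ← e]
          exact card_partner_eq_eq_le hne (Finset.mem_filter.1 hk').2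
      _ ≤ ∑ k, D * (P.filter (fun σ => σ h = k)).card := by
          refine Finset.sum_le_sum fun k _ => ?_
          rw [Finset.sum_const, smul_eq_mul]
          gcongr
          exact (Finset.card_filter_le _ _).trans (hD _)
      _ = D * P.card := by
          rw [← Finset.mul_sum]
          congr 1
          exact (Finset.card_eq_sum_card_fiberwise (f := fun σ : Equiv.Perm H => σ h)
            (by simp)).symm
  calc _ ≤ (((halfEdgesAt vtx (vtx h)).biUnion fun k => P.filter (fun σ => σ h = k)).card +
      (((halfEdgesAt vtx (vtx h)).filter (fun h' => h' ≠ h ∧ κ h' = κ h)).biUnion fun h' =>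
        Finset.univ.biUnion fun k => ((halfEdgesAt vtx (vtx k)).filter (fun k' => k' ≠ h)).biUnion
          fun k' => P.filter (fun σ => σ h = k ∧ σ h' = k')).card) * M := by
        gcongr
        exact (Finset.card_le_card hsub).trans (Finset.card_union_le _ _)
    _ ≤ (∑ k ∈ halfEdgesAt vtx (vtx h), (P.filter (fun σ => σ h = k)).card) * M +
        (∑ h' ∈ (halfEdgesAt vtx (vtx h)).filter (fun h' => h' ≠ h ∧ κ h' = κ h),
        (Finset.univ.biUnion fun k => ((halfEdgesAt vtx (vtx k)).filter (fun k' => k' ≠ h)).biUnion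
          fun k' => P.filter (fun σ => σ h = k ∧ σ h' = k')).card) * M := by
        rw [← add_mul]
        gcongr <;> exact Finset.card_biUnion_le
    _ ≤ (∑ k ∈ halfEdgesAt vtx (vtx h), P.card) +
        (∑ h' ∈ (halfEdgesAt vtx (vtx h)).filter (fun h' => h' ≠ h ∧ κ h' = κ h), D * P.card) := by
        rw [Finset.sum_mul, Finset.sum_mul]
        refine Nat.add_le_add (Finset.sum_le_sum fun k _ => card_partner_eq_le h k)
          (Finset.sum_le_sum fun h' hh' => ?_)
        exact hc1 h' (Finset.mem_filter.1 hh').2.2 (Finset.mem_filter.1 hh').2.1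
    _ ≤ D * P.card + D * (D * P.card) := by
        rw [Finset.sum_const, Finset.sum_const, smul_eq_mul, smul_eq_mul]
        gcongr
        · exact hD _
        · exact (Finset.card_filter_le _ _).trans (hD _)
    _ = _ := by ring

variable [Fintype T]

/-- Twice a bound for the mean number of bad half-edges, for degrees at most `D` and `q` types. -/
def badBound (D q : ℕ) : ℕ := 4 * (D + D * D) * (q * q)

/-- At least half of all pairings have a bounded number of bad half-edges, by Markov's
inequality. -/
theorem card_pairings_le_two_mul {D : ℕ} (hD : ∀ v, (halfEdgesAt vtx v).card ≤ D)
    (hlarge : ∀ h, 6 ≤ classCard (halfEdgeClass vtx τ t) Finset.univ (halfEdgeClass vtx τ t h)) :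
    (pairings (halfEdgeClass vtx τ t) Prod.swap Finset.univ).card ≤
      2 * ((pairings (halfEdgeClass vtx τ t) Prod.swap Finset.univ).filter
        (fun σ => (badSet vtx σ).card ≤ badBound D (Fintype.card T))).card := by
  set κ := halfEdgeClass vtx τ t with hκ
  set P := pairings κ Prod.swap Finset.univ with hP
  rcases P.eq_empty_or_nonempty with h0 | ⟨σ₀, hσ₀⟩
  · simp [h0]
  have hbar : Function.Involutive (Prod.swap : T × T → T × T) := Prod.swap_swap
  set C := 2 * (D + D * D) with hC
  have hm : ∀ h, classCard κ Finset.univ (κ h) *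
      (P.filter (fun σ => h ∈ badSet vtx σ)).card ≤ C * P.card := by
    intro h
    have h1 := card_bad_mul_le (vtx := vtx) (τ := τ) (t := t) hD h
    rw [← hκ, ← hP, classCard_bar hbar (mem_pairings.1 hσ₀)] at h1
    have h2 := hlarge h
    calc _ ≤ (2 * (classCard κ Finset.univ (κ h) - 3)) *
        (P.filter (fun σ => h ∈ badSet vtx σ)).card := by gcongr; omega
      _ = 2 * ((P.filter (fun σ => h ∈ badSet vtx σ)).card *
          (classCard κ Finset.univ (κ h) - 3)) := by ring
      _ ≤ 2 * ((D + D * D) * P.card) := by gcongr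
      _ = C * P.card := by rw [hC]; ring
  have hsum : ∑ σ ∈ P, (badSet vtx σ).card ≤
      Fintype.card T * Fintype.card T * (C * P.card) := by
    calc _ = ∑ h, (P.filter (fun σ => h ∈ badSet vtx σ)).card := by
          simp_rw [Finset.card_eq_sum_ones, Finset.sum_filter]
          rw [Finset.sum_comm]
          refine Finset.sum_congr rfl fun σ _ => ?_
          rw [← Finset.sum_filter]
          congr 1
          ext h; simp
      _ = ∑ c : T × T, ∑ h ∈ Finset.univ.filter (fun h => κ h = c),
          (P.filter (fun σ => h ∈ badSet vtx σ)).card :=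
          (Finset.sum_fiberwise _ _ _).symm
      _ ≤ ∑ c : T × T, C * P.card := by
          refine Finset.sum_le_sum fun c _ => ?_
          rcases (Finset.univ.filter (fun h => κ h = c)).eq_empty_or_nonempty with he | hne
          · rw [he]; simp
          refine Nat.le_of_mul_le_mul_left ?_ (Finset.card_pos.2 hne)
          rw [Finset.mul_sum, ← smul_eq_mul]
          refine Finset.sum_le_card_nsmul _ _ _ fun h hh => ?_
          have := hm h
          rw [(Finset.mem_filter.1 hh).2] at this
          exact this
      _ = _ := by simp [Fintype.card_prod]
  have hsplit := Finset.card_filter_add_card_filter_not (s := P)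
    (fun σ => (badSet vtx σ).card ≤ badBound D (Fintype.card T))
  set G := (P.filter (fun σ => (badSet vtx σ).card ≤ badBound D (Fintype.card T))).card
  set B := (P.filter (fun σ => ¬ (badSet vtx σ).card ≤ badBound D (Fintype.card T))).card with hB
  have h3 : (badBound D (Fintype.card T) + 1) * B ≤ ∑ σ ∈ P, (badSet vtx σ).card := by
    calc _ = ∑ σ ∈ P.filter (fun σ => ¬ (badSet vtx σ).card ≤ badBound D (Fintype.card T)),
          (badBound D (Fintype.card T) + 1) := by simp [hB, mul_comm]
      _ ≤ ∑ σ ∈ P.filter (fun σ => ¬ (badSet vtx σ).card ≤ badBound D (Fintype.card T)),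
          (badSet vtx σ).card := by
          refine Finset.sum_le_sum fun σ hσ => ?_
          have := (Finset.mem_filter.1 hσ).2
          omega
      _ ≤ _ := Finset.sum_le_sum_of_subset (Finset.filter_subset _ _)
  have h4 : 2 * B ≤ P.card := by
    refine Nat.le_of_mul_le_mul_left ?_ (Nat.succ_pos (badBound D (Fintype.card T)))
    calc (badBound D (Fintype.card T)).succ * (2 * B)
        = 2 * ((badBound D (Fintype.card T) + 1) * B) := by rw [Nat.succ_eq_add_one]; ring
      _ ≤ 2 * (Fintype.card T * Fintype.card T * (C * P.card)) :=
          Nat.mul_le_mul_left _ (h3.trans hsum)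
      _ = badBound D (Fintype.card T) * P.card := by rw [badBound, hC]; ring
      _ ≤ _ := Nat.mul_le_mul_right _ (Nat.le_succ _)
  omega

/-- A bad half-edge `h` can be repaired by one switching, without creating new bad half-edges: swap
the partners of `h` and of a half-edge `h'` of the same class that is far from `h`. -/
theorem exists_switch {D : ℕ} (hD : ∀ v, (halfEdgesAt vtx v).card ≤ D) {σ : Equiv.Perm H}
    (hσ : σ ∈ pairings (halfEdgeClass vtx τ t) Prod.swap Finset.univ) {h : H}
    (hh : h ∈ badSet vtx σ)
    (hlarge : 4 * D + 2 * (D * D) + (badSet vtx σ).card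
      < classCard (halfEdgeClass vtx τ t) Finset.univ (halfEdgeClass vtx τ t h)) :
    ∃ h', Equiv.swap h h' * σ * Equiv.swap h h' ∈
        pairings (halfEdgeClass vtx τ t) Prod.swap Finset.univ ∧
      (badSet vtx (Equiv.swap h h' * σ * Equiv.swap h h')).card < (badSet vtx σ).card := by
  have hσ' := mem_pairings.1 hσ
  have hinv := hσ'.1
  have hfix : ∀ z, σ z ≠ z := fun z => (hσ'.2.1 z (Finset.mem_univ _)).1
  set x := vtx h with hx
  set y := vtx (σ h) with hy
  -- the half-edges `h'` for which the switching could create a loop or a multiple edge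
  set X := halfEdgesAt vtx x ∪ halfEdgesAt vtx y ∪ (halfEdgesAt vtx x).image σ ∪
    (halfEdgesAt vtx y).image σ ∪
    (halfEdgesAt vtx x).biUnion (fun z => (halfEdgesAt vtx (vtx (σ z))).image σ) ∪
    (halfEdgesAt vtx y).biUnion (fun z => halfEdgesAt vtx (vtx (σ z))) ∪ badSet vtx σ with hX
  have hXcard : X.card ≤ 4 * D + 2 * (D * D) + (badSet vtx σ).card := by
    have a1 : ((halfEdgesAt vtx x).biUnion
        (fun z => (halfEdgesAt vtx (vtx (σ z))).image σ)).card ≤ D * D :=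
      (Finset.card_biUnion_le_card_mul _ _ D fun z _ =>
        Finset.card_image_le.trans (hD _)).trans (Nat.mul_le_mul_right _ (hD _))
    have a2 : ((halfEdgesAt vtx y).biUnion
        (fun z => halfEdgesAt vtx (vtx (σ z)))).card ≤ D * D :=
      (Finset.card_biUnion_le_card_mul _ _ D fun z _ => hD _).trans
        (Nat.mul_le_mul_right _ (hD _))
    have a3 : ((halfEdgesAt vtx x).image σ).card ≤ D := Finset.card_image_le.trans (hD _)
    have a4 : ((halfEdgesAt vtx y).image σ).card ≤ D := Finset.card_image_le.trans (hD _)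
    have a5 := hD x
    have a6 := hD y
    calc X.card ≤ _ := (Finset.card_union_le _ _).trans (Nat.add_le_add_right
          ((Finset.card_union_le _ _).trans (Nat.add_le_add_right
          ((Finset.card_union_le _ _).trans (Nat.add_le_add_right
          ((Finset.card_union_le _ _).trans (Nat.add_le_add_right
          ((Finset.card_union_le _ _).trans (Nat.add_le_add_right
          (Finset.card_union_le _ _) _)) _)) _)) _)) _)
      _ ≤ _ := by omega
  obtain ⟨h', h'1, h'2⟩ := Finset.exists_mem_notMem_of_card_lt_card (hXcard.trans_lt hlarge)
  simp only [Finset.mem_filter, Finset.mem_univ, true_and] at h'1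
  simp only [hX, Finset.mem_union, not_or, mem_halfEdgesAt, Finset.mem_image, Finset.mem_biUnion,
    not_exists, not_and, mem_badSet] at h'2
  obtain ⟨⟨⟨⟨⟨⟨b1, b2⟩, b3⟩, b4⟩, b5⟩, b6⟩, b7⟩ := h'2
  set k := σ h with hk
  set k' := σ h' with hk'
  have c1 : vtx k' ≠ x := fun e => b3 k' e (hinv h')
  have c2 : vtx k' ≠ y := fun e => b4 k' e (hinv h')
  have c3 : ∀ z, vtx z = x → vtx (σ z) ≠ vtx k' := fun z hz e => b5 z hz k' e.symm (hinv h')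
  have c4 : ∀ z, vtx z = y → vtx h' ≠ vtx (σ z) := fun z hz e => b6 z hz e
  have c5 : vtx k' ≠ vtx h' := fun e => b7 (Or.inl e)
  have n1 : h' ≠ h := fun e => b1 (by rw [e])
  have n2 : h' ≠ k := fun e => b2 (by rw [e])
  have n3 : k ≠ h := hfix h
  have n4 : k' ≠ h' := hfix h'
  have n5 : k' ≠ h := fun e => n2 (by rw [hk, ← e, hinv])
  have n6 : k ≠ k' := fun e => n1 (σ.injective e).symm
  set ρ := Equiv.swap h h' * σ * Equiv.swap h h' with hρ
  have hρP : IsPairing (halfEdgeClass vtx τ t) Prod.swap Finset.univ ρ :=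
    hσ'.conj_swap (Finset.mem_univ _) (Finset.mem_univ _) h'1.symm
  have v1 : ρ h = k' := by
    simp only [hρ, Equiv.Perm.mul_apply, Equiv.swap_apply_left]
    exact Equiv.swap_apply_of_ne_of_ne n5 n4
  have v2 : ρ h' = k := by
    simp only [hρ, Equiv.Perm.mul_apply, Equiv.swap_apply_right]
    exact Equiv.swap_apply_of_ne_of_ne n3 n2.symm
  have v3 : ρ k = h' := by rw [← v2, hρP.1]
  have v4 : ρ k' = h := by rw [← v1, hρP.1]
  have v5 : ∀ z, z ≠ h → z ≠ h' → z ≠ k → z ≠ k' → ρ z = σ z := by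
    intro z z1 z2 z3 z4
    simp only [hρ, Equiv.Perm.mul_apply, Equiv.swap_apply_of_ne_of_ne z1 z2]
    refine Equiv.swap_apply_of_ne_of_ne (fun e => z3 ?_) (fun e => z4 ?_)
    · rw [hk, ← e, hinv]
    · rw [hk', ← e, hinv]
  have g1 : ¬ IsBad vtx ρ h := by
    rintro (e | ⟨z, z1, z2, z3⟩)
    · rw [v1] at e; exact c1 e
    · rw [v1] at z3
      by_cases e2 : z = h'
      · subst e2; exact b1 z2
      by_cases e3 : z = k
      · subst e3; rw [v3] at z3; exact c5 z3.symm
      by_cases e4 : z = k'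
      · subst e4; exact c1 z2
      rw [v5 z z1 e2 e3 e4] at z3
      exact c3 z z2 z3
  have g2 : ¬ IsBad vtx ρ h' := by
    rintro (e | ⟨z, z1, z2, z3⟩)
    · rw [v2] at e; exact b2 e.symm
    · rw [v2] at z3
      by_cases e1 : z = h
      · subst e1; exact b1 z2.symm
      by_cases e3 : z = k
      · subst e3; exact b2 z2.symm
      by_cases e4 : z = k'
      · subst e4; exact c5 z2
      rw [v5 z e1 z1 e3 e4] at z3
      exact c4 (σ z) z3 (by rw [hinv, z2])
  have g3 : ¬ IsBad vtx ρ k := fun e => g2 (by simpa [v3] using isBad_apply hρP.1 e)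
  have g4 : ¬ IsBad vtx ρ k' := fun e => g1 (by simpa [v4] using isBad_apply hρP.1 e)
  have v6 : ∀ z, IsBad vtx ρ z → ρ z = σ z := fun z hz =>
    v5 z (fun e => g1 (e ▸ hz)) (fun e => g2 (e ▸ hz)) (fun e => g3 (e ▸ hz))
      (fun e => g4 (e ▸ hz))
  refine ⟨h', mem_pairings.2 hρP, Finset.card_lt_card ?_⟩
  refine ⟨fun z hz => ?_, fun hsub => g1 (mem_badSet.1 (hsub hh))⟩
  rw [mem_badSet] at hz ⊢
  have e1 := v6 z hz
  rcases hz with hz | ⟨w, w1, w2, w3⟩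
  · left; rw [← e1, hz]
  · have e2 := v6 w (Or.inr ⟨z, w1.symm, w2.symm, w3.symm⟩)
    right
    exact ⟨w, w1, w2, by rw [← e1, ← e2, w3]⟩

/-- At least a polynomial fraction of all pairings is simple: a switching is determined by two
half-edges, and a bounded number of switchings suffices for half of all pairings. -/
theorem card_pairings_le_simple {D : ℕ} (hD : ∀ v, (halfEdgesAt vtx v).card ≤ D)
    (hlarge : ∀ h, 4 * D + 2 * (D * D) + badBound D (Fintype.card T) + 6
      ≤ classCard (halfEdgeClass vtx τ t) Finset.univ (halfEdgeClass vtx τ t h)) :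
    (pairings (halfEdgeClass vtx τ t) Prod.swap Finset.univ).card ≤
      2 * (Fintype.card H ^ 2 + 1) ^ badBound D (Fintype.card T) *
        ((pairings (halfEdgeClass vtx τ t) Prod.swap Finset.univ).filter
        (fun σ => badSet vtx σ = ∅)).card := by
  set κ := halfEdgeClass vtx τ t with hκ
  set P := pairings κ Prod.swap Finset.univ with hP
  set B := badBound D (Fintype.card T) with hB
  have hstep : ∀ b, b + 1 ≤ B → (P.filter (fun σ => (badSet vtx σ).card ≤ b + 1)).card ≤
      (Fintype.card H ^ 2 + 1) * (P.filter (fun σ => (badSet vtx σ).card ≤ b)).card := by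
    intro b hb
    -- the identity and the transpositions; conjugation by them is undone by repeating it
    set S : Finset (Equiv.Perm H) := insert 1
      ((Finset.univ : Finset (H × H)).image fun p => Equiv.swap p.1 p.2) with hS
    have hScard : S.card ≤ Fintype.card H ^ 2 + 1 := by
      refine (Finset.card_insert_le _ _).trans (Nat.add_le_add_right ?_ 1)
      refine Finset.card_image_le.trans ?_
      simp [Fintype.card_prod, sq]
    have hch : ∀ σ ∈ P.filter (fun σ => (badSet vtx σ).card ≤ b + 1), ∃ π ∈ S, π * π = 1 ∧
        π * σ * π ∈ P.filter (fun σ => (badSet vtx σ).card ≤ b) := by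
      intro σ hσ
      rw [Finset.mem_filter] at hσ
      rcases (badSet vtx σ).eq_empty_or_nonempty with he | ⟨h, hh⟩
      · exact ⟨1, by simp [hS], by simp, by simp [hσ.1, he]⟩
      · obtain ⟨h', h1, h2⟩ := exists_switch hD hσ.1 hh (by have := hlarge h; rw [hκ] at this; omega)
        refine ⟨Equiv.swap h h', ?_, by simp, Finset.mem_filter.2 ⟨h1, by omega⟩⟩
        simp only [hS, Finset.mem_insert, Finset.mem_image]
        exact Or.inr ⟨(h, h'), Finset.mem_univ _, rfl⟩
    choose! π hπS hπ1 hπ2 using hch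
    calc _ ≤ (S ×ˢ P.filter (fun σ => (badSet vtx σ).card ≤ b)).card := by
          refine Finset.card_le_card_of_injOn (fun σ => (π σ, π σ * σ * π σ)) ?_ ?_
          · intro σ hσ
            exact Finset.mem_product.2 ⟨hπS σ hσ, hπ2 σ hσ⟩
          · intro σ hσ σ' hσ' he
            simp only [Prod.mk.injEq] at he
            have h1 := hπ1 σ hσ
            have h2 := he.2
            rw [← he.1] at h2
            have h3 := mul_right_cancel h2
            exact mul_left_cancel h3
      _ ≤ _ := by rw [Finset.card_product]; gcongr
  have hall : ∀ b, b ≤ B → (P.filter (fun σ => (badSet vtx σ).card ≤ b)).card ≤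
      (Fintype.card H ^ 2 + 1) ^ b * (P.filter (fun σ => badSet vtx σ = ∅)).card := by
    intro b
    induction b with
    | zero => intro _; simp
    | succ b ih =>
      intro hb
      refine (hstep b hb).trans ?_
      rw [pow_succ' (_ + 1), mul_assoc]
      exact Nat.mul_le_mul_left _ (ih (by omega))
  refine (card_pairings_le_two_mul hD fun h => by have := hlarge h; rw [← hκ]; omega).trans ?_
  rw [mul_assoc]
  exact Nat.mul_le_mul_left _ (hall B le_rfl)

end Switching

/-! ### Ordered graphs and simple pairings -/

section Ordered

variable {k : ℕ} {d : Matrix (Fin k) (Fin k) ℕ} {n : Fin k → ℕ} {S : Fin k → Type}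
  [∀ i, Fintype (S i)] [∀ i, DecidableEq (S i)] {t : ∀ i, S i → Fin k}

/-- Half-edges: every vertex of type `i` has one half-edge for every slot in `S i`. -/
abbrev HalfEdge (n : Fin k → ℕ) (S : Fin k → Type) : Type := Σ x : GraphVertex n, S x.1

/-- `e` lists the neighbours of `x` in `G`, indexed by slots of the right types. -/
structure IsOrdering (t : ∀ i, S i → Fin k) (G : SimpleGraph (GraphVertex n)) (x : GraphVertex n)
    (e : S x.1 → GraphVertex n) : Prop where
  inj : Function.Injective e
  adj : ∀ s, G.Adj x (e s)
  type : ∀ s, (e s).1 = t x.1 s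

/-- The slots of a vertex of type `i` match the degree matrix. -/
def SlotCard (d : Matrix (Fin k) (Fin k) ℕ) (t : ∀ i, S i → Fin k) : Prop :=
  ∀ i j, (Finset.univ.filter (fun s : S i => t i s = j)).card = d i j

theorem IsOrdering.exists_slot (hS : SlotCard d t) (G : ConfigGraph d n) {x : GraphVertex n}
    {e : S x.1 → GraphVertex n} (he : IsOrdering t G.1 x e) {y : GraphVertex n}
    (hy : G.1.Adj x y) : ∃ s, e s = y := by
  set A := (Finset.univ.filter (fun s : S x.1 => t x.1 s = y.1)).image e with hA
  have h1 : (A : Set (GraphVertex n)) ⊆ {z | G.1.Adj x z ∧ z.1 = y.1} := by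
    intro z hz
    simp only [hA, Finset.coe_image, Set.mem_image, Finset.mem_coe, Finset.mem_filter,
      Finset.mem_univ, true_and] at hz
    obtain ⟨s, hs, rfl⟩ := hz
    exact ⟨he.adj s, (he.type s).trans hs⟩
  have h2 : (A : Set (GraphVertex n)) = {z | G.1.Adj x z ∧ z.1 = y.1} := by
    refine Set.eq_of_subset_of_ncard_le h1 ?_ (Set.toFinite _)
    rw [G.2 x y.1, Set.ncard_coe_finset, hA, Finset.card_image_of_injective _ he.inj, hS]
  have h3 : y ∈ (A : Set (GraphVertex n)) := by rw [h2]; exact ⟨hy, rfl⟩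
  simp only [hA, Finset.coe_image, Set.mem_image] at h3
  obtain ⟨s, -, hs⟩ := h3
  exact ⟨s, hs⟩

theorem exists_isOrdering (hS : SlotCard d t) (G : ConfigGraph d n) (x : GraphVertex n) :
    ∃ e : S x.1 → GraphVertex n, IsOrdering t G.1 x e := by
  have h1 : ∀ j, Nonempty ({s : S x.1 // t x.1 s = j} ≃ {y // G.1.Adj x y ∧ y.1 = j}) := by
    intro j
    refine (Finite.card_eq (α := {s : S x.1 // t x.1 s = j})
      (β := {y // G.1.Adj x y ∧ y.1 = j})).1 ?_
    rw [Nat.card_eq_fintype_card, Fintype.card_subtype, hS, ← G.2 x j]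
    exact (Nat.card_coe_set_eq _).symm
  have f := fun j => (h1 j).some
  refine ⟨fun s => (f (t x.1 s) ⟨s, rfl⟩).1, ?_, ?_, ?_⟩
  · have key : ∀ j j' (a : {s : S x.1 // t x.1 s = j}) (b : {s : S x.1 // t x.1 s = j'}),
        (f j a).1 = (f j' b).1 → a.1 = b.1 := by
      intro j j' a b hab
      have hj : j = j' := by rw [← (f j a).2.2, ← (f j' b).2.2, hab]
      subst hj
      rw [(f j).injective (Subtype.ext hab)]
    intro s s' h
    exact key _ _ _ _ h
  · intro s; exact (f (t x.1 s) ⟨s, rfl⟩).2.1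
  · intro s; exact (f (t x.1 s) ⟨s, rfl⟩).2.2

open Classical in
/-- All orderings of the neighbours of `x`. -/
noncomputable def orderingsAt (t : ∀ i, S i → Fin k) (G : SimpleGraph (GraphVertex n))
    (x : GraphVertex n) : Finset (S x.1 → GraphVertex n) :=
  Finset.univ.filter (IsOrdering t G x)

/-- The permutations of the slots of a vertex of type `i` that preserve types. -/
def slotPerms (t : ∀ i, S i → Fin k) (i : Fin k) : Finset (Equiv.Perm (S i)) :=
  Finset.univ.filter (fun π => ∀ s, t i (π s) = t i s)

theorem mem_orderingsAt {G : SimpleGraph (GraphVertex n)} {x : GraphVertex n}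
    {e : S x.1 → GraphVertex n} : e ∈ orderingsAt t G x ↔ IsOrdering t G x e := by
  simp [orderingsAt]

theorem mem_slotPerms {i : Fin k} {π : Equiv.Perm (S i)} :
    π ∈ slotPerms t i ↔ ∀ s, t i (π s) = t i s := by simp [slotPerms]

theorem slotPerms_card_pos (i : Fin k) : 0 < (slotPerms t i).card :=
  Finset.card_pos.2 ⟨1, by simp [mem_slotPerms]⟩

/-- All orderings of the neighbours of `x` arise from one of them by permuting slots. -/
theorem exists_slotPerm (hS : SlotCard d t) (G : ConfigGraph d n) {x : GraphVertex n}
    {e e' : S x.1 → GraphVertex n} (he : IsOrdering t G.1 x e) (he' : IsOrdering t G.1 x e') :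
    ∃ π ∈ slotPerms t x.1, e ∘ π = e' := by
  choose π hπ using fun s => he.exists_slot hS G (he'.adj s)
  have hinj : Function.Injective π := fun a b hab => he'.inj (by rw [← hπ, ← hπ, hab])
  refine ⟨Equiv.ofBijective π (Finite.injective_iff_bijective.1 hinj), ?_, ?_⟩
  · rw [mem_slotPerms]
    intro s
    rw [← he'.type s, ← hπ s, he.type]
    rfl
  · funext s
    exact hπ s

theorem sum_orderingsAt (hS : SlotCard d t) (G : ConfigGraph d n) (x : GraphVertex n)
    {e : S x.1 → GraphVertex n} (he : IsOrdering t G.1 x e) {M : Type*} [AddCommMonoid M]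
    (F : (S x.1 → GraphVertex n) → M) :
    ∑ e' ∈ orderingsAt t G.1 x, F e' = ∑ π ∈ slotPerms t x.1, F (e ∘ π) := by
  symm
  refine Finset.sum_bij (fun π _ => e ∘ π) ?_ ?_ ?_ ?_
  · intro π hπ
    rw [mem_slotPerms] at hπ
    rw [mem_orderingsAt]
    exact ⟨he.inj.comp π.injective, fun s => he.adj _, fun s => (he.type _).trans (hπ s)⟩
  · intro π _ π' _ h
    ext s
    exact he.inj (congrFun h s)
  · intro e' he'
    obtain ⟨π, hπ, h⟩ := exists_slotPerm hS G he (mem_orderingsAt.1 he')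
    exact ⟨π, hπ, h⟩
  · intro π _; rfl

theorem card_orderingsAt (hS : SlotCard d t) (G : ConfigGraph d n) (x : GraphVertex n) :
    (orderingsAt t G.1 x).card = (slotPerms t x.1).card := by
  obtain ⟨e, he⟩ := exists_isOrdering hS G x
  rw [Finset.card_eq_sum_ones, sum_orderingsAt hS G x he, Finset.card_eq_sum_ones]

/-- The class of a half-edge: the type of its vertex and the type of its slot. -/
def slotClass (n : Fin k → ℕ) (t : ∀ i, S i → Fin k) : HalfEdge n S → Fin k × Fin k :=
  halfEdgeClass (Sigma.fst : HalfEdge n S → GraphVertex n) Sigma.fst (fun h => t h.1.1 h.2)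

theorem halfEdge_ext {G : SimpleGraph (GraphVertex n)} {e : ∀ x : GraphVertex n,
    S x.1 → GraphVertex n} (he : ∀ x, IsOrdering t G x (e x)) {h h' : HalfEdge n S}
    (h1 : h.1 = h'.1) (h2 : e h.1 h.2 = e h'.1 h'.2) : h = h' := by
  obtain ⟨x, s⟩ := h
  obtain ⟨x', s'⟩ := h'
  obtain rfl : x = x' := h1
  exact congrArg (Sigma.mk x) ((he x).inj h2)

/-- An ordered graph defines a pairing of its half-edges. -/
theorem exists_pairing_of_ordering (hS : SlotCard d t) (G : ConfigGraph d n)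
    {e : ∀ x : GraphVertex n, S x.1 → GraphVertex n} (he : ∀ x, IsOrdering t G.1 x (e x)) :
    ∃ σ : Equiv.Perm (HalfEdge n S), IsPairing (slotClass n t) Prod.swap Finset.univ σ ∧
      ∀ h, (σ h).1 = e h.1 h.2 := by
  have h1 : ∀ h : HalfEdge n S, ∃ s : S (e h.1 h.2).1, e (e h.1 h.2) s = h.1 := fun h =>
    (he _).exists_slot hS G ((he h.1).adj h.2).symm
  choose f hf using h1
  set g : HalfEdge n S → HalfEdge n S := fun h => ⟨e h.1 h.2, f h⟩ with hg
  have g1 : ∀ h, (g h).1 = e h.1 h.2 := fun h => rfl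
  have g2 : ∀ h, e (g h).1 (g h).2 = h.1 := fun h => hf h
  have ginv : Function.Involutive g := fun h =>
    halfEdge_ext he (by rw [g1, g2]) (by rw [g2, g1])
  refine ⟨ginv.toPerm, ⟨ginv, fun h _ => ⟨?_, Finset.mem_univ _, ?_⟩, fun h hh => ?_⟩, g1⟩
  · intro h0
    have h2 : g h = h := h0
    have h3 := (he h.1).adj h.2
    rw [← g1, h2] at h3
    exact G.1.loopless.irrefl _ h3
  · show slotClass n t (g h) = _
    simp only [slotClass, halfEdgeClass, Prod.swap_prod_mk, Prod.mk.injEq]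
    refine ⟨(he h.1).type h.2, ?_⟩
    rw [← (he _).type, g2]
  · exact absurd (Finset.mem_univ _) hh

theorem graph_eq_of_orderings (hS : SlotCard d t) {G G' : ConfigGraph d n}
    {e : ∀ x : GraphVertex n, S x.1 → GraphVertex n} (he : ∀ x, IsOrdering t G.1 x (e x))
    (he' : ∀ x, IsOrdering t G'.1 x (e x)) : G = G' := by
  apply Subtype.ext
  ext x y
  constructor
  · intro h
    obtain ⟨s, rfl⟩ := (he x).exists_slot hS G h
    exact (he' x).adj s
  · intro h
    obtain ⟨s, rfl⟩ := (he' x).exists_slot hS G' h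
    exact (he x).adj s

/-- A simple pairing comes from an ordered graph. -/
theorem exists_ordering_of_simple (hS : SlotCard d t) {σ : Equiv.Perm (HalfEdge n S)}
    (hσ : IsPairing (slotClass n t) Prod.swap Finset.univ σ)
    (hsimple : badSet (Sigma.fst : HalfEdge n S → GraphVertex n) σ = ∅) :
    ∃ G : ConfigGraph d n, ∀ x, IsOrdering t G.1 x (fun s => (σ ⟨x, s⟩).1) := by
  have hnb : ∀ h, ¬ IsBad (Sigma.fst : HalfEdge n S → GraphVertex n) σ h := by
    intro h hb
    have := mem_badSet.2 hb
    rw [hsimple] at this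
    simp at this
  have htype : ∀ h, (σ h).1.1 = t h.1.1 h.2 := fun h =>
    congrArg Prod.fst (hσ.2.1 h (Finset.mem_univ _)).2.2
  have hinj : ∀ x : GraphVertex n, Function.Injective (fun s : S x.1 => (σ ⟨x, s⟩).1) := by
    intro x s s' h
    by_contra hne
    refine hnb ⟨x, s'⟩ (Or.inr ⟨⟨x, s⟩, fun e => hne ?_, rfl, h⟩)
    simpa using e
  let G : SimpleGraph (GraphVertex n) :=
    { Adj := fun x y => ∃ h : HalfEdge n S, h.1 = x ∧ (σ h).1 = y
      symm := ⟨fun x y ⟨h, h1, h2⟩ => ⟨σ h, h2, by rw [hσ.1, h1]⟩⟩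
      loopless := ⟨fun x ⟨h, h1, h2⟩ => hnb h (Or.inl (h2.trans h1.symm))⟩ }
  refine ⟨⟨G, fun x j => ?_⟩, fun x => ⟨hinj x, fun s => ⟨⟨x, s⟩, rfl, rfl⟩, fun s => htype _⟩⟩
  have : {y | G.Adj x y ∧ y.1 = j} = (fun s : S x.1 => (σ ⟨x, s⟩).1) ''
      ((Finset.univ.filter (fun s : S x.1 => t x.1 s = j) : Finset (S x.1)) : Set (S x.1)) := by
    ext y
    constructor
    · rintro ⟨⟨⟨x', s⟩, rfl, rfl⟩, h2⟩
      exact ⟨s, by simpa [← h2] using (htype ⟨x', s⟩).symm, rfl⟩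
    · rintro ⟨s, hs, rfl⟩
      refine ⟨⟨⟨x, s⟩, rfl, rfl⟩, (htype _).trans (by simpa using hs)⟩
  rw [this, Set.ncard_image_of_injective _ (hinj x), Set.ncard_coe_finset, hS]

/-- A simple pairing is determined by the endpoints of its edges. -/
theorem pairing_eq_of_ordering {σ σ' : Equiv.Perm (HalfEdge n S)}
    (hσ : IsPairing (slotClass n t) Prod.swap Finset.univ σ)
    (hσ' : IsPairing (slotClass n t) Prod.swap Finset.univ σ')
    (hsimple : badSet (Sigma.fst : HalfEdge n S → GraphVertex n) σ = ∅)
    (h : ∀ h, (σ h).1 = (σ' h).1) : σ = σ' := by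
  ext1 z
  by_contra hne
  have h1 : σ z ∈ badSet (Sigma.fst : HalfEdge n S → GraphVertex n) σ := by
    rw [mem_badSet]
    refine Or.inr ⟨σ' z, fun e => hne e.symm, (h z).symm, ?_⟩
    rw [h, hσ'.1, hσ.1]
  rw [hsimple] at h1
  simp at h1

/-- The number of orderings of a graph. -/
def orderingCount (n : Fin k → ℕ) (t : ∀ i, S i → Fin k) : ℕ :=
  ∏ x : GraphVertex n, (slotPerms t x.1).card

theorem card_piFinset_orderingsAt (hS : SlotCard d t) (G : ConfigGraph d n) :
    (Fintype.piFinset (fun x => orderingsAt t G.1 x)).card = orderingCount n t := by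
  rw [Fintype.card_piFinset]
  exact Finset.prod_congr rfl fun x _ => card_orderingsAt hS G x

/-- There are at most as many simple pairings as ordered graphs. -/
theorem card_simple_le (hS : SlotCard d t) :
    ((pairings (slotClass n t) Prod.swap Finset.univ).filter (fun σ =>
        badSet (Sigma.fst : HalfEdge n S → GraphVertex n) σ = ∅)).card
      ≤ Nat.card (ConfigGraph d n) * orderingCount n t := by
  have : Fintype (ConfigGraph d n) := Fintype.ofFinite _
  have h1 : ∀ σ ∈ (pairings (slotClass n t) Prod.swap Finset.univ).filter (fun σ =>
        badSet (Sigma.fst : HalfEdge n S → GraphVertex n) σ = ∅),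
        ∃ G : ConfigGraph d n, ∀ x, IsOrdering t G.1 x (fun s => (σ ⟨x, s⟩).1) := by
    intro σ hσ
    rw [Finset.mem_filter, mem_pairings] at hσ
    exact exists_ordering_of_simple hS hσ.1 hσ.2
  rcases isEmpty_or_nonempty (ConfigGraph d n) with hE | hN
  · rw [Finset.card_eq_zero.2]
    · exact Nat.zero_le _
    · rw [Finset.eq_empty_iff_forall_notMem]
      intro σ hσ
      exact hE.elim (h1 σ hσ).choose
  choose! G hG using h1
  have h2 : Nat.card (ConfigGraph d n) * orderingCount n t =
      ((Finset.univ : Finset (ConfigGraph d n)).sigma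
        (fun G => Fintype.piFinset (fun x => orderingsAt t G.1 x))).card := by
    rw [Finset.card_sigma, Finset.sum_congr rfl fun G _ => card_piFinset_orderingsAt hS G]
    simp [Nat.card_eq_fintype_card]
  rw [h2]
  refine Finset.card_le_card_of_injOn (fun σ => ⟨G σ, fun x s => (σ ⟨x, s⟩).1⟩) ?_ ?_
  · intro σ hσ
    simp only [Finset.coe_sigma, Set.mem_sigma_iff, Finset.mem_coe, Finset.mem_univ, true_and,
      Fintype.mem_piFinset, mem_orderingsAt]
    exact hG σ hσ
  · intro σ hσ σ' hσ' he
    have h3 := (Sigma.mk.inj_iff.1 he).2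
    have h4 := eq_of_heq h3
    rw [Finset.mem_coe, Finset.mem_filter, mem_pairings] at hσ hσ'
    exact pairing_eq_of_ordering hσ.1 hσ'.1 hσ.2 fun h => congrFun (congrFun h4 h.1) h.2

end Ordered

/-! ### The first moment bound -/

section FirstMoment

variable {k : ℕ} {d : Matrix (Fin k) (Fin k) ℕ} {n : Fin k → ℕ} {S : Fin k → Type}
  [∀ i, Fintype (S i)] [∀ i, DecidableEq (S i)] {t : ∀ i, S i → Fin k}
  {B : Type} [Fintype B] [DecidableEq B]

/-- The labels seen from `x`: the label of `x` and the labels of its neighbours, slot by slot. -/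
def starLabels (e : ∀ x : GraphVertex n, S x.1 → GraphVertex n) (y : GraphVertex n → B)
    (x : GraphVertex n) : B × (S x.1 → B) := (y x, fun s => y (e x s))

/-- The class of a half-edge with labels at both of its ends. -/
def labelClass (t : ∀ i, S i → Fin k) (s : ∀ x : GraphVertex n, B × (S x.1 → B))
    (h : HalfEdge n S) : (Fin k × B) × (Fin k × B) :=
  ((h.1.1, (s h.1).1), (t h.1.1 h.2, (s h.1).2 h.2))

/-- The pairing of a labelled ordered graph respects the labels at both ends of the half-edges. -/
theorem isPairing_labelClass {e : ∀ x : GraphVertex n, S x.1 → GraphVertex n}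
    {σ : Equiv.Perm (HalfEdge n S)} (hσ : IsPairing (slotClass n t) Prod.swap Finset.univ σ)
    (hσe : ∀ h, (σ h).1 = e h.1 h.2) (y : GraphVertex n → B) :
    IsPairing (labelClass t (starLabels e y)) Prod.swap Finset.univ σ := by
  refine ⟨hσ.1, fun h hh => ⟨(hσ.2.1 h hh).1, Finset.mem_univ _, ?_⟩, hσ.2.2⟩
  have h1 := (hσ.2.1 h hh).2.2
  simp only [slotClass, halfEdgeClass, Prod.swap_prod_mk, Prod.mk.injEq] at h1
  have h2 : e (σ h).1 (σ h).2 = h.1 := by rw [← hσe, hσ.1]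
  simp only [labelClass, starLabels, Prod.swap_prod_mk, Prod.mk.injEq]
  exact ⟨⟨h1.1, by rw [hσe]⟩, h1.2, by rw [h2]⟩

/-- Assignments of star labels of large probability are few. -/
theorem card_le_exp_of_prod {p : ∀ i, B × (S i → B) → ℝ} (hp : ∀ i b, 0 < p i b)
    (hp1 : ∀ i, ∑ b, p i b = 1) {C : ℝ} (L : Finset (∀ x : GraphVertex n, B × (S x.1 → B)))
    (hL : ∀ s ∈ L, ∑ x, - Real.log (p x.1 (s x)) ≤ C) : (L.card : ℝ) ≤ Real.exp C := by
  have h1 : ∑ s : (∀ x : GraphVertex n, B × (S x.1 → B)), ∏ x, p x.1 (s x) = 1 := by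
    rw [← Fintype.piFinset_univ, ← Finset.prod_univ_sum]
    simp [hp1]
  have h2 : ∀ s ∈ L, Real.exp (-C) ≤ ∏ x, p x.1 (s x) := by
    intro s hs
    rw [← Real.log_le_log_iff (Real.exp_pos _) (Finset.prod_pos fun x _ => hp _ _),
      Real.log_exp, Real.log_prod (fun x _ => (hp _ _).ne')]
    have := hL s hs
    rw [Finset.sum_neg_distrib] at this
    linarith
  have h3 : (L.card : ℝ) * Real.exp (-C) ≤ 1 := by
    rw [← h1, ← nsmul_eq_mul]
    refine (Finset.card_nsmul_le_sum L _ _ h2).trans ?_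
    exact Finset.sum_le_sum_of_subset_of_nonneg (Finset.subset_univ _)
      fun s _ _ => Finset.prod_nonneg fun x _ => (hp _ _).le
  rw [Real.exp_neg] at h3
  rwa [← div_eq_mul_inv, div_le_one (Real.exp_pos _)] at h3

theorem halfEdgesAt_card (x : GraphVertex n) :
    (halfEdgesAt (Sigma.fst : HalfEdge n S → GraphVertex n) x).card = Fintype.card (S x.1) := by
  rw [← Finset.card_univ (α := S x.1)]
  symm
  refine Finset.card_bij (fun s _ => ⟨x, s⟩) ?_ ?_ ?_
  · intro s _; simp [mem_halfEdgesAt]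
  · intro s _ s' _ h; simpa using h
  · rintro ⟨x', s⟩ h
    obtain rfl : x' = x := mem_halfEdgesAt.1 h
    exact ⟨s, Finset.mem_univ _, rfl⟩

/-- The polynomial factor in the first moment bound. -/
noncomputable def polyFactor (n : Fin k → ℕ) (t : ∀ i, S i → Fin k) (D : ℕ) : ℝ :=
  2 * ((Fintype.card (HalfEdge n S) : ℝ) ^ 2 + 1) ^ badBound D k *
    √(∏ c, ((classCard (slotClass n t) Finset.univ c : ℝ) + 1))

/-- First moment bound: if every graph in `𝒢` carries many labellings whose star statistics have
large probability under `p`, and whose edge statistics are compatible with few pairings, then `𝒢`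
is a small part of all graphs. -/
theorem card_mul_le_first_moment (hS : SlotCard d t) [Nonempty (ConfigGraph d n)] {D : ℕ}
    (hD : ∀ i, Fintype.card (S i) ≤ D)
    (hlarge : ∀ h : HalfEdge n S, 4 * D + 2 * (D * D) + badBound D k + 6
      ≤ classCard (slotClass n t) Finset.univ (slotClass n t h))
    {p : ∀ i, B × (S i → B) → ℝ} (hp : ∀ i b, 0 < p i b) (hp1 : ∀ i, ∑ b, p i b = 1)
    {𝒢 : Finset (ConfigGraph d n)} {Y : ConfigGraph d n → Finset (GraphVertex n → B)} {R C₁ C₂ : ℝ}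
    (hY : ∀ G ∈ 𝒢, R ≤ (Y G).card)
    (h1 : ∀ G ∈ 𝒢, ∀ y ∈ Y G, ∀ e : ∀ x : GraphVertex n, S x.1 → GraphVertex n,
      (∀ x, IsOrdering t G.1 x (e x)) → ∑ x, - Real.log (p x.1 (starLabels e y x)) ≤ C₁)
    (h2 : ∀ G ∈ 𝒢, ∀ y ∈ Y G, ∀ e : ∀ x : GraphVertex n, S x.1 → GraphVertex n,
      (∀ x, IsOrdering t G.1 x (e x)) →
      ∏ c, ((classCard (labelClass t (starLabels e y)) Finset.univ c).factorial : ℝ) ≤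
      Real.exp (-C₂) ^ 2 * ∏ c, ((classCard (slotClass n t) Finset.univ c).factorial : ℝ)) :
    (𝒢.card : ℝ) * R ≤ Nat.card (ConfigGraph d n) * (polyFactor n t D * Real.exp (C₁ - C₂)) := by
  classical
  have hbar : Function.Involutive (Prod.swap : Fin k × Fin k → Fin k × Fin k) := Prod.swap_swap
  have hbar' : Function.Involutive
    (Prod.swap : (Fin k × B) × (Fin k × B) → (Fin k × B) × (Fin k × B)) := Prod.swap_swap
  set P := pairings (slotClass n t) Prod.swap (Finset.univ : Finset (HalfEdge n S)) with hP
  set Ps := P.filter (fun σ => badSet (Sigma.fst : HalfEdge n S → GraphVertex n) σ = ∅) with hPs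
  set F := orderingCount n t with hF
  have hFpos : 0 < F := Finset.prod_pos fun x _ => slotPerms_card_pos _
  have hPne : P.Nonempty := by
    obtain ⟨G⟩ := ‹Nonempty (ConfigGraph d n)›
    choose e he using exists_isOrdering hS G
    obtain ⟨σ, hσ, -⟩ := exists_pairing_of_ordering hS G he
    exact ⟨σ, mem_pairings.2 hσ⟩
  set L : Finset (∀ x : GraphVertex n, B × (S x.1 → B)) := Finset.univ.filter (fun s =>
    ∑ x, - Real.log (p x.1 (s x)) ≤ C₁ ∧
    ∏ c, ((classCard (labelClass t s) Finset.univ c).factorial : ℝ) ≤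
      Real.exp (-C₂) ^ 2 * ∏ c, ((classCard (slotClass n t) Finset.univ c).factorial : ℝ)) with hL
  -- ordered graphs with labels are pairings compatible with star labels
  have hcount : (𝒢.sigma fun G => Fintype.piFinset (fun x => orderingsAt t G.1 x) ×ˢ Y G).card ≤
      (L.sigma fun s => pairings (labelClass t s) Prod.swap Finset.univ).card := by
    have hex : ∀ q ∈ 𝒢.sigma (fun G => Fintype.piFinset (fun x => orderingsAt t G.1 x) ×ˢ Y G),
        ∃ σ : Equiv.Perm (HalfEdge n S), IsPairing (slotClass n t) Prod.swap Finset.univ σ ∧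
        ∀ h, (σ h).1 = q.2.1 h.1 h.2 := by
      intro q hq
      simp only [Finset.mem_sigma, Finset.mem_product, Fintype.mem_piFinset,
        mem_orderingsAt] at hq
      exact exists_pairing_of_ordering hS q.1 hq.2.1
    choose! σ hσ hσe using hex
    refine Finset.card_le_card_of_injOn
      (fun q => ⟨starLabels q.2.1 q.2.2, σ q⟩) ?_ ?_
    · intro q hq
      have hq' := Finset.mem_coe.1 hq
      simp only [Finset.mem_sigma, Finset.mem_product, Fintype.mem_piFinset,
        mem_orderingsAt] at hq'
      rw [Finset.mem_coe, Finset.mem_sigma]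
      refine ⟨?_, ?_⟩
      · rw [hL, Finset.mem_filter]
        exact ⟨Finset.mem_univ _, h1 q.1 hq'.1 _ hq'.2.2 _ hq'.2.1,
          h2 q.1 hq'.1 _ hq'.2.2 _ hq'.2.1⟩
      · exact mem_pairings.2 (isPairing_labelClass (hσ q hq) (hσe q hq) _)
    · rintro q hq q' hq' heq
      have e1 := (Sigma.mk.inj_iff.1 heq).1
      have e2 := eq_of_heq (Sigma.mk.inj_iff.1 heq).2
      have e3 : q.2.1 = q'.2.1 := by
        funext x s
        have := hσe q hq ⟨x, s⟩
        rw [e2, hσe q' hq'] at this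
        exact this.symm
      have e4 : q.2.2 = q'.2.2 := by
        funext x
        exact congrArg Prod.fst (congrFun e1 x)
      have hq1 := Finset.mem_coe.1 hq
      have hq1' := Finset.mem_coe.1 hq'
      simp only [Finset.mem_sigma, Finset.mem_product, Fintype.mem_piFinset,
        mem_orderingsAt] at hq1 hq1'
      have e5 : q.1 = q'.1 := by
        refine graph_eq_of_orderings hS hq1.2.1 ?_
        rw [e3]
        exact hq1'.2.1
      obtain ⟨G, e, y⟩ := q
      obtain ⟨G', e', y'⟩ := q'
      simp only at e3 e4 e5
      subst e3 e4 e5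
      rfl
  -- compare the numbers of pairings with and without labels through the square root formula
  have hratio : ∀ s ∈ L, ((pairings (labelClass t s) Prod.swap
      (Finset.univ : Finset (HalfEdge n S))).card : ℝ) ≤ Real.exp (-C₂) * (P.card *
        √(∏ c, ((classCard (slotClass n t) Finset.univ c : ℝ) + 1))) := by
    intro s hs
    have a1 : ((pairings (labelClass t s) Prod.swap
      (Finset.univ : Finset (HalfEdge n S))).card : ℝ) ^ 2 ≤
      ∏ c, ((classCard (labelClass t s) Finset.univ c).factorial : ℝ) := by
      exact_mod_cast card_pairings_sq_le (s := (Finset.univ : Finset (HalfEdge n S)))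
        (κ := labelClass t s) hbar'
    have a2 : ∏ c, ((classCard (slotClass n t) Finset.univ c).factorial : ℝ) ≤
        (P.card : ℝ) ^ 2 * ∏ c, ((classCard (slotClass n t) Finset.univ c : ℝ) + 1) := by
      exact_mod_cast prod_factorial_le_card_pairings_sq (κ := slotClass n t) hbar hPne
    have a3 := (Finset.mem_filter.1 hs).2.2
    have a4 : 0 ≤ ∏ c, ((classCard (slotClass n t) Finset.univ c : ℝ) + 1) :=
      Finset.prod_nonneg fun c _ => by positivity
    refine abs_le_of_sq_le_sq' ?_ (by positivity) |>.2
    rw [mul_pow, mul_pow, Real.sq_sqrt a4]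
    exact a1.trans (a3.trans (mul_le_mul_of_nonneg_left a2 (by positivity)))
  have hLcard : (L.card : ℝ) ≤ Real.exp C₁ :=
    card_le_exp_of_prod hp hp1 L fun s hs => (Finset.mem_filter.1 hs).2.1
  -- all pairings are bounded by the simple ones, hence by the ordered graphs
  have hPcard : (P.card : ℝ) ≤ 2 * ((Fintype.card (HalfEdge n S) : ℝ) ^ 2 + 1) ^ badBound D k *
      (Nat.card (ConfigGraph d n) * F) := by
    have b1 := card_pairings_le_simple (vtx := (Sigma.fst : HalfEdge n S → GraphVertex n))
      (τ := (Sigma.fst : GraphVertex n → Fin k)) (t := fun h => t h.1.1 h.2) (D := D)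
      (fun x => (halfEdgesAt_card x).trans_le (hD _)) (by
        rw [Fintype.card_fin]; exact hlarge)
    rw [Fintype.card_fin] at b1
    have b2 := card_simple_le (n := n) hS
    have b3 : P.card ≤ 2 * (Fintype.card (HalfEdge n S) ^ 2 + 1) ^ badBound D k *
        (Nat.card (ConfigGraph d n) * F) :=
      b1.trans (Nat.mul_le_mul_left _ b2)
    exact_mod_cast b3
  have hlow : (𝒢.card : ℝ) * (F * R) ≤
      (𝒢.sigma fun G => Fintype.piFinset (fun x => orderingsAt t G.1 x) ×ˢ Y G).card := by
    rw [Finset.card_sigma]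
    push_cast
    rw [← nsmul_eq_mul]
    refine Finset.card_nsmul_le_sum _ _ _ fun G hG => ?_
    rw [Finset.card_product, card_piFinset_orderingsAt hS G]
    push_cast
    exact mul_le_mul_of_nonneg_left (hY G hG) (by positivity)
  have hup : ((L.sigma fun s => pairings (labelClass t s) Prod.swap
      (Finset.univ : Finset (HalfEdge n S))).card : ℝ) ≤
      Real.exp C₁ * (Real.exp (-C₂) * (P.card *
        √(∏ c, ((classCard (slotClass n t) Finset.univ c : ℝ) + 1)))) := by
    rw [Finset.card_sigma]
    push_cast
    refine (Finset.sum_le_card_nsmul _ _ _ hratio).trans ?_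
    rw [nsmul_eq_mul]
    exact mul_le_mul_of_nonneg_right hLcard (by positivity)
  have hfin : (F : ℝ) * (𝒢.card * R) ≤
      F * (Nat.card (ConfigGraph d n) * (polyFactor n t D * Real.exp (C₁ - C₂))) := by
    calc (F : ℝ) * (𝒢.card * R) = (𝒢.card : ℝ) * (F * R) := by ring
      _ ≤ _ := hlow
      _ ≤ _ := by exact_mod_cast hcount
      _ ≤ _ := hup
      _ ≤ Real.exp C₁ * (Real.exp (-C₂) *
          ((2 * ((Fintype.card (HalfEdge n S) : ℝ) ^ 2 + 1) ^ badBound D k *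
          (Nat.card (ConfigGraph d n) * F)) *
          √(∏ c, ((classCard (slotClass n t) Finset.univ c : ℝ) + 1)))) := by gcongr
      _ = _ := by rw [polyFactor, sub_eq_add_neg, Real.exp_add]; ring
  exact le_of_mul_le_mul_left hfin (by exact_mod_cast hFpos)

end FirstMoment

/-! ### Stars of the universal cover and their coverings -/

section Tree

variable {k : ℕ} {d : Matrix (Fin k) (Fin k) ℕ} {r : Fin k}

theorem mem_nbrs {u v : TreeVertex d r} : v ∈ nbrs u ↔ (coverTree d r).Adj u v := by
  simp [nbrs]

theorem mem_star {u v : TreeVertex d r} : v ∈ star u ↔ v = u ∨ v ∈ nbrs u := by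
  simp [star]

theorem self_mem_star (u : TreeVertex d r) : u ∈ star u := mem_star.2 (Or.inl rfl)

theorem mem_star_of_mem_nbrs {u v : TreeVertex d r} (h : v ∈ nbrs u) : v ∈ star u :=
  mem_star.2 (Or.inr h)

theorem length_parity {u v : TreeVertex d r} (h : (coverTree d r).Adj u v) :
    u.1.length % 2 ≠ v.1.length % 2 := by
  rcases h with ⟨s, h⟩ | ⟨s, h⟩
  · rw [h, List.length_cons]; omega
  · rw [h, List.length_cons]; omega

theorem not_adj_of_mem_nbrs {u v w : TreeVertex d r} (hv : v ∈ nbrs u) (hw : w ∈ nbrs u) :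
    ¬ (coverTree d r).Adj v w := by
  intro h
  have h1 := length_parity (mem_nbrs.1 hv)
  have h2 := length_parity (mem_nbrs.1 hw)
  have h3 := length_parity h
  omega

theorem notMem_nbrs_self (u : TreeVertex d r) : u ∉ nbrs u := fun h =>
  (coverTree d r).loopless.irrefl _ (mem_nbrs.1 h)

theorem ncard_nbrs_type (hd : ∀ i j, 0 < d i j → 0 < d j i) (u : TreeVertex d r) (j : Fin k) :
    {v | (coverTree d r).Adj u v ∧ v.type = j}.ncard = d u.type j := by
  rw [← Set.ncard_image_of_injective _ Subtype.val_injective]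
  obtain ⟨w, hw⟩ := u
  have hchild : ∀ N : ℕ, ((fun m => (j, m) :: w) '' Set.Iio N).ncard = N := by
    intro N
    rw [Set.ncard_image_of_injective _ (fun a b h => by simpa using h), ← Finset.coe_Iio,
      Set.ncard_coe_finset, Nat.card_Iio]
  cases w with
  | nil =>
    have : Subtype.val '' {v : TreeVertex d r | (coverTree d r).Adj ⟨[], hw⟩ v ∧ v.type = j} =
        (fun m => (j, m) :: []) '' Set.Iio (d r j) := by
      ext l
      constructor
      · rintro ⟨⟨v, hv⟩, ⟨h | h, h2⟩, rfl⟩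
        · obtain ⟨⟨j', m⟩, rfl⟩ := h
          obtain rfl : j' = j := h2
          refine ⟨m, ?_, rfl⟩
          have := hv.2
          simpa [parentCount, wordType] using this
        · obtain ⟨s, h⟩ := h; simp at h
      · rintro ⟨m, hm, rfl⟩
        have hm' : m < d r j := hm
        exact ⟨⟨[(j, m)], trivial, by simpa [parentCount, wordType] using hm'⟩,
          ⟨Or.inl ⟨_, rfl⟩, rfl⟩, rfl⟩
    rw [this, hchild]
    rfl
  | cons s w =>
    have hpos : 0 < d s.1 (wordType r w) := hd _ _ (lt_of_le_of_lt (Nat.zero_le _) hw.2)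
    have hty : TreeVertex.type (⟨s :: w, hw⟩ : TreeVertex d r) = s.1 := rfl
    have : Subtype.val '' {v : TreeVertex d r | (coverTree d r).Adj ⟨s :: w, hw⟩ v ∧ v.type = j} =
        (fun m => (j, m) :: s :: w) '' Set.Iio (d s.1 j - if wordType r w = j then 1 else 0) ∪
          (if wordType r w = j then {w} else ∅) := by
      ext l
      constructor
      · rintro ⟨⟨v, hv⟩, ⟨h | h, h2⟩, rfl⟩
        · left
          obtain ⟨⟨j', m⟩, rfl⟩ := h
          obtain rfl : j' = j := h2
          refine ⟨m, ?_, rfl⟩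
          have : m + (if wordType r w = j' then 1 else 0) < d s.1 j' := hv.2
          simp only [Set.mem_Iio]
          omega
        · right
          obtain ⟨s', h⟩ := h
          simp only [List.cons.injEq] at h
          obtain ⟨-, rfl⟩ := h
          have h3 : wordType r w = j := h2
          rw [if_pos h3]
          rfl
      · rintro (⟨m, hm, rfl⟩ | h)
        · simp only [Set.mem_Iio] at hm
          refine ⟨⟨(j, m) :: s :: w, hw, ?_⟩, ⟨Or.inl ⟨_, rfl⟩, rfl⟩, rfl⟩
          change m + (if wordType r w = j then 1 else 0) < d s.1 j
          omega
        · split_ifs at h with h1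
          · obtain rfl : l = w := h
            exact ⟨⟨l, hw.1⟩, ⟨Or.inr ⟨s, rfl⟩, h1⟩, rfl⟩
          · simp at h
    rw [this, hty, Set.ncard_union_eq (ht := by split_ifs <;> simp), hchild]
    · split_ifs with h1
      · rw [Set.ncard_singleton]
        rw [h1] at hpos
        omega
      · simp
    · rw [Set.disjoint_left]
      rintro l ⟨m, -, rfl⟩ h
      split_ifs at h with h1
      · have := congrArg List.length (Set.mem_singleton_iff.1 h)
        simp at this
        omega
      · simp at h

/-- The slots of a vertex of type `i` are the neighbours of the representative of type `i`. -/
abbrev Slots (o : Fin k → TreeVertex d r) (i : Fin k) : Type := {v // v ∈ nbrs (o i)}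

/-- The type of a slot. -/
def slotType (o : Fin k → TreeVertex d r) (i : Fin k) (s : Slots o i) : Fin k := s.1.type

variable {o : Fin k → TreeVertex d r}

theorem slotCard_slots (hd : ∀ i j, 0 < d i j → 0 < d j i) (ho : ∀ i, (o i).type = i) :
    SlotCard d (slotType o) := by
  intro i j
  rw [← Set.ncard_coe_finset, ← Set.ncard_image_of_injective _ Subtype.val_injective]
  have h := ncard_nbrs_type hd (o i) j
  rw [ho] at h
  rw [← h]
  congr 1
  ext v
  constructor
  · rintro ⟨s, hs, rfl⟩
    exact ⟨mem_nbrs.1 s.2, (Finset.mem_filter.1 hs).2⟩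
  · rintro ⟨h1, h2⟩
    exact ⟨⟨v, mem_nbrs.2 h1⟩, Finset.mem_filter.2 ⟨Finset.mem_univ _, h2⟩, rfl⟩

theorem card_slots (hd : ∀ i j, 0 < d i j → 0 < d j i) (ho : ∀ i, (o i).type = i) (i : Fin k) :
    Fintype.card (Slots o i) = ∑ j, d i j := by
  rw [← Finset.card_univ, Finset.card_eq_sum_card_fiberwise (f := slotType o i)
    (t := Finset.univ) (by simp)]
  exact Finset.sum_congr rfl fun j _ => slotCard_slots hd ho i j

/-- A function on a star is a value at the centre and a value in every slot. -/
def starEquiv (u : TreeVertex d r) (Z : Type*) : (star u → Z) ≃ Z × ({v // v ∈ nbrs u} → Z) where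
  toFun X := (X ⟨u, self_mem_star u⟩, fun s => X ⟨s.1, mem_star_of_mem_nbrs s.2⟩)
  invFun p v := if h : v.1 = u then p.1 else p.2 ⟨v.1, (mem_star.1 v.2).resolve_left h⟩
  left_inv X := by
    funext v
    dsimp only
    split_ifs with h
    · congr 1; exact Subtype.ext h.symm
    · rfl
  right_inv p := by
    refine Prod.ext (by simp) ?_
    funext s
    have : s.1 ≠ u := fun h => by
      have h2 := s.2
      rw [h] at h2
      exact notMem_nbrs_self u h2
    simp [this]

theorem connected_induce_star (u : TreeVertex d r) :
    ((coverTree d r).induce (star u : Set (TreeVertex d r))).Connected := by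
  have hu : u ∈ (star u : Set (TreeVertex d r)) := self_mem_star u
  rw [SimpleGraph.connected_iff_exists_forall_reachable]
  refine ⟨⟨u, hu⟩, fun ⟨v, hv⟩ => ?_⟩
  rcases mem_star.1 (Finset.mem_coe.1 hv) with rfl | h
  · exact SimpleGraph.Reachable.refl _
  · exact SimpleGraph.Adj.reachable (by simpa using mem_nbrs.1 h)

variable {n : Fin k → ℕ}

/-- A sum over the coverings of a star is a sum over vertices with an ordering. -/
theorem sum_coverings_star (ho : ∀ i, (o i).type = i) (G : SimpleGraph (GraphVertex n))
    (i : Fin k) (F : (star (o i) → GraphVertex n) → ℝ) :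
    ∑ p ∈ coverings G (star (o i)), F p =
      ∑ m : Fin (n i), ∑ e ∈ orderingsAt (S := Slots o) (slotType o) G ⟨i, m⟩,
        F ((starEquiv (o i) _).symm (⟨i, m⟩, e)) := by
  have hcov : ∀ p, p ∈ coverings G (star (o i)) ↔ IsCovering G (star (o i)) p := by
    intro p; simp [coverings]
  rw [Finset.sum_sigma']
  symm
  refine Finset.sum_bij (fun q _ => (starEquiv (o i) _).symm (⟨i, q.1⟩, q.2)) ?_ ?_ ?_ ?_
  · rintro ⟨m, e⟩ hq
    simp only [Finset.mem_sigma, Finset.mem_univ, true_and, mem_orderingsAt] at hq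
    rw [hcov]
    have e1 : ∀ (h : o i ∈ star (o i)), (starEquiv (o i) (GraphVertex n)).symm (⟨i, m⟩, e)
        ⟨o i, h⟩ = ⟨i, m⟩ := by
      intro h; simp [starEquiv]
    have e2 : ∀ v (hv : v ∈ nbrs (o i)) (h : v ∈ star (o i)),
        (starEquiv (o i) (GraphVertex n)).symm (⟨i, m⟩, e) ⟨v, h⟩ = e ⟨v, hv⟩ := by
      intro v hv h
      have : v ≠ o i := fun h => notMem_nbrs_self (o i) (h ▸ hv)
      simp [starEquiv, this]
    refine ⟨?_, ?_, ?_⟩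
    · rintro ⟨v, hv⟩
      rcases mem_star.1 hv with rfl | h
      · rw [e1]; exact (ho i).symm
      · rw [e2 v h]; exact hq.type ⟨v, h⟩
    · rintro ⟨u, hu⟩ ⟨v, hv⟩ huv
      rcases mem_star.1 hu with rfl | h
      · rcases mem_star.1 hv with rfl | h'
        · exact absurd huv ((coverTree d r).loopless.irrefl _)
        · rw [e1, e2 v h']; exact hq.adj ⟨v, h'⟩
      · rcases mem_star.1 hv with rfl | h'
        · rw [e1, e2 u h]; exact (hq.adj ⟨u, h⟩).symm
        · exact absurd huv (not_adj_of_mem_nbrs h h')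
    · rintro ⟨w, hw⟩ ⟨u, hu⟩ ⟨v, hv⟩ hwu hwv huv
      rcases mem_star.1 hw with rfl | h
      · have h1 : u ∈ nbrs (o i) := mem_nbrs.2 hwu
        have h2 : v ∈ nbrs (o i) := mem_nbrs.2 hwv
        rw [e2 u h1, e2 v h2] at huv
        simpa using hq.inj huv
      · have h1 : u = o i := by
          rcases mem_star.1 hu with rfl | h'
          · rfl
          · exact absurd hwu (not_adj_of_mem_nbrs h h')
        have h2 : v = o i := by
          rcases mem_star.1 hv with rfl | h'
          · rfl
          · exact absurd hwv (not_adj_of_mem_nbrs h h')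
        simp [h1, h2]
  · rintro ⟨m, e⟩ _ ⟨m', e'⟩ _ h
    have := (starEquiv (o i) (GraphVertex n)).symm.injective h
    simp only [Prod.mk.injEq, Sigma.mk.injEq, heq_eq_eq, true_and] at this
    obtain ⟨rfl, rfl⟩ := this
    rfl
  · intro p hp
    rw [hcov] at hp
    obtain ⟨i', m, hm⟩ : ∃ i' m, p ⟨o i, self_mem_star _⟩ = ⟨i', m⟩ := ⟨_, _, rfl⟩
    have h1 := hp.1 ⟨o i, self_mem_star _⟩
    rw [hm] at h1
    obtain rfl : i' = i := h1.trans (ho i)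
    refine ⟨⟨m, fun s => p ⟨s.1, mem_star_of_mem_nbrs s.2⟩⟩, ?_, ?_⟩
    · simp only [Finset.mem_sigma, Finset.mem_univ, true_and, mem_orderingsAt]
      refine ⟨fun s s' h => ?_, fun s => ?_, fun s => hp.1 _⟩
      · have := hp.2.2 ⟨o i', self_mem_star _⟩ _ _ (mem_nbrs.1 s.2) (mem_nbrs.1 s'.2) h
        exact Subtype.ext (congrArg (fun z : star (o i') => z.1) this)
      · have := hp.2.1 ⟨o i', self_mem_star _⟩ ⟨s.1, mem_star_of_mem_nbrs s.2⟩ (mem_nbrs.1 s.2)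
        rwa [hm] at this
    · rw [Equiv.symm_apply_eq, starEquiv]
      simp only [Equiv.coe_fn_mk, Prod.mk.injEq, and_true]
      exact hm.symm
  · intro _ _; rfl

variable {Y : Type*} [MeasurableSpace Y]

/-- The star marginal of the empirical process, through one ordering of the graph. -/
theorem integral_distrStar_star (hd : ∀ i j, 0 < d i j → 0 < d j i) (ho : ∀ i, (o i).type = i)
    (G : ConfigGraph d n) (f : GraphVertex n → Y)
    {e : ∀ x : GraphVertex n, Slots o x.1 → GraphVertex n}
    (he : ∀ x, IsOrdering (S := Slots o) (slotType o) G.1 x (e x)) (i : Fin k)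
    (Ψ : Y × (Slots o i → Y) → ℝ) (hΨ : Measurable fun X => Ψ (starEquiv (o i) Y X)) :
    ∫ X, Ψ (starEquiv (o i) Y X) ∂(distrStar G.1 f (star (o i))) =
      ((n i : ℝ) * (slotPerms (S := Slots o) (slotType o) i).card)⁻¹ *
        ∑ m : Fin (n i), ∑ π ∈ slotPerms (S := Slots o) (slotType o) i,
          Ψ (f ⟨i, m⟩, fun s => f (e ⟨i, m⟩ (π s))) := by
  have hS := slotCard_slots hd ho
  have hsum : ∀ F : (star (o i) → GraphVertex n) → ℝ, ∑ p ∈ coverings G.1 (star (o i)), F p =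
      ∑ m : Fin (n i), ∑ π ∈ slotPerms (S := Slots o) (slotType o) i,
        F ((starEquiv (o i) _).symm (⟨i, m⟩, e ⟨i, m⟩ ∘ π)) := by
    intro F
    rw [sum_coverings_star ho]
    exact Finset.sum_congr rfl fun m _ => sum_orderingsAt hS G ⟨i, m⟩ (he _) _
  have hcard : ((coverings G.1 (star (o i))).card : ℝ) =
      (n i : ℝ) * (slotPerms (S := Slots o) (slotType o) i).card := by
    have := hsum (fun _ => 1)
    simpa using this
  rw [distrStar, integral_smul_measure, integral_finsetSum_measure]
  · have h1 : ∀ p : star (o i) → GraphVertex n,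
        ∫ X, Ψ (starEquiv (o i) Y X) ∂(Measure.dirac fun u => f (p u)) =
        Ψ (starEquiv (o i) Y fun u => f (p u)) := fun p =>
      integral_dirac' _ _ hΨ.stronglyMeasurable
    simp_rw [h1]
    rw [hsum, ENNReal.toReal_inv, ENNReal.toReal_natCast, hcard, smul_eq_mul]
    congr 1
    refine Finset.sum_congr rfl fun m _ => Finset.sum_congr rfl fun π _ => ?_
    congr 1
    refine Prod.ext ?_ ?_
    · simp [starEquiv]
    · funext s
      have : s.1 ≠ o i := fun h => by
        have h2 := s.2
        rw [h] at h2
        exact notMem_nbrs_self _ h2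
      simp [starEquiv, this]
  · intro p _
    refine (integrable_dirac' hΨ.stronglyMeasurable ?_)
    exact enorm_lt_top

end Tree

/-! ### Independent labels with finite-range statistics concentrate -/

section Concentration

variable {V B : Type*} [Fintype V] [DecidableEq V] [Fintype B] [DecidableEq B]

/-- The probability of `y` when the labels `y x` are independent with laws `w x`. -/
def prodWeight (w : V → B → ℝ) (y : V → B) : ℝ := ∏ x, w x (y x)

variable {w : V → B → ℝ}

theorem prodWeight_nonneg (hw : ∀ x b, 0 ≤ w x b) (y : V → B) : 0 ≤ prodWeight w y :=
  Finset.prod_nonneg fun x _ => hw x _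

theorem sum_prodWeight (hw1 : ∀ x, ∑ b, w x b = 1) : ∑ y, prodWeight w y = 1 := by
  unfold prodWeight
  rw [← Fintype.piFinset_univ, ← Finset.prod_univ_sum]
  simp [hw1]

/-- Statistics of disjoint sets of labels are independent. -/
theorem sum_prodWeight_mul (hw1 : ∀ x, ∑ b, w x b = 1) (s : Finset V) {f g : (V → B) → ℝ}
    (hf : ∀ y y', (∀ x ∈ s, y x = y' x) → f y = f y')
    (hg : ∀ y y', (∀ x ∉ s, y x = y' x) → g y = g y') :
    ∑ y, prodWeight w y * (f y * g y) =
      (∑ y, prodWeight w y * f y) * ∑ y, prodWeight w y * g y := by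
  rcases isEmpty_or_nonempty (V → B) with hE | ⟨⟨y₀⟩⟩
  · simp
  let E := Equiv.piEquivPiSubtypeProd (fun x => x ∈ s) (fun _ : V => B)
  let P₁ : ({x // x ∈ s} → B) → ℝ := fun a => ∏ x : {x // x ∈ s}, w x (a x)
  let P₂ : ({x // x ∉ s} → B) → ℝ := fun a => ∏ x : {x // x ∉ s}, w x (a x)
  let f' : ({x // x ∈ s} → B) → ℝ := fun a => f (E.symm (a, fun x => y₀ x))
  let g' : ({x // x ∉ s} → B) → ℝ := fun a => g (E.symm (fun x => y₀ x, a))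
  have hP : ∀ y, prodWeight w y = P₁ (E y).1 * P₂ (E y).2 := fun y => by
    convert (Fintype.prod_subtype_mul_prod_subtype (fun x => x ∈ s) (fun x => w x (y x))).symm <;> rfl
  have hf' : ∀ y, f y = f' (E y).1 := fun y => hf _ _ fun x hx => by
    simp [E, Equiv.piEquivPiSubtypeProd, hx]
  have hg' : ∀ y, g y = g' (E y).2 := fun y => hg _ _ fun x hx => by
    simp [E, Equiv.piEquivPiSubtypeProd, hx]
  have h1 : ∑ a, P₁ a = 1 := by
    have := sum_prodWeight (V := {x // x ∈ s}) (w := fun x => w x) fun x => hw1 x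
    exact this
  have h2 : ∑ a, P₂ a = 1 := by
    have := sum_prodWeight (V := {x // x ∉ s}) (w := fun x => w x) fun x => hw1 x
    exact this
  have key : ∀ (F : ({x // x ∈ s} → B) → ℝ) (G : ({x // x ∉ s} → B) → ℝ),
      ∑ y, prodWeight w y * (F (E y).1 * G (E y).2) = (∑ a, P₁ a * F a) * ∑ b, P₂ b * G b := by
    intro F G
    rw [Finset.sum_mul_sum, ← Fintype.sum_prod_type']
    rw [← Equiv.sum_comp E]
    exact Finset.sum_congr rfl fun y _ => by rw [hP]; ring
  have k1 := key f' g'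
  have k2 := key f' (fun _ => 1)
  have k3 := key (fun _ => 1) g'
  simp only [mul_one, one_mul, h1, h2] at k2 k3
  simp_rw [hf', hg']
  rw [k1, k2, k3]

/-- The mean of a function of finitely many labels. -/
theorem sum_prodWeight_comp {I : Type*} [Fintype I] [DecidableEq I]
    (hw1 : ∀ x, ∑ b, w x b = 1) {ι : I → V} (hι : Function.Injective ι) (g : (I → B) → ℝ) :
    ∑ y, prodWeight w y * g (y ∘ ι) = ∑ c : I → B, (∏ i, w (ι i) (c i)) * g c := by
  have h1 : ∀ c : I → B, ∑ y, prodWeight w y * (if y ∘ ι = c then 1 else 0) =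
      ∏ i, w (ι i) (c i) := by
    intro c
    have e1 : ∀ y, prodWeight w y * (if y ∘ ι = c then (1 : ℝ) else 0) =
        ∏ x, (w x (y x) * if ∀ i, ι i = x → c i = y x then 1 else 0) := by
      intro y
      rw [Finset.prod_mul_distrib, prodWeight]
      congr 1
      split_ifs with h
      · symm
        refine Finset.prod_eq_one fun x _ => if_pos ?_
        rintro i rfl
        rw [← h]; rfl
      · have : ∃ i, y (ι i) ≠ c i := by
          by_contra! h'
          exact h (funext h')
        obtain ⟨i, hi⟩ := this
        symm
        refine Finset.prod_eq_zero (Finset.mem_univ (ι i)) (if_neg fun h' => hi (h' i rfl).symm)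
    simp_rw [e1]
    rw [← Fintype.piFinset_univ, ← Finset.prod_univ_sum (fun _ => Finset.univ)
      (fun x b => w x b * if ∀ i, ι i = x → c i = b then 1 else 0)]
    rw [← Finset.prod_subset (Finset.subset_univ (Finset.univ.image ι)),
      Finset.prod_image hι.injOn]
    · refine Finset.prod_congr rfl fun i _ => ?_
      rw [Finset.sum_eq_single (c i)]
      · rw [if_pos, mul_one]
        intro i' hi'
        rw [hι hi']
      · intro b _ hb
        rw [if_neg, mul_zero]
        exact fun h => hb (h i rfl).symm
      · simp
    · intro x _ hx
      refine Eq.trans (Finset.sum_congr rfl fun b _ => ?_) (hw1 x)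
      rw [if_pos, mul_one]
      rintro i rfl
      simp at hx
  calc _ = ∑ y, ∑ c : I → B, (prodWeight w y * (if y ∘ ι = c then 1 else 0)) * g c := by
        refine Finset.sum_congr rfl fun y _ => ?_
        rw [Finset.sum_eq_single (y ∘ ι)]
        · simp
        · intro c _ hc
          rw [if_neg hc.symm]; simp
        · simp
    _ = _ := by
        rw [Finset.sum_comm]
        refine Finset.sum_congr rfl fun c _ => ?_
        rw [← Finset.sum_mul, h1]

/-- Chebyshev's inequality for a sum of bounded statistics of finite range: `F x` depends only on the
labels in `N x`, and every `N x` meets at most `C` of these sets. -/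
theorem prodWeight_chebyshev (hw : ∀ x b, 0 ≤ w x b) (hw1 : ∀ x, ∑ b, w x b = 1)
    {N : V → Finset V} {C : ℕ}
    (hN : ∀ x, (Finset.univ.filter (fun x' => ¬ Disjoint (N x) (N x'))).card ≤ C)
    {F : V → (V → B) → ℝ} {K : ℝ} (hK : ∀ x y, |F x y| ≤ K)
    (hF : ∀ x y y', (∀ z ∈ N x, y z = y' z) → F x y = F x y') {η : ℝ} (hη : 0 < η) :
    ∑ y ∈ Finset.univ.filter
      (fun y => η < |∑ x, F x y - ∑ y', prodWeight w y' * ∑ x, F x y'|), prodWeight w y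
      ≤ Fintype.card V * (C * (2 * K) ^ 2) / η ^ 2 := by
  set m : V → ℝ := fun x => ∑ y, prodWeight w y * F x y with hm
  set G : V → (V → B) → ℝ := fun x y => F x y - m x with hG
  have hP0 := prodWeight_nonneg hw
  have hP1 := sum_prodWeight hw1
  have hmK : ∀ x, |m x| ≤ K := by
    intro x
    calc |m x| ≤ ∑ y, |prodWeight w y * F x y| := Finset.abs_sum_le_sum_abs _ _
      _ ≤ ∑ y, prodWeight w y * K := by
          refine Finset.sum_le_sum fun y _ => ?_
          rw [abs_mul, abs_of_nonneg (hP0 y)]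
          exact mul_le_mul_of_nonneg_left (hK x y) (hP0 y)
      _ = K := by rw [← Finset.sum_mul, hP1, one_mul]
  have hGK : ∀ x y, |G x y| ≤ 2 * K := fun x y => by
    calc |G x y| ≤ |F x y| + |m x| := abs_sub _ _
      _ ≤ 2 * K := by linarith [hK x y, hmK x]
  have hG0 : ∀ x, ∑ y, prodWeight w y * G x y = 0 := by
    intro x
    simp only [hG, mul_sub, Finset.sum_sub_distrib]
    rw [← Finset.sum_mul, hP1, one_mul, hm, sub_self]
  have hZ : ∀ y, ∑ x, F x y - ∑ y', prodWeight w y' * ∑ x, F x y' = ∑ x, G x y := by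
    intro y
    rw [hG, Finset.sum_sub_distrib]
    congr 1
    rw [hm, Finset.sum_comm]
    exact Finset.sum_congr rfl fun y' _ => Finset.mul_sum _ _ _
  simp_rw [hZ]
  have hcov : ∀ x x', ∑ y, prodWeight w y * (G x y * G x' y) ≤
      if ¬ Disjoint (N x) (N x') then (2 * K) ^ 2 else 0 := by
    intro x x'
    by_cases h : Disjoint (N x) (N x')
    swap
    · rw [if_pos h]
      calc _ ≤ ∑ y, prodWeight w y * (2 * K) ^ 2 := by
            refine Finset.sum_le_sum fun y _ => mul_le_mul_of_nonneg_left ?_ (hP0 y)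
            refine (le_abs_self _).trans ?_
            rw [abs_mul, sq]
            exact mul_le_mul (hGK x y) (hGK x' y) (abs_nonneg _)
              ((abs_nonneg _).trans (hGK x y))
        _ = _ := by rw [← Finset.sum_mul, hP1, one_mul]
    · rw [if_neg (not_not.2 h)]
      rw [sum_prodWeight_mul hw1 (N x), hG0, zero_mul]
      · intro y y' hy
        simp only [hG]
        rw [hF x y y' hy]
      · intro y y' hy
        simp only [hG]
        rw [hF x' y y' fun z hz => hy z fun hz' => Finset.disjoint_left.1 h hz' hz]
  have hvar : ∑ y, prodWeight w y * (∑ x, G x y) ^ 2 ≤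
      Fintype.card V * (C * (2 * K) ^ 2) := by
    calc _ = ∑ x, ∑ x', ∑ y, prodWeight w y * (G x y * G x' y) := by
          simp_rw [sq, Finset.sum_mul_sum, Finset.mul_sum]
          rw [Finset.sum_comm]
          refine Finset.sum_congr rfl fun x _ => ?_
          rw [Finset.sum_comm]
      _ ≤ ∑ x, ∑ x', if ¬ Disjoint (N x) (N x') then (2 * K) ^ 2 else 0 :=
          Finset.sum_le_sum fun x _ => Finset.sum_le_sum fun x' _ => hcov x x'
      _ ≤ ∑ x : V, C * (2 * K) ^ 2 := by
          refine Finset.sum_le_sum fun x _ => ?_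
          rw [← Finset.sum_filter, Finset.sum_const, nsmul_eq_mul]
          exact mul_le_mul_of_nonneg_right (by exact_mod_cast hN x) (sq_nonneg _)
      _ = _ := by simp
  rw [le_div_iff₀ (by positivity), Finset.sum_mul]
  refine le_trans ?_ hvar
  calc _ ≤ ∑ y ∈ Finset.univ.filter (fun y => η < |∑ x, G x y|),
        prodWeight w y * (∑ x, G x y) ^ 2 := by
        refine Finset.sum_le_sum fun y hy => mul_le_mul_of_nonneg_left ?_ (hP0 y)
        have := (Finset.mem_filter.1 hy).2
        rw [← sq_abs (∑ x, G x y)]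
        exact pow_le_pow_left₀ hη.le this.le 2
    _ ≤ _ := Finset.sum_le_sum_of_subset_of_nonneg (Finset.subset_univ _)
        fun y _ _ => mul_nonneg (hP0 y) (sq_nonneg _)

/-- There are many labellings with prescribed statistics, if independent labels have these
statistics on average. The statistic `j₀` is the log-likelihood: as it is controlled too, every
labelling with these statistics has small probability, whereas all of them together have probability
at least `1 / 2`. -/
theorem exp_le_card_of_prodWeight {J : Type*} [Fintype J] (hw : ∀ x b, 0 < w x b)
    (hw1 : ∀ x, ∑ b, w x b = 1) {N : V → Finset V} {C : ℕ}
    (hN : ∀ x, (Finset.univ.filter (fun x' => ¬ Disjoint (N x) (N x'))).card ≤ C)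
    {F : J → V → (V → B) → ℝ} {K : ℝ} (hK : ∀ j x y, |F j x y| ≤ K)
    (hF : ∀ j x y y', (∀ z ∈ N x, y z = y' z) → F j x y = F j x y') {η : ℝ} (hη : 0 < η)
    {a : J → ℝ} (ha : ∀ j, |∑ y, prodWeight w y * ∑ x, F j x y - a j| ≤ η) {j₀ : J}
    (hj₀ : ∀ x y, F j₀ x y = - Real.log (w x (y x)))
    (hbig : Fintype.card J * (Fintype.card V * (C * (2 * K) ^ 2) / η ^ 2) ≤ 1 / 2) :
    1 / 2 * Real.exp (a j₀ - 2 * η) ≤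
      (Finset.univ.filter (fun y => ∀ j, |∑ x, F j x y - a j| ≤ 2 * η)).card := by
  classical
  have hw' : ∀ x b, 0 ≤ w x b := fun x b => (hw x b).le
  set A := Finset.univ.filter (fun y => ∀ j, |∑ x, F j x y - a j| ≤ 2 * η) with hA
  have h1 : ∑ y ∈ Finset.univ.filter (fun y => ¬ ∀ j, |∑ x, F j x y - a j| ≤ 2 * η),
      prodWeight w y ≤ 1 / 2 := by
    refine le_trans ?_ hbig
    calc _ ≤ ∑ y, ∑ j, (if η < |∑ x, F j x y - ∑ y', prodWeight w y' * ∑ x, F j x y'| then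
          prodWeight w y else 0) := by
          rw [Finset.sum_filter]
          refine Finset.sum_le_sum fun y _ => ?_
          have hnn : ∀ j, 0 ≤ (if η < |∑ x, F j x y - ∑ y', prodWeight w y' * ∑ x, F j x y'| then
              prodWeight w y else 0) := fun j => by
            split_ifs
            · exact prodWeight_nonneg hw' y
            · exact le_rfl
          split_ifs with hy
          · exact Finset.sum_nonneg fun j _ => hnn j
          push Not at hy
          obtain ⟨j, hj⟩ := hy
          refine le_trans (le_of_eq ?_) (Finset.single_le_sum (fun j _ => hnn j)
            (Finset.mem_univ j))
          have e1 := abs_sub_le (∑ x, F j x y) (∑ y', prodWeight w y' * ∑ x, F j x y') (a j)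
          rw [if_pos]
          linarith [ha j]
      _ = ∑ j, ∑ y ∈ Finset.univ.filter
          (fun y => η < |∑ x, F j x y - ∑ y', prodWeight w y' * ∑ x, F j x y'|),
          prodWeight w y := by
          rw [Finset.sum_comm]
          exact Finset.sum_congr rfl fun j _ => (Finset.sum_filter _ _).symm
      _ ≤ ∑ j : J, Fintype.card V * (C * (2 * K) ^ 2) / η ^ 2 :=
          Finset.sum_le_sum fun j _ => prodWeight_chebyshev hw' hw1 hN (hK j) (hF j) hη
      _ = _ := by simp
  have h2 : 1 / 2 ≤ ∑ y ∈ A, prodWeight w y := by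
    have := Finset.sum_filter_add_sum_filter_not Finset.univ
      (fun y => ∀ j, |∑ x, F j x y - a j| ≤ 2 * η) (fun y => prodWeight w y)
    rw [sum_prodWeight hw1] at this
    rw [hA]
    linarith
  have h3 : ∀ y ∈ A, prodWeight w y ≤ Real.exp (-(a j₀ - 2 * η)) := by
    intro y hy
    have e1 := (Finset.mem_filter.1 hy).2 j₀
    have e2 : ∑ x, F j₀ x y = - Real.log (prodWeight w y) := by
      rw [prodWeight, Real.log_prod fun x _ => (hw x _).ne', ← Finset.sum_neg_distrib]
      exact Finset.sum_congr rfl fun x _ => hj₀ x y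
    have hpos : 0 < prodWeight w y := Finset.prod_pos fun x _ => hw x _
    rw [← Real.log_le_iff_le_exp hpos]
    rw [e2, abs_le] at e1
    linarith
  have h4 := Finset.sum_le_card_nsmul A _ _ h3
  rw [nsmul_eq_mul] at h4
  have h5 : 1 / 2 ≤ A.card * Real.exp (-(a j₀ - 2 * η)) := h2.trans h4
  rw [Real.exp_neg, ← div_eq_mul_inv, le_div_iff₀ (Real.exp_pos _)] at h5
  exact h5

end Concentration

/-! ### Logarithms of factorials -/

theorem log_factorial_lower (m : ℕ) : m * Real.log m - m ≤ Real.log m.factorial := by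
  rcases Nat.eq_zero_or_pos m with rfl | hm
  · simp
  have h1 := Stirling.le_log_factorial_stirling hm.ne'
  have h2 : 0 ≤ Real.log m := Real.log_natCast_nonneg m
  have h3 : 0 ≤ Real.log (2 * Real.pi) := Real.log_nonneg (by linarith [Real.pi_gt_three])
  linarith

theorem log_factorial_upper (m : ℕ) :
    Real.log m.factorial ≤ m * Real.log m - m + (2 * Real.log (m + 1) + 1) := by
  induction m with
  | zero => simp
  | succ m ih =>
    have hm : (0 : ℝ) < m + 1 := by positivity
    rw [Nat.factorial_succ, Nat.cast_mul, Real.log_mul (by positivity) (by positivity)]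
    push_cast
    have key2 : 1 / ((m : ℝ) + 2) ≤ Real.log (m + 1 + 1) - Real.log (m + 1) := by
      rw [← Real.log_div (by positivity) hm.ne']
      have := Real.one_sub_inv_le_log_of_pos (show 0 < ((m : ℝ) + 1 + 1) / (m + 1) by positivity)
      refine le_trans (le_of_eq ?_) this
      field_simp
      ring
    have key : (m : ℝ) / (m + 1) ≤ m * (Real.log (m + 1) - Real.log m) := by
      rcases Nat.eq_zero_or_pos m with rfl | hm0
      · simp
      have hm0' : (0 : ℝ) < m := by exact_mod_cast hm0
      rw [← Real.log_div hm.ne' hm0'.ne', div_eq_mul_one_div]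
      refine mul_le_mul_of_nonneg_left ?_ hm0'.le
      have := Real.one_sub_inv_le_log_of_pos (show 0 < ((m : ℝ) + 1) / m by positivity)
      refine le_trans (le_of_eq ?_) this
      field_simp
      ring
    have key3 : 1 ≤ (m : ℝ) / (m + 1) + 2 * (1 / ((m : ℝ) + 2)) := by
      have : (m : ℝ) / (m + 1) + 2 * (1 / ((m : ℝ) + 2)) - 1 = m / ((m + 1) * (m + 2)) := by
        field_simp
        ring
      have h2 : (0 : ℝ) ≤ m / ((m + 1) * (m + 2)) := by positivity
      linarith
    linarith

/-! ### Graphs with a good labelling carry many noisy labellings -/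

section GoodGraph

variable {k : ℕ} {d : Matrix (Fin k) (Fin k) ℕ} {r : Fin k} {o : Fin k → TreeVertex d r}
  {n : Fin k → ℕ} {B : Type} [Fintype B] [DecidableEq B] {Y : Type*}

/-- The probability that the channel `W` turns the labels `y` of a star into `b`. -/
def starWeight {S : Type*} [Fintype S] (W : B → Y → ℝ) (b : B × (S → B)) (y : Y × (S → Y)) : ℝ :=
  W b.1 y.1 * ∏ s, W (b.2 s) (y.2 s)

/-- The mean of `Φ` over the output of the channel `W` on a star with labels `y`. -/
def starAverage {S : Type*} [Fintype S] [DecidableEq S] (W : B → Y → ℝ) (Φ : B × (S → B) → ℝ)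
    (y : Y × (S → Y)) : ℝ :=
  ∑ b, starWeight W b y * Φ b

/-- A function of the labels of a star that is invariant under permutations of the slots. -/
def IsSlotSymm {Z : Type*} {i : Fin k} (Ψ : Z × (Slots o i → Z) → ℝ) : Prop :=
  ∀ π ∈ slotPerms (S := Slots o) (slotType o) i, ∀ z, Ψ (z.1, z.2 ∘ π) = Ψ z

theorem IsSlotSymm.starAverage {i : Fin k} {Φ : B × (Slots o i → B) → ℝ} (hΦ : IsSlotSymm Φ)
    (W : B → Y → ℝ) : IsSlotSymm (starAverage W Φ) := by
  intro π hπ z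
  unfold ConfigModel.starAverage
  let E : B × (Slots o i → B) ≃ B × (Slots o i → B) :=
    Equiv.prodCongr (Equiv.refl B) (Equiv.arrowCongr π.symm (Equiv.refl B))
  have hE : ∀ b, E b = (b.1, b.2 ∘ π) := fun b => rfl
  rw [← Equiv.sum_comp E]
  refine Finset.sum_congr rfl fun b _ => ?_
  rw [hE, hΦ π hπ b]
  congr 1
  simp only [starWeight, Function.comp]
  congr 1
  exact Equiv.prod_comp π (fun s => W (b.2 s) (z.2 s))

/-- A sum of a symmetric statistic over all vertices, through the star marginals. -/
theorem sum_eq_sum_integral_distrStar [MeasurableSpace Y] (hd : ∀ i j, 0 < d i j → 0 < d j i)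
    (ho : ∀ i, (o i).type = i) (G : ConfigGraph d n) (f : GraphVertex n → Y)
    {e : ∀ x : GraphVertex n, Slots o x.1 → GraphVertex n}
    (he : ∀ x, IsOrdering (S := Slots o) (slotType o) G.1 x (e x))
    {Ψ : ∀ i, Y × (Slots o i → Y) → ℝ} (hΨ : ∀ i, IsSlotSymm (Ψ i))
    (hm : ∀ i, Measurable fun X => Ψ i (starEquiv (o i) Y X)) :
    ∑ x, Ψ x.1 (f x, fun s => f (e x s)) =
      ∑ i, (n i : ℝ) * ∫ X, Ψ i (starEquiv (o i) Y X) ∂(distrStar G.1 f (star (o i))) := by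
  rw [Fintype.sum_sigma]
  refine Finset.sum_congr rfl fun i _ => ?_
  rw [integral_distrStar_star hd ho G f he i (Ψ i) (hm i)]
  have h1 : ∀ m : Fin (n i), ∑ π ∈ slotPerms (S := Slots o) (slotType o) i,
      Ψ i (f ⟨i, m⟩, fun s => f (e ⟨i, m⟩ (π s))) =
      (slotPerms (S := Slots o) (slotType o) i).card * Ψ i (f ⟨i, m⟩, fun s => f (e ⟨i, m⟩ s)) := by
    intro m
    rw [← nsmul_eq_mul]
    refine Finset.sum_eq_card_nsmul fun π hπ => ?_
    exact hΨ i π hπ (f ⟨i, m⟩, fun s => f (e ⟨i, m⟩ s))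
  simp_rw [h1]
  rw [← Finset.mul_sum]
  have hpos : (0 : ℝ) < (slotPerms (S := Slots o) (slotType o) i).card := by
    exact_mod_cast slotPerms_card_pos i
  rcases Nat.eq_zero_or_pos (n i) with h0 | h0
  · have : IsEmpty (Fin (n i)) := by rw [h0]; infer_instance
    simp
  · have : (0 : ℝ) < n i := by exact_mod_cast h0
    field_simp

/-- The mean of a statistic of the star of `x`, when each label `f y` is passed through the
channel. The centre and its neighbours are distinct, so that their labels are independent. -/
theorem sum_prodWeight_starLabels {G : ConfigGraph d n} (f : GraphVertex n → Y)
    {e : ∀ x : GraphVertex n, Slots o x.1 → GraphVertex n}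
    (he : ∀ x, IsOrdering (S := Slots o) (slotType o) G.1 x (e x)) {W : B → Y → ℝ}
    (hW1 : ∀ y, ∑ b, W b y = 1) (x : GraphVertex n) (Φ : B × (Slots o x.1 → B) → ℝ) :
    ∑ y, prodWeight (fun x b => W b (f x)) y * Φ (starLabels e y x) =
      starAverage W Φ (f x, fun s => f (e x s)) := by
  let ι : Option (Slots o x.1) → GraphVertex n := fun a => a.elim x (e x)
  have hι : Function.Injective ι := by
    intro a b hab
    rcases a with _ | a <;> rcases b with _ | b
    · rfl
    · exact absurd hab (G.1.ne_of_adj ((he x).adj b))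
    · exact absurd hab (G.1.ne_of_adj ((he x).adj a)).symm
    · rw [(he x).inj hab]
  have h := sum_prodWeight_comp (w := fun x b => W b (f x)) (fun x => hW1 (f x)) hι
    (fun c => Φ (c none, fun s => c (some s)))
  refine h.trans ?_
  unfold starAverage
  rw [← Equiv.sum_comp (Equiv.piOptionEquivProd (β := fun _ : Option (Slots o x.1) => B)).symm]
  refine Finset.sum_congr rfl fun c _ => ?_
  rw [Fintype.prod_option]
  rfl

/-- The statistics that are controlled: the means of `Φ j i` over star labels, and the entropy of
the channel. -/
noncomputable def testFun {J : Type*} (W : B → Y → ℝ)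
    (Φ : J → ∀ i, B × (Slots o i → B) → ℝ) : Option J → ∀ i, Y × (Slots o i → Y) → ℝ
  | some j, i => starAverage W (Φ j i)
  | none, _ => fun y => ∑ b, Real.negMulLog (W b y.1)

/-- The corresponding statistics of a labelling by `B`. -/
noncomputable def statFun {J : Type*} (W : B → Y → ℝ)
    (Φ : J → ∀ i, B × (Slots o i → B) → ℝ) (f : GraphVertex n → Y)
    (e : ∀ x : GraphVertex n, Slots o x.1 → GraphVertex n) :
    Option J → GraphVertex n → (GraphVertex n → B) → ℝ
  | some j, x, y => Φ j x.1 (starLabels e y x)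
  | none, x, y => - Real.log (W (y x) (f x))

variable {J : Type*} [Fintype J]

theorem sum_prodWeight_statFun {G : ConfigGraph d n} (f : GraphVertex n → Y)
    {e : ∀ x : GraphVertex n, Slots o x.1 → GraphVertex n}
    (he : ∀ x, IsOrdering (S := Slots o) (slotType o) G.1 x (e x)) {W : B → Y → ℝ}
    (hW1 : ∀ y, ∑ b, W b y = 1) (Φ : J → ∀ i, B × (Slots o i → B) → ℝ) (j : Option J)
    (x : GraphVertex n) :
    ∑ y, prodWeight (fun x b => W b (f x)) y * statFun W Φ f e j x y =
      testFun W Φ j x.1 (f x, fun s => f (e x s)) := by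
  rcases j with _ | j
  · have h := sum_prodWeight_comp (w := fun x b => W b (f x)) (fun x => hW1 (f x))
      (ι := fun _ : Unit => x) (fun _ _ _ => rfl) (fun c => - Real.log (W (c ()) (f x)))
    refine h.trans ?_
    rw [← Equiv.sum_comp (Equiv.funUnique Unit B).symm]
    refine Finset.sum_congr rfl fun b _ => ?_
    simp [Real.negMulLog, Equiv.funUnique]
  · exact sum_prodWeight_starLabels f he hW1 x (Φ j x.1)

theorem isSlotSymm_testFun {W : B → Y → ℝ} {Φ : J → ∀ i, B × (Slots o i → B) → ℝ}
    (hΦ : ∀ j i, IsSlotSymm (Φ j i)) (j : Option J) (i : Fin k) :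
    IsSlotSymm (testFun W Φ j i) := by
  rcases j with _ | j
  · intro π _ z; rfl
  · exact (hΦ j i).starAverage W

/-- Only vertices at distance at most `2` from `x` have a star that meets the star of `x`. -/
theorem card_overlap_le (hd : ∀ i j, 0 < d i j → 0 < d j i) (ho : ∀ i, (o i).type = i)
    (G : ConfigGraph d n) {e : ∀ x : GraphVertex n, Slots o x.1 → GraphVertex n}
    (he : ∀ x, IsOrdering (S := Slots o) (slotType o) G.1 x (e x)) {D : ℕ}
    (hD : ∀ i, Fintype.card (Slots o i) ≤ D) (x : GraphVertex n) :
    (Finset.univ.filter (fun x' => ¬ Disjoint (insert x (Finset.univ.image (e x)))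
      (insert x' (Finset.univ.image (e x'))))).card ≤ (D + 1) * (D + 1) := by
  have hcard : ∀ z, (insert z (Finset.univ.image (e z))).card ≤ D + 1 := fun z =>
    (Finset.card_insert_le _ _).trans (Nat.add_le_add_right (Finset.card_image_le.trans
      (by rw [Finset.card_univ]; exact hD _)) 1)
  refine (Finset.card_le_card (t := (insert x (Finset.univ.image (e x))).biUnion
    fun z => insert z (Finset.univ.image (e z))) ?_).trans
    ((Finset.card_biUnion_le_card_mul _ _ (D + 1) fun z _ => hcard z).trans
      (Nat.mul_le_mul_right _ (hcard x)))
  intro x' hx'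
  have := (Finset.mem_filter.1 hx').2
  rw [Finset.not_disjoint_iff] at this
  obtain ⟨z, h1, h2⟩ := this
  rw [Finset.mem_biUnion]
  refine ⟨z, h1, ?_⟩
  rw [Finset.mem_insert] at h2 ⊢
  rcases h2 with rfl | h2
  · left; rfl
  · right
    simp only [Finset.mem_image, Finset.mem_univ, true_and] at h2 ⊢
    obtain ⟨s, rfl⟩ := h2
    exact (he _).exists_slot (slotCard_slots hd ho) G ((he x').adj s).symm

/-- If the star marginals of `f` are close to the expected ones, then many labellings by `B` have
statistics that are close to the expected ones. -/
theorem exp_le_card_labels [MeasurableSpace Y] (hd : ∀ i j, 0 < d i j → 0 < d j i)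
    (ho : ∀ i, (o i).type = i) (G : ConfigGraph d n) (f : GraphVertex n → Y)
    {e : ∀ x : GraphVertex n, Slots o x.1 → GraphVertex n}
    (he : ∀ x, IsOrdering (S := Slots o) (slotType o) G.1 x (e x)) {D : ℕ}
    (hD : ∀ i, Fintype.card (Slots o i) ≤ D) {W : B → Y → ℝ} (hW : ∀ b y, 0 < W b y)
    (hW1 : ∀ y, ∑ b, W b y = 1) {Φ : J → ∀ i, B × (Slots o i → B) → ℝ}
    (hΦ : ∀ j i, IsSlotSymm (Φ j i))
    (hm : ∀ j i, Measurable fun X => testFun W Φ j i (starEquiv (o i) Y X))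
    {K : ℝ} (hΦK : ∀ j i b, |Φ j i b| ≤ K) (hWK : ∀ b y, |Real.log (W b y)| ≤ K)
    {A : Option J → Fin k → ℝ} {η : ℝ} (hη : 0 < η)
    (hA : ∀ j i, |∫ X, testFun W Φ j i (starEquiv (o i) Y X) ∂(distrStar G.1 f (star (o i)))
      - A j i| ≤ η)
    (hN : 0 < ∑ i, n i)
    (hbig : (Fintype.card J + 1 : ℝ) * (((D + 1) * (D + 1) : ℕ) * (2 * K) ^ 2) / η ^ 2
      ≤ 1 / 2 * (∑ i, n i : ℕ)) :
    1 / 2 * Real.exp (∑ i, n i * A none i - 2 * ((∑ i, n i : ℕ) * η)) ≤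
      (Finset.univ.filter (fun y : GraphVertex n → B => ∀ j,
        |∑ x, statFun W Φ f e j x y - ∑ i, n i * A j i| ≤ 2 * ((∑ i, n i : ℕ) * η))).card := by
  have hcardV : Fintype.card (GraphVertex n) = ∑ i, n i := by simp [Fintype.card_sigma]
  have hNr : (0 : ℝ) < (∑ i, n i : ℕ) := by exact_mod_cast hN
  refine exp_le_card_of_prodWeight (w := fun x b => W b (f x)) (fun x b => hW b (f x))
    (fun x => hW1 (f x)) (N := fun x => insert x (Finset.univ.image (e x)))
    (C := (D + 1) * (D + 1)) (card_overlap_le hd ho G he hD) (F := statFun W Φ f e) (K := K)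
    ?_ ?_ (mul_pos hNr hη) (a := fun j => ∑ i, n i * A j i) ?_ (j₀ := none) (fun x y => rfl) ?_
  · intro j x y
    rcases j with _ | j
    · rw [statFun, abs_neg]; exact hWK _ _
    · exact hΦK _ _ _
  · intro j x y y' hy
    rcases j with _ | j
    · simp only [statFun]
      rw [hy x (Finset.mem_insert_self _ _)]
    · simp only [statFun]
      congr 1
      refine Prod.ext (hy x (Finset.mem_insert_self _ _)) ?_
      funext s
      exact hy _ (Finset.mem_insert_of_mem (Finset.mem_image_of_mem _ (Finset.mem_univ s)))
  · intro j
    have h1 : ∑ y, prodWeight (fun x b => W b (f x)) y * ∑ x, statFun W Φ f e j x y =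
        ∑ i, (n i : ℝ) * ∫ X, testFun W Φ j i (starEquiv (o i) Y X)
          ∂(distrStar G.1 f (star (o i))) := by
      simp_rw [Finset.mul_sum]
      rw [Finset.sum_comm]
      rw [← sum_eq_sum_integral_distrStar hd ho G f he (isSlotSymm_testFun hΦ j) (hm j)]
      exact Finset.sum_congr rfl fun x _ => sum_prodWeight_statFun f he hW1 Φ j x
    rw [h1, ← Finset.sum_sub_distrib]
    calc _ ≤ ∑ i, |(n i : ℝ) * ∫ X, testFun W Φ j i (starEquiv (o i) Y X)
          ∂(distrStar G.1 f (star (o i))) - n i * A j i| := Finset.abs_sum_le_sum_abs _ _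
      _ ≤ ∑ i, (n i : ℝ) * η := by
          refine Finset.sum_le_sum fun i _ => ?_
          rw [← mul_sub, abs_mul, abs_of_nonneg (by positivity : (0 : ℝ) ≤ n i)]
          exact mul_le_mul_of_nonneg_left (hA j i) (by positivity)
      _ = _ := by rw [← Finset.sum_mul]; push_cast; rfl
  · rw [hcardV, Fintype.card_option]
    rw [div_le_iff₀ (by positivity)] at hbig
    rw [← mul_div_assoc, div_le_iff₀ (by positivity)]
    push_cast at hbig ⊢
    have h3 : (0 : ℝ) ≤ ∑ i, (n i : ℝ) := Finset.sum_nonneg fun i _ => by positivity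
    nlinarith [mul_le_mul_of_nonneg_left hbig h3]

end GoodGraph

/-! ### Sizes of the vertex classes -/

section Sizes

variable {k : ℕ} {d : Matrix (Fin k) (Fin k) ℕ} {n : Fin k → ℕ} {q : Fin k → ℝ}

/-- A property that is passed on to neighbouring types holds for all types, by irreducibility. -/
theorem IsExpandingDegreeMatrix.induction (hd : IsExpandingDegreeMatrix d) {P : Fin k → Prop}
    {i : Fin k} (hi : P i) (h : ∀ j l, 0 < d j l → P j → P l) (l : Fin k) : P l := by
  let _ := Matrix.toQuiver (d.map (Nat.cast : ℕ → ℤ))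
  obtain ⟨p, -⟩ := hd.irreducible.connected i l
  induction p with
  | nil => exact hi
  | cons p e ih =>
    refine h _ _ ?_ ih
    have := e.down
    simpa using this

/-- Every type has positive probability, by irreducibility. -/
theorem IsRootLaw.pos (hq : IsRootLaw d q) (hd : IsExpandingDegreeMatrix d) (i : Fin k) :
    0 < q i := by
  by_contra h
  have h0 : q i = 0 := le_antisymm (not_lt.1 h) (hq.nonneg i)
  have := hd.induction (P := fun j => q j = 0) h0 (fun j l hjl hj => by
    have h1 := hq.balance j l
    rw [hj, zero_mul] at h1
    have h2 : (d l j : ℝ) ≠ 0 := by exact_mod_cast (hd.pos_symm j l hjl).ne'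
    exact (mul_eq_zero.1 h1.symm).resolve_right h2)
  have h2 := hq.sum_eq_one
  rw [Finset.sum_eq_zero (fun j _ => this j)] at h2
  exact zero_ne_one h2

section

variable {S : Fin k → Type} [∀ i, Fintype (S i)] [∀ i, DecidableEq (S i)] {t : ∀ i, S i → Fin k}

/-- The number of half-edges from type `c.1` to type `c.2`. -/
theorem classCard_slotClass (hS : SlotCard d t) (c : Fin k × Fin k) :
    classCard (slotClass n t) Finset.univ c = n c.1 * d c.1 c.2 := by
  have h : classCard (slotClass n t) Finset.univ c =
      ∑ x : GraphVertex n, if x.1 = c.1 then d c.1 c.2 else 0 := by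
    unfold classCard
    rw [Finset.card_eq_sum_ones, Finset.sum_filter, Fintype.sum_sigma]
    refine Finset.sum_congr rfl fun x _ => ?_
    split_ifs with hx
    · rw [← hx, ← hS x.1 c.2, Finset.card_eq_sum_ones, Finset.sum_filter]
      refine Finset.sum_congr rfl fun s _ => ?_
      simp only [slotClass, halfEdgeClass, Prod.ext_iff, hx, true_and]
    · refine Finset.sum_eq_zero fun s _ => if_neg fun hc => hx ?_
      exact congrArg Prod.fst hc
  rw [h, Fintype.sum_sigma, Finset.sum_eq_single c.1]
  · simp
  · intro i _ hi
    simp [hi]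
  · simp

theorem card_halfEdge_le {D : ℕ} (hD : ∀ i, Fintype.card (S i) ≤ D) :
    Fintype.card (HalfEdge n S) ≤ (∑ i, n i) * D := by
  rw [Fintype.card_sigma]
  refine (Finset.sum_le_card_nsmul _ _ D fun x _ => hD _).trans ?_
  rw [Finset.card_univ, Fintype.card_sigma]
  simp

theorem ConfigGraph.balance (hS : SlotCard d t) (G : ConfigGraph d n) (i j : Fin k) :
    n i * d i j = n j * d j i := by
  choose e he using exists_isOrdering hS G
  obtain ⟨σ, hσ, -⟩ := exists_pairing_of_ordering hS G he
  have h := classCard_bar (bar := Prod.swap) Prod.swap_swap hσ (i, j)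
  rw [classCard_slotClass hS, classCard_slotClass hS] at h
  exact h.symm

/-- The class sizes are determined by the root law. -/
theorem ConfigGraph.size_eq (hS : SlotCard d t) (hd : IsExpandingDegreeMatrix d)
    (hq : IsRootLaw d q) (G : ConfigGraph d n) (i : Fin k) :
    (n i : ℝ) = q i * (∑ j, n j : ℕ) := by
  have key : ∀ j, (n i : ℝ) * q j = n j * q i := by
    refine hd.induction (i := i) rfl fun j l hjl hj => ?_
    have h1 : (n j : ℝ) * d j l = n l * d l j := by exact_mod_cast G.balance hS j l
    have h2 := hq.balance j l
    have h3 : (d j l : ℝ) ≠ 0 := by exact_mod_cast hjl.ne'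
    have h4 : (d l j : ℝ) ≠ 0 := by exact_mod_cast (hd.pos_symm j l hjl).ne'
    have h5 := (hq.pos hd j).ne'
    apply mul_right_cancel₀ (mul_ne_zero h4 h5)
    calc (n i : ℝ) * q l * (d l j * q j) = (n i * q j) * (q l * d l j) := by ring
      _ = (n j * q i) * (q j * d j l) := by rw [hj, h2]
      _ = (n j * d j l) * (q i * q j) := by ring
      _ = _ := by rw [h1]; ring
  have h : ∑ j, (n i : ℝ) * q j = ∑ j, (n j : ℝ) * q i := Finset.sum_congr rfl fun j _ => key j
  rw [← Finset.mul_sum, hq.sum_eq_one, mul_one, ← Finset.sum_mul] at h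
  rw [h]
  push_cast
  ring

end

end Sizes

/-! ### Asymptotics of the first moment bound -/

section Asymptotics

/-- Stirling's formula for a refinement of a classification. -/
theorem sum_log_factorial_sub_le {C C' : Type*} [Fintype C] [Fintype C'] [DecidableEq C']
    (π : C → C') {m : C → ℕ} {M : C' → ℕ} (hM : ∀ i, M i = ∑ c with π c = i, m c) {N : ℝ}
    (hN : 0 < N) {T : ℝ} (hT : ∀ c, (m c : ℝ) ≤ T) {a : C → ℝ} {β : C' → ℝ}
    (hβ : ∀ i, (M i : ℝ) = N * β i) {ε : ℝ}
    (ha : ∀ c, Real.negMulLog (a c) - ε ≤ Real.negMulLog (m c / N)) :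
    ∑ c, Real.log (m c).factorial - ∑ i, Real.log (M i).factorial ≤
      -(N * (∑ c, (Real.negMulLog (a c) - ε) - ∑ i, Real.negMulLog (β i))) +
        Fintype.card C * (2 * Real.log (T + 1) + 1) := by
  have h0 : ∀ x : ℝ, 0 ≤ x → x * Real.log x = - (N * Real.negMulLog (x / N)) + x * Real.log N := by
    intro x hx
    rcases hx.eq_or_lt with rfl | hx
    · simp
    rw [Real.negMulLog, Real.log_div hx.ne' hN.ne']
    field_simp
    ring
  have hsum : ∑ i, (M i : ℝ) = ∑ c, (m c : ℝ) := by
    have : ∑ i, M i = ∑ c, m c := by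
      simp_rw [hM]
      exact Finset.sum_fiberwise _ _ _
    exact_mod_cast this
  have h1 : ∑ c, Real.log (m c).factorial ≤ ∑ c, (-(N * (Real.negMulLog (a c) - ε)) +
      (m c * Real.log N - m c) + (2 * Real.log (T + 1) + 1)) := by
    refine Finset.sum_le_sum fun c _ => (log_factorial_upper (m c)).trans ?_
    rw [h0 _ (Nat.cast_nonneg _)]
    have h2 : Real.log (m c + 1) ≤ Real.log (T + 1) :=
      Real.log_le_log (by positivity) (by linarith [hT c])
    have h3 := mul_le_mul_of_nonneg_left (ha c) hN.le
    linarith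
  have h2 : ∑ i, (-(N * Real.negMulLog (β i)) + (M i * Real.log N - M i)) ≤
      ∑ i, Real.log (M i).factorial := by
    refine Finset.sum_le_sum fun i _ => le_trans (le_of_eq ?_) (log_factorial_lower (M i))
    rw [h0 _ (Nat.cast_nonneg _)]
    have : (M i : ℝ) / N = β i := by rw [hβ]; field_simp
    rw [this]
    ring
  simp only [Finset.sum_add_distrib, Finset.sum_sub_distrib, Finset.sum_neg_distrib,
    ← Finset.mul_sum, ← Finset.sum_mul, Finset.sum_const, Finset.card_univ, nsmul_eq_mul,
    hsum] at h1 h2 ⊢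
  linarith

/-- A polynomial times a decaying exponential tends to zero. -/
theorem tendsto_const_mul_pow_mul_exp (K D δ : ℝ) (b : ℕ) (hδ : 0 < δ) {N : ℕ → ℝ}
    (hN : Tendsto N atTop atTop) :
    Tendsto (fun m => K * (D * N m + 1) ^ b * Real.exp (-(δ * N m))) atTop (𝓝 0) := by
  have h1 : Tendsto (fun m => δ * N m) atTop atTop := hN.const_mul_atTop hδ
  have h2 : Tendsto (fun x : ℝ => K * (D / δ * x + 1) ^ b * Real.exp (-x)) atTop (𝓝 0) := by
    have h3 : Tendsto (fun x : ℝ => ∑ l ∈ Finset.range (b + 1),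
        (K * ((D / δ) ^ l * (b.choose l : ℝ))) * (x ^ l * Real.exp (-x))) atTop (𝓝 0) := by
      rw [← Finset.sum_const_zero (s := Finset.range (b + 1))]
      refine tendsto_finsetSum _ fun l _ => ?_
      simpa using (Real.tendsto_pow_mul_exp_neg_atTop_nhds_zero l).const_mul
        (K * ((D / δ) ^ l * (b.choose l : ℝ)))
    refine h3.congr fun x => ?_
    rw [add_pow, Finset.mul_sum, Finset.sum_mul]
    refine Finset.sum_congr rfl fun l _ => ?_
    rw [mul_pow, one_pow]
    ring
  refine (h2.comp h1).congr fun m => ?_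
  simp only [Function.comp]
  congr 3
  field_simp

variable {k : ℕ} {n : Fin k → ℕ} {S : Fin k → Type}
  [∀ i, Fintype (S i)] [∀ i, DecidableEq (S i)] {t : ∀ i, S i → Fin k}

theorem polyFactor_le {D : ℕ} (hD : ∀ i, Fintype.card (S i) ≤ D) :
    polyFactor n t D ≤ 2 * ((D : ℝ) * (∑ i, n i : ℕ) + 1) ^ (2 * badBound D k + k * k) := by
  set x : ℝ := (D : ℝ) * (∑ i, n i : ℕ) with hx
  have hx0 : 0 ≤ x := by positivity
  have hH : (Fintype.card (HalfEdge n S) : ℝ) ≤ x := by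
    have := card_halfEdge_le (n := n) hD
    rw [hx, mul_comm]
    exact_mod_cast this
  have h1 : (Fintype.card (HalfEdge n S) : ℝ) ^ 2 + 1 ≤ (x + 1) ^ 2 := by
    have : (Fintype.card (HalfEdge n S) : ℝ) ^ 2 ≤ x ^ 2 := by gcongr
    nlinarith
  have h2 : √(∏ c, ((classCard (slotClass n t) Finset.univ c : ℝ) + 1)) ≤ (x + 1) ^ (k * k) := by
    rw [Real.sqrt_le_left (by positivity)]
    have h3 : ∏ c, ((classCard (slotClass n t) Finset.univ c : ℝ) + 1) ≤ (x + 1) ^ (k * k) := by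
      refine (Finset.prod_le_prod (fun c _ => by positivity) (g := fun _ => x + 1)
        fun c _ => ?_).trans (le_of_eq ?_)
      · have : (classCard (slotClass n t) Finset.univ c : ℝ) ≤ Fintype.card (HalfEdge n S) := by
          exact_mod_cast (Finset.card_filter_le _ _)
        linarith
      · simp
    refine h3.trans (le_self_pow₀ (one_le_pow₀ (by linarith)) two_ne_zero)
  unfold polyFactor
  rw [pow_add, pow_mul, ← mul_assoc]
  gcongr

end Asymptotics

/-! ### Graphs with good labellings are rare when the entropy inequality fails -/

section Rare

variable {k : ℕ} {d : Matrix (Fin k) (Fin k) ℕ} {r : Fin k} {o : Fin k → TreeVertex d r}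
  {n : Fin k → ℕ} {q : Fin k → ℝ} {B : Type} [Fintype B] [DecidableEq B] {Y : Type*}

/-- The number of half-edges of class `c` at the centre of a star of type `i` with labels `b`. -/
noncomputable def edgeCount (o : Fin k → TreeVertex d r) (c : (Fin k × B) × (Fin k × B)) (i : Fin k)
    (b : B × (Slots o i → B)) : ℝ :=
  ∑ s, if ((i, b.1), (slotType o i s, b.2 s)) = c then 1 else 0

theorem classCard_labelClass (c : (Fin k × B) × (Fin k × B))
    (s : ∀ x : GraphVertex n, B × (Slots o x.1 → B)) :
    (classCard (labelClass (slotType o) s) Finset.univ c : ℝ) =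
      ∑ x, edgeCount o c x.1 (s x) := by
  unfold classCard edgeCount labelClass
  rw [Finset.card_eq_sum_ones, Finset.sum_filter, Fintype.sum_sigma]
  push_cast
  rfl

theorem edgeCount_nonneg (c : (Fin k × B) × (Fin k × B)) (i : Fin k)
    (b : B × (Slots o i → B)) : 0 ≤ edgeCount o c i b :=
  Finset.sum_nonneg fun s _ => by split_ifs <;> norm_num

theorem edgeCount_le (c : (Fin k × B) × (Fin k × B)) (i : Fin k)
    (b : B × (Slots o i → B)) : edgeCount o c i b ≤ Fintype.card (Slots o i) := by
  refine (Finset.sum_le_card_nsmul _ _ 1 fun s _ => ?_).trans (by simp)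
  split_ifs <;> norm_num

theorem isSlotSymm_edgeCount (c : (Fin k × B) × (Fin k × B)) (i : Fin k) :
    IsSlotSymm (edgeCount o c i) := by
  intro π hπ b
  unfold edgeCount
  rw [← Equiv.sum_comp π (fun s => if ((i, b.1), (slotType o i s, b.2 s)) = c then (1 : ℝ) else 0)]
  refine Finset.sum_congr rfl fun s _ => ?_
  rw [mem_slotPerms.1 hπ s]
  rfl

/-- The statistics of star labels used in the first moment bound: the log-likelihood, and the
numbers of half-edges of each class. -/
noncomputable def likelihoodStat (p : ∀ i, B × (Slots o i → B) → ℝ) :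
    Option ((Fin k × B) × (Fin k × B)) → ∀ i, B × (Slots o i → B) → ℝ
  | none, i => fun b => - Real.log (p i b)
  | some c, i => edgeCount o c i

/-- The expected values of the statistics when star labels have law `p`, and the channel has mean
entropy `h i` at a vertex of type `i`. -/
noncomputable def likelihoodMean (p : ∀ i, B × (Slots o i → B) → ℝ) (h : Fin k → ℝ) :
    Option (Option ((Fin k × B) × (Fin k × B))) → Fin k → ℝ
  | none, i => h i
  | some j, i => ∑ b, p i b * likelihoodStat p j i b

theorem isSlotSymm_likelihoodStat {p : ∀ i, B × (Slots o i → B) → ℝ}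
    (hp : ∀ i, IsSlotSymm (p i)) (j : Option ((Fin k × B) × (Fin k × B))) (i : Fin k) :
    IsSlotSymm (likelihoodStat p j i) := by
  rcases j with _ | c
  · intro π hπ b
    simp only [likelihoodStat]
    rw [hp i π hπ b]
  · exact isSlotSymm_edgeCount c i

/-- The expected proportion of half-edges of class `c`. -/
noncomputable def edgeLaw (q : Fin k → ℝ) (p : ∀ i, B × (Slots o i → B) → ℝ)
    (c : (Fin k × B) × (Fin k × B)) : ℝ :=
  ∑ i, q i * ∑ b, p i b * edgeCount o c i b

/-- Sums of symmetric statistics do not depend on the ordering of the graph. -/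
theorem sum_starLabels_congr (hd : ∀ i j, 0 < d i j → 0 < d j i) (ho : ∀ i, (o i).type = i)
    (G : ConfigGraph d n) {e e' : ∀ x : GraphVertex n, Slots o x.1 → GraphVertex n}
    (he : ∀ x, IsOrdering (S := Slots o) (slotType o) G.1 x (e x))
    (he' : ∀ x, IsOrdering (S := Slots o) (slotType o) G.1 x (e' x))
    {Φ : ∀ i, B × (Slots o i → B) → ℝ} (hΦ : ∀ i, IsSlotSymm (Φ i)) (y : GraphVertex n → B) :
    ∑ x, Φ x.1 (starLabels e' y x) = ∑ x, Φ x.1 (starLabels e y x) := by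
  refine Finset.sum_congr rfl fun x _ => ?_
  obtain ⟨π, hπ, h⟩ := exists_slotPerm (slotCard_slots hd ho) G (he x) (he' x)
  rw [← hΦ x.1 π hπ (starLabels e y x)]
  simp only [starLabels, ← h]
  rfl

/-- The graphs with a labelling whose star marginals give the statistics the expected values, up
to an error `η`. -/
def goodGraphs [MeasurableSpace Y] (d : Matrix (Fin k) (Fin k) ℕ) {r : Fin k}
    (o : Fin k → TreeVertex d r) (n : Fin k → ℕ) (W : B → Y → ℝ)
    (p : ∀ i, B × (Slots o i → B) → ℝ) (h : Fin k → ℝ) (η : ℝ) : Set (ConfigGraph d n) :=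
  {G | ∃ f : GraphVertex n → Y, ∀ j i,
    |∫ X, testFun W (likelihoodStat p) j i (starEquiv (o i) Y X) ∂(distrStar G.1 f (star (o i)))
      - likelihoodMean p h j i| ≤ η}

/-- The first moment bound for the good graphs: each of them carries about `exp (N ∑ i, q i * h i)`
labellings by `B`, whose star labels are likely under `p`, and whose half-edge classes have the
proportions `edgeLaw q p`. Stirling's formula turns the factorials into entropies. -/
theorem ncard_goodGraphs_le [MeasurableSpace Y] [Nonempty Y] (hd : IsExpandingDegreeMatrix d)
    (hq : IsRootLaw d q) (ho : ∀ i, (o i).type = i) [Nonempty (ConfigGraph d n)] {D : ℕ}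
    (hD : ∀ i, Fintype.card (Slots o i) ≤ D) {W : B → Y → ℝ} (hW : ∀ b y, 0 < W b y)
    (hW1 : ∀ y, ∑ b, W b y = 1) {p : ∀ i, B × (Slots o i → B) → ℝ} (hp : ∀ i b, 0 < p i b)
    (hp1 : ∀ i, ∑ b, p i b = 1) (hps : ∀ i, IsSlotSymm (p i)) {h : Fin k → ℝ}
    (hm : ∀ j i, Measurable fun X => testFun W (likelihoodStat p) j i (starEquiv (o i) Y X))
    {K : ℝ} (hpK : ∀ i b, |Real.log (p i b)| ≤ K) (hWK : ∀ b y, |Real.log (W b y)| ≤ K)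
    (hDK : (D : ℝ) ≤ K) {η ε : ℝ} (hη : 0 < η)
    (hε : ∀ c x, |x - edgeLaw q p c| ≤ 2 * η →
      Real.negMulLog (edgeLaw q p c) - ε ≤ Real.negMulLog x)
    (hlarge : ∀ i, 4 * D + 2 * (D * D) + badBound D k + 6 ≤ n i)
    (hbig : (Fintype.card (Option ((Fin k × B) × (Fin k × B))) + 1 : ℝ) *
      (((D + 1) * (D + 1) : ℕ) * (2 * K) ^ 2) / η ^ 2 ≤ 1 / 2 * (∑ i, n i : ℕ)) :
    ((goodGraphs d o n W p h η).ncard : ℝ) *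
      (1 / 2 * Real.exp ((∑ i, n i : ℕ) * (∑ i, q i * h i) - 2 * ((∑ i, n i : ℕ) * η))) ≤
    Nat.card (ConfigGraph d n) * (polyFactor n (slotType o) D *
      Real.exp (((∑ i, n i : ℕ) * (∑ i, q i * ∑ b, Real.negMulLog (p i b)) +
        2 * ((∑ i, n i : ℕ) * η)) -
        1 / 2 * ((∑ i, n i : ℕ) * (∑ c, (Real.negMulLog (edgeLaw q p c) - ε)
          - ∑ c : Fin k × Fin k, Real.negMulLog (q c.1 * d c.1 c.2)) -
        Fintype.card ((Fin k × B) × (Fin k × B)) *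
          (2 * Real.log ((∑ i, n i : ℕ) * D + 1) + 1)))) := by
  classical
  have hS := slotCard_slots hd.pos_symm ho
  have hn : ∀ i, (n i : ℝ) = q i * (∑ j, n j : ℕ) := fun i =>
    ConfigGraph.size_eq hS hd hq (Classical.arbitrary (ConfigGraph d n)) i
  set N : ℝ := ((∑ i, n i : ℕ) : ℝ) with hN
  have hk : 0 < k := by
    obtain ⟨i, -⟩ := hd.exists_three_le
    exact i.pos
  have hN0 : 0 < ∑ i, n i := by
    have i : Fin k := ⟨0, hk⟩
    have h1 := hlarge i
    have h2 := Finset.single_le_sum (f := n) (fun j _ => Nat.zero_le _) (Finset.mem_univ i)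
    omega
  have hNr : 0 < N := by rw [hN]; exact_mod_cast hN0
  have hsum : ∀ F : Fin k → ℝ, ∑ i, (n i : ℝ) * F i = N * ∑ i, q i * F i := by
    intro F
    rw [Finset.mul_sum]
    exact Finset.sum_congr rfl fun i _ => by rw [hn]; ring
  have hfin : (goodGraphs d o n W p h η).Finite := Set.toFinite _
  choose e he using fun (G : ConfigGraph d n) (x : GraphVertex n) => exists_isOrdering hS G x
  have hgood : ∀ G ∈ hfin.toFinset, ∃ f : GraphVertex n → Y, ∀ j i,
      |∫ X, testFun W (likelihoodStat p) j i (starEquiv (o i) Y X)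
        ∂(distrStar G.1 f (star (o i))) - likelihoodMean p h j i| ≤ η :=
    fun G hG => (Set.Finite.mem_toFinset hfin).1 hG
  choose! f hf using hgood
  rw [Set.ncard_eq_toFinset_card _ hfin]
  have hstat : ∀ G, ∀ y ∈ Finset.univ.filter (fun y : GraphVertex n → B => ∀ j,
      |∑ x, statFun W (likelihoodStat p) (f G) (e G) j x y - ∑ i, n i * likelihoodMean p h j i|
        ≤ 2 * (N * η)), ∀ e' : ∀ x : GraphVertex n, Slots o x.1 → GraphVertex n,
      (∀ x, IsOrdering (S := Slots o) (slotType o) G.1 x (e' x)) → ∀ j,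
      |∑ x, likelihoodStat p j x.1 (starLabels e' y x) -
        N * ∑ i, q i * likelihoodMean p h (some j) i| ≤ 2 * (N * η) := by
    intro G y hy e' he' j
    have h1 := (Finset.mem_filter.1 hy).2 (some j)
    rw [hsum] at h1
    rw [sum_starLabels_congr hd.pos_symm ho G (he G) he' (isSlotSymm_likelihoodStat hps j) y]
    exact h1
  refine card_mul_le_first_moment (t := slotType o) hS hD ?_ hp hp1
    (Y := fun G => Finset.univ.filter (fun y : GraphVertex n → B => ∀ j,
      |∑ x, statFun W (likelihoodStat p) (f G) (e G) j x y - ∑ i, n i * likelihoodMean p h j i|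
        ≤ 2 * (N * η))) ?_ ?_ ?_
  · intro x
    rw [classCard_slotClass hS]
    refine (hlarge (slotClass n (slotType o) x).1).trans (Nat.le_mul_of_pos_right _ ?_)
    have h1 : (slotClass n (slotType o) x) = (x.1.1, slotType o x.1.1 x.2) := rfl
    rw [h1, ← hS]
    exact Finset.card_pos.2 ⟨x.2, by simp⟩
  · intro G hG
    have h1 := exp_le_card_labels hd.pos_symm ho G (f G) (he G) hD hW hW1
      (isSlotSymm_likelihoodStat hps) hm (K := K) ?_ hWK hη (A := likelihoodMean p h)
      (hf G hG) hN0 hbig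
    · rw [hsum] at h1
      exact h1
    · intro j i b
      rcases j with _ | c
      · simp only [likelihoodStat, abs_neg]
        exact hpK i b
      · simp only [likelihoodStat]
        rw [abs_of_nonneg (edgeCount_nonneg _ _ _)]
        exact (edgeCount_le c i b).trans ((Nat.cast_le.2 (hD i)).trans hDK)
  · intro G _ y hy e' he'
    have h1 := (abs_le.1 (hstat G y hy e' he' none)).2
    have h2 : ∀ i, likelihoodMean p h (some none) i = ∑ b, Real.negMulLog (p i b) := by
      intro i
      simp only [likelihoodMean, likelihoodStat, Real.negMulLog]
      exact Finset.sum_congr rfl fun b _ => by ring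
    simp only [h2, likelihoodStat] at h1
    linarith
  · intro G _ y hy e' he'
    have h1 : ∀ c, |(classCard (labelClass (slotType o) (starLabels e' y)) Finset.univ c : ℝ) / N
        - edgeLaw q p c| ≤ 2 * η := by
      intro c
      have h2 := hstat G y hy e' he' (some c)
      simp only [likelihoodStat, likelihoodMean] at h2
      rw [← classCard_labelClass] at h2
      have h3 : (classCard (labelClass (slotType o) (starLabels e' y)) Finset.univ c : ℝ) / N
        - edgeLaw q p c = ((classCard (labelClass (slotType o) (starLabels e' y)) Finset.univ c : ℝ)
        - N * edgeLaw q p c) / N := by field_simp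
      rw [h3, abs_div, abs_of_pos hNr, div_le_iff₀ hNr]
      calc _ ≤ 2 * (N * η) := h2
        _ = _ := by ring
    have h4 := sum_log_factorial_sub_le
      (π := fun c : (Fin k × B) × (Fin k × B) => ((c.1.1, c.2.1) : Fin k × Fin k))
      (m := classCard (labelClass (slotType o) (starLabels e' y)) Finset.univ)
      (M := classCard (slotClass n (slotType o)) Finset.univ) ?_ hNr (T := N * D) ?_
      (a := edgeLaw q p) (β := fun c => q c.1 * d c.1 c.2) ?_ (ε := ε)
      (fun c => hε c _ (h1 c))
    · have hpos : ∀ {C : Type} [Fintype C] (m : C → ℕ),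
          0 < ∏ c, ((m c).factorial : ℝ) := fun m =>
        Finset.prod_pos fun c _ => by exact_mod_cast Nat.factorial_pos _
      rw [← Real.log_le_log_iff (hpos _) (mul_pos (by positivity) (hpos _)),
        Real.log_mul (by positivity) (hpos _).ne', Real.log_pow, Real.log_exp,
        Real.log_prod (fun c _ => by positivity), Real.log_prod (fun c _ => by positivity)]
      push_cast
      linarith
    · intro c'
      unfold classCard
      rw [Finset.card_eq_sum_card_fiberwise
        (f := labelClass (slotType o) (starLabels e' y))
        (t := Finset.univ.filter fun c : (Fin k × B) × (Fin k × B) => (c.1.1, c.2.1) = c')]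
      · refine Finset.sum_congr rfl fun c hc => ?_
        rw [Finset.filter_filter]
        congr 1
        refine Finset.filter_congr fun x _ => ?_
        refine ⟨fun hx => hx.2, fun hx => ⟨?_, hx⟩⟩
        rw [← (Finset.mem_filter.1 hc).2, ← hx]
        rfl
      · intro x hx
        simp only [Finset.mem_coe, Finset.mem_filter, Finset.mem_univ, true_and] at hx ⊢
        rw [← hx]
        rfl
    · intro c
      have h5 : classCard (labelClass (slotType o) (starLabels e' y)) Finset.univ c ≤
        (∑ i, n i) * D := (Finset.card_filter_le _ _).trans (card_halfEdge_le hD)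
      rw [hN]
      exact_mod_cast h5
    · intro c
      rw [classCard_slotClass hS]
      push_cast
      rw [hn]
      ring

/-- The proportion of good graphs tends to zero when the entropy inequality fails: the exponential
rate in the first moment bound is then negative, and beats the polynomial factors. -/
theorem exists_ncard_goodGraphs_le [MeasurableSpace Y] [Nonempty Y] (hd : IsExpandingDegreeMatrix d)
    (hq : IsRootLaw d q) (ho : ∀ i, (o i).type = i) {W : B → Y → ℝ} {τ : ℝ} (hτ : 0 < τ)
    (hW : ∀ b y, τ ≤ W b y) (hW1 : ∀ y, ∑ b, W b y = 1)
    {p : ∀ i, B × (Slots o i → B) → ℝ} (hp : ∀ i b, 0 < p i b)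
    (hp1 : ∀ i, ∑ b, p i b = 1) (hps : ∀ i, IsSlotSymm (p i)) {h : Fin k → ℝ}
    (hm : ∀ j i, Measurable fun X => testFun W (likelihoodStat p) j i (starEquiv (o i) Y X))
    (hlt : ∑ i, q i * ∑ b, Real.negMulLog (p i b) -
      1 / 2 * (∑ c, Real.negMulLog (edgeLaw q p c)
        - ∑ c : Fin k × Fin k, Real.negMulLog (q c.1 * d c.1 c.2)) < ∑ i, q i * h i)
    {n : ℕ → Fin k → ℕ} (hn : StrictMono fun m => ∑ i, n m i)
    (hne : ∀ m, Nonempty (ConfigGraph d (n m))) :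
    ∃ η > 0, Tendsto (fun m => ((goodGraphs d o (n m) W p h η).ncard : ℝ) /
      Nat.card (ConfigGraph d (n m))) atTop (𝓝 0) := by
  classical
  set δ := ∑ i, q i * h i - (∑ i, q i * ∑ b, Real.negMulLog (p i b) -
      1 / 2 * (∑ c, Real.negMulLog (edgeLaw q p c)
        - ∑ c : Fin k × Fin k, Real.negMulLog (q c.1 * d c.1 c.2))) with hδ
  have hδ0 : 0 < δ := by rw [hδ]; linarith
  set c₀ : ℝ := ((Fintype.card ((Fin k × B) × (Fin k × B)) : ℕ) : ℝ) with hc₀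
  have hc₀0 : 0 ≤ c₀ := by positivity
  set ε : ℝ := δ / (4 * (c₀ + 1)) with hε
  have hε0 : 0 < ε := by positivity
  have hε1 : c₀ * ε ≤ δ / 4 := by
    rw [hε, ← mul_div_assoc, div_le_div_iff₀ (by positivity) (by norm_num)]
    nlinarith
  -- the errors are chosen such that they cost at most half of the gap `δ`
  have hη : ∀ c, ∃ η > 0, ∀ x, |x - edgeLaw q p c| ≤ 2 * η →
      Real.negMulLog (edgeLaw q p c) - ε ≤ Real.negMulLog x := by
    intro c
    have h1 := Real.continuous_negMulLog.continuousAt (x := edgeLaw q p c)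
    rw [Metric.continuousAt_iff] at h1
    obtain ⟨ρ, hρ, h2⟩ := h1 ε hε0
    refine ⟨ρ / 4, by positivity, fun x hx => ?_⟩
    have := h2 (x := x) (by rw [Real.dist_eq]; linarith)
    rw [Real.dist_eq] at this
    linarith [(abs_lt.1 this).1]
  choose η₀ hη₀ hη₁ using hη
  obtain ⟨η, hηpos, hη⟩ : ∃ η > 0, η ≤ δ / 32 ∧ ∀ c, η ≤ η₀ c := by
    have hfin := Set.finite_range η₀
    obtain ⟨z, hz0, hz⟩ : ∃ z > 0, ∀ c, z ≤ η₀ c := by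
      rcases isEmpty_or_nonempty ((Fin k × B) × (Fin k × B)) with hE | hE
      · exact ⟨1, one_pos, fun c => hE.elim c⟩
      · obtain ⟨c, hc⟩ := Finite.exists_min η₀
        exact ⟨η₀ c, hη₀ c, hc⟩
    exact ⟨min z (δ / 32), by positivity, min_le_right _ _,
      fun c => (min_le_left _ _).trans (hz c)⟩
  refine ⟨η, hηpos, ?_⟩
  set D : ℕ := ∑ i, Fintype.card (Slots o i) with hD
  have hDi : ∀ i, Fintype.card (Slots o i) ≤ D := fun i =>
    Finset.single_le_sum (f := fun i => Fintype.card (Slots o i)) (fun j _ => Nat.zero_le _)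
      (Finset.mem_univ i)
  obtain ⟨Kp, hKp⟩ : ∃ K, ∀ i b, |Real.log (p i b)| ≤ K := by
    have : ∀ i, ∃ K, ∀ b, |Real.log (p i b)| ≤ K := fun i => by
      obtain ⟨K, hK⟩ := (Set.finite_range fun b => |Real.log (p i b)|).bddAbove
      exact ⟨K, fun b => hK ⟨b, rfl⟩⟩
    choose K hK using this
    obtain ⟨K', hK'⟩ := (Set.finite_range K).bddAbove
    exact ⟨K', fun i b => (hK i b).trans (hK' ⟨i, rfl⟩)⟩
  have hWle : ∀ b y, W b y ≤ 1 := fun b y => by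
    rw [← hW1 y]
    exact Finset.single_le_sum (f := fun b => W b y) (fun b _ => hτ.le.trans (hW b y))
      (Finset.mem_univ b)
  set K : ℝ := max (max Kp (-Real.log τ)) D with hK
  have hWK : ∀ b y, |Real.log (W b y)| ≤ K := by
    intro b y
    rw [abs_of_nonpos (Real.log_nonpos (hτ.le.trans (hW b y)) (hWle b y))]
    exact (neg_le_neg (Real.log_le_log hτ (hW b y))).trans
      ((le_max_right _ _).trans (le_max_left _ _))
  have hN : Tendsto (fun m => ((∑ i, n m i : ℕ) : ℝ)) atTop atTop :=
    tendsto_natCast_atTop_atTop.comp hn.tendsto_atTop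
  have hsize : ∀ m i, (n m i : ℝ) = q i * (∑ j, n m j : ℕ) := fun m i =>
    ConfigGraph.size_eq (slotCard_slots hd.pos_symm ho) hd hq (hne m).some i
  have hlarge : ∀ᶠ m in atTop, ∀ i, 4 * D + 2 * (D * D) + badBound D k + 6 ≤ n m i := by
    rw [eventually_all]
    intro i
    have : Tendsto (fun m => (n m i : ℝ)) atTop atTop := by
      simp_rw [hsize]
      exact hN.const_mul_atTop (hq.pos hd i)
    filter_upwards [this.eventually_ge_atTop ((4 * D + 2 * (D * D) + badBound D k + 6 : ℕ) : ℝ)]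
      with m hm
    exact_mod_cast hm
  have hbig : ∀ᶠ m in atTop, (Fintype.card (Option ((Fin k × B) × (Fin k × B))) + 1 : ℝ) *
      (((D + 1) * (D + 1) : ℕ) * (2 * K) ^ 2) / η ^ 2 ≤ 1 / 2 * (∑ i, n m i : ℕ) :=
    (hN.const_mul_atTop (by norm_num : (0 : ℝ) < 1 / 2)).eventually_ge_atTop _
  set cN : ℕ := Fintype.card ((Fin k × B) × (Fin k × B)) with hcN
  refine squeeze_zero' (Eventually.of_forall fun m => by positivity) ?_
    (tendsto_const_mul_pow_mul_exp (4 * Real.exp (1 / 2 * c₀)) D (δ / 2)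
      (2 * badBound D k + k * k + cN) (by positivity) hN)
  filter_upwards [hlarge, hbig] with m hm1 hm2
  have := hne m
  have hcard : (0 : ℝ) < Nat.card (ConfigGraph d (n m)) := by exact_mod_cast Nat.card_pos
  have key := ncard_goodGraphs_le (h := h) hd hq ho hDi (fun b y => hτ.trans_le (hW b y)) hW1 hp
    hp1 hps hm (K := K) (fun i b => (hKp i b).trans ((le_max_left _ _).trans (le_max_left _ _)))
    hWK (le_max_right _ _) (η := η) (ε := ε) hηpos
    (fun c x hx => hη₁ c x (hx.trans (by linarith [hη.2 c]))) hm1 hm2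
  set N : ℝ := ((∑ i, n m i : ℕ) : ℝ) with hNm
  have hN0 : 0 ≤ N := by positivity
  rw [div_le_iff₀ hcard]
  set a3 := ∑ i, q i * h i
  set a1 := ∑ i, q i * ∑ b, Real.negMulLog (p i b)
  set a4 := ∑ c : Fin k × Fin k, Real.negMulLog (q c.1 * d c.1 c.2)
  have hsumε : ∑ c, (Real.negMulLog (edgeLaw q p c) - ε) =
      ∑ c, Real.negMulLog (edgeLaw q p c) - c₀ * ε := by
    rw [Finset.sum_sub_distrib, Finset.sum_const, Finset.card_univ, nsmul_eq_mul]
  rw [hsumε] at key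
  set a2 := ∑ c, Real.negMulLog (edgeLaw q p c)
  have hpow : Real.exp (1 / 2 * (c₀ * (2 * Real.log (N * D + 1) + 1))) =
      Real.exp (1 / 2 * c₀) * (D * N + 1) ^ cN := by
    rw [← Real.exp_log (by positivity : (0 : ℝ) < (D * N + 1) ^ cN), ← Real.exp_add,
      Real.log_pow, mul_comm N]
    congr 1
    ring
  have hexp : Real.exp ((N * a1 + 2 * (N * η)) - 1 / 2 * (N * ((a2 - c₀ * ε) - a4) -
      c₀ * (2 * Real.log (N * D + 1) + 1))) ≤
      Real.exp (N * a3 - 2 * (N * η)) * (Real.exp (1 / 2 * c₀) * (D * N + 1) ^ cN *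
        Real.exp (-(δ / 2 * N))) := by
    rw [← hpow, ← Real.exp_add, ← Real.exp_add, Real.exp_le_exp]
    have h1 : N * (4 * η + 1 / 2 * (c₀ * ε)) ≤ N * (δ / 2) :=
      mul_le_mul_of_nonneg_left (by linarith [hη.1]) hN0
    have h2 : N * δ = N * a3 - N * a1 + 1 / 2 * (N * a2 - N * a4) := by rw [hδ]; ring
    linarith
  have hpoly := polyFactor_le (n := n m) (t := slotType o) hDi
  have hE : 0 < Real.exp (N * a3 - 2 * (N * η)) := Real.exp_pos _
  refine le_of_mul_le_mul_right ?_ (by positivity : 0 < 1 / 2 * Real.exp (N * a3 - 2 * (N * η)))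
  refine key.trans ?_
  calc (Nat.card (ConfigGraph d (n m)) : ℝ) * (polyFactor (n m) (slotType o) D * _)
      ≤ Nat.card (ConfigGraph d (n m)) * ((2 * (D * N + 1) ^ (2 * badBound D k + k * k)) *
        (Real.exp (N * a3 - 2 * (N * η)) * (Real.exp (1 / 2 * c₀) * (D * N + 1) ^ cN *
        Real.exp (-(δ / 2 * N))))) := by
        refine mul_le_mul_of_nonneg_left ?_ hcard.le
        exact mul_le_mul hpoly hexp (Real.exp_pos _).le (by positivity)
    _ = _ := by rw [pow_add _ (2 * badBound D k + k * k) cN]; ring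

end Rare

/-! ### The entropy inequality for finite continuous channels -/

section Limits

variable {k : ℕ} {d : Matrix (Fin k) (Fin k) ℕ} {r : Fin k} {o : Fin k → TreeVertex d r}
  {q : Fin k → ℝ} {Y : Type*} [TopologicalSpace Y] [SecondCountableTopology Y]
  [MeasurableSpace Y] [BorelSpace Y] {μ : Measure (TreeVertex d r → Y)}

instance isProbabilityMeasure_configLaw (n : Fin k → ℕ) [Nonempty (ConfigGraph d n)] :
    IsProbabilityMeasure (configLaw d n) :=
  isProbabilityMeasure_uniformOn Set.finite_univ Set.univ_nonempty

theorem configLaw_apply (n : Fin k → ℕ) (s : Set (ConfigGraph d n)) :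
    configLaw d n s = ENNReal.ofReal ((s.ncard : ℝ) / Nat.card (ConfigGraph d n)) := by
  have := Fintype.ofFinite (ConfigGraph d n)
  rw [configLaw, uniformOn_univ, Measure.count_apply_finite' (Set.toFinite s) trivial,
    Nat.card_eq_fintype_card, ← Set.ncard_eq_toFinset_card s (Set.toFinite s)]
  rcases Nat.eq_zero_or_pos (Fintype.card (ConfigGraph d n)) with h | h
  · have : IsEmpty (ConfigGraph d n) := Fintype.card_eq_zero_iff.1 h
    have h2 : s = ∅ := Set.eq_empty_of_isEmpty s
    simp [h2]
  · rw [ENNReal.ofReal_div_of_pos (by exact_mod_cast h), ENNReal.ofReal_natCast,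
      ENNReal.ofReal_natCast]

theorem continuous_starEquiv (u : TreeVertex d r) : Continuous (starEquiv u Y) := by
  refine Continuous.prodMk (continuous_apply _) (continuous_pi fun s => continuous_apply _)

/-- Typical processes are limits of star marginals of labelled graphs. -/
theorem IsTypical.ae_exists_tendsto (hμ : IsTypical μ) :
    ∃ n : ℕ → Fin k → ℕ, StrictMono (fun m => ∑ i, n m i) ∧
      (∀ m, Nonempty (ConfigGraph d (n m))) ∧
      ∀ᵐ G ∂(Measure.infinitePi fun m => configLaw d (n m)),
        ∃ f : ∀ m, GraphVertex (n m) → Y, ∀ i (Ψ : Y × (Slots o i → Y) → ℝ), Continuous Ψ →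
          (∃ C, ∀ y, |Ψ y| ≤ C) →
          Tendsto (fun m => ∫ X, Ψ (starEquiv (o i) Y X) ∂(distrStar (G m).1 (f m) (star (o i))))
            atTop (𝓝 (∫ X, Ψ (X (o i), fun s => X s.1) ∂μ)) := by
  obtain ⟨n, h1, h2, h3⟩ := hμ
  refine ⟨n, h1, h2, ?_⟩
  filter_upwards [h3] with G hG
  obtain ⟨f, hf⟩ := hG
  refine ⟨f, fun i Ψ hΨ ⟨C, hC⟩ => ?_⟩
  exact hf (star (o i)) (connected_induce_star (o i))
    (BoundedContinuousFunction.ofNormedAddCommGroup (fun X => Ψ (starEquiv (o i) Y X))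
      (hΨ.comp (continuous_starEquiv _)) C fun X => hC _)

/-- The star marginals of a typical process are invariant under permutations of slots. -/
theorem IsTypical.integral_slotPerm (hμ : IsTypical μ) (hd : ∀ i j, 0 < d i j → 0 < d j i)
    (ho : ∀ i, (o i).type = i) {i : Fin k} {π : Equiv.Perm (Slots o i)}
    (hπ : π ∈ slotPerms (S := Slots o) (slotType o) i) {Ψ : Y × (Slots o i → Y) → ℝ}
    (hΨ : Continuous Ψ) (hC : ∃ C, ∀ y, |Ψ y| ≤ C) :
    ∫ X, Ψ (X (o i), fun s => X (π s).1) ∂μ = ∫ X, Ψ (X (o i), fun s => X s.1) ∂μ := by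
  obtain ⟨n, -, hne, hae⟩ := hμ.ae_exists_tendsto (o := o)
  obtain ⟨G, f, hf⟩ := hae.exists
  have hΨ' : Continuous fun y : Y × (Slots o i → Y) => Ψ (y.1, y.2 ∘ π) :=
    hΨ.comp (continuous_fst.prodMk (continuous_pi fun s =>
      (continuous_apply (π s)).comp continuous_snd))
  have h1 := hf i Ψ hΨ hC
  have h2 := hf i (fun y => Ψ (y.1, y.2 ∘ π)) hΨ' (hC.imp fun C hC y => hC _)
  refine tendsto_nhds_unique h2 (h1.congr fun m => ?_)
  have hS := slotCard_slots hd ho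
  choose e he using fun x => exists_isOrdering hS (G m) x
  rw [integral_distrStar_star hd ho (G m) (f m) he i Ψ
      (hΨ.comp (continuous_starEquiv _)).measurable,
    integral_distrStar_star hd ho (G m) (f m) he i (fun y => Ψ (y.1, y.2 ∘ π))
      (hΨ'.comp (continuous_starEquiv _)).measurable]
  congr 1
  refine Finset.sum_congr rfl fun x _ => ?_
  refine (Finset.sum_bij (fun π' _ => π' * π) ?_ ?_ ?_ ?_).symm
  · intro π' hπ'
    rw [mem_slotPerms] at hπ hπ' ⊢
    intro s
    rw [Equiv.Perm.mul_apply, hπ', hπ]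
  · intro a _ b _ h
    exact mul_right_cancel h
  · intro a ha
    refine ⟨a * π⁻¹, ?_, by simp⟩
    rw [mem_slotPerms] at hπ ha ⊢
    intro s
    rw [Equiv.Perm.mul_apply, ha, ← hπ (π⁻¹ s)]
    simp
  · intro a _
    rfl

end Limits

section Channel

variable {k : ℕ} {d : Matrix (Fin k) (Fin k) ℕ} {r : Fin k} {o : Fin k → TreeVertex d r}
  {q : Fin k → ℝ} {Y : Type*} [MeasurableSpace Y] {μ : Measure (TreeVertex d r → Y)} {B : Type}

/-- The law of the output of the channel `W` on the star of type `i`. -/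
noncomputable def outputLaw (μ : Measure (TreeVertex d r → Y)) (o : Fin k → TreeVertex d r)
    (W : B → Y → ℝ) (i : Fin k) (b : B × (Slots o i → B)) : ℝ :=
  ∫ X, starWeight W b (X (o i), fun s => X s.1) ∂μ

/-- The law of the output of the channel `W` on the edge in slot `s` of the star of type `i`. -/
noncomputable def outputEdgeLaw (μ : Measure (TreeVertex d r → Y)) (o : Fin k → TreeVertex d r)
    (W : B → Y → ℝ) (i : Fin k) (s : Slots o i) (c : B × B) : ℝ :=
  ∫ X, W c.1 (X (o i)) * W c.2 (X s.1) ∂μ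

/-- The mean entropy of the output of the channel `W` given its input, at a vertex of type `i`. -/
noncomputable def channelEntropy [Fintype B] (μ : Measure (TreeVertex d r → Y))
    (o : Fin k → TreeVertex d r) (W : B → Y → ℝ) (i : Fin k) : ℝ :=
  ∫ X, ∑ b, Real.negMulLog (W b (X (o i))) ∂μ

section

variable {S : Type*} [Fintype S] [DecidableEq S] {W : B → Y → ℝ}

theorem starWeight_nonneg (hW : ∀ b y, 0 ≤ W b y) (b : B × (S → B)) (y : Y × (S → Y)) :
    0 ≤ starWeight W b y :=
  mul_nonneg (hW _ _) (Finset.prod_nonneg fun _ _ => hW _ _)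

theorem channel_le_one [Fintype B] (hW : ∀ b y, 0 ≤ W b y) (hW1 : ∀ y, ∑ b, W b y = 1) (b : B)
    (y : Y) : W b y ≤ 1 := by
  rw [← hW1 y]
  exact Finset.single_le_sum (f := fun b => W b y) (fun b _ => hW b y) (Finset.mem_univ b)

theorem starWeight_le_one (hW : ∀ b y, 0 ≤ W b y) (hW1 : ∀ b y, W b y ≤ 1)
    (b : B × (S → B)) (y : Y × (S → Y)) : starWeight W b y ≤ 1 :=
  mul_le_one₀ (hW1 _ _) (Finset.prod_nonneg fun _ _ => hW _ _)
    (Finset.prod_le_one (fun _ _ => hW _ _) fun _ _ => hW1 _ _)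

theorem sum_starWeight [Fintype B] [DecidableEq B] (hW1 : ∀ y, ∑ b, W b y = 1)
    (y : Y × (S → Y)) : ∑ b : B × (S → B), starWeight W b y = 1 := by
  rw [Fintype.sum_prod_type]
  simp only [starWeight, ← Finset.mul_sum]
  have h := sum_prodWeight (w := fun s b => W b (y.2 s)) fun s => hW1 _
  unfold prodWeight at h
  simp only [h, mul_one, hW1]

/-- The edge marginals of the output on a star. -/
theorem sum_starWeight_edge [Fintype B] [DecidableEq B] (hW1 : ∀ y, ∑ b, W b y = 1)
    (y : Y × (S → Y)) (s : S) (c : B × B) :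
    ∑ b : B × (S → B), starWeight W b y * (if (b.1, b.2 s) = c then 1 else 0) =
      W c.1 y.1 * W c.2 (y.2 s) := by
  have h := sum_prodWeight_comp (w := fun s b => W b (y.2 s)) (fun s => hW1 _)
    (ι := fun _ : Unit => s) (fun _ _ _ => rfl) (fun b => if b () = c.2 then 1 else 0)
  rw [← Equiv.sum_comp (Equiv.funUnique Unit B).symm] at h
  simp only [Finset.univ_unique, Finset.prod_singleton, Equiv.funUnique, Equiv.piUnique_symm_apply,
    uniqueElim_const, mul_ite, mul_one, mul_zero, Finset.sum_ite_eq', Finset.mem_univ,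
    if_true] at h
  rw [Fintype.sum_prod_type]
  have h2 : ∀ a : B, ∑ b : S → B, starWeight W (a, b) y *
      (if (a, b s) = c then (1 : ℝ) else 0) = if a = c.1 then W a y.1 * W c.2 (y.2 s) else 0 := by
    intro a
    split_ifs with ha
    · rw [← h, Finset.mul_sum]
      refine Finset.sum_congr rfl fun b _ => ?_
      simp only [starWeight, prodWeight, Prod.ext_iff, ha, true_and, Function.comp]
      split_ifs <;> simp
    · refine Finset.sum_eq_zero fun b _ => ?_
      rw [if_neg fun hc => ha (congrArg Prod.fst hc), mul_zero]
  simp only [h2, Finset.sum_ite_eq', Finset.mem_univ, if_true]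

end

variable [IsProbabilityMeasure μ] {W : B → Y → ℝ}

theorem measurable_starWeight (hm : ∀ b, Measurable (W b)) (i : Fin k) (b : B × (Slots o i → B)) :
    Measurable fun X : TreeVertex d r → Y =>
      starWeight W b (X (o i), fun s : Slots o i => X s.1) := by
  unfold starWeight
  exact ((hm _).comp (measurable_pi_apply _)).mul (Finset.measurable_fun_prod _ fun s _ =>
    (hm _).comp (measurable_pi_apply _))

theorem integrable_starWeight (hm : ∀ b, Measurable (W b)) (hW : ∀ b y, 0 ≤ W b y)
    (hW1 : ∀ b y, W b y ≤ 1) (i : Fin k) (b : B × (Slots o i → B)) :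
    Integrable (fun X : TreeVertex d r → Y =>
      starWeight W b (X (o i), fun s : Slots o i => X s.1)) μ := by
  refine Integrable.of_bound (measurable_starWeight hm i b).aestronglyMeasurable 1 ?_
  refine Eventually.of_forall fun X => ?_
  rw [Real.norm_of_nonneg (starWeight_nonneg hW _ _)]
  exact starWeight_le_one hW hW1 _ _

variable [Fintype B] [DecidableEq B]

theorem sum_outputLaw (hm : ∀ b, Measurable (W b)) (hW : ∀ b y, 0 ≤ W b y)
    (hW1 : ∀ y, ∑ b, W b y = 1) (i : Fin k) : ∑ b, outputLaw μ o W i b = 1 := by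
  unfold outputLaw
  rw [← integral_finsetSum _ fun b _ => integrable_starWeight hm hW (channel_le_one hW hW1) i b]
  simp [sum_starWeight hW1]

theorem sum_outputLaw_edge (hm : ∀ b, Measurable (W b)) (hW : ∀ b y, 0 ≤ W b y)
    (hW1 : ∀ y, ∑ b, W b y = 1) (i : Fin k) (s : Slots o i) (c : B × B) :
    ∑ b, outputLaw μ o W i b * (if (b.1, b.2 s) = c then 1 else 0) =
      outputEdgeLaw μ o W i s c := by
  unfold outputLaw outputEdgeLaw
  simp_rw [← integral_mul_const]
  rw [← integral_finsetSum _ fun b _ =>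
    (integrable_starWeight hm hW (channel_le_one hW hW1) i b).mul_const _]
  refine integral_congr_ae (Eventually.of_forall fun X => ?_)
  exact sum_starWeight_edge hW1 _ s c

theorem sum_outputEdgeLaw (hm : ∀ b, Measurable (W b)) (hW : ∀ b y, 0 ≤ W b y)
    (hW1 : ∀ y, ∑ b, W b y = 1) (i : Fin k) (s : Slots o i) :
    ∑ c, outputEdgeLaw μ o W i s c = 1 := by
  rw [← sum_outputLaw (μ := μ) (o := o) hm hW hW1 i]
  simp_rw [← sum_outputLaw_edge hm hW hW1]
  rw [Finset.sum_comm]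
  simp

theorem outputEdgeLaw_nonneg (hW : ∀ b y, 0 ≤ W b y) (i : Fin k) (s : Slots o i) (c : B × B) :
    0 ≤ outputEdgeLaw μ o W i s c :=
  integral_nonneg fun _ => mul_nonneg (hW _ _) (hW _ _)

/-- Concavity of the entropy, for the laws on the slots `s` of one type; `x` is the mass of the
class of the centre, and the last term is the entropy of the class of the edge without labels. -/
theorem mul_sum_entropy_le {T E : Type*} [Fintype E] (s : Finset T) {ν : T → E → ℝ}
    (hν : ∀ t e, 0 ≤ ν t e) (hν1 : ∀ t, ∑ e, ν t e = 1) {x : ℝ} (hx : 0 ≤ x) :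
    x * ∑ t ∈ s, ∑ e, Real.negMulLog (ν t e) ≤
      ∑ e, Real.negMulLog (x * ∑ t ∈ s, ν t e) - Real.negMulLog (x * s.card) := by
  rcases s.eq_empty_or_nonempty with rfl | hs
  · simp
  have hc : (0 : ℝ) < s.card := by exact_mod_cast hs.card_pos
  have h1 : ∀ e, ∑ t ∈ s, (s.card : ℝ)⁻¹ * Real.negMulLog (ν t e) ≤
      Real.negMulLog (∑ t ∈ s, (s.card : ℝ)⁻¹ * ν t e) := fun e =>
    Real.concaveOn_negMulLog.le_map_sum (fun t _ => by positivity)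
      (by rw [Finset.sum_const, nsmul_eq_mul]; field_simp) fun t _ => hν t e
  have h2 : ∀ e, Real.negMulLog (x * ∑ t ∈ s, ν t e) =
      (∑ t ∈ s, (s.card : ℝ)⁻¹ * ν t e) * Real.negMulLog (x * s.card) +
      (x * s.card) * Real.negMulLog (∑ t ∈ s, (s.card : ℝ)⁻¹ * ν t e) := by
    intro e
    rw [← Real.negMulLog_mul, ← Finset.mul_sum]
    congr 1
    field_simp
  have h3 : ∑ e, ∑ t ∈ s, (s.card : ℝ)⁻¹ * ν t e = 1 := by
    rw [Finset.sum_comm]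
    simp_rw [← Finset.mul_sum, hν1]
    rw [Finset.sum_const, nsmul_eq_mul]
    field_simp
  simp_rw [h2]
  rw [Finset.sum_add_distrib, ← Finset.sum_mul, h3, one_mul, ← Finset.mul_sum,
    add_sub_cancel_left, Finset.sum_comm, mul_assoc]
  refine mul_le_mul_of_nonneg_left ?_ hx
  rw [Finset.mul_sum]
  refine Finset.sum_le_sum fun e _ => ?_
  refine le_trans (le_of_eq ?_) (mul_le_mul_of_nonneg_left (h1 e) hc.le)
  rw [← Finset.mul_sum, ← mul_assoc, mul_inv_cancel₀ hc.ne', one_mul]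

end Channel

section Core

variable {k : ℕ} {d : Matrix (Fin k) (Fin k) ℕ} {r : Fin k} {o : Fin k → TreeVertex d r}
  {q : Fin k → ℝ} {Y : Type*} [TopologicalSpace Y] [SecondCountableTopology Y]
  [MeasurableSpace Y] [BorelSpace Y] {μ : Measure (TreeVertex d r → Y)} [IsProbabilityMeasure μ]
  {B : Type} [Fintype B] [DecidableEq B]

theorem continuous_starWeight {S : Type*} [Fintype S] {W : B → Y → ℝ}
    (hc : ∀ b, Continuous (W b)) (b : B × (S → B)) : Continuous (starWeight W b) :=
  ((hc _).comp continuous_fst).mul (continuous_finsetProd _ fun s _ =>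
    (hc _).comp ((continuous_apply s).comp continuous_snd))

theorem continuous_testFun {J : Type*} {W : B → Y → ℝ} (hc : ∀ b, Continuous (W b))
    (Φ : J → ∀ i, B × (Slots o i → B) → ℝ) (j : Option J) (i : Fin k) :
    Continuous (testFun W Φ j i) := by
  rcases j with _ | j
  · exact continuous_finsetSum _ fun b _ =>
      Real.continuous_negMulLog.comp ((hc b).comp continuous_fst)
  · exact continuous_finsetSum _ fun b _ => (continuous_starWeight hc b).mul continuous_const

theorem negMulLog_le_one {x : ℝ} (h0 : 0 ≤ x) :
    Real.negMulLog x ≤ 1 := by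
  have h2 := Real.negMulLog_le_one_sub_self h0
  linarith

theorem exists_bound_testFun {J : Type*} {W : B → Y → ℝ} (hW : ∀ b y, 0 ≤ W b y)
    (hW1 : ∀ y, ∑ b, W b y = 1) (Φ : J → ∀ i, B × (Slots o i → B) → ℝ) (j : Option J) (i : Fin k) :
    ∃ C, ∀ y, |testFun W Φ j i y| ≤ C := by
  rcases j with _ | j
  · refine ⟨Fintype.card B, fun y => ?_⟩
    have h0 : ∀ b, 0 ≤ Real.negMulLog (W b y.1) := fun b =>
      Real.negMulLog_nonneg (hW b _) (channel_le_one hW hW1 b _)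
    simp only [testFun]
    rw [abs_of_nonneg (Finset.sum_nonneg fun b _ => h0 b)]
    refine (Finset.sum_le_card_nsmul _ _ 1 fun b _ =>
      negMulLog_le_one (hW b _)).trans (by simp)
  · refine ⟨∑ b, |Φ j i b|, fun y => ?_⟩
    refine (Finset.abs_sum_le_sum_abs _ _).trans (Finset.sum_le_sum fun b _ => ?_)
    rw [abs_mul, abs_of_nonneg (starWeight_nonneg hW _ _)]
    exact mul_le_of_le_one_left (abs_nonneg _)
      (starWeight_le_one hW (channel_le_one hW hW1) _ _)

/-- The law of star labels produced by a typical process and a channel satisfies the first moment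
inequality. Otherwise good graphs are rare, whereas typicality makes the random graphs good from
some size on. -/
theorem IsTypical.sum_channelEntropy_le_edgeLaw (hμ : IsTypical μ)
    (hd : IsExpandingDegreeMatrix d) (hq : IsRootLaw d q) (ho : ∀ i, (o i).type = i)
    {W : B → Y → ℝ} {τ : ℝ} (hτ : 0 < τ) (hc : ∀ b, Continuous (W b)) (hW : ∀ b y, τ ≤ W b y)
    (hW1 : ∀ y, ∑ b, W b y = 1) :
    ∑ i, q i * channelEntropy μ o W i ≤ ∑ i, q i * ∑ b, Real.negMulLog (outputLaw μ o W i b) -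
      1 / 2 * (∑ c, Real.negMulLog (edgeLaw q (outputLaw μ o W) c)
        - ∑ c : Fin k × Fin k, Real.negMulLog (q c.1 * d c.1 c.2)) := by
  by_contra hlt
  rw [not_le] at hlt
  have hW0 : ∀ b y, 0 ≤ W b y := fun b y => hτ.le.trans (hW b y)
  have hm : ∀ b, Measurable (W b) := fun b => (hc b).measurable
  have hYne : Nonempty Y := by
    obtain ⟨X⟩ := μ.nonempty_of_neZero
    exact ⟨X (o ⟨0, by obtain ⟨i, -⟩ := hd.exists_three_le; exact i.pos⟩)⟩
  have hp : ∀ i b, 0 < outputLaw μ o W i b := by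
    intro i b
    have h1 : ∀ y : Y × (Slots o i → Y), τ * τ ^ Fintype.card (Slots o i) ≤ starWeight W b y := by
      intro y
      refine mul_le_mul (hW _ _) ?_ (by positivity) (hW0 _ _)
      rw [← Finset.card_univ, ← Finset.prod_const]
      exact Finset.prod_le_prod (fun _ _ => hτ.le) fun s _ => hW _ _
    refine lt_of_lt_of_le (by positivity : 0 < τ * τ ^ Fintype.card (Slots o i)) ?_
    have h2 := integral_mono (μ := μ) (integrable_const _)
      (integrable_starWeight (o := o) hm hW0 (channel_le_one hW0 hW1) i b) fun X => h1 _
    rw [integral_const, probReal_univ, one_smul] at h2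
    exact h2
  have hps : ∀ i, IsSlotSymm (outputLaw μ o W i) := by
    intro i π hπ b
    have h1 := hμ.integral_slotPerm hd.pos_symm ho hπ
      (continuous_starWeight hc ((b.1, b.2 ∘ π) : B × (Slots o i → B)))
      ⟨1, fun y => by
        rw [abs_of_nonneg (starWeight_nonneg hW0 _ _)]
        exact starWeight_le_one hW0 (channel_le_one hW0 hW1) _ _⟩
    unfold outputLaw
    rw [← h1]
    refine integral_congr_ae (Eventually.of_forall fun X => ?_)
    simp only [starWeight, Function.comp]
    congr 1
    exact Equiv.prod_comp π (fun s => W (b.2 s) (X s.1))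
  obtain ⟨n, hn, hne, hae⟩ := hμ.ae_exists_tendsto (o := o)
  obtain ⟨η, hη, htend⟩ := exists_ncard_goodGraphs_le hd hq ho hτ hW hW1 hp
    (sum_outputLaw hm hW0 hW1) hps (h := channelEntropy μ o W)
    (fun j i => ((continuous_testFun hc _ j i).comp (continuous_starEquiv _)).measurable) hlt hn hne
  have hmean : ∀ j i, ∫ X, testFun W (likelihoodStat (outputLaw μ o W)) j i
      (X (o i), fun s => X s.1) ∂μ =
      likelihoodMean (outputLaw μ o W) (channelEntropy μ o W) j i := by
    intro j i
    rcases j with _ | j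
    · rfl
    · simp only [testFun, starAverage, likelihoodMean, outputLaw]
      rw [integral_finsetSum _ fun b _ => (integrable_starWeight hm hW0
        (channel_le_one hW0 hW1) i b).mul_const _]
      simp_rw [integral_mul_const]
  set ν := Measure.infinitePi fun m => configLaw d (n m) with hν
  have hgood : ∀ᵐ G ∂ν, ∃ m₀, ∀ m ≥ m₀,
      G m ∈ goodGraphs d o (n m) W (outputLaw μ o W) (channelEntropy μ o W) η := by
    filter_upwards [hae] with G hG
    obtain ⟨f, hf⟩ := hG
    have h1 : ∀ᶠ m in atTop, ∀ j i, |∫ X, testFun W (likelihoodStat (outputLaw μ o W)) j i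
        (starEquiv (o i) Y X) ∂(distrStar (G m).1 (f m) (star (o i)))
        - likelihoodMean (outputLaw μ o W) (channelEntropy μ o W) j i| ≤ η := by
      rw [eventually_all]
      intro j
      rw [eventually_all]
      intro i
      have h2 := hf i _ (continuous_testFun hc (likelihoodStat (outputLaw μ o W)) j i)
        (exists_bound_testFun hW0 hW1 _ j i)
      rw [hmean] at h2
      have h3 := (Metric.tendsto_nhds.1 h2) η hη
      filter_upwards [h3] with m hm
      rw [Real.dist_eq] at hm
      exact hm.le
    obtain ⟨m₀, hm₀⟩ := eventually_atTop.1 h1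
    exact ⟨m₀, fun m hm => ⟨f m, hm₀ m hm⟩⟩
  -- no rate is needed: the probability of one large size already bounds that of all of them
  have hzero : ∀ m₀, ν {G | ∀ m ≥ m₀,
      G m ∈ goodGraphs d o (n m) W (outputLaw μ o W) (channelEntropy μ o W) η} = 0 := by
    intro m₀
    have h1 : Tendsto (fun m => ENNReal.ofReal
        (((goodGraphs d o (n m) W (outputLaw μ o W) (channelEntropy μ o W) η).ncard : ℝ) /
        Nat.card (ConfigGraph d (n m)))) atTop (𝓝 0) := by
      rw [← ENNReal.ofReal_zero]
      exact (ENNReal.continuous_ofReal.tendsto 0).comp htend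
    refine le_antisymm (ge_of_tendsto h1 ?_) zero_le
    filter_upwards [eventually_ge_atTop m₀] with m hm
    have h2 := (measurePreserving_eval_infinitePi (fun m => configLaw d (n m)) m).measure_preimage
      (s := goodGraphs d o (n m) W (outputLaw μ o W) (channelEntropy μ o W) η)
      (MeasurableSet.nullMeasurableSet trivial)
    rw [← configLaw_apply, ← h2]
    exact measure_mono fun G hG => hG m hm
  have hnull : ν (⋃ m₀, {G | ∀ m ≥ m₀,
      G m ∈ goodGraphs d o (n m) W (outputLaw μ o W) (channelEntropy μ o W) η}) = 0 :=
    measure_iUnion_null hzero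
  have hfalse : ∀ᵐ G ∂ν, False := by
    filter_upwards [hgood, measure_eq_zero_iff_ae_notMem.1 hnull] with G h1 h2
    exact h2 (Set.mem_iUnion.2 h1)
  exact hfalse.exists.elim fun _ h => h

/-- The entropy inequality for the output of a positive continuous channel. The slots of one type
have a common edge law in the first moment inequality, and concavity separates them. -/
theorem IsTypical.core_continuous (hμ : IsTypical μ)
    (hd : IsExpandingDegreeMatrix d) (hq : IsRootLaw d q) (ho : ∀ i, (o i).type = i)
    {W : B → Y → ℝ} {τ : ℝ} (hτ : 0 < τ) (hc : ∀ b, Continuous (W b)) (hW : ∀ b y, τ ≤ W b y)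
    (hW1 : ∀ y, ∑ b, W b y = 1) :
    ∑ i, q i * (channelEntropy μ o W i +
      1 / 2 * ∑ s, ∑ c, Real.negMulLog (outputEdgeLaw μ o W i s c)) ≤
      ∑ i, q i * ∑ b, Real.negMulLog (outputLaw μ o W i b) := by
  have h1 := hμ.sum_channelEntropy_le_edgeLaw hd hq ho hτ hc hW hW1
  have hW0 : ∀ b y, 0 ≤ W b y := fun b y => hτ.le.trans (hW b y)
  have hm : ∀ b, Measurable (W b) := fun b => (hc b).measurable
  have hedge : ∀ i j (a b : B), edgeLaw q (outputLaw μ o W) ((i, a), (j, b)) =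
      q i * ∑ s with slotType o i s = j, outputEdgeLaw μ o W i s (a, b) := by
    intro i j a b
    unfold edgeLaw
    rw [Finset.sum_eq_single i]
    · congr 1
      simp_rw [← sum_outputLaw_edge hm hW0 hW1]
      rw [Finset.sum_comm]
      refine Finset.sum_congr rfl fun b' _ => ?_
      rw [← Finset.mul_sum, edgeCount, Finset.sum_filter]
      congr 1
      refine Finset.sum_congr rfl fun s _ => ?_
      simp only [Prod.mk.injEq, true_and]
      split_ifs <;> tauto
    · intro i' _ hi'
      rw [Finset.sum_eq_zero, mul_zero]
      intro b' _
      rw [edgeCount, Finset.sum_eq_zero, mul_zero]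
      intro s _
      rw [if_neg]
      simp [hi']
    · simp
  have h2 : ∑ i, q i * ∑ s, ∑ c, Real.negMulLog (outputEdgeLaw μ o W i s c) ≤
      ∑ c, Real.negMulLog (edgeLaw q (outputLaw μ o W) c)
        - ∑ c : Fin k × Fin k, Real.negMulLog (q c.1 * d c.1 c.2) := by
    have h3 : ∑ c, Real.negMulLog (edgeLaw q (outputLaw μ o W) c) = ∑ i, ∑ j, ∑ c : B × B,
        Real.negMulLog (edgeLaw q (outputLaw μ o W) ((i, c.1), (j, c.2))) := by
      simp only [Fintype.sum_prod_type]
      refine Finset.sum_congr rfl fun i _ => ?_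
      rw [Finset.sum_comm]
    rw [h3, Fintype.sum_prod_type, ← Finset.sum_sub_distrib]
    refine Finset.sum_le_sum fun i _ => ?_
    rw [← Finset.sum_sub_distrib, ← Finset.sum_fiberwise _ (slotType o i), Finset.mul_sum]
    refine Finset.sum_le_sum fun j _ => ?_
    simp_rw [hedge]
    rw [← slotCard_slots hd.pos_symm ho i j]
    exact mul_sum_entropy_le _ (fun s c => outputEdgeLaw_nonneg hW0 i s c)
      (fun s => sum_outputEdgeLaw hm hW0 hW1 i s) (hq.nonneg i)
  simp_rw [mul_add, Finset.sum_add_distrib]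
  have h4 : ∑ i, q i * (1 / 2 * ∑ s, ∑ c, Real.negMulLog (outputEdgeLaw μ o W i s c)) =
      1 / 2 * ∑ i, q i * ∑ s, ∑ c, Real.negMulLog (outputEdgeLaw μ o W i s c) := by
    rw [Finset.mul_sum]
    exact Finset.sum_congr rfl fun i _ => by ring
  rw [h4]
  linarith

end Core

/-! ### The entropy inequality for finite measurable channels -/

section MeasurableChannel

variable {Y : Type*} [TopologicalSpace Y] [SecondCountableTopology Y]
  [TopologicalSpace.MetrizableSpace Y] [MeasurableSpace Y] [BorelSpace Y]
  {B : Type} [Fintype B] [DecidableEq B]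

/-- A measurable channel is an almost everywhere limit of positive continuous channels. -/
theorem exists_continuous_channel_tendsto (ρ : Measure Y) [IsFiniteMeasure ρ] [Nonempty B]
    {W : B → Y → ℝ} (hm : ∀ b, Measurable (W b)) (hW : ∀ b y, 0 ≤ W b y)
    (hW1 : ∀ y, ∑ b, W b y = 1) :
    ∃ V : ℕ → B → Y → ℝ, (∀ m b, Continuous (V m b)) ∧ (∀ m, ∃ τ > 0, ∀ b y, τ ≤ V m b y) ∧
      (∀ m y, ∑ b, V m b y = 1) ∧
      ∀ᵐ y ∂ρ, ∀ b, Tendsto (fun m => V m b y) atTop (𝓝 (W b y)) := by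
  have hWle := channel_le_one hW hW1
  let w : Y → B → ℝ := fun y b => W b y
  have hw : MemLp w 1 ρ := by
    refine MemLp.of_bound (measurable_pi_lambda _ hm).aestronglyMeasurable 1 ?_
    refine Eventually.of_forall fun y => (pi_norm_le_iff_of_nonneg zero_le_one).2 fun b => ?_
    rw [Real.norm_of_nonneg (hW b y)]
    exact hWle b y
  have h1 : ∀ m : ℕ, ∃ g : BoundedContinuousFunction Y (B → ℝ),
      eLpNorm (w - (g : Y → B → ℝ)) 1 ρ ≤ ((m : ℝ≥0∞) + 1)⁻¹ := fun m => by
    obtain ⟨g, hg, -⟩ := hw.exists_boundedContinuous_eLpNorm_sub_le ENNReal.one_ne_top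
      (ε := ((m : ℝ≥0∞) + 1)⁻¹) (by simp)
    exact ⟨g, hg⟩
  choose g hg using h1
  have h2 : TendstoInMeasure ρ (fun m => (g m : Y → B → ℝ)) atTop w := by
    refine tendstoInMeasure_of_tendsto_eLpNorm one_ne_zero
      (fun m => (g m).continuous.aestronglyMeasurable) hw.1 ?_
    refine tendsto_of_tendsto_of_tendsto_of_le_of_le tendsto_const_nhds
      (h := fun m : ℕ => ((m : ℝ≥0∞) + 1)⁻¹) ?_ (fun m => zero_le) ?_
    · refine ENNReal.tendsto_inv_nat_nhds_zero.comp (tendsto_add_atTop_nat 1) |>.congr fun m => ?_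
      simp
    · intro m
      exact (eLpNorm_sub_comm _ _ _ _).trans_le (hg m)
  obtain ⟨ns, -, hns⟩ := h2.exists_seq_tendsto_ae
  -- clip to `[0, 1]`, make positive, and normalize
  let c : ℕ → B → Y → ℝ := fun m b y => max 0 (min 1 (g (ns m) y b)) + 1 / ((m : ℝ) + 1)
  have hcpos : ∀ (m : ℕ) b y, 1 / ((m : ℝ) + 1) ≤ c m b y := fun m b y => by
    simp only [c]
    linarith [le_max_left 0 (min 1 (g (ns m) y b))]
  have hpos : ∀ m : ℕ, (0 : ℝ) < 1 / ((m : ℝ) + 1) := fun m => by positivity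
  have hcle : ∀ m b y, c m b y ≤ 2 := fun m b y => by
    have e1 : max 0 (min 1 (g (ns m) y b)) ≤ 1 := max_le zero_le_one (min_le_left _ _)
    have e2 : 1 / ((m : ℝ) + 1) ≤ 1 := by
      rw [div_le_one (by positivity)]
      linarith [(Nat.cast_nonneg m : (0 : ℝ) ≤ m)]
    simp only [c]
    linarith
  have hsum : ∀ m y, 0 < ∑ b, c m b y := fun m y =>
    Finset.sum_pos (fun b _ => (hpos m).trans_le (hcpos m b y)) Finset.univ_nonempty
  have hsumle : ∀ m y, ∑ b, c m b y ≤ Fintype.card B * 2 := fun m y => by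
    refine (Finset.sum_le_card_nsmul _ _ 2 fun b _ => hcle m b y).trans (le_of_eq ?_)
    simp
  have hcont : ∀ m b, Continuous (c m b) := fun m b => by
    have : Continuous fun y => g (ns m) y b := (continuous_apply b).comp (g (ns m)).continuous
    exact (continuous_const.max (continuous_const.min this)).add continuous_const
  refine ⟨fun m b y => c m b y / ∑ b', c m b' y, fun m b => ?_, fun m => ?_, fun m y => ?_, ?_⟩
  · exact (hcont m b).div (continuous_finsetSum _ fun b _ => hcont m b) fun y => (hsum m y).ne'
  · refine ⟨1 / ((m : ℝ) + 1) / (Fintype.card B * 2), ?_, fun b y => ?_⟩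
    · have : (0 : ℝ) < Fintype.card B := by exact_mod_cast Fintype.card_pos
      positivity
    · exact div_le_div₀ ((hpos m).le.trans (hcpos m b y)) (hcpos m b y) (hsum m y) (hsumle m y)
  · rw [← Finset.sum_div, div_self (hsum m y).ne']
  · filter_upwards [hns] with y hy
    have h3 : ∀ b, Tendsto (fun m => c m b y) atTop (𝓝 (W b y)) := by
      intro b
      have h4 : Tendsto (fun m => g (ns m) y b) atTop (𝓝 (W b y)) :=
        (tendsto_pi_nhds.1 hy) b
      have h5 := ((tendsto_const_nhds (x := (0 : ℝ))).max
        ((tendsto_const_nhds (x := (1 : ℝ))).min h4)).add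
        (tendsto_one_div_add_atTop_nhds_zero_nat (𝕜 := ℝ))
      rwa [min_eq_right (hWle b y), max_eq_right (hW b y), add_zero] at h5
    intro b
    have h6 := (h3 b).div (tendsto_finsetSum Finset.univ fun b _ => h3 b)
      (by rw [hW1 y]; exact one_ne_zero)
    rw [hW1 y, div_one] at h6
    exact h6

variable {k : ℕ} {d : Matrix (Fin k) (Fin k) ℕ} {r : Fin k} {o : Fin k → TreeVertex d r}
  {q : Fin k → ℝ} {μ : Measure (TreeVertex d r → Y)} [IsProbabilityMeasure μ]

/-- The entropy inequality for the output of a finite measurable channel, by approximation with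
positive continuous channels. -/
theorem IsTypical.core_measurable (hμ : IsTypical μ)
    (hd : IsExpandingDegreeMatrix d) (hq : IsRootLaw d q) (ho : ∀ i, (o i).type = i)
    {W : B → Y → ℝ} (hm : ∀ b, Measurable (W b)) (hW : ∀ b y, 0 ≤ W b y)
    (hW1 : ∀ y, ∑ b, W b y = 1) :
    ∑ i, q i * (channelEntropy μ o W i +
      1 / 2 * ∑ s, ∑ c, Real.negMulLog (outputEdgeLaw μ o W i s c)) ≤
      ∑ i, q i * ∑ b, Real.negMulLog (outputLaw μ o W i b) := by
  classical
  have hY : Nonempty Y := by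
    obtain ⟨X⟩ := μ.nonempty_of_neZero
    exact ⟨X (o ⟨0, by obtain ⟨i, -⟩ := hd.exists_three_le; exact i.pos⟩)⟩
  have hB : Nonempty B := by
    by_contra hB
    rw [not_nonempty_iff] at hB
    obtain ⟨y⟩ := hY
    have := hW1 y
    simp at this
  -- one measure that dominates the laws of all labels that occur
  let U : Finset (TreeVertex d r) := Finset.univ.biUnion fun i => star (o i)
  have hU : ∀ i u, u ∈ star (o i) → u ∈ U := fun i u hu =>
    Finset.mem_biUnion.2 ⟨i, Finset.mem_univ i, hu⟩
  let ρ : Measure Y := ∑ u ∈ U, μ.map (fun X => X u)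
  obtain ⟨V, hc, hτ, hV1, hlim⟩ := exists_continuous_channel_tendsto ρ hm hW hW1
  have hV : ∀ m b y, 0 ≤ V m b y := fun m b y => by
    obtain ⟨τ, h0, h1⟩ := hτ m
    exact h0.le.trans (h1 b y)
  have hVm : ∀ m b, Measurable (V m b) := fun m b => (hc m b).measurable
  have hVle : ∀ m b y, V m b y ≤ 1 := fun m => channel_le_one (hV m) (hV1 m)
  have hae : ∀ i u, u ∈ star (o i) → ∀ᵐ X ∂μ, ∀ b,
      Tendsto (fun m => V m b (X u)) atTop (𝓝 (W b (X u))) := by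
    intro i u hu
    have h1 : μ.map (fun X => X u) ≤ ρ :=
      Finset.single_le_sum (f := fun u => μ.map (fun X : TreeVertex d r → Y => X u))
        (fun _ _ => Measure.zero_le _) (hU i u hu)
    have h2 := h1.absolutelyContinuous.ae_le hlim
    exact ae_of_ae_map (measurable_pi_apply u).aemeasurable h2
  have hlaw : ∀ i b, Tendsto (fun m => outputLaw μ o (V m) i b) atTop
      (𝓝 (outputLaw μ o W i b)) := by
    intro i b
    refine tendsto_integral_of_dominated_convergence (fun _ => 1)
      (fun m => (measurable_starWeight (hVm m) i b).aestronglyMeasurable) (integrable_const _) ?_ ?_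
    · intro m
      refine Eventually.of_forall fun X => ?_
      rw [Real.norm_of_nonneg (starWeight_nonneg (hV m) _ _)]
      exact starWeight_le_one (hV m) (hVle m) _ _
    · filter_upwards [hae i (o i) (self_mem_star _), (ae_all_iff (ι := Slots o i)).2
        fun s => hae i s.1 (mem_star_of_mem_nbrs s.2)] with X h1 h2
      exact (h1 _).mul (tendsto_finsetProd _ fun s _ => h2 s _)
  have hedge : ∀ i (s : Slots o i) c, Tendsto (fun m => outputEdgeLaw μ o (V m) i s c) atTop
      (𝓝 (outputEdgeLaw μ o W i s c)) := by
    intro i s c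
    refine tendsto_integral_of_dominated_convergence (fun _ => 1)
      (fun m => (((hVm m _).comp (measurable_pi_apply _)).mul
        ((hVm m _).comp (measurable_pi_apply _))).aestronglyMeasurable) (integrable_const _) ?_ ?_
    · intro m
      refine Eventually.of_forall fun X => ?_
      rw [Real.norm_of_nonneg (mul_nonneg (hV m _ _) (hV m _ _))]
      exact mul_le_one₀ (hVle m _ _) (hV m _ _) (hVle m _ _)
    · filter_upwards [hae i (o i) (self_mem_star _),
        hae i s.1 (mem_star_of_mem_nbrs s.2)] with X h1 h2
      exact (h1 _).mul (h2 _)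
  have hent : ∀ i, Tendsto (fun m => channelEntropy μ o (V m) i) atTop
      (𝓝 (channelEntropy μ o W i)) := by
    intro i
    refine tendsto_integral_of_dominated_convergence (fun _ => (Fintype.card B : ℝ))
      (fun m => (Finset.measurable_fun_sum _ fun b _ => Real.continuous_negMulLog.measurable.comp
        ((hVm m b).comp (measurable_pi_apply _))).aestronglyMeasurable) (integrable_const _) ?_ ?_
    · intro m
      refine Eventually.of_forall fun X => ?_
      rw [Real.norm_of_nonneg (Finset.sum_nonneg fun b _ =>
        Real.negMulLog_nonneg (hV m b _) (hVle m b _))]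
      exact (Finset.sum_le_card_nsmul _ _ 1 fun b _ => negMulLog_le_one (hV m b _)).trans (by simp)
    · filter_upwards [hae i (o i) (self_mem_star _)] with X h1
      exact tendsto_finsetSum _ fun b _ => (Real.continuous_negMulLog.tendsto _).comp (h1 b)
  have hnl := fun x => Real.continuous_negMulLog.tendsto x
  refine le_of_tendsto_of_tendsto' (f := fun m => ∑ i, q i * (channelEntropy μ o (V m) i +
      1 / 2 * ∑ s, ∑ c, Real.negMulLog (outputEdgeLaw μ o (V m) i s c)))
    (g := fun m => ∑ i, q i * ∑ b, Real.negMulLog (outputLaw μ o (V m) i b)) (b := atTop)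
    ?_ ?_ fun m => ?_
  · refine tendsto_finsetSum _ fun i _ => Tendsto.const_mul _ ((hent i).add (Tendsto.const_mul _ ?_))
    exact tendsto_finsetSum _ fun s _ => tendsto_finsetSum _ fun c _ => (hnl _).comp (hedge i s c)
  · refine tendsto_finsetSum _ fun i _ => Tendsto.const_mul _ ?_
    exact tendsto_finsetSum _ fun b _ => (hnl _).comp (hlaw i b)
  · obtain ⟨τ, h0, h1⟩ := hτ m
    exact hμ.core_continuous hd hq ho h0 (hc m) h1 (hV1 m)

end MeasurableChannel

/-! ### Entropy of countable families of masses -/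

section Entropy

/-- The contribution `-p log p` of an atom of mass `p` to the Shannon entropy. -/
noncomputable def atomEntropy (p : ℝ≥0∞) : ℝ≥0∞ := ENNReal.ofReal (Real.negMulLog p.toReal)

@[simp] theorem atomEntropy_zero : atomEntropy 0 = 0 := by simp [atomEntropy]

theorem atomEntropy_ofReal {x : ℝ} (hx : 0 ≤ x) :
    atomEntropy (ENNReal.ofReal x) = ENNReal.ofReal (Real.negMulLog x) := by
  rw [atomEntropy, ENNReal.toReal_ofReal hx]

theorem shannon_eq_tsum {S : Type*} [MeasurableSpace S] (ν : Measure S) :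
    shannon ν = ∑' s, atomEntropy (ν {s}) := rfl

theorem atomEntropy_eq {p : ℝ≥0∞} (hp : p ≤ 1) :
    atomEntropy p = p * ENNReal.ofReal (-Real.log p.toReal) := by
  have h : p ≠ ⊤ := ne_top_of_le_ne_top ENNReal.one_ne_top hp
  rw [atomEntropy, Real.negMulLog, neg_mul_comm, ENNReal.ofReal_mul ENNReal.toReal_nonneg,
    ENNReal.ofReal_toReal h]

/-- The entropy contribution is subadditive. -/
theorem atomEntropy_tsum_le {X : Type*} (p : X → ℝ≥0∞) (h : ∑' x, p x ≤ 1) :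
    atomEntropy (∑' x, p x) ≤ ∑' x, atomEntropy (p x) := by
  have hp : ∀ x, p x ≤ ∑' x, p x := fun x => ENNReal.le_tsum x
  have htop : ∑' x, p x ≠ ⊤ := ne_top_of_le_ne_top ENNReal.one_ne_top h
  rw [atomEntropy_eq h, ← ENNReal.tsum_mul_right]
  refine ENNReal.tsum_le_tsum fun x => ?_
  rw [atomEntropy_eq ((hp x).trans h)]
  rcases eq_or_ne (p x) 0 with h0 | h0
  · simp [h0]
  refine mul_le_mul_right (ENNReal.ofReal_le_ofReal (neg_le_neg ?_)) _
  exact Real.log_le_log (ENNReal.toReal_pos h0 (ne_top_of_le_ne_top htop (hp x)))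
    (ENNReal.toReal_mono htop (hp x))

open Classical in
/-- The sum of the masses in the fibre of `f` over `e`. -/
noncomputable def fiberSum {X E : Type*} (f : X → E) (p : X → ℝ≥0∞) (e : E) : ℝ≥0∞ :=
  ∑' x, if f x = e then p x else 0

theorem tsum_fiberSum {X E : Type*} (f : X → E) (p : X → ℝ≥0∞) :
    ∑' e, fiberSum f p e = ∑' x, p x := by
  unfold fiberSum
  rw [ENNReal.tsum_comm]
  refine tsum_congr fun x => ?_
  rw [tsum_eq_single (f x) fun e he => if_neg he.symm, if_pos rfl]

/-- Entropy decreases under coarse graining. -/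
theorem tsum_atomEntropy_fiberSum_le {X E : Type*} (f : X → E) (p : X → ℝ≥0∞)
    (h : ∑' x, p x ≤ 1) : ∑' e, atomEntropy (fiberSum f p e) ≤ ∑' x, atomEntropy (p x) := by
  classical
  have h1 : ∀ e, fiberSum f p e ≤ ∑' x, p x := fun e =>
    ENNReal.tsum_le_tsum fun x => by split_ifs <;> simp
  calc ∑' e, atomEntropy (fiberSum f p e)
      ≤ ∑' e, fiberSum f (fun x => atomEntropy (p x)) e := by
        refine ENNReal.tsum_le_tsum fun e => ?_
        refine (atomEntropy_tsum_le _ ((h1 e).trans h)).trans (ENNReal.tsum_le_tsum fun x => ?_)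
        split_ifs <;> simp
    _ = _ := tsum_fiberSum _ _

theorem prod_tsum {S : Type*} [Fintype S] {B : Type*} (v : S → B → ℝ≥0∞) :
    ∏ s, ∑' b, v s b = ∑' x : S → B, ∏ s, v s (x s) := by
  classical
  revert v
  refine Fintype.induction_empty_option (P := fun S _ => ∀ v : S → B → ℝ≥0∞,
    ∏ s, ∑' b, v s b = ∑' x : S → B, ∏ s, v s (x s)) ?_ ?_ ?_ S
  · intro α β hβ e h v
    let _ := Fintype.ofEquiv β e.symm
    rw [← Equiv.prod_comp e, ← (Equiv.arrowCongr e (Equiv.refl B)).tsum_eq]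
    have := h fun s => v (e s)
    convert this using 2
    · funext x
      rw [← Equiv.prod_comp e]
      simp
  · intro v
    simp
  · intro α _ h v
    rw [Fintype.prod_option, h, ← (Equiv.piOptionEquivProd
      (β := fun _ : Option α => B)).symm.tsum_eq, ENNReal.tsum_prod', ← ENNReal.tsum_mul_right]
    refine tsum_congr fun b => ?_
    rw [← ENNReal.tsum_mul_left]
    refine tsum_congr fun x => ?_
    rw [Fintype.prod_option]
    rfl

end Entropy

/-! ### The entropy inequality for countable channels -/

section CountableChannel

variable {B E : Type} {Y : Type*}

/-- The channel `W` followed by the map `φ`. -/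
noncomputable def mapChannel (φ : B → E) (W : B → Y → ℝ) (e : E) (y : Y) : ℝ :=
  (fiberSum φ (fun b => ENNReal.ofReal (W b y)) e).toReal

variable {W : B → Y → ℝ} {φ : B → E}

theorem tsum_ofReal_channel (hW : ∀ b y, 0 ≤ W b y) (hW1 : ∀ y, HasSum (fun b => W b y) 1) (y : Y) :
    ∑' b, ENNReal.ofReal (W b y) = 1 := by
  rw [← ENNReal.ofReal_tsum_of_nonneg (fun b => hW b y) (hW1 y).summable, (hW1 y).tsum_eq,
    ENNReal.ofReal_one]

theorem mapChannel_nonneg (e : E) (y : Y) : 0 ≤ mapChannel φ W e y := ENNReal.toReal_nonneg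

theorem ofReal_mapChannel (hW : ∀ b y, 0 ≤ W b y) (hW1 : ∀ y, HasSum (fun b => W b y) 1) (e : E)
    (y : Y) : ENNReal.ofReal (mapChannel φ W e y) =
      fiberSum φ (fun b => ENNReal.ofReal (W b y)) e := by
  refine ENNReal.ofReal_toReal (ne_top_of_le_ne_top ENNReal.one_ne_top ?_)
  rw [← tsum_ofReal_channel hW hW1 y, ← tsum_fiberSum φ]
  exact ENNReal.le_tsum e

theorem sum_mapChannel [Fintype E] (hW : ∀ b y, 0 ≤ W b y)
    (hW1 : ∀ y, HasSum (fun b => W b y) 1) (y : Y) : ∑ e, mapChannel φ W e y = 1 := by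
  have h : ENNReal.ofReal (∑ e, mapChannel φ W e y) = 1 := by
    rw [ENNReal.ofReal_sum_of_nonneg fun e _ => mapChannel_nonneg e y]
    simp_rw [ofReal_mapChannel hW hW1]
    rw [← tsum_fintype (L := .unconditional _), tsum_fiberSum, tsum_ofReal_channel hW hW1]
  rwa [ENNReal.ofReal_eq_one] at h

theorem ofReal_starWeight {S : Type*} [Fintype S] (hW : ∀ b y, 0 ≤ W b y) (b : B × (S → B))
    (y : Y × (S → Y)) : ENNReal.ofReal (starWeight W b y) =
      ENNReal.ofReal (W b.1 y.1) * ∏ s, ENNReal.ofReal (W (b.2 s) (y.2 s)) := by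
  rw [starWeight, ENNReal.ofReal_mul (hW _ _), ENNReal.ofReal_prod_of_nonneg fun s _ => hW _ _]

theorem tsum_ofReal_starWeight {S : Type*} [Fintype S] (hW : ∀ b y, 0 ≤ W b y)
    (hW1 : ∀ y, HasSum (fun b => W b y) 1) (y : Y × (S → Y)) :
    ∑' b : B × (S → B), ENNReal.ofReal (starWeight W b y) = 1 := by
  simp_rw [ofReal_starWeight hW]
  rw [ENNReal.tsum_prod']
  simp_rw [ENNReal.tsum_mul_left]
  have h := prod_tsum fun s b => ENNReal.ofReal (W b (y.2 s))
  simp_rw [← h, tsum_ofReal_channel hW hW1, Finset.prod_const_one, mul_one,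
    tsum_ofReal_channel hW hW1]

theorem ofReal_starWeight_mapChannel {S : Type*} [Fintype S] (hW : ∀ b y, 0 ≤ W b y)
    (hW1 : ∀ y, HasSum (fun b => W b y) 1) (e : E × (S → E)) (y : Y × (S → Y)) :
    ENNReal.ofReal (starWeight (mapChannel φ W) e y) =
      fiberSum (fun b : B × (S → B) => (φ b.1, φ ∘ b.2))
        (fun b => ENNReal.ofReal (starWeight W b y)) e := by
  classical
  rw [ofReal_starWeight mapChannel_nonneg]
  simp_rw [ofReal_mapChannel hW hW1, ofReal_starWeight hW]
  unfold fiberSum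
  rw [prod_tsum, ENNReal.tsum_prod', ← ENNReal.tsum_mul_right]
  refine tsum_congr fun b => ?_
  rw [← ENNReal.tsum_mul_left]
  refine tsum_congr fun x => ?_
  by_cases h1 : φ b = e.1
  · by_cases h2 : ∀ s, φ (x s) = e.2 s
    · rw [if_pos h1, if_pos (Prod.ext h1 (funext h2))]
      congr 1
      exact Finset.prod_congr rfl fun s _ => if_pos (h2 s)
    · rw [if_neg fun h => h2 fun s => congrFun (congrArg Prod.snd h) s]
      push Not at h2
      obtain ⟨s, hs⟩ := h2
      rw [Finset.prod_eq_zero (Finset.mem_univ s) (if_neg hs), mul_zero]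
  · rw [if_neg h1, zero_mul, if_neg fun h => h1 (congrArg Prod.fst h)]

theorem countable_channel_le_one (hW : ∀ b y, 0 ≤ W b y) (hW1 : ∀ y, HasSum (fun b => W b y) 1)
    (b : B) (y : Y) : W b y ≤ 1 :=
  le_hasSum (hW1 y) b fun b _ => hW b y

theorem mapChannel_apply (hW : ∀ b y, 0 ≤ W b y) {b : B} {e : E}
    (h : ∀ b', φ b' = e ↔ b' = b) (y : Y) : mapChannel φ W e y = W b y := by
  rw [mapChannel, fiberSum, tsum_eq_single b fun b' hb' => if_neg fun hc => hb' ((h b').1 hc),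
    if_pos ((h b).2 rfl), ENNReal.toReal_ofReal (hW _ _)]

variable [MeasurableSpace Y] {k : ℕ} {d : Matrix (Fin k) (Fin k) ℕ} {r : Fin k}
  {o : Fin k → TreeVertex d r} {q : Fin k → ℝ} {μ : Measure (TreeVertex d r → Y)}
  [IsProbabilityMeasure μ]

theorem measurable_mapChannel [Countable B] (hm : ∀ b, Measurable (W b)) (e : E) :
    Measurable (mapChannel φ W e) := by
  classical
  unfold mapChannel fiberSum
  refine (Measurable.tsum fun b => ?_).ennreal_toReal
  split_ifs
  · exact (hm b).ennreal_ofReal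
  · exact measurable_const

theorem ofReal_outputLaw (hm : ∀ b, Measurable (W b)) (hW : ∀ b y, 0 ≤ W b y)
    (hW1 : ∀ b y, W b y ≤ 1) (i : Fin k) (b : B × (Slots o i → B)) :
    ENNReal.ofReal (outputLaw μ o W i b) =
      ∫⁻ X, ENNReal.ofReal (starWeight W b (X (o i), fun s => X s.1)) ∂μ :=
  ofReal_integral_eq_lintegral_ofReal (integrable_starWeight hm hW hW1 i b)
    (Eventually.of_forall fun _ => starWeight_nonneg hW _ _)

theorem tsum_ofReal_outputLaw [Countable B] (hm : ∀ b, Measurable (W b)) (hW : ∀ b y, 0 ≤ W b y)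
    (hW1 : ∀ y, HasSum (fun b => W b y) 1) (i : Fin k) :
    ∑' b, ENNReal.ofReal (outputLaw μ o W i b) = 1 := by
  simp_rw [ofReal_outputLaw hm hW (countable_channel_le_one hW hW1)]
  rw [← lintegral_tsum fun b => (measurable_starWeight hm i b).ennreal_ofReal.aemeasurable]
  simp_rw [tsum_ofReal_starWeight hW hW1]
  simp

theorem ofReal_outputLaw_mapChannel [Countable B] [Fintype E] (hm : ∀ b, Measurable (W b))
    (hW : ∀ b y, 0 ≤ W b y) (hW1 : ∀ y, HasSum (fun b => W b y) 1) (i : Fin k)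
    (e : E × (Slots o i → E)) :
    ENNReal.ofReal (outputLaw μ o (mapChannel φ W) i e) =
      fiberSum (fun b : B × (Slots o i → B) => (φ b.1, φ ∘ b.2))
        (fun b => ENNReal.ofReal (outputLaw μ o W i b)) e := by
  classical
  have hV : ∀ e y, 0 ≤ mapChannel φ W e y := mapChannel_nonneg
  rw [ofReal_outputLaw (measurable_mapChannel hm) hV (channel_le_one hV (sum_mapChannel hW hW1))]
  simp_rw [ofReal_starWeight_mapChannel hW hW1, ofReal_outputLaw hm hW
    (countable_channel_le_one hW hW1)]
  unfold fiberSum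
  rw [lintegral_tsum]
  · refine tsum_congr fun b => ?_
    split_ifs <;> simp
  · intro b
    split_ifs
    · exact (measurable_starWeight hm i b).ennreal_ofReal.aemeasurable
    · exact aemeasurable_const

theorem outputEdgeLaw_le_one (hm : ∀ b, Measurable (W b)) (hW : ∀ b y, 0 ≤ W b y)
    (hW1 : ∀ b y, W b y ≤ 1) (i : Fin k) (s : Slots o i) (c : B × B) :
    outputEdgeLaw μ o W i s c ≤ 1 := by
  have h := integral_mono (μ := μ) (f := fun X : TreeVertex d r → Y =>
    W c.1 (X (o i)) * W c.2 (X s.1)) (g := fun _ => 1) (Integrable.of_bound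
      (((hm _).comp (measurable_pi_apply _)).mul
        ((hm _).comp (measurable_pi_apply _))).aestronglyMeasurable 1
      (Eventually.of_forall fun X => ?_)) (integrable_const _)
      fun X => mul_le_one₀ (hW1 _ _) (hW _ _) (hW1 _ _)
  · exact h.trans (by simp)
  · rw [Real.norm_of_nonneg (mul_nonneg (hW _ _) (hW _ _))]
    exact mul_le_one₀ (hW1 _ _) (hW _ _) (hW1 _ _)

variable [TopologicalSpace Y] [SecondCountableTopology Y] [TopologicalSpace.MetrizableSpace Y]
  [BorelSpace Y]

/-- The entropy inequality for the output of a countable channel, with the entropy of the channel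
itself on the left. All symbols outside a finite set are merged; this can only decrease the right
side, and keeps the terms of the finite set on the left. -/
theorem IsTypical.core_countable [Countable B] (hμ : IsTypical μ)
    (hd : IsExpandingDegreeMatrix d) (hq : IsRootLaw d q) (ho : ∀ i, (o i).type = i)
    (hm : ∀ b, Measurable (W b)) (hW : ∀ b y, 0 ≤ W b y) (hW1 : ∀ y, HasSum (fun b => W b y) 1) :
    ∑ i, ENNReal.ofReal (q i) *
        (∫⁻ X, ∑' b, ENNReal.ofReal (Real.negMulLog (W b (X (o i)))) ∂μ +
        2⁻¹ * ∑ s, ∑' c, ENNReal.ofReal (Real.negMulLog (outputEdgeLaw μ o W i s c))) ≤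
      ∑ i, ENNReal.ofReal (q i) *
        ∑' b, ENNReal.ofReal (Real.negMulLog (outputLaw μ o W i b)) := by
  classical
  have hWle := countable_channel_le_one hW hW1
  have hmeas : ∀ b i, Measurable fun X : TreeVertex d r → Y =>
      ENNReal.ofReal (Real.negMulLog (W b (X (o i)))) := fun b i =>
    (Real.continuous_negMulLog.measurable.comp
      ((hm b).comp (measurable_pi_apply _))).ennreal_ofReal
  -- the left side is the limit of its restrictions to finite sets of symbols
  have hlim : Tendsto (fun F : Finset B => ∑ i, ENNReal.ofReal (q i) *
        (∑ b ∈ F, ∫⁻ X, ENNReal.ofReal (Real.negMulLog (W b (X (o i)))) ∂μ +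
        2⁻¹ * ∑ s, ∑ c ∈ F ×ˢ F,
          ENNReal.ofReal (Real.negMulLog (outputEdgeLaw μ o W i s c)))) atTop
      (𝓝 (∑ i, ENNReal.ofReal (q i) *
        (∫⁻ X, ∑' b, ENNReal.ofReal (Real.negMulLog (W b (X (o i)))) ∂μ +
        2⁻¹ * ∑ s, ∑' c, ENNReal.ofReal (Real.negMulLog (outputEdgeLaw μ o W i s c))))) := by
    refine tendsto_finsetSum _ fun i _ => ENNReal.Tendsto.const_mul (Tendsto.add ?_
      (ENNReal.Tendsto.const_mul (tendsto_finsetSum _ fun s _ => ?_) (Or.inr (by simp))))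
      (Or.inr ENNReal.ofReal_ne_top)
    · rw [lintegral_tsum fun b => (hmeas b i).aemeasurable]
      exact ENNReal.summable.hasSum
    · rw [ENNReal.tsum_eq_iSup_sum' (fun F : Finset B => F ×ˢ F)]
      · exact tendsto_atTop_iSup fun F F' h => Finset.sum_le_sum_of_subset
          (Finset.product_subset_product h h)
      · intro t
        refine ⟨t.image Prod.fst ∪ t.image Prod.snd, fun c hc => ?_⟩
        rw [Finset.mem_product]
        exact ⟨Finset.mem_union_left _ (Finset.mem_image_of_mem _ hc),
          Finset.mem_union_right _ (Finset.mem_image_of_mem _ hc)⟩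
  refine le_of_tendsto' hlim fun F => ?_
  -- `φ` merges the symbols outside `F`
  let φ : B → Option F := fun b => if h : b ∈ F then some ⟨b, h⟩ else none
  have hφ : ∀ (b : F) b', φ b' = some b ↔ b' = b := by
    intro b b'
    simp only [φ]
    split_ifs with h
    · rw [Option.some.injEq, Subtype.ext_iff]
    · simp only [false_iff]
      rintro rfl
      exact h b.2
  set V := mapChannel φ W with hVdef
  have hV0 : ∀ e y, 0 ≤ V e y := mapChannel_nonneg
  have hV1 : ∀ y, ∑ e, V e y = 1 := sum_mapChannel hW hW1
  have hVm : ∀ e, Measurable (V e) := measurable_mapChannel hm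
  have hVle := channel_le_one hV0 hV1
  have hVb : ∀ (b : F) y, V (some b) y = W b y := fun b y => mapChannel_apply hW (hφ b) y
  have hcore := hμ.core_measurable hd hq ho hVm hV0 hV1
  have hVlaw : ∀ i e, 0 ≤ outputLaw μ o V i e := fun i e =>
    integral_nonneg fun X => starWeight_nonneg hV0 _ _
  have hVlaw1 : ∀ i e, outputLaw μ o V i e ≤ 1 := fun i e => by
    rw [← sum_outputLaw (μ := μ) (o := o) hVm hV0 hV1 i]
    exact Finset.single_le_sum (f := outputLaw μ o V i) (fun e _ => hVlaw i e) (Finset.mem_univ e)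
  have hEnt : ∀ i, ∑ b ∈ F, ∫⁻ X, ENNReal.ofReal (Real.negMulLog (W b (X (o i)))) ∂μ ≤
      ENNReal.ofReal (channelEntropy μ o V i) := by
    intro i
    have h1 : Integrable (fun X : TreeVertex d r → Y =>
        ∑ e, Real.negMulLog (V e (X (o i)))) μ := by
      refine integrable_finsetSum _ fun e _ => Integrable.of_bound
        (Real.continuous_negMulLog.measurable.comp
          ((hVm e).comp (measurable_pi_apply _))).aestronglyMeasurable 1
        (Eventually.of_forall fun X => ?_)
      rw [Real.norm_of_nonneg (Real.negMulLog_nonneg (hV0 _ _) (hVle _ _))]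
      exact negMulLog_le_one (hV0 _ _)
    rw [channelEntropy, ofReal_integral_eq_lintegral_ofReal h1 (Eventually.of_forall fun X =>
      Finset.sum_nonneg fun e _ => Real.negMulLog_nonneg (hV0 _ _) (hVle _ _)),
      ← lintegral_finsetSum _ fun b _ => hmeas b i]
    refine lintegral_mono fun X => ?_
    rw [ENNReal.ofReal_sum_of_nonneg fun e _ => Real.negMulLog_nonneg (hV0 _ _) (hVle _ _),
      Fintype.sum_option]
    refine le_trans (le_of_eq ?_) le_add_self
    rw [← Finset.sum_coe_sort F]
    exact Finset.sum_congr rfl fun b _ => by rw [hVb]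
  have hEdge : ∀ i (s : Slots o i), ∑ c ∈ F ×ˢ F,
      ENNReal.ofReal (Real.negMulLog (outputEdgeLaw μ o W i s c)) ≤
      ENNReal.ofReal (∑ c, Real.negMulLog (outputEdgeLaw μ o V i s c)) := by
    intro i s
    rw [ENNReal.ofReal_sum_of_nonneg fun e _ => Real.negMulLog_nonneg
      (outputEdgeLaw_nonneg hV0 _ _ _) (outputEdgeLaw_le_one hVm hV0 hVle _ _ _),
      Finset.sum_product, ← Finset.sum_coe_sort F, Fintype.sum_prod_type, Fintype.sum_option]
    refine le_trans (Finset.sum_le_sum fun a _ => ?_) le_add_self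
    rw [← Finset.sum_coe_sort F, Fintype.sum_option]
    refine le_trans (le_of_eq (Finset.sum_congr rfl fun b _ => ?_)) le_add_self
    simp only [outputEdgeLaw, hVb]
  have hnn : ∀ i, 0 ≤ channelEntropy μ o V i := fun i => integral_nonneg fun X =>
    Finset.sum_nonneg fun e _ => Real.negMulLog_nonneg (hV0 _ _) (hVle _ _)
  have hnn2 : ∀ i (s : Slots o i), 0 ≤ ∑ c, Real.negMulLog (outputEdgeLaw μ o V i s c) :=
    fun i s => Finset.sum_nonneg fun c _ => Real.negMulLog_nonneg
      (outputEdgeLaw_nonneg hV0 _ _ _) (outputEdgeLaw_le_one hVm hV0 hVle _ _ _)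
  have hhalf : (2⁻¹ : ℝ≥0∞) = ENNReal.ofReal (1 / 2) := by
    rw [one_div, ENNReal.ofReal_inv_of_pos two_pos, ENNReal.ofReal_ofNat]
  calc _ ≤ ∑ i, ENNReal.ofReal (q i) * (ENNReal.ofReal (channelEntropy μ o V i) +
        2⁻¹ * ∑ s, ENNReal.ofReal (∑ c, Real.negMulLog (outputEdgeLaw μ o V i s c))) := by
        refine Finset.sum_le_sum fun i _ => mul_le_mul_right (add_le_add (hEnt i)
          (mul_le_mul_right (Finset.sum_le_sum fun s _ => hEdge i s) _)) _
    _ = ENNReal.ofReal (∑ i, q i * (channelEntropy μ o V i +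
        1 / 2 * ∑ s, ∑ c, Real.negMulLog (outputEdgeLaw μ o V i s c))) := by
        have h0 : ∀ i, 0 ≤ 1 / 2 * ∑ s, ∑ c, Real.negMulLog (outputEdgeLaw μ o V i s c) :=
          fun i => mul_nonneg (by norm_num) (Finset.sum_nonneg fun s _ => hnn2 i s)
        rw [ENNReal.ofReal_sum_of_nonneg fun i _ =>
          mul_nonneg (hq.nonneg i) (add_nonneg (hnn i) (h0 i))]
        refine Finset.sum_congr rfl fun i _ => ?_
        rw [ENNReal.ofReal_mul (hq.nonneg i), ENNReal.ofReal_add (hnn i) (h0 i),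
          ENNReal.ofReal_mul (by norm_num), ENNReal.ofReal_sum_of_nonneg fun s _ => hnn2 i s, hhalf]
    _ ≤ ENNReal.ofReal (∑ i, q i * ∑ b, Real.negMulLog (outputLaw μ o V i b)) :=
        ENNReal.ofReal_le_ofReal hcore
    _ = ∑ i, ENNReal.ofReal (q i) * ∑' e, atomEntropy (ENNReal.ofReal (outputLaw μ o V i e)) := by
        rw [ENNReal.ofReal_sum_of_nonneg fun i _ => mul_nonneg (hq.nonneg i)
          (Finset.sum_nonneg fun e _ => Real.negMulLog_nonneg (hVlaw i e) (hVlaw1 i e))]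
        refine Finset.sum_congr rfl fun i _ => ?_
        rw [ENNReal.ofReal_mul (hq.nonneg i), ENNReal.ofReal_sum_of_nonneg fun e _ =>
          Real.negMulLog_nonneg (hVlaw i e) (hVlaw1 i e), tsum_fintype]
        congr 1
        exact Finset.sum_congr rfl fun e _ => by rw [atomEntropy_ofReal (hVlaw i e)]
    _ ≤ _ := by
        refine Finset.sum_le_sum fun i _ => mul_le_mul_right ?_ _
        simp_rw [hVdef, ofReal_outputLaw_mapChannel hm hW hW1]
        refine (tsum_atomEntropy_fiberSum_le _ _ (tsum_ofReal_outputLaw hm hW hW1 i).le).trans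
          (le_of_eq (tsum_congr fun b => ?_))
        rw [atomEntropy_ofReal]
        exact integral_nonneg fun X => starWeight_nonneg hW _ _

end CountableChannel

/-! ### Shannon entropy of discrete random variables -/

section Shannon

variable {Ω : Type*} [MeasurableSpace Ω] {μ : Measure Ω} [IsProbabilityMeasure μ]
  {S T : Type*} [MeasurableSpace S] [MeasurableSingletonClass S] [MeasurableSpace T]
  [MeasurableSingletonClass T]

theorem measure_eq_tsum_of_countable {ν : Measure S} {A : Set S} (hA : A.Countable)
    (hν : ν Aᶜ = 0) (E : Set S) [DecidablePred (· ∈ E)] :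
    ν E = ∑' x, if x ∈ E then ν {x} else 0 := by
  have h1 : ν E = ν (E ∩ A) := by
    refine le_antisymm ?_ (measure_mono Set.inter_subset_left)
    calc ν E ≤ ν ((E ∩ A) ∪ Aᶜ) := measure_mono fun x hx => by
          by_cases h : x ∈ A
          · exact Or.inl ⟨hx, h⟩
          · exact Or.inr h
      _ ≤ ν (E ∩ A) + ν Aᶜ := measure_union_le _ _
      _ = _ := by rw [hν, add_zero]
  have hEA : (E ∩ A).Countable := hA.mono Set.inter_subset_right
  have h2 : ν (E ∩ A) = ∑' x : ↥(E ∩ A), ν {(x : S)} := by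
    have := tsum_measure_preimage_singleton (μ := ν) (f := id) hEA
      fun x _ => measurableSet_singleton x
    simpa using this.symm
  rw [h1, h2, tsum_subtype (E ∩ A) fun x => ν {x}]
  refine tsum_congr fun x => ?_
  by_cases hx : x ∈ E
  · by_cases hxA : x ∈ A
    · rw [if_pos hx]
      exact Set.indicator_of_mem (s := E ∩ A) ⟨hx, hxA⟩ fun x => ν {x}
    · rw [Set.indicator_of_notMem (fun h => hxA h.2), if_pos hx]
      exact (measure_mono_null (Set.singleton_subset_iff.2 hxA) hν).symm
  · rw [Set.indicator_of_notMem (fun h => hx h.1), if_neg hx]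

theorem tsum_measure_singleton_eq_one {ν : Measure S} [IsProbabilityMeasure ν] {A : Set S}
    (hA : A.Countable) (hν : ν Aᶜ = 0) : ∑' x, ν {x} = 1 := by
  classical
  have := measure_eq_tsum_of_countable hA hν Set.univ
  simpa using this.symm

/-- A function of a discrete random variable has at most the entropy of that variable. -/
theorem shannon_map_le_of_ae {f : Ω → S} {g : Ω → T} (hf : Measurable f) (hg : Measurable g)
    {A : Set S} (hA : A.Countable) (hfA : μ.map f Aᶜ = 0) (h : S → T)
    (hgf : ∀ᵐ ω ∂μ, g ω = h (f ω)) : shannon (μ.map g) ≤ shannon (μ.map f) := by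
  classical
  have := Measure.isProbabilityMeasure_map (μ := μ) hf.aemeasurable
  have h0 : ∀ᵐ ω ∂μ, f ω ∈ A := by
    have : ∀ᵐ x ∂(μ.map f), x ∈ A := hfA
    exact ae_of_ae_map hf.aemeasurable this
  have h1 : ∀ t, μ.map g {t} = fiberSum h (fun x => μ.map f {x}) t := by
    intro t
    have h2 := measure_eq_tsum_of_countable hA hfA (h ⁻¹' {t})
    rw [Measure.map_apply hg (measurableSet_singleton t)]
    have h3 : μ (g ⁻¹' {t}) = μ (f ⁻¹' (h ⁻¹' {t} ∩ A)) := by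
      refine measure_congr ?_
      filter_upwards [h0, hgf] with ω e1 e2
      refine propext ⟨fun e3 => ⟨?_, e1⟩, fun e3 => ?_⟩
      · exact e2.symm.trans e3
      · exact e2.trans e3.1
    have hm : MeasurableSet (h ⁻¹' {t} ∩ A) := (hA.mono Set.inter_subset_right).measurableSet
    rw [h3, ← Measure.map_apply hf hm, measure_eq_tsum_of_countable hA hfA]
    refine tsum_congr fun x => ?_
    by_cases hx : h x = t
    · rw [if_pos hx]
      split_ifs with hx2
      · rfl
      · have hxA : x ∉ A := fun hxA => hx2 ⟨hx, hxA⟩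
        exact (measure_mono_null (Set.singleton_subset_iff.2 hxA) hfA).symm
    · rw [if_neg hx, if_neg fun hx2 => hx hx2.1]
  rw [shannon_eq_tsum, shannon_eq_tsum]
  simp_rw [h1]
  exact tsum_atomEntropy_fiberSum_le h _ (tsum_measure_singleton_eq_one hA hfA).le

/-- Gibbs' inequality. -/
theorem tsum_atomEntropy_le_of_gibbs {X : Type*} {p Q : X → ℝ≥0∞} (hp : ∑' x, p x = 1)
    (hQ : ∑' x, Q x ≤ 1) (h0 : ∀ x, Q x = 0 → p x = 0) :
    ∑' x, atomEntropy (p x) ≤ ∑' x, p x * ENNReal.ofReal (-Real.log (Q x).toReal) := by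
  have hQ1 : ∀ x, Q x ≤ 1 := fun x => (ENNReal.le_tsum x).trans hQ
  have hp1 : ∀ x, p x ≤ 1 := fun x => (ENNReal.le_tsum x).trans hp.le
  have key : ∀ x, atomEntropy (p x) + p x ≤ p x * ENNReal.ofReal (-Real.log (Q x).toReal) + Q x := by
    intro x
    rcases eq_or_ne (p x) 0 with hpx | hpx
    · simp [hpx]
    have hQx : Q x ≠ 0 := fun h => hpx (h0 x h)
    have hpt : p x ≠ ⊤ := ne_top_of_le_ne_top ENNReal.one_ne_top (hp1 x)
    have hQt : Q x ≠ ⊤ := ne_top_of_le_ne_top ENNReal.one_ne_top (hQ1 x)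
    have a0 := ENNReal.toReal_pos hpx hpt
    have b0 := ENNReal.toReal_pos hQx hQt
    have a1 : (p x).toReal ≤ 1 := ENNReal.toReal_mono ENNReal.one_ne_top (hp1 x)
    have b1 : (Q x).toReal ≤ 1 := ENNReal.toReal_mono ENNReal.one_ne_top (hQ1 x)
    have e1 : p x * ENNReal.ofReal (-Real.log (Q x).toReal) + Q x =
        ENNReal.ofReal ((p x).toReal * (-Real.log (Q x).toReal) + (Q x).toReal) := by
      have e2 : 0 ≤ -Real.log (Q x).toReal := by
        linarith [Real.log_nonpos b0.le b1]
      rw [ENNReal.ofReal_add (mul_nonneg a0.le e2) b0.le, ENNReal.ofReal_mul a0.le,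
        ENNReal.ofReal_toReal hpt, ENNReal.ofReal_toReal hQt]
    have e3 : atomEntropy (p x) + p x =
        ENNReal.ofReal (Real.negMulLog (p x).toReal + (p x).toReal) := by
      rw [ENNReal.ofReal_add (Real.negMulLog_nonneg a0.le a1) a0.le, ENNReal.ofReal_toReal hpt,
        atomEntropy]
    rw [e1, e3]
    refine ENNReal.ofReal_le_ofReal ?_
    have e4 := Real.log_le_sub_one_of_pos (div_pos b0 a0)
    rw [Real.log_div b0.ne' a0.ne'] at e4
    have e5 := mul_le_mul_of_nonneg_left e4 a0.le
    have e6 : (p x).toReal * ((Q x).toReal / (p x).toReal - 1) = (Q x).toReal - (p x).toReal := by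
      field_simp
    rw [e6] at e5
    rw [Real.negMulLog]
    linarith
  have hsum := ENNReal.tsum_le_tsum key
  rw [ENNReal.tsum_add, ENNReal.tsum_add, hp] at hsum
  exact (ENNReal.add_le_add_iff_right ENNReal.one_ne_top).1 (hsum.trans (by gcongr))

theorem shannon_eq_tsum_mul {ν : Measure S} [IsProbabilityMeasure ν] :
    shannon ν = ∑' x, ν {x} * ENNReal.ofReal (-Real.log (ν {x}).toReal) :=
  tsum_congr fun _ => atomEntropy_eq prob_le_one

/-- The entropy of a discrete random vector is at most the sum of the entropies of its
coordinates. -/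
theorem shannon_map_pi_le {I : Type*} [Fintype I] [Countable S] {f : I → Ω → S}
    (hf : ∀ i, Measurable (f i)) :
    shannon (μ.map fun ω i => f i ω) ≤ ∑ i, shannon (μ.map (f i)) := by
  classical
  have hF : Measurable fun ω i => f i ω := measurable_pi_lambda _ hf
  have := Measure.isProbabilityMeasure_map (μ := μ) hF.aemeasurable
  have hprob : ∀ i, IsProbabilityMeasure (μ.map (f i)) := fun i =>
    Measure.isProbabilityMeasure_map (hf i).aemeasurable
  set p : (I → S) → ℝ≥0∞ := fun x => μ.map (fun ω i => f i ω) {x} with hp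
  have hmarg : ∀ i t, μ.map (f i) {t} = fiberSum (fun x : I → S => x i) p t := by
    intro i t
    have h1 := measure_eq_tsum_of_countable (ν := μ.map fun ω i => f i ω) Set.countable_univ
      (by simp) ((fun x : I → S => x i) ⁻¹' {t})
    rw [Measure.map_apply hF (measurable_pi_apply i (measurableSet_singleton t))] at h1
    rw [Measure.map_apply (hf i) (measurableSet_singleton t)]
    refine h1.trans (tsum_congr fun x => ?_)
    simp [hp]
  have hle : ∀ i x, p x ≤ μ.map (f i) {x i} := by
    intro i x
    rw [hmarg]
    refine le_trans (le_of_eq ?_) (ENNReal.le_tsum x)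
    rw [if_pos rfl]
  have h1 : ∑' x, p x = 1 := tsum_measure_singleton_eq_one Set.countable_univ (by simp)
  rw [shannon_eq_tsum]
  refine (tsum_atomEntropy_le_of_gibbs (Q := fun x => ∏ i, μ.map (f i) {x i}) h1 ?_ ?_).trans ?_
  · rw [← prod_tsum fun i t => μ.map (f i) {t}]
    refine (Finset.prod_congr rfl fun i _ => ?_).trans_le (Finset.prod_const_one.le)
    exact tsum_measure_singleton_eq_one Set.countable_univ (by simp)
  · intro x hx
    obtain ⟨i, -, hi⟩ := Finset.prod_eq_zero_iff.1 hx
    exact le_antisymm ((hle i x).trans hi.le) zero_le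
  · have h2 : ∀ x, p x * ENNReal.ofReal (-Real.log (∏ i, μ.map (f i) {x i}).toReal) ≤
        ∑ i, p x * ENNReal.ofReal (-Real.log (μ.map (f i) {x i}).toReal) := by
      intro x
      rcases eq_or_ne (p x) 0 with hx | hx
      · simp [hx]
      have h3 : ∀ i, 0 < (μ.map (f i) {x i}).toReal := fun i =>
        ENNReal.toReal_pos (fun h => hx (le_antisymm ((hle i x).trans h.le) zero_le))
          (measure_ne_top _ _)
      rw [ENNReal.toReal_prod, Real.log_prod fun i _ => (h3 i).ne', ← Finset.sum_neg_distrib,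
        ENNReal.ofReal_sum_of_nonneg fun i _ => ?_, Finset.mul_sum]
      have := Real.log_nonpos (h3 i).le (ENNReal.toReal_mono ENNReal.one_ne_top prob_le_one)
      linarith
    refine (ENNReal.tsum_le_tsum h2).trans (le_of_eq ?_)
    rw [Summable.tsum_finsetSum fun i _ => ENNReal.summable]
    refine Finset.sum_congr rfl fun i _ => ?_
    rw [shannon_eq_tsum_mul]
    have h4 := tsum_fiberSum (fun x : I → S => x i)
      (fun x => p x * ENNReal.ofReal (-Real.log (μ.map (f i) {x i}).toReal))
    rw [← h4]
    refine tsum_congr fun t => ?_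
    rw [hmarg i t, fiberSum, fiberSum, ← ENNReal.tsum_mul_right]
    refine tsum_congr fun x => ?_
    split_ifs with hx
    · rw [← hx, hmarg]
      rfl
    · simp

end Shannon

/-! ### The entropy inequality for discretized labels -/

section Partition

variable {k : ℕ} {d : Matrix (Fin k) (Fin k) ℕ} {r : Fin k} {o : Fin k → TreeVertex d r}
  {q : Fin k → ℝ}

/-- The entropy inequality in `[0, ∞]` gives the inequality for the defect, which is computed with
`toReal`. Only the finiteness on the stars is needed: an infinite entropy on an edge would count as
zero. -/
theorem entropyDefect_nonneg_of_le (hq : ∀ i, 0 ≤ q i) {H : Finset (TreeVertex d r) → ℝ≥0∞}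
    (hfin : ∀ i, H (star (o i)) ≠ ⊤)
    (hle : ∑ i, ENNReal.ofReal (q i) * (2⁻¹ * ∑ v ∈ nbrs (o i), H (edge (o i) v)) ≤
      ∑ i, ENNReal.ofReal (q i) * H (star (o i))) : 0 ≤ entropyDefect q o H := by
  have hhalf : (2⁻¹ : ℝ≥0∞) = ENNReal.ofReal (1 / 2) := by
    rw [one_div, ENNReal.ofReal_inv_of_pos two_pos, ENNReal.ofReal_ofNat]
  have h1 : ENNReal.ofReal (∑ i, q i * (1 / 2 * ∑ v ∈ nbrs (o i), (H (edge (o i) v)).toReal)) ≤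
      ENNReal.ofReal (∑ i, q i * (H (star (o i))).toReal) := by
    have h0 : ∀ i, 0 ≤ ∑ v ∈ nbrs (o i), (H (edge (o i) v)).toReal := fun i =>
      Finset.sum_nonneg fun v _ => ENNReal.toReal_nonneg
    rw [ENNReal.ofReal_sum_of_nonneg fun i _ => mul_nonneg (hq i) (mul_nonneg (by norm_num) (h0 i)),
      ENNReal.ofReal_sum_of_nonneg fun i _ => mul_nonneg (hq i) ENNReal.toReal_nonneg]
    refine le_trans (Finset.sum_le_sum fun i _ => ?_) (hle.trans (le_of_eq ?_))
    · rw [ENNReal.ofReal_mul (hq i), ENNReal.ofReal_mul (by norm_num), ← hhalf,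
        ENNReal.ofReal_sum_of_nonneg fun v _ => ENNReal.toReal_nonneg]
      exact mul_le_mul_right (mul_le_mul_right (Finset.sum_le_sum fun v _ =>
        ENNReal.ofReal_toReal_le) _) _
    · exact Finset.sum_congr rfl fun i _ => by
        rw [ENNReal.ofReal_mul (hq i), ENNReal.ofReal_toReal (hfin i)]
  rw [ENNReal.ofReal_le_ofReal_iff (Finset.sum_nonneg fun i _ =>
    mul_nonneg (hq i) ENNReal.toReal_nonneg)] at h1
  unfold entropyDefect
  simp_rw [mul_sub, Finset.sum_sub_distrib]
  linarith

theorem mem_edge {u v w : TreeVertex d r} : w ∈ edge u v ↔ w = u ∨ w = v := by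
  simp [edge]

variable {Y : Type*} [MeasurableSpace Y] {μ : Measure (TreeVertex d r → Y)}
  [IsProbabilityMeasure μ] {c : Y → ℕ}

theorem measurable_partition (hc : Measurable c) (Γ : Finset (TreeVertex d r)) :
    Measurable fun (X : TreeVertex d r → Y) (u : Γ) => c (X u) :=
  measurable_pi_lambda _ fun _ => hc.comp (measurable_pi_apply _)

theorem shannon_partitionMarginal_star (hc : Measurable c) (i : Fin k) :
    shannon (partitionMarginal c μ (star (o i))) = shannon (μ.map fun X =>
      ((c (X (o i)), fun s => c (X s.1)) : ℕ × (Slots o i → ℕ))) := by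
  have h1 := measurable_partition hc (star (o i))
  have h2 : Measurable fun X : TreeVertex d r → Y =>
      ((c (X (o i)), fun s => c (X s.1)) : ℕ × (Slots o i → ℕ)) :=
    (hc.comp (measurable_pi_apply _)).prodMk
      (measurable_pi_lambda _ fun s => hc.comp (measurable_pi_apply _))
  refine le_antisymm ?_ ?_
  · refine shannon_map_le_of_ae h2 h1 Set.countable_univ (by simp) (starEquiv (o i) ℕ).symm
      (Eventually.of_forall fun X => ?_)
    rw [Equiv.eq_symm_apply]
    rfl
  · exact shannon_map_le_of_ae h1 h2 Set.countable_univ (by simp) (starEquiv (o i) ℕ)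
      (Eventually.of_forall fun X => rfl)

theorem shannon_partitionMarginal_edge (hc : Measurable c) (u v : TreeVertex d r) :
    shannon (partitionMarginal c μ (edge u v)) = shannon (μ.map fun X => (c (X u), c (X v))) := by
  classical
  have h1 := measurable_partition hc (edge u v)
  have h2 : Measurable fun X : TreeVertex d r → Y => (c (X u), c (X v)) :=
    (hc.comp (measurable_pi_apply _)).prodMk (hc.comp (measurable_pi_apply _))
  refine le_antisymm ?_ ?_
  · refine shannon_map_le_of_ae h2 h1 Set.countable_univ (by simp)
      (fun p w => if w.1 = u then p.1 else p.2) (Eventually.of_forall fun X => ?_)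
    funext w
    dsimp only
    split_ifs with h
    · rw [h]
    · rw [(mem_edge.1 w.2).resolve_left h]
  · exact shannon_map_le_of_ae h1 h2 Set.countable_univ (by simp)
      (fun x => (x ⟨u, mem_edge.2 (Or.inl rfl)⟩, x ⟨v, mem_edge.2 (Or.inr rfl)⟩))
      (Eventually.of_forall fun X => rfl)

variable [TopologicalSpace Y] [SecondCountableTopology Y] [TopologicalSpace.MetrizableSpace Y]
  [BorelSpace Y]

/-- A partition is a deterministic channel, whose entropy given the input is zero. -/
theorem IsTypical.sum_edge_le_sum_star (hμ : IsTypical μ)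
    (hd : IsExpandingDegreeMatrix d) (hq : IsRootLaw d q) (ho : ∀ i, (o i).type = i)
    (hc : Measurable c) :
    ∑ i, ENNReal.ofReal (q i) *
        (2⁻¹ * ∑ v ∈ nbrs (o i), shannon (partitionMarginal c μ (edge (o i) v))) ≤
      ∑ i, ENNReal.ofReal (q i) * shannon (partitionMarginal c μ (star (o i))) := by
  classical
  let W : ℕ → Y → ℝ := fun b => (c ⁻¹' {b}).indicator 1
  have hW : ∀ b y, 0 ≤ W b y := fun b y => Set.indicator_nonneg (fun _ _ => zero_le_one) y
  have hWeq : ∀ b y, W b y = if c y = b then 1 else 0 := fun b y => by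
    simp [W, Set.indicator_apply]
  have hWm : ∀ b, Measurable (W b) := fun b =>
    measurable_one.indicator (hc (measurableSet_singleton b))
  have hW1 : ∀ y, HasSum (fun b => W b y) 1 := by
    intro y
    have := hasSum_single (f := fun b => W b y) (c y) fun b hb =>
      (hWeq b y).trans (if_neg fun h => hb h.symm)
    rwa [hWeq, if_pos rfl] at this
  have h1 := hμ.core_countable hd hq ho hWm hW hW1
  have h2 : ∀ b y, Real.negMulLog (W b y) = 0 := by
    intro b y
    rw [hWeq]
    split_ifs <;> simp
  simp only [h2, ENNReal.ofReal_zero, tsum_zero, lintegral_zero, zero_add] at h1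
  refine le_trans (le_of_eq ?_) (h1.trans (le_of_eq ?_))
  · refine Finset.sum_congr rfl fun i _ => ?_
    rw [← Finset.sum_coe_sort (nbrs (o i))]
    congr 2
    refine Finset.sum_congr rfl fun s _ => ?_
    rw [shannon_partitionMarginal_edge hc]
    refine tsum_congr fun b => ?_
    have hm : Measurable fun X : TreeVertex d r → Y => (c (X (o i)), c (X s.1)) :=
      (hc.comp (measurable_pi_apply _)).prodMk (hc.comp (measurable_pi_apply _))
    rw [measureReal_def, Measure.map_apply hm (measurableSet_singleton b), ← measureReal_def,
      ← integral_indicator_one (hm (measurableSet_singleton b))]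
    congr 3
    funext X
    simp only [hWeq, Set.indicator_apply, Set.mem_preimage, Set.mem_singleton_iff, Pi.one_apply,
      Prod.ext_iff]
    split_ifs <;> simp_all
  · refine Finset.sum_congr rfl fun i _ => ?_
    rw [shannon_partitionMarginal_star hc]
    congr 1
    refine tsum_congr fun b => ?_
    have hm : Measurable fun X : TreeVertex d r → Y =>
        ((c (X (o i)), fun s => c (X s.1)) : ℕ × (Slots o i → ℕ)) :=
      (hc.comp (measurable_pi_apply _)).prodMk
        (measurable_pi_lambda _ fun s => hc.comp (measurable_pi_apply _))
    rw [measureReal_def, Measure.map_apply hm (measurableSet_singleton b), ← measureReal_def,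
      ← integral_indicator_one (hm (measurableSet_singleton b)), outputLaw]
    congr 3
    funext X
    simp only [starWeight, hWeq, Set.indicator_apply, Set.mem_preimage, Set.mem_singleton_iff,
      Pi.one_apply, Prod.ext_iff, funext_iff]
    rw [Finset.prod_ite_zero]
    split_ifs <;> simp_all

/-- The entropy inequality for a countable partition of the label space. -/
theorem IsTypical.entropyDefect_partition_nonneg (hμ : IsTypical μ)
    (hd : IsExpandingDegreeMatrix d) (hq : IsRootLaw d q) (ho : ∀ i, (o i).type = i)
    (hc : Measurable c) (hfin : ∀ i, ∀ u ∈ star (o i), shannon (μ.map fun X => c (X u)) ≠ ⊤) :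
    0 ≤ entropyDefect q o (fun Γ => shannon (partitionMarginal c μ Γ)) := by
  refine entropyDefect_nonneg_of_le hq.nonneg (fun i => ?_) (hμ.sum_edge_le_sum_star hd hq ho hc)
  refine ne_top_of_le_ne_top ?_ (shannon_map_pi_le (μ := μ)
    (f := fun (u : star (o i)) X => c (X u)) fun u => hc.comp (measurable_pi_apply _))
  exact ENNReal.sum_ne_top.2 fun u _ => hfin i u u.2

end Partition

/-! ### Local solutions of the eigenvector equation on edges and stars -/

section Eigen

variable {k : ℕ} {d : Matrix (Fin k) (Fin k) ℕ} {r : Fin k} {o : Fin k → TreeVertex d r}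
  {lam : ℝ}

/-- Every vertex has at least two neighbours. The family `o` serves only to have a vertex of each
type, one of which is replaced by `u`. -/
theorem two_le_card_nbrs (hd : IsExpandingDegreeMatrix d) (ho : ∀ i, (o i).type = i)
    (u : TreeVertex d r) : 2 ≤ (nbrs u).card := by
  have ho' : ∀ i, (Function.update o u.type u i).type = i := by
    intro i
    by_cases h : i = u.type
    · subst h; simp
    · rw [Function.update_of_ne h, ho]
  have h1 := card_slots hd.pos_symm ho' u.type
  have h2 := hd.two_le u.type
  rw [← h1, Fintype.card_coe, Function.update_self] at h2
  exact h2

theorem exists_mem_nbrs_ne (hd : IsExpandingDegreeMatrix d) (ho : ∀ i, (o i).type = i)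
    (u v : TreeVertex d r) : ∃ w ∈ nbrs u, w ≠ v := by
  have h := two_le_card_nbrs hd ho u
  exact Finset.exists_mem_ne (by omega) v

/-- The restriction of `X` to `Γ`. -/
noncomputable def restrictTo (Γ : Finset (TreeVertex d r)) (X : TreeVertex d r → ℝ) :
    EuclideanSpace ℝ Γ := WithLp.toLp 2 fun u => X u

/-- There are no constraints on an edge, since both endpoints have further neighbours. -/
theorem eigenSpace_edge (hd : IsExpandingDegreeMatrix d) (ho : ∀ i, (o i).type = i)
    {u v : TreeVertex d r} (huv : v ∈ nbrs u) : eigenSpace lam (edge u v) = ⊤ := by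
  have h : {w | w ∈ edge u v ∧ ∀ w', (coverTree d r).Adj w w' → w' ∈ edge u v} = ∅ := by
    ext w
    simp only [Set.mem_ofPred_eq, Set.mem_empty_iff_false, iff_false, not_and]
    intro hw hall
    have key : ∀ a b : TreeVertex d r, (∀ w', (coverTree d r).Adj a w' → w' = a ∨ w' = b) →
        False := by
      intro a b hab
      obtain ⟨w', h1, h2⟩ := exists_mem_nbrs_ne hd ho a b
      rcases hab w' (mem_nbrs.1 h1) with rfl | rfl
      · exact notMem_nbrs_self _ h1
      · exact h2 rfl
    rcases mem_edge.1 hw with rfl | rfl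
    · exact key _ v fun w' hw' => mem_edge.1 (hall w' hw')
    · exact key _ u fun w' hw' => (mem_edge.1 (hall w' hw')).symm
  rw [eigenSpace, h, Set.image_empty, Submodule.span_empty, Submodule.bot_orthogonal_eq_top]

/-- The only constraint on a star is the one at its centre. -/
theorem eigenSpace_star (hd : IsExpandingDegreeMatrix d) (ho : ∀ i, (o i).type = i)
    (u : TreeVertex d r) : eigenSpace lam (star u) =
      (Submodule.span ℝ {eigenConstraint lam (star u) u})ᗮ := by
  -- a neighbour of `u` has a neighbour other than `u`, which is at distance `2` from `u`
  have h : {w | w ∈ star u ∧ ∀ w', (coverTree d r).Adj w w' → w' ∈ star u} = {u} := by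
    ext w
    simp only [Set.mem_ofPred_eq, Set.mem_singleton_iff]
    constructor
    · rintro ⟨hw, hall⟩
      by_contra hne
      have hwu := (mem_star.1 hw).resolve_left hne
      obtain ⟨w', h1, h2⟩ := exists_mem_nbrs_ne hd ho w u
      have h3 := (mem_star.1 (hall w' (mem_nbrs.1 h1))).resolve_left h2
      exact not_adj_of_mem_nbrs hwu h3 (mem_nbrs.1 h1)
    · rintro rfl
      exact ⟨self_mem_star _, fun w' hw' => mem_star_of_mem_nbrs (mem_nbrs.2 hw')⟩
  rw [eigenSpace, h, Set.image_singleton]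

theorem sum_star_eq (u : TreeVertex d r) (f : TreeVertex d r → ℝ) :
    ∑ w : star u, f w = f u + ∑ v ∈ nbrs u, f v := by
  classical
  rw [Finset.sum_coe_sort (star u) f, star, Finset.sum_insert (notMem_nbrs_self u)]

theorem inner_eigenConstraint (u : TreeVertex d r) (X : TreeVertex d r → ℝ) :
    inner ℝ (eigenConstraint lam (star u) u) (restrictTo (star u) X) =
      lam * X u - ∑ v ∈ nbrs u, X v := by
  classical
  have h1 : inner ℝ (eigenConstraint lam (star u) u) (restrictTo (star u) X) =
      ∑ w : star u, (X w * ((if w.1 = u then lam else 0) -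
        (if (coverTree d r).Adj u w.1 then 1 else 0))) := by
    rw [PiLp.inner_apply]
    refine Finset.sum_congr rfl fun w _ => ?_
    simp [eigenConstraint, restrictTo]
  rw [h1, sum_star_eq u fun w => X w * ((if w = u then lam else 0) -
    (if (coverTree d r).Adj u w then 1 else 0))]
  rw [if_pos rfl, if_neg ((coverTree d r).irrefl), sub_zero, sub_eq_add_neg,
    ← Finset.sum_neg_distrib]
  congr 1
  · ring
  · refine Finset.sum_congr rfl fun v hv => ?_
    rw [if_neg (fun h : v = u => notMem_nbrs_self u (h ▸ hv)), if_pos (mem_nbrs.1 hv)]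
    ring

theorem restrictTo_mem_eigenSpace_star (hd : IsExpandingDegreeMatrix d)
    (ho : ∀ i, (o i).type = i) {u : TreeVertex d r} {X : TreeVertex d r → ℝ}
    (h : lam * X u = ∑ v ∈ nbrs u, X v) : restrictTo (star u) X ∈ eigenSpace lam (star u) := by
  rw [eigenSpace_star hd ho, Submodule.mem_orthogonal_singleton_iff_inner_right,
    inner_eigenConstraint, h, sub_self]

theorem eigenConstraint_ne_zero (hd : IsExpandingDegreeMatrix d) (ho : ∀ i, (o i).type = i)
    (u : TreeVertex d r) : eigenConstraint lam (star u) u ≠ 0 := by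
  obtain ⟨v, hv, -⟩ := exists_mem_nbrs_ne hd ho u u
  intro h
  have h1 := congrArg (fun x : EuclideanSpace ℝ (star u) => x ⟨v, mem_star_of_mem_nbrs hv⟩) h
  have h2 : v ≠ u := fun h => notMem_nbrs_self u (h ▸ hv)
  simp [eigenConstraint, h2, mem_nbrs.1 hv] at h1

theorem card_star (u : TreeVertex d r) : (star u).card = (nbrs u).card + 1 := by
  classical
  rw [star, Finset.card_insert_of_notMem (notMem_nbrs_self u)]

theorem finrank_eigenSpace_star (hd : IsExpandingDegreeMatrix d) (ho : ∀ i, (o i).type = i)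
    (u : TreeVertex d r) : Module.finrank ℝ (eigenSpace lam (star u)) = (nbrs u).card := by
  have : Fact (Module.finrank ℝ (EuclideanSpace ℝ (star u)) = (nbrs u).card + 1) :=
    ⟨by rw [finrank_euclideanSpace, Fintype.card_coe, card_star]⟩
  rw [eigenSpace_star hd ho]
  exact Submodule.finrank_orthogonal_span_singleton (eigenConstraint_ne_zero hd ho u)

theorem finrank_eigenSpace_edge (hd : IsExpandingDegreeMatrix d) (ho : ∀ i, (o i).type = i)
    {u v : TreeVertex d r} (huv : v ∈ nbrs u) :
    Module.finrank ℝ (eigenSpace lam (edge u v)) = 2 := by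
  have h : u ≠ v := fun h => notMem_nbrs_self u (by rw [← h] at huv; exact huv)
  classical
  rw [eigenSpace_edge hd ho huv, finrank_top, finrank_euclideanSpace, Fintype.card_coe, edge,
    Finset.card_pair h]

variable (b : EigenBases d r lam)

/-- The local solution with given coordinates. -/
noncomputable def ofCoords (Γ : Finset (TreeVertex d r))
    (z : Fin (Module.finrank ℝ (eigenSpace lam Γ)) → ℝ) : EuclideanSpace ℝ Γ :=
  ∑ j, z j • ((b Γ j : eigenSpace lam Γ) : EuclideanSpace ℝ Γ)

/-- The coordinates of a function on `Γ` in the chosen basis. -/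
noncomputable def coordsOf (Γ : Finset (TreeVertex d r)) (x : Γ → ℝ) :
    Fin (Module.finrank ℝ (eigenSpace lam Γ)) → ℝ :=
  fun j => inner ℝ ((b Γ j : eigenSpace lam Γ) : EuclideanSpace ℝ Γ) (WithLp.toLp 2 x)

theorem ofCoords_coordsOf {Γ : Finset (TreeVertex d r)} {x : Γ → ℝ}
    (h : (WithLp.toLp 2 x : EuclideanSpace ℝ Γ) ∈ eigenSpace lam Γ) :
    ofCoords b Γ (coordsOf b Γ x) = WithLp.toLp 2 x := by
  have h1 := (b Γ).sum_repr' ⟨_, h⟩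
  have h2 := congrArg (fun x : eigenSpace lam Γ => (x : EuclideanSpace ℝ Γ)) h1
  simp only [Submodule.coe_sum, Submodule.coe_smul, Submodule.coe_inner] at h2
  exact h2

theorem ofCoords_eigenCoords {Γ : Finset (TreeVertex d r)} {X : TreeVertex d r → ℝ}
    (h : restrictTo Γ X ∈ eigenSpace lam Γ) : ofCoords b Γ (eigenCoords b Γ X) = restrictTo Γ X :=
  ofCoords_coordsOf b (x := fun u => X u) h

theorem measurable_restrictTo (Γ : Finset (TreeVertex d r)) :
    Measurable (restrictTo Γ : (TreeVertex d r → ℝ) → EuclideanSpace ℝ Γ) :=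
  (WithLp.measurable_toLp 2 _).comp (measurable_pi_lambda _ fun _ => measurable_pi_apply _)

theorem measurable_eigenCoords (Γ : Finset (TreeVertex d r)) : Measurable (eigenCoords b Γ) :=
  measurable_pi_lambda _ fun j =>
    ((innerSL ℝ ((b Γ j : eigenSpace lam Γ) : EuclideanSpace ℝ Γ)).continuous.measurable).comp
      (measurable_restrictTo Γ)

variable {μ : Measure (TreeVertex d r → ℝ)} [IsProbabilityMeasure μ]

theorem ae_restrictTo_mem_eigenSpace_star (hd : IsExpandingDegreeMatrix d)
    (ho : ∀ i, (o i).type = i) (hμ : IsEigenvectorLaw lam μ) (u : TreeVertex d r) :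
    ∀ᵐ X ∂μ, restrictTo (star u) X ∈ eigenSpace lam (star u) :=
  (hμ.equation u).mono fun _ hX => restrictTo_mem_eigenSpace_star hd ho hX

/-- The cell of the coordinates at scale `a`, as an integer vector. -/
noncomputable def cellOf {ι : Type*} (a : ℝ) (z : ι → ℝ) (j : ι) : ℤ := ⌊a * z j⌋

theorem measurable_cellOf {ι : Type*} (a : ℝ) : Measurable (cellOf (ι := ι) a) :=
  measurable_pi_lambda _ fun j => by
    have : Measurable fun z : ι → ℝ => a * z j := by fun_prop
    exact Int.measurable_floor.comp this

/-- The factor `1 / a` is injective on the integer cells, so that it does not affect the entropy. -/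
theorem shannon_scaleMarginal {a : ℝ} (ha : 0 < a) (Γ : Finset (TreeVertex d r)) :
    shannon (scaleMarginal b a μ Γ) = shannon ((μ.map (eigenCoords b Γ)).map (cellOf a)) := by
  have hc := measurable_eigenCoords b Γ
  have h1 : Measurable fun X => cellOf a (eigenCoords b Γ X) := (measurable_cellOf a).comp hc
  have h2 : Measurable fun (X : TreeVertex d r → ℝ)
      (j : Fin (Module.finrank ℝ (eigenSpace lam Γ))) =>
      1 / a * (⌊a * eigenCoords b Γ X j⌋ : ℝ) :=
    measurable_pi_lambda _ fun j => ((measurable_of_countable (fun n : ℤ => (n : ℝ))).comp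
      ((measurable_pi_apply j).comp h1)).const_mul (1 / a)
  rw [Measure.map_map (measurable_cellOf a) hc, scaleMarginal]
  refine le_antisymm ?_ ?_
  · exact shannon_map_le_of_ae h1 h2 Set.countable_univ (by simp)
      (fun z j => 1 / a * (z j : ℝ)) (Eventually.of_forall fun X => rfl)
  · refine shannon_map_le_of_ae h2 h1 (A := Set.range fun (z : Fin (Module.finrank ℝ
      (eigenSpace lam Γ)) → ℤ) j => 1 / a * (z j : ℝ)) (Set.countable_range _) ?_
      (fun y j => ⌊a * y j⌋) (Eventually.of_forall fun X => ?_)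
    · rw [Measure.map_apply h2 (Set.countable_range _).measurableSet.compl]
      convert measure_empty (μ := μ)
      ext X
      simp only [Set.mem_preimage, Set.mem_compl_iff, Set.mem_range, not_exists,
        Set.mem_empty_iff_false, iff_false, not_forall, not_not]
      exact ⟨fun j => ⌊a * eigenCoords b Γ X j⌋, rfl⟩
    · funext j
      simp only [Function.comp, cellOf]
      rw [← mul_assoc, mul_one_div_cancel ha.ne', one_mul, Int.floor_intCast]

end Eigen

/-! ### Discrete eigenvector processes -/

section DiscreteLimit

theorem dist_le_of_cellOf_eq {ι : Type*} [Fintype ι] {a : ℝ} (ha : 0 < a) {x y : ι → ℝ}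
    (h : cellOf a x = cellOf a y) : dist x y ≤ 1 / a := by
  refine (dist_pi_le_iff (by positivity)).2 fun j => ?_
  have h1 := Int.abs_sub_lt_one_of_floor_eq_floor (congrFun h j)
  rw [← mul_sub, abs_mul, abs_of_pos ha] at h1
  rw [Real.dist_eq, le_div_iff₀ ha, mul_comm]
  exact h1.le

theorem tendsto_atomEntropy {ι : Type*} {l : Filter ι} {p : ι → ℝ≥0∞} {x : ℝ≥0∞}
    (hx : x ≠ ⊤) (h : Tendsto p l (𝓝 x)) :
    Tendsto (fun i => atomEntropy (p i)) l (𝓝 (atomEntropy x)) :=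
  (ENNReal.continuous_ofReal.tendsto _).comp
    ((Real.continuous_negMulLog.tendsto _).comp ((ENNReal.tendsto_toReal hx).comp h))

/-- The entropy of the cells of a discrete random vector tends to its entropy, as the cells
shrink. -/
theorem tendsto_shannon_cellOf {ι : Type*} [Fintype ι] {ν : Measure (ι → ℝ)}
    [IsProbabilityMeasure ν] {A : Set (ι → ℝ)} (hA : A.Countable) (hν : ν Aᶜ = 0) :
    Tendsto (fun a : ℝ => shannon (ν.map (cellOf a))) atTop (𝓝 (shannon ν)) := by
  classical
  have hle : ∀ a, shannon (ν.map (cellOf a)) ≤ shannon ν := fun a => by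
    have h := shannon_map_le_of_ae (μ := ν) (f := id) measurable_id (measurable_cellOf a) hA
      (by rwa [Measure.map_id]) (cellOf a) (Eventually.of_forall fun x => rfl)
    rwa [Measure.map_id] at h
  refine tendsto_order.2 ⟨fun c hc => ?_, fun c hc => Eventually.of_forall fun a =>
    (hle a).trans_lt hc⟩
  rw [shannon_eq_tsum, ENNReal.tsum_eq_iSup_sum, lt_iSup_iff] at hc
  obtain ⟨F, hF⟩ := hc
  have hinv : Tendsto (fun a : ℝ => 1 / a) atTop (𝓝 0) := by
    simpa only [one_div] using tendsto_inv_atTop_zero (𝕜 := ℝ)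
  have hmass : ∀ x, Tendsto (fun a : ℝ => ν (cellOf a ⁻¹' {cellOf a x})) atTop (𝓝 (ν {x})) := by
    intro x
    have h1 : Tendsto (fun a : ℝ => ν (Metric.cthickening (1 / a) {x})) atTop (𝓝 (ν {x})) :=
      (tendsto_measure_cthickening_of_isCompact isCompact_singleton).comp hinv
    refine tendsto_of_tendsto_of_tendsto_of_le_of_le' tendsto_const_nhds h1
      (Eventually.of_forall fun a => measure_mono (by rintro _ rfl; rfl)) ?_
    filter_upwards [eventually_gt_atTop 0] with a ha
    refine measure_mono fun y hy => ?_
    rw [Metric.cthickening_singleton _ (by positivity)]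
    exact Metric.mem_closedBall.2 (dist_le_of_cellOf_eq ha hy)
  have hsum : Tendsto (fun a : ℝ => ∑ x ∈ F, atomEntropy (ν (cellOf a ⁻¹' {cellOf a x}))) atTop
      (𝓝 (∑ x ∈ F, atomEntropy (ν {x}))) :=
    tendsto_finsetSum _ fun x _ => tendsto_atomEntropy (measure_ne_top _ _) (hmass x)
  have hinj : ∀ᶠ a : ℝ in atTop, Set.InjOn (cellOf a) (F : Set (ι → ℝ)) := by
    have h1 : ∀ᶠ a : ℝ in atTop, ∀ x ∈ F, ∀ y ∈ F, x ≠ y → 1 / a < dist x y := by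
      rw [Filter.eventually_all_finset]
      intro x _
      rw [Filter.eventually_all_finset]
      intro y _
      rcases eq_or_ne x y with h | h
      · exact Eventually.of_forall fun a h' => absurd h h'
      · exact (hinv.eventually_lt_const (dist_pos.2 h)).mono fun a ha _ => ha
    filter_upwards [h1, eventually_gt_atTop 0] with a h2 ha x hx y hy hxy
    by_contra hne
    exact absurd (dist_le_of_cellOf_eq ha hxy) (not_le.2 (h2 x hx y hy hne))
  filter_upwards [hsum.eventually_const_lt hF, hinj] with a h1 h2
  refine h1.trans_le ?_
  rw [shannon_eq_tsum]
  calc ∑ x ∈ F, atomEntropy (ν (cellOf a ⁻¹' {cellOf a x}))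
      = ∑ z ∈ F.image (cellOf a), atomEntropy (ν.map (cellOf a) {z}) := by
        rw [Finset.sum_image h2]
        exact Finset.sum_congr rfl fun x _ => by
          rw [Measure.map_apply (measurable_cellOf a) (measurableSet_singleton _)]
    _ ≤ _ := ENNReal.sum_le_tsum _

/-- A random variable that is almost surely a function of a discrete one is discrete. -/
theorem exists_countable_of_ae {Ω S T : Type*} [MeasurableSpace Ω] {μ : Measure Ω}
    [MeasurableSpace S] [MeasurableSpace T] [MeasurableSingletonClass T] {f : Ω → S} {g : Ω → T}
    (hf : Measurable f) (hg : Measurable g) {A : Set S} (hA : A.Countable) (hfA : μ.map f Aᶜ = 0)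
    (h : S → T) (hgf : ∀ᵐ ω ∂μ, g ω = h (f ω)) : μ.map g (h '' A)ᶜ = 0 := by
  rw [Measure.map_apply hg (hA.image h).measurableSet.compl]
  have h0 : ∀ᵐ x ∂(μ.map f), x ∈ A := hfA
  filter_upwards [hgf, ae_of_ae_map hf.aemeasurable h0] with ω h1 h2
  have h3 : g ω ∈ h '' A := by rw [h1]; exact Set.mem_image_of_mem h h2
  exact h3

/-- A countable set of labels can be encoded injectively by a measurable function. -/
theorem exists_measurable_injOn {Y : Type*} [MeasurableSpace Y] [MeasurableSingletonClass Y]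
    {A : Set Y} (hA : A.Countable) : ∃ c : Y → ℕ, Measurable c ∧ Set.InjOn c A := by
  classical
  obtain ⟨f, hf⟩ := Set.countable_iff_exists_injOn.1 hA
  refine ⟨fun x => if x ∈ A then f x + 1 else 0, measurable_to_countable' fun n => ?_, ?_⟩
  · rcases n with _ | n
    · have : (fun x => if x ∈ A then f x + 1 else 0) ⁻¹' {0} = Aᶜ := by
        ext x
        by_cases h : x ∈ A <;> simp [h]
      rw [this]
      exact hA.measurableSet.compl
    · refine (hA.mono fun x hx => ?_).measurableSet
      by_contra h
      simp [h] at hx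
  · intro x hx y hy hxy
    simp only [if_pos hx, if_pos hy] at hxy
    exact hf hx hy (Nat.succ_injective hxy)

end DiscreteLimit

section DiscreteProcess

variable {k : ℕ} {d : Matrix (Fin k) (Fin k) ℕ} {r : Fin k} {o : Fin k → TreeVertex d r}
  {lam : ℝ} {q : Fin k → ℝ} {μ : Measure (TreeVertex d r → ℝ)} [IsProbabilityMeasure μ]
  (b : EigenBases d r lam)

/-- The coordinates on an edge of a star, from the coordinates on the star. -/
noncomputable def edgeOfStar (u v : TreeVertex d r) (hv : v ∈ nbrs u)
    (z : Fin (Module.finrank ℝ (eigenSpace lam (star u))) → ℝ) :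
    Fin (Module.finrank ℝ (eigenSpace lam (edge u v))) → ℝ :=
  coordsOf b (edge u v) fun w => ofCoords b (star u) z ⟨w.1, by
    rcases mem_edge.1 w.2 with h | h
    · rw [h]; exact self_mem_star u
    · rw [h]; exact mem_star_of_mem_nbrs hv⟩

theorem eigenCoords_edge_eq {u v : TreeVertex d r} (hv : v ∈ nbrs u) {X : TreeVertex d r → ℝ}
    (h : restrictTo (star u) X ∈ eigenSpace lam (star u)) :
    eigenCoords b (edge u v) X = edgeOfStar b u v hv (eigenCoords b (star u) X) := by
  unfold edgeOfStar
  rw [ofCoords_eigenCoords b h]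
  rfl

/-- An injective encoding of the labels has the same entropy as the coordinates. -/
theorem shannon_partitionMarginal_eq {Γ : Finset (TreeVertex d r)}
    (hΓ : ∀ᵐ X ∂μ, restrictTo Γ X ∈ eigenSpace lam Γ)
    {A : Set (Fin (Module.finrank ℝ (eigenSpace lam Γ)) → ℝ)} (hA : A.Countable)
    (hμA : μ.map (eigenCoords b Γ) Aᶜ = 0) {A' : Set ℝ} {c : ℝ → ℕ} (hc : Measurable c)
    (hcA : Set.InjOn c A') (hX : ∀ u ∈ Γ, ∀ᵐ X ∂μ, X u ∈ A') :
    shannon (partitionMarginal c μ Γ) = shannon (μ.map (eigenCoords b Γ)) := by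
  have h1 := measurable_partition hc Γ
  have h2 := measurable_eigenCoords b Γ
  refine le_antisymm ?_ ?_
  · refine shannon_map_le_of_ae h2 h1 hA hμA (fun z u => c (ofCoords b Γ z u)) ?_
    filter_upwards [hΓ] with X hX
    rw [ofCoords_eigenCoords b hX]
    rfl
  · refine shannon_map_le_of_ae h1 h2 Set.countable_univ (by simp)
      (fun y => coordsOf b Γ fun u => Function.invFunOn c A' (y u)) ?_
    have hX' : ∀ᵐ X ∂μ, ∀ u : Γ, X u ∈ A' := ae_all_iff.2 fun u => hX u u.2
    filter_upwards [hX'] with X hX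
    have h3 : (fun u : Γ => Function.invFunOn c A' (c (X u))) = fun u : Γ => X u :=
      funext fun u => hcA.leftInvOn_invFunOn (hX u)
    rw [h3]
    rfl

/-- The limit of the entropy defect, for discrete eigenvector processes: it is the entropy defect of
the coordinates, which is also that of an injective encoding of the labels. -/
theorem IsTypical.exists_tendsto_of_discrete (hμ : IsTypical μ) (hd : IsExpandingDegreeMatrix d)
    (hq : IsRootLaw d q) (ho : ∀ i, (o i).type = i) (heig : IsEigenvectorLaw lam μ)
    (hdisc : ∀ i, IsDiscreteWithFiniteEntropy (μ.map (eigenCoords b (star (o i))))) :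
    ∃ L : ℝ, 0 ≤ L ∧ Tendsto (fun a : ℝ => entropyDefect q o
      (fun Γ => shannon (scaleMarginal b a μ Γ))) atTop (𝓝 L) := by
  have hcoord := measurable_eigenCoords b
  have hprob : ∀ Γ, IsProbabilityMeasure (μ.map (eigenCoords b Γ)) := fun Γ =>
    Measure.isProbabilityMeasure_map (hcoord Γ).aemeasurable
  have hstar := fun i => ae_restrictTo_mem_eigenSpace_star hd ho heig (o i)
  choose A hA hμA using fun i => (hdisc i).1
  have hfin := fun i => (hdisc i).2
  have hedge : ∀ i, ∀ v (hv : v ∈ nbrs (o i)), ∀ᵐ X ∂μ, eigenCoords b (edge (o i) v) X =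
      edgeOfStar b (o i) v hv (eigenCoords b (star (o i)) X) := fun i v hv =>
    (hstar i).mono fun X hX => eigenCoords_edge_eq b hv hX
  have hedgeA : ∀ i, ∀ v ∈ nbrs (o i), ∃ A' : Set (Fin (Module.finrank ℝ
      (eigenSpace lam (edge (o i) v))) → ℝ), A'.Countable ∧
      μ.map (eigenCoords b (edge (o i) v)) A'ᶜ = 0 := fun i v hv =>
    ⟨_, (hA i).image _, exists_countable_of_ae (hcoord _) (hcoord _) (hA i) (hμA i) _
      (hedge i v hv)⟩
  have hedgefin : ∀ i, ∀ v ∈ nbrs (o i), shannon (μ.map (eigenCoords b (edge (o i) v))) ≠ ⊤ :=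
    fun i v hv => ne_top_of_le_ne_top (hfin i) (shannon_map_le_of_ae (hcoord _) (hcoord _) (hA i)
      (hμA i) _ (hedge i v hv))
  refine ⟨entropyDefect q o fun Γ => shannon (μ.map (eigenCoords b Γ)), ?_, ?_⟩
  · -- the labels take countably many values, so that the discrete inequality applies
    let A' : Set ℝ := ⋃ i, ⋃ u : star (o i), (fun z => ofCoords b (star (o i)) z u) '' A i
    have hA' : A'.Countable := Set.countable_iUnion fun i => Set.countable_iUnion fun u =>
      (hA i).image _
    have hX : ∀ i, ∀ u ∈ star (o i), ∀ᵐ X ∂μ, X u ∈ A' := by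
      intro i u hu
      have h0 : ∀ᵐ z ∂(μ.map (eigenCoords b (star (o i)))), z ∈ A i := hμA i
      filter_upwards [hstar i, ae_of_ae_map (hcoord _).aemeasurable h0] with X h1 h2
      refine Set.mem_iUnion.2 ⟨i, Set.mem_iUnion.2 ⟨⟨u, hu⟩, _, h2, ?_⟩⟩
      simp only [ofCoords_eigenCoords b h1]
      rfl
    obtain ⟨c, hc, hcA⟩ := exists_measurable_injOn hA'
    have e1 : ∀ i, shannon (partitionMarginal c μ (star (o i))) =
        shannon (μ.map (eigenCoords b (star (o i)))) := fun i =>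
      shannon_partitionMarginal_eq b (hstar i) (hA i) (hμA i) hc hcA (hX i)
    have e2 : ∀ i, ∀ v ∈ nbrs (o i), shannon (partitionMarginal c μ (edge (o i) v)) =
        shannon (μ.map (eigenCoords b (edge (o i) v))) := by
      intro i v hv
      obtain ⟨A'', h1, h2⟩ := hedgeA i v hv
      refine shannon_partitionMarginal_eq b (Eventually.of_forall fun X => ?_) h1 h2 hc hcA ?_
      · rw [eigenSpace_edge hd ho hv]
        exact Submodule.mem_top
      · intro u hu
        rcases mem_edge.1 hu with rfl | rfl
        · exact hX i _ (self_mem_star _)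
        · exact hX i _ (mem_star_of_mem_nbrs hv)
    have h := hμ.entropyDefect_partition_nonneg hd hq ho hc fun i u hu => by
      refine ne_top_of_le_ne_top (hfin i) (shannon_map_le_of_ae (hcoord (star (o i)))
        (hc.comp (measurable_pi_apply u)) (hA i) (hμA i)
        (fun z => c (ofCoords b (star (o i)) z ⟨u, hu⟩)) ?_)
      filter_upwards [hstar i] with X hX
      rw [ofCoords_eigenCoords b hX]
      rfl
    refine h.trans_eq ?_
    unfold entropyDefect
    refine Finset.sum_congr rfl fun i _ => ?_
    dsimp only
    rw [e1]
    congr 3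
    exact Finset.sum_congr rfl fun v hv => by rw [e2 i v hv]
  · have hlim : ∀ Γ, shannon (μ.map (eigenCoords b Γ)) ≠ ⊤ →
        (∃ A : Set (Fin (Module.finrank ℝ (eigenSpace lam Γ)) → ℝ), A.Countable ∧
          μ.map (eigenCoords b Γ) Aᶜ = 0) →
        Tendsto (fun a : ℝ => (shannon (scaleMarginal b a μ Γ)).toReal) atTop
          (𝓝 (shannon (μ.map (eigenCoords b Γ))).toReal) := by
      rintro Γ h1 ⟨A, h2, h3⟩
      refine ((ENNReal.tendsto_toReal h1).comp (tendsto_shannon_cellOf h2 h3)).congr' ?_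
      filter_upwards [eventually_gt_atTop 0] with a ha
      simp only [Function.comp]
      rw [shannon_scaleMarginal b ha]
    unfold entropyDefect
    refine tendsto_finsetSum _ fun i _ => Tendsto.const_mul _ (Tendsto.sub
      (hlim _ (hfin i) ⟨A i, hA i, hμA i⟩) (Tendsto.const_mul _ (tendsto_finsetSum _ fun v hv =>
      hlim _ (hedgefin i v hv) (hedgeA i v hv))))

end DiscreteProcess

/-! ### Relative entropy with respect to Lebesgue measure -/

section RelativeEntropy

variable {E F : Type*} [MeasurableSpace E] [MeasurableSpace F]

/-- `ν` has finite entropy relative to the measure `m`, which can be infinite (Lebesgue measure), so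
that the relative entropy can have either sign. -/
def HasFiniteEntropy (m ν : Measure E) : Prop := ν ≪ m ∧ Integrable (llr ν m) ν

/-- The differential entropy `-∫ log (dν/dm) dν`. -/
noncomputable def differentialEntropy (m ν : Measure E) : ℝ := -∫ x, llr ν m x ∂ν

theorem hasFiniteEntropy_of_negMulLog {n : ℕ} {ν : Measure (Fin n → ℝ)} [IsProbabilityMeasure ν]
    (h : HasFiniteDifferentialEntropy ν) : HasFiniteEntropy volume ν := by
  refine ⟨h.1, (integrable_rnDeriv_mul_log_iff h.1).1 ?_⟩
  refine h.2.neg.congr (Eventually.of_forall fun x => ?_)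
  simp only [Pi.neg_apply, Real.negMulLog]
  ring

/-- Tilting the reference measure changes the entropy by the mean of an integrable function. -/
theorem hasFiniteEntropy_tilted_iff {m ν : Measure E} [SigmaFinite m] [IsProbabilityMeasure ν]
    {w : E → ℝ} (hw : Integrable (fun x => Real.exp (w x)) m) (hwν : Integrable w ν) :
    HasFiniteEntropy (m.tilted w) ν ↔ HasFiniteEntropy m ν := by
  have hac : ν ≪ m.tilted w ↔ ν ≪ m :=
    ⟨fun h => h.trans (tilted_absolutelyContinuous m w),
      fun h => h.trans (absolutelyContinuous_tilted hw)⟩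
  refine ⟨fun h => ⟨hac.1 h.1, ?_⟩, fun h => ⟨hac.2 h.1, ?_⟩⟩
  · have h1 := llr_tilted_right (hac.1 h.1) hw
    have h2 : llr ν m =ᵐ[ν] fun x => llr ν (m.tilted w) x +
        (w x - Real.log (∫ z, Real.exp (w z) ∂m)) := by
      filter_upwards [h1] with x hx
      rw [hx]
      ring
    exact (integrable_congr h2).2 (h.2.add (hwν.sub (integrable_const _)))
  · exact integrable_llr_tilted_right h.1 hwν h.2 hw

theorem HasFiniteEntropy.smul {m ν : Measure E} [SigmaFinite m] [IsProbabilityMeasure ν]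
    (h : HasFiniteEntropy m ν) {c : ℝ≥0∞} (hc : c ≠ 0) (hc' : c ≠ ⊤) :
    HasFiniteEntropy (c • m) ν :=
  ⟨h.1.smul_right hc, (integrable_congr (llr_smul_right h.1 c hc hc')).2
    (h.2.sub (integrable_const _))⟩

theorem HasFiniteEntropy.map_equiv {m ν : Measure E} [SigmaFinite m] [IsProbabilityMeasure ν]
    (h : HasFiniteEntropy m ν) (e : E ≃ᵐ F) : HasFiniteEntropy (m.map e) (ν.map e) := by
  refine ⟨h.1.map e.measurable, ?_⟩
  rw [integrable_map_equiv e]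
  have h1 := h.1.ae_le (e.measurableEmbedding.rnDeriv_map ν m)
  refine (integrable_congr ?_).2 h.2
  filter_upwards [h1] with x hx
  simp only [Function.comp, llr]
  rw [hx]

/-- Relative entropy with respect to a finite measure does not increase under maps, by the data
processing inequality. -/
theorem HasFiniteEntropy.map {m ν : Measure E} [IsFiniteMeasure m] [IsProbabilityMeasure ν]
    (h : HasFiniteEntropy m ν) {g : E → F} (hg : Measurable g) :
    HasFiniteEntropy (m.map g) (ν.map g) :=
  InformationTheory.klDiv_ne_top_iff.1 (ne_top_of_le_ne_top (InformationTheory.klDiv_ne_top h.1 h.2)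
    (InformationTheory.klDiv_map_le _ _ hg))

theorem tilted_prod_tilted {m : Measure E} {n : Measure F} [SigmaFinite m] [SigmaFinite n]
    {v : E → ℝ} {w : F → ℝ} (hv : Measurable v) (hw : Measurable w) :
    (m.tilted v).prod (n.tilted w) = (m.prod n).tilted fun z => v z.1 + w z.2 := by
  rw [Measure.tilted, Measure.tilted, Measure.tilted, prod_withDensity (by fun_prop) (by fun_prop)]
  congr 1
  funext z
  rw [← ENNReal.ofReal_mul (by positivity)]
  have h : ∫ z : E × F, Real.exp (v z.1 + w z.2) ∂(m.prod n) =
      (∫ x, Real.exp (v x) ∂m) * ∫ y, Real.exp (w y) ∂n := by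
    simp_rw [Real.exp_add]
    exact integral_prod_mul (fun x => Real.exp (v x)) fun y => Real.exp (w y)
  rw [h, Real.exp_add, div_mul_div_comm]

end RelativeEntropy

section NormedSpace

variable {E F G : Type*} [NormedAddCommGroup E] [NormedSpace ℝ E] [FiniteDimensional ℝ E]
  [MeasurableSpace E] [BorelSpace E] [NormedAddCommGroup F] [NormedSpace ℝ F]
  [FiniteDimensional ℝ F] [MeasurableSpace F] [BorelSpace F]

/-- The logarithm of an unnormalized probability density with polynomial decay. -/
noncomputable def decayWeight (E : Type*) [NormedAddCommGroup E] [NormedSpace ℝ E] (x : E) : ℝ :=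
  -((Module.finrank ℝ E + 1 : ℝ) * Real.log (1 + ‖x‖))

theorem integrable_exp_decayWeight (m : Measure E) [m.IsAddHaarMeasure] :
    Integrable (fun x => Real.exp (decayWeight E x)) m := by
  have h := integrable_one_add_norm (μ := m) (r := (Module.finrank ℝ E + 1 : ℝ)) (by linarith)
  convert h using 2 with x
  rw [Real.rpow_def_of_pos (by positivity), decayWeight]
  congr 1
  ring

theorem abs_log_one_add_sub_le {s t : ℝ} (hs : 0 ≤ s) (ht : 0 ≤ t) :
    |Real.log (1 + s) - Real.log (1 + t)| ≤ |s - t| := by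
  have key : ∀ {s t : ℝ}, 0 ≤ s → 0 ≤ t → Real.log (1 + s) - Real.log (1 + t) ≤ |s - t| := by
    intro s t hs ht
    rw [← Real.log_div (by positivity) (by positivity)]
    refine (Real.log_le_sub_one_of_pos (by positivity)).trans ?_
    rw [div_sub_one (by positivity), div_le_iff₀ (by positivity)]
    have h1 := le_abs_self (s - t)
    have h2 := mul_nonneg (abs_nonneg (s - t)) ht
    nlinarith
  rw [abs_le]
  refine ⟨?_, key hs ht⟩
  have := key ht hs
  rw [abs_sub_comm] at this
  linarith

theorem abs_decayWeight_sub_le (x y : E) :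
    |decayWeight E x - decayWeight E y| ≤ (Module.finrank ℝ E + 1 : ℝ) * ‖x - y‖ := by
  have h : decayWeight E x - decayWeight E y =
      -((Module.finrank ℝ E + 1 : ℝ) * (Real.log (1 + ‖x‖) - Real.log (1 + ‖y‖))) := by
    unfold decayWeight
    ring
  rw [h, abs_neg, abs_mul, abs_of_nonneg (by positivity : (0:ℝ) ≤ Module.finrank ℝ E + 1)]
  gcongr
  exact (abs_log_one_add_sub_le (norm_nonneg _) (norm_nonneg _)).trans (abs_norm_sub_norm_le x y)

theorem continuous_decayWeight : Continuous (decayWeight E) := by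
  unfold decayWeight
  refine (Continuous.log (by fun_prop) fun x => by positivity).const_mul _ |>.neg

theorem integrable_decayWeight {ν : Measure E} [IsFiniteMeasure ν]
    (h : Integrable (fun x => ‖x‖) ν) : Integrable (decayWeight E) ν := by
  refine (h.const_mul (Module.finrank ℝ E + 1 : ℝ)).mono'
    continuous_decayWeight.measurable.aestronglyMeasurable (Eventually.of_forall fun x => ?_)
  have := abs_decayWeight_sub_le x 0
  rw [sub_zero] at this
  have h0 : decayWeight E 0 = 0 := by simp [decayWeight]
  rwa [h0, sub_zero] at this

/-- The image under a linear surjection of a law with finite differential entropy has finite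
differential entropy: after completing the surjection to an isomorphism onto a product, the
reference measures become product probability measures, so that relative entropies decrease. -/
theorem HasFiniteEntropy.map_linear {m : Measure E} [m.IsAddHaarMeasure] {n : Measure F}
    [n.IsAddHaarMeasure] {ν : Measure E} [IsProbabilityMeasure ν]
    (h : HasFiniteEntropy m ν) (hint : Integrable (fun x => ‖x‖) ν) {M : E →ₗ[ℝ] F}
    (hM : Function.Surjective M) : HasFiniteEntropy n (ν.map M) := by
  obtain ⟨p, hp⟩ := (LinearMap.ker M).exists_isCompl
  let g := (LinearMap.ker M).projectionOnto p hp
  let S : E ≃ₗ[ℝ] F × LinearMap.ker M := LinearMap.equivProdOfSurjectiveOfIsCompl M g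
    (LinearMap.range_eq_top.2 hM) (by simp [g])
    (by simpa [g] using hp)
  let S' : E ≃L[ℝ] F × LinearMap.ker M := S.toContinuousLinearEquiv
  let e : E ≃ᵐ F × LinearMap.ker M := S'.toHomeomorph.toMeasurableEquiv
  let G := LinearMap.ker M
  let mG : Measure G := Measure.addHaar
  have hMc : Continuous M := M.continuous_of_finiteDimensional
  have : (m.map e).IsAddHaarMeasure := S'.isAddHaarMeasure_map m
  have hν : IsProbabilityMeasure (ν.map e) := Measure.isProbabilityMeasure_map e.measurable.aemeasurable
  have h1 : HasFiniteEntropy (n.prod mG) (ν.map e) := by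
    have h2 := h.map_equiv e
    obtain ⟨c, hc, hc', h3⟩ : ∃ c : ℝ≥0∞, c ≠ 0 ∧ c ≠ ⊤ ∧ n.prod mG = c • m.map e := by
      have h4 := Measure.isAddLeftInvariant_eq_smul (n.prod mG) (m.map e)
      refine ⟨_, ?_, ENNReal.coe_ne_top, h4⟩
      have := Measure.addHaarScalarFactor_pos_of_isAddHaarMeasure (n.prod mG) (m.map e)
      exact_mod_cast this.ne'
    rw [h3]
    exact h2.smul hc hc'
  have hi : Integrable (fun z : F × G => decayWeight F z.1 + decayWeight G z.2) (ν.map e) := by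
    have hb : ∀ x, ‖e x‖ ≤ ‖(S' : E →L[ℝ] F × LinearMap.ker M)‖ * ‖x‖ := fun x =>
      (S' : E →L[ℝ] F × LinearMap.ker M).le_opNorm x
    have hn : Integrable (fun z : F × G => ‖z‖) (ν.map e) := by
      rw [integrable_map_equiv e]
      refine (hint.const_mul ‖(S' : E →L[ℝ] F × LinearMap.ker M)‖).mono' (e.measurable.norm.aestronglyMeasurable)
        (Eventually.of_forall fun x => ?_)
      simpa using hb x
    refine Integrable.add ?_ ?_
    · have := Measure.isProbabilityMeasure_map (μ := ν.map e) measurable_fst.aemeasurable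
      have h5 : Integrable (decayWeight F) ((ν.map e).map Prod.fst) :=
        integrable_decayWeight ((integrable_map_measure (by fun_prop) (by fun_prop)).2
          (hn.mono' (by fun_prop) (Eventually.of_forall fun z => by simpa using norm_fst_le z)))
      exact h5.comp_measurable measurable_fst
    · have := Measure.isProbabilityMeasure_map (μ := ν.map e) measurable_snd.aemeasurable
      have h5 : Integrable (decayWeight G) ((ν.map e).map Prod.snd) :=
        integrable_decayWeight ((integrable_map_measure (by fun_prop) (by fun_prop)).2
          (hn.mono' (by fun_prop) (Eventually.of_forall fun z => by simpa using norm_snd_le z)))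
      exact h5.comp_measurable measurable_snd
  have hexp : Integrable (fun z : F × G => Real.exp (decayWeight F z.1 + decayWeight G z.2))
      (n.prod mG) := by
    simp_rw [Real.exp_add]
    exact (integrable_exp_decayWeight n).mul_prod (integrable_exp_decayWeight mG)
  have h6 := (hasFiniteEntropy_tilted_iff hexp hi).2 h1
  rw [← tilted_prod_tilted continuous_decayWeight.measurable
    continuous_decayWeight.measurable] at h6
  have := isProbabilityMeasure_tilted (integrable_exp_decayWeight n)
  have := isProbabilityMeasure_tilted (integrable_exp_decayWeight mG)
  have h7 := h6.map measurable_fst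
  rw [Measure.map_fst_prod, measure_univ, one_smul, Measure.map_map measurable_fst e.measurable]
    at h7
  have h8 : (Prod.fst ∘ e : E → F) = M := rfl
  rw [h8] at h7
  have := Measure.isProbabilityMeasure_map (μ := ν) hMc.measurable.aemeasurable
  refine (hasFiniteEntropy_tilted_iff (integrable_exp_decayWeight n) (integrable_decayWeight ?_)).1 h7
  refine (integrable_map_measure (by fun_prop) hMc.measurable.aemeasurable).2 ?_
  refine (hint.const_mul ‖LinearMap.toContinuousLinearMap M‖).mono'
    (hMc.norm.measurable.aestronglyMeasurable) (Eventually.of_forall fun x => ?_)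
  simpa using (LinearMap.toContinuousLinearMap M).le_opNorm x

end NormedSpace

/-! ### Gibbs' inequality and the entropy of discretizations -/

section Gibbs

variable {Ω J : Type*} [MeasurableSpace Ω] [MeasurableSpace J]

/-- Gibbs' inequality for densities with respect to a σ-finite measure. -/
theorem integral_log_le_of_density {ρ : Measure Ω} {F : Ω → ℝ≥0∞} (hF : Measurable F)
    [IsProbabilityMeasure (ρ.withDensity F)] {q : Ω → ℝ} (hq : Measurable q)
    (hq0 : ∀ x, 0 ≤ q x) (hq1 : (∫⁻ x, ENNReal.ofReal (q x) ∂ρ) ≤ 1)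
    (hpos : ∀ᵐ x ∂(ρ.withDensity F), 0 < q x)
    (hlogq : Integrable (fun x => Real.log (q x)) (ρ.withDensity F))
    (hlogF : Integrable (fun x => Real.log (F x).toReal) (ρ.withDensity F)) :
    ∫ x, Real.log (q x) ∂(ρ.withDensity F) ≤
      ∫ x, Real.log (F x).toReal ∂(ρ.withDensity F) := by
  set P := ρ.withDensity F with hP
  have hF0 : ∀ᵐ x ∂P, F x ≠ 0 := by
    rw [hP, ae_withDensity_iff hF]
    exact Eventually.of_forall fun x hx => hx
  have hFt : ∀ᵐ x ∂P, F x < ⊤ := by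
    refine (withDensity_absolutelyContinuous ρ F).ae_le (ae_lt_top hF ?_)
    have : P Set.univ = 1 := measure_univ
    rw [hP, withDensity_apply _ MeasurableSet.univ, setLIntegral_univ] at this
    rw [this]
    exact ENNReal.one_ne_top
  have hle : ∫⁻ x, ENNReal.ofReal (q x / (F x).toReal) ∂P ≤ 1 := by
    rw [hP, lintegral_withDensity_eq_lintegral_mul _ hF (by fun_prop)]
    refine (lintegral_mono fun x => ?_).trans hq1
    simp only [Pi.mul_apply]
    rcases eq_or_ne (F x) ⊤ with h | h
    · simp [h]
    rcases eq_or_ne (F x) 0 with h0 | h0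
    · simp [h0]
    have h1 := ENNReal.toReal_pos h0 h
    nth_rewrite 1 [← ENNReal.ofReal_toReal h]
    rw [← ENNReal.ofReal_mul h1.le, mul_div_cancel₀ _ h1.ne']
  have hnn : ∀ x, 0 ≤ q x / (F x).toReal := fun x => div_nonneg (hq0 x) ENNReal.toReal_nonneg
  have hint : Integrable (fun x => q x / (F x).toReal) P := by
    refine ⟨(hq.div hF.ennreal_toReal).aestronglyMeasurable, ?_⟩
    rw [hasFiniteIntegral_iff_ofReal (Eventually.of_forall hnn)]
    exact hle.trans_lt ENNReal.one_lt_top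
  have h1 : ∫ x, q x / (F x).toReal ∂P ≤ 1 := by
    rw [integral_eq_lintegral_of_nonneg_ae (Eventually.of_forall hnn) hint.1]
    exact ENNReal.toReal_le_of_le_ofReal zero_le_one (by simpa using hle)
  have h2 : ∫ x, (Real.log (q x) - Real.log (F x).toReal) ∂P ≤
      ∫ x, (q x / (F x).toReal - 1) ∂P := by
    refine integral_mono_ae (hlogq.sub hlogF) (hint.sub (integrable_const _)) ?_
    filter_upwards [hpos, hF0, hFt] with x h3 h4 h5
    have h6 := ENNReal.toReal_pos h4 h5.ne
    rw [← Real.log_div h3.ne' h6.ne']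
    exact Real.log_le_sub_one_of_pos (div_pos h3 h6)
  rw [integral_sub hlogq hlogF, integral_sub hint (integrable_const _)] at h2
  simp at h2
  linarith

/-- The cells of a partition into sets of measure at most `v` have entropy at least
`-log v` plus the differential entropy. -/
theorem le_shannon_map_of_density [Countable J] [MeasurableSingletonClass J] {ρ : Measure Ω}
    {F : Ω → ℝ≥0∞} (hF : Measurable F) [IsProbabilityMeasure (ρ.withDensity F)]
    (hlogF : Integrable (fun x => Real.log (F x).toReal) (ρ.withDensity F)) {c : Ω → J}
    (hc : Measurable c) {v : ℝ} (hv : 0 < v) (hcell : ∀ j, ρ (c ⁻¹' {j}) ≤ ENNReal.ofReal v) :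
    ENNReal.ofReal (-Real.log v - ∫ x, Real.log (F x).toReal ∂(ρ.withDensity F)) ≤
      shannon ((ρ.withDensity F).map c) := by
  rcases eq_or_ne (shannon ((ρ.withDensity F).map c)) ⊤ with htop | htop
  · rw [htop]; exact le_top
  set P := ρ.withDensity F with hP
  have : IsProbabilityMeasure (P.map c) := Measure.isProbabilityMeasure_map hc.aemeasurable
  set p : J → ℝ≥0∞ := fun j => P.map c {j} with hp
  have hp1 : ∀ j, p j ≤ 1 := fun j => prob_le_one
  have hpt : ∀ j, p j ≠ ⊤ := fun j => measure_ne_top _ _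
  have hpsum : ∑' j, p j = 1 :=
    tsum_measure_singleton_eq_one (ν := P.map c) Set.countable_univ (by simp)
  have hm : ∀ g : J → ℝ, Measurable g := fun g => measurable_of_countable g
  have hpp : ∀ᵐ x ∂P, p (c x) ≠ 0 := by
    refine ae_of_ae_map (p := fun j => p j ≠ 0) hc.aemeasurable ?_
    rw [ae_iff_of_countable]
    exact fun j hj => hj
  have hS : ∫⁻ x, ENNReal.ofReal (-Real.log (p (c x)).toReal) ∂P = shannon (P.map c) := by
    rw [shannon_eq_tsum_mul, ← lintegral_map (f := fun j => ENNReal.ofReal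
      (-Real.log (p j).toReal)) (measurable_of_countable _) hc, lintegral_countable']
    exact tsum_congr fun j => mul_comm _ _
  have hnn : ∀ x, 0 ≤ -Real.log (p (c x)).toReal := fun x => neg_nonneg.2
    (Real.log_nonpos ENNReal.toReal_nonneg (ENNReal.toReal_le_of_le_ofReal zero_le_one
      (by simpa using hp1 (c x))))
  have hint : Integrable (fun x => -Real.log (p (c x)).toReal) P := by
    refine ⟨((hm fun j => -Real.log (p j).toReal).comp hc).aestronglyMeasurable, ?_⟩
    rw [hasFiniteIntegral_iff_ofReal (Eventually.of_forall hnn), hS]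
    exact htop.lt_top
  have hI : ∫ x, -Real.log (p (c x)).toReal ∂P = (shannon (P.map c)).toReal := by
    rw [integral_eq_lintegral_of_nonneg_ae (Eventually.of_forall hnn) hint.1, hS]
  have hlog : (fun x => Real.log ((p (c x)).toReal / v)) =ᵐ[P]
      fun x => -(-Real.log (p (c x)).toReal) - Real.log v := by
    filter_upwards [hpp] with x hx
    rw [Real.log_div (ENNReal.toReal_pos hx (hpt _)).ne' hv.ne', neg_neg]
  have key := integral_log_le_of_density (ρ := ρ) hF (q := fun x => (p (c x)).toReal / v)
    ((hm fun j => (p j).toReal / v).comp hc)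
    (fun x => div_nonneg ENNReal.toReal_nonneg hv.le) ?_
    (hpp.mono fun x hx => div_pos (ENNReal.toReal_pos hx (hpt _)) hv)
    ((integrable_congr hlog).2 (hint.neg.sub (integrable_const _))) hlogF
  · have hint' : Integrable (fun x => - -Real.log (p (c x)).toReal) P := hint.neg
    rw [integral_congr_ae hlog, integral_sub hint' (integrable_const _), integral_neg, hI] at key
    simp only [integral_const, probReal_univ, smul_eq_mul, one_mul] at key
    refine ENNReal.ofReal_le_of_le_toReal ?_
    linarith
  · rw [← lintegral_map (f := fun j => ENNReal.ofReal ((p j).toReal / v))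
      (measurable_of_countable _) hc, lintegral_countable', ← hpsum]
    refine ENNReal.tsum_le_tsum fun j => ?_
    rw [Measure.map_apply hc (measurableSet_singleton j)]
    calc ENNReal.ofReal ((p j).toReal / v) * ρ (c ⁻¹' {j})
        ≤ ENNReal.ofReal ((p j).toReal / v) * ENNReal.ofReal v := by gcongr; exact hcell j
      _ = p j := by
        rw [← ENNReal.ofReal_mul (div_nonneg ENNReal.toReal_nonneg hv.le),
          div_mul_cancel₀ _ hv.ne', ENNReal.ofReal_toReal (hpt j)]

/-- The entropy of a discrete random variable is at most the mean length of a code. -/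
theorem shannon_map_le_of_code [Countable J] [MeasurableSingletonClass J] {P : Measure Ω}
    [IsProbabilityMeasure P] {c : Ω → J} (hc : Measurable c) {Q : J → ℝ≥0∞} (hQ : ∑' j, Q j ≤ 1)
    {L : Ω → ℝ} (hL : Integrable L P) (h0 : ∀ᵐ x ∂P, Q (c x) ≠ 0)
    (h : ∀ᵐ x ∂P, -Real.log (Q (c x)).toReal ≤ L x) :
    0 ≤ ∫ x, L x ∂P ∧ shannon (P.map c) ≤ ENNReal.ofReal (∫ x, L x ∂P) := by
  have : IsProbabilityMeasure (P.map c) := Measure.isProbabilityMeasure_map hc.aemeasurable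
  have hL0 : ∀ᵐ x ∂P, 0 ≤ L x := h.mono fun x hx =>
    (neg_nonneg.2 (Real.log_nonpos ENNReal.toReal_nonneg (ENNReal.toReal_le_of_le_ofReal zero_le_one
      (by simpa using (ENNReal.le_tsum (c x)).trans hQ)))).trans hx
  refine ⟨integral_nonneg_of_ae hL0, ?_⟩
  have hpsum : ∑' j, P.map c {j} = 1 :=
    tsum_measure_singleton_eq_one (ν := P.map c) Set.countable_univ (by simp)
  rw [shannon_eq_tsum]
  refine (tsum_atomEntropy_le_of_gibbs hpsum hQ fun j hj => ?_).trans ?_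
  · rw [Measure.map_apply hc (measurableSet_singleton j)]
    refine measure_mono_null (t := {x | ¬ Q (c x) ≠ 0}) ?_ h0
    rintro x rfl
    exact not_not.2 hj
  · rw [ofReal_integral_eq_lintegral_ofReal hL hL0]
    calc ∑' j, P.map c {j} * ENNReal.ofReal (-Real.log (Q j).toReal)
        = ∫⁻ x, ENNReal.ofReal (-Real.log (Q (c x)).toReal) ∂P := by
          rw [← lintegral_map (f := fun j => ENNReal.ofReal (-Real.log (Q j).toReal))
            (measurable_of_countable _) hc, lintegral_countable']
          exact tsum_congr fun j => mul_comm _ _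
      _ ≤ _ := lintegral_mono_ae (h.mono fun x hx => ENNReal.ofReal_le_ofReal hx)

end Gibbs

section Cells

variable {Ω κ : Type*} [MeasurableSpace Ω] [Fintype κ]

theorem volume_cellOf {a : ℝ} (ha : 0 < a) (j : κ → ℤ) :
    volume (cellOf a ⁻¹' {j} : Set (κ → ℝ)) = ENNReal.ofReal (a⁻¹ ^ Fintype.card κ) := by
  have h : (cellOf a ⁻¹' {j} : Set (κ → ℝ)) =
      Set.pi Set.univ fun i => Set.Ico ((j i : ℝ) / a) ((j i + 1 : ℝ) / a) := by
    ext y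
    simp only [Set.mem_preimage, Set.mem_singleton_iff, Set.mem_pi, Set.mem_univ, true_implies,
      Set.mem_Ico, funext_iff, cellOf, Int.floor_eq_iff]
    refine forall_congr' fun i => ?_
    rw [div_le_iff₀ ha, lt_div_iff₀ ha, mul_comm]
  rw [h, volume_pi_pi]
  simp only [Real.volume_Ico]
  have h2 : ∀ i, ((j i : ℝ) + 1) / a - j i / a = a⁻¹ := fun i => by
    rw [← sub_div, add_sub_cancel_left, one_div]
  simp only [h2, Finset.prod_const, Finset.card_univ]
  rw [ENNReal.ofReal_pow (by positivity)]

theorem log_inv_pow {a : ℝ} (n : ℕ) : Real.log (a⁻¹ ^ n) = -(n * Real.log a) := by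
  rw [Real.log_pow, Real.log_inv]
  ring

/-- The code that assigns to a cell the integral of a probability density `e^{-ℓ}`. -/
theorem shannon_cellOf_le {P : Measure Ω} [IsProbabilityMeasure P] {a : ℝ} (ha : 0 < a)
    {Z : Ω → κ → ℝ} (hZ : Measurable Z) {ℓ : (κ → ℝ) → ℝ}
    (h1 : (∫⁻ y, ENNReal.ofReal (Real.exp (-ℓ y))) ≤ 1) {L : Ω → ℝ} (hL : Integrable L P)
    (h : ∀ᵐ x ∂P, ∀ y, cellOf a y = cellOf a (Z x) → ℓ y ≤ L x) :
    0 ≤ Fintype.card κ * Real.log a + ∫ x, L x ∂P ∧ shannon (P.map fun x => cellOf a (Z x)) ≤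
      ENNReal.ofReal (Fintype.card κ * Real.log a + ∫ x, L x ∂P) := by
  classical
  let Q : (κ → ℤ) → ℝ≥0∞ := fun j => ∫⁻ y in cellOf a ⁻¹' {j}, ENNReal.ofReal (Real.exp (-ℓ y))
  have hmeas : ∀ j : κ → ℤ, MeasurableSet (cellOf a ⁻¹' {j} : Set (κ → ℝ)) := fun j =>
    measurable_cellOf a (measurableSet_singleton j)
  have hQ : ∑' j, Q j ≤ 1 := by
    refine (le_of_eq ?_).trans h1
    rw [← lintegral_iUnion hmeas fun i j hij => Disjoint.preimage _ (by simpa using hij),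
      show (⋃ j : κ → ℤ, (cellOf a ⁻¹' {j} : Set (κ → ℝ))) = Set.univ by ext y; simp,
      setLIntegral_univ]
  have hlow : ∀ᵐ x ∂P,
      ENNReal.ofReal (Real.exp (-L x) * a⁻¹ ^ Fintype.card κ) ≤ Q (cellOf a (Z x)) := by
    filter_upwards [h] with x h
    rw [ENNReal.ofReal_mul (Real.exp_pos _).le, ← volume_cellOf ha (cellOf a (Z x)),
      ← setLIntegral_const]
    refine setLIntegral_mono' (hmeas _) fun y hy => ?_
    exact ENNReal.ofReal_le_ofReal (Real.exp_le_exp.2 (neg_le_neg (h y hy)))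
  have hpos : ∀ x, 0 < Real.exp (-L x) * a⁻¹ ^ Fintype.card κ := fun x => by positivity
  have key := shannon_map_le_of_code (P := P) (c := fun x => cellOf a (Z x))
    ((measurable_cellOf a).comp hZ) hQ (L := fun x => Fintype.card κ * Real.log a + L x)
    ((integrable_const _).add hL) (hlow.mono fun x h2 h0 => ?_) (hlow.mono fun x h2 => ?_)
  · rw [integral_add (integrable_const _) hL] at key
    simpa using key
  · rw [h0, nonpos_iff_eq_zero, ENNReal.ofReal_eq_zero] at h2
    exact absurd (hpos x) (not_lt.2 h2)
  · have ht : Q (cellOf a (Z x)) ≠ ⊤ :=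
      ne_top_of_le_ne_top ENNReal.one_ne_top ((ENNReal.le_tsum _).trans hQ)
    have h3 := Real.log_le_log (hpos x) ((ENNReal.ofReal_le_iff_le_toReal ht).1 h2)
    rw [Real.log_mul (Real.exp_pos _).ne' (by positivity), Real.log_exp, log_inv_pow] at h3
    linarith

end Cells

/-! ### Differential entropy and discretization at small scales -/

section NoiseLowerBound

variable {E U J : Type*} [MeasurableSpace E] [MeasurableSpace U] [MeasurableSpace J]
  [Countable J] [MeasurableSingletonClass J]

/-- The entropy of a partition into cells of measure at most `v`, where the cells may depend on an
independent random parameter `u`. -/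
theorem HasFiniteEntropy.le_shannon_map_prod {m ν : Measure E} [SigmaFinite m]
    [IsProbabilityMeasure ν] (h : HasFiniteEntropy m ν) (γ : Measure U) [IsProbabilityMeasure γ]
    {c : E × U → J} (hc : Measurable c) {v : ℝ} (hv : 0 < v)
    (hcell : ∀ u j, m {z | c (z, u) = j} ≤ ENNReal.ofReal v) :
    ENNReal.ofReal (-Real.log v + differentialEntropy m ν) ≤ shannon ((ν.prod γ).map c) := by
  have hF : Measurable fun z : E × U => ν.rnDeriv m z.1 :=
    (Measure.measurable_rnDeriv ν m).comp measurable_fst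
  have hP : (m.prod γ).withDensity (fun z => ν.rnDeriv m z.1) = ν.prod γ := by
    have h1 := prod_withDensity_left (μ := m) (ν := γ) (Measure.measurable_rnDeriv ν m)
    rw [Measure.withDensity_rnDeriv_eq ν m h.1] at h1
    exact h1.symm
  have : IsProbabilityMeasure ((m.prod γ).withDensity fun z => ν.rnDeriv m z.1) := by
    rw [hP]; infer_instance
  have key := le_shannon_map_of_density (ρ := m.prod γ) hF
    (by rw [hP]; exact h.2.comp_fst γ) hc hv fun j => ?_
  · rw [hP] at key
    have h2 : ∫ z : E × U, Real.log (ν.rnDeriv m z.1).toReal ∂(ν.prod γ) = ∫ x, llr ν m x ∂ν := by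
      have := integral_fun_fst (μ := ν) (ν := γ) (llr ν m)
      simpa [llr] using this
    rw [h2] at key
    exact key
  · rw [Measure.prod_apply_symm (hc (measurableSet_singleton j))]
    calc ∫⁻ u, m ((fun z => (z, u)) ⁻¹' (c ⁻¹' {j})) ∂γ ≤ ∫⁻ _u, ENNReal.ofReal v ∂γ :=
          lintegral_mono fun u => hcell u j
      _ = _ := by simp

theorem HasFiniteEntropy.le_shannon_map {m ν : Measure E} [SigmaFinite m]
    [IsProbabilityMeasure ν] (h : HasFiniteEntropy m ν)
    {c : E → J} (hc : Measurable c) {v : ℝ} (hv : 0 < v)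
    (hcell : ∀ j, m (c ⁻¹' {j}) ≤ ENNReal.ofReal v) :
    ENNReal.ofReal (-Real.log v + differentialEntropy m ν) ≤ shannon (ν.map c) := by
  have h1 := h.le_shannon_map_prod (Measure.dirac ()) (hc.comp measurable_fst) hv
    fun _ j => hcell j
  rwa [← Measure.map_map hc measurable_fst, Measure.map_fst_prod, measure_univ, one_smul] at h1

end NoiseLowerBound

section NearlyLipschitz

variable {E : Type*} [NormedAddCommGroup E] [NormedSpace ℝ E] [FiniteDimensional ℝ E]
  [MeasurableSpace E] [BorelSpace E]

theorem abs_log_sub_log_le {δ s t : ℝ} (hδ : 0 < δ) (hs : δ ≤ s) (ht : δ ≤ t) :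
    |Real.log s - Real.log t| ≤ |s - t| / δ := by
  have key : ∀ {s t : ℝ}, δ ≤ s → δ ≤ t → Real.log s - Real.log t ≤ |s - t| / δ := by
    intro s t hs ht
    have hs0 := hδ.trans_le hs
    have ht0 := hδ.trans_le ht
    rw [← Real.log_div hs0.ne' ht0.ne']
    refine (Real.log_le_sub_one_of_pos (by positivity)).trans ?_
    rw [div_sub_one ht0.ne']
    calc (s - t) / t ≤ |s - t| / t := by gcongr; exact le_abs_self _
      _ ≤ |s - t| / δ := by gcongr
  rw [abs_le]
  refine ⟨?_, key hs ht⟩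
  have := key ht hs
  rw [abs_sub_comm] at this
  linarith

theorem abs_clamp_le {A t : ℝ} (hA : 0 ≤ A) : |max (-A) (min A t)| ≤ |t| := by
  rcases abs_cases t with ⟨h1, h2⟩ | ⟨h1, h2⟩ <;> rw [h1, abs_le] <;> constructor <;>
    simp only [le_max_iff, max_le_iff, min_le_iff, le_min_iff] <;> grind

theorem tendsto_integral_clamp {ν : Measure E} {f : E → ℝ} (hf : Integrable f ν)
    (hm : Measurable f) :
    Tendsto (fun A : ℕ => ∫ x, max (-(A : ℝ)) (min A (f x)) ∂ν) atTop (𝓝 (∫ x, f x ∂ν)) := by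
  refine tendsto_integral_of_dominated_convergence (fun x => |f x|)
    (fun A => by fun_prop) hf.abs (fun A => Eventually.of_forall fun x =>
      abs_clamp_le (Nat.cast_nonneg A)) (Eventually.of_forall fun x => ?_)
  refine tendsto_const_nhds.congr' ?_
  filter_upwards [eventually_ge_atTop ⌈|f x|⌉₊] with A hA
  have h1 : |f x| ≤ A := (Nat.le_ceil _).trans (by exact_mod_cast hA)
  rw [abs_le] at h1
  rw [min_eq_right h1.2, max_eq_right h1.1]

/-- A law with finite differential entropy has a code with nearly optimal mean length, in the
form of a probability density `e^{-ℓ}` whose logarithm is Lipschitz up to `ε`. -/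
theorem HasFiniteEntropy.exists_code {m ν : Measure E} [m.IsAddHaarMeasure]
    [IsProbabilityMeasure ν] (h : HasFiniteEntropy m ν) (hint : Integrable (fun x => ‖x‖) ν)
    {ε : ℝ} (hε : 0 < ε) : ∃ (ℓ : E → ℝ) (K : ℝ), 0 ≤ K ∧ Measurable ℓ ∧ Integrable ℓ ν ∧
      (∫⁻ x, ENNReal.ofReal (Real.exp (-ℓ x)) ∂m) ≤ 1 ∧
      (∀ x y, ℓ x ≤ ℓ y + ε + K * ‖x - y‖) ∧ ∫ x, ℓ x ∂ν ≤ differentialEntropy m ν + ε := by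
  have hexp := integrable_exp_decayWeight (E := E) m
  have hw := integrable_decayWeight hint
  set w := decayWeight E with hwdef
  have hwc : Continuous w := continuous_decayWeight
  set ρ := m.tilted w with hρ
  have : IsProbabilityMeasure ρ := isProbabilityMeasure_tilted hexp
  obtain ⟨hac, hllr⟩ := (hasFiniteEntropy_tilted_iff hexp hw).2 h
  have hllrint := integral_llr_tilted_right h.1 hw hexp h.2
  -- the level `δ = e^{-A}` at which the density is truncated
  obtain ⟨A, hA1, hA2⟩ : ∃ A : ℕ, ∫ x, llr ν ρ x ∂ν - ε / 4 <
      ∫ x, max (-(A : ℝ)) (min A (llr ν ρ x)) ∂ν ∧ Real.exp (-(A : ℝ)) < min 1 (ε / 8) := by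
    have h1 := (tendsto_integral_clamp hllr (measurable_llr ν ρ)).eventually_const_lt
      (sub_lt_self _ (by positivity : 0 < ε / 4))
    have h2 : Tendsto (fun A : ℕ => Real.exp (-(A : ℝ))) atTop (𝓝 0) :=
      Real.tendsto_exp_neg_atTop_nhds_zero.comp tendsto_natCast_atTop_atTop
    exact (h1.and (h2.eventually_lt_const (by positivity))).exists
  set δ := Real.exp (-(A : ℝ)) with hδdef
  have hδ : 0 < δ := Real.exp_pos _
  have hδ1 : δ < 1 := hA2.trans_le (min_le_left _ _)
  have hδε : δ < ε / 8 := hA2.trans_le (min_le_right _ _)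
  set g : E → ℝ := fun x => (ν.rnDeriv ρ x).toReal with hg
  have hgm : Measurable g := (Measure.measurable_rnDeriv ν ρ).ennreal_toReal
  have hgi : Integrable g ρ := Measure.integrable_toReal_rnDeriv
  have hg1 : ∫ x, g x ∂ρ = 1 := by
    rw [hg, Measure.integral_toReal_rnDeriv hac, probReal_univ]
  set f : E → ℝ := fun x => max δ (min (Real.exp A) (g x)) with hf
  have hfm : Measurable f := by fun_prop
  have hf0 : ∀ x, δ ≤ f x := fun x => le_max_left _ _
  have hfb : ∀ x, ‖f x‖ ≤ Real.exp A := fun x => by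
    rw [Real.norm_of_nonneg (hδ.le.trans (hf0 x))]
    refine max_le ?_ (min_le_left _ _)
    exact Real.exp_le_exp.2 (by have : (0:ℝ) ≤ A := Nat.cast_nonneg A; linarith)
  have hfint : ∀ (P : Measure E) [IsFiniteMeasure P], Integrable f P := fun P _ =>
    Integrable.of_bound hfm.aestronglyMeasurable _ (Eventually.of_forall hfb)
  have hlogf : (fun x => Real.log (f x)) =ᵐ[ν] fun x => max (-(A : ℝ)) (min A (llr ν ρ x)) := by
    filter_upwards [Measure.rnDeriv_pos hac, hac.ae_le (Measure.rnDeriv_lt_top ν ρ)] with x h1 h2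
    have h3 : 0 < g x := ENNReal.toReal_pos h1.ne' h2.ne
    have h4 : f x = Real.exp (max (-(A : ℝ)) (min A (llr ν ρ x))) := by
      rw [Real.exp_monotone.map_max, Real.exp_monotone.map_min, llr, Real.exp_log h3]
    rw [h4, Real.log_exp]
  have hfρ : ∫ x, f x ∂ρ ≤ 1 + δ := by
    calc ∫ x, f x ∂ρ ≤ ∫ x, (g x + δ) ∂ρ := by
          refine integral_mono (hfint ρ) (hgi.add (integrable_const _)) fun x => ?_
          have h0 : 0 ≤ g x := ENNReal.toReal_nonneg
          exact max_le (by linarith) ((min_le_right _ _).trans (by linarith))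
      _ = 1 + δ := by rw [integral_add hgi (integrable_const _), hg1]; simp
  set τ := δ * (ε / 4) with hτdef
  have hτ : 0 < τ := by positivity
  -- a continuous approximation of `f` in `L¹`, of compact support and hence uniformly continuous
  obtain ⟨ψ, hψs, hψ1, hψc, -⟩ := (hfint (ν + ρ)).exists_hasCompactSupport_integral_sub_le hτ
  obtain ⟨B, hB⟩ := hψs.exists_bound_of_continuous hψc
  have hψint : ∀ (P : Measure E) [IsFiniteMeasure P], Integrable ψ P := fun P _ =>
    Integrable.of_bound hψc.measurable.aestronglyMeasurable _ (Eventually.of_forall hB)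
  have hsub : ∀ (P : Measure E) [IsFiniteMeasure P], Integrable (fun x => ‖f x - ψ x‖) P :=
    fun P _ => ((hfint P).sub (hψint P)).norm
  rw [integral_add_measure (hsub ν) (hsub ρ)] at hψ1
  have hn1 : 0 ≤ ∫ x, ‖f x - ψ x‖ ∂ν := integral_nonneg fun x => norm_nonneg _
  have hn2 : 0 ≤ ∫ x, ‖f x - ψ x‖ ∂ρ := integral_nonneg fun x => norm_nonneg _
  set φ : E → ℝ := fun x => max δ (ψ x) with hφ
  have hφc : Continuous φ := by fun_prop
  have hφ0 : ∀ x, δ ≤ φ x := fun x => le_max_left _ _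
  have hφpos : ∀ x, 0 < φ x := fun x => hδ.trans_le (hφ0 x)
  have hφf : ∀ x, |f x - φ x| ≤ ‖f x - ψ x‖ := fun x => by
    have h1 : f x = max δ (f x) := (max_eq_right (hf0 x)).symm
    rw [Real.norm_eq_abs]
    calc |f x - φ x| = |max (f x) δ - max (ψ x) δ| := by
          rw [max_comm (f x), max_comm (ψ x), ← h1]
      _ ≤ _ := abs_max_sub_max_le_abs _ _ _
  have hφint : Integrable φ ρ := (integrable_const δ).sup (hψint ρ)
  have hφρ : ∫ x, φ x ∂ρ ≤ 1 + δ + τ := by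
    have h1 : ∫ x, φ x ∂ρ ≤ ∫ x, (f x + ‖f x - ψ x‖) ∂ρ := by
      refine integral_mono hφint ((hfint ρ).add (hsub ρ)) fun x => ?_
      have := (abs_le.1 (hφf x)).1
      show φ x ≤ f x + ‖f x - ψ x‖
      linarith
    rw [integral_add (hfint ρ) (hsub ρ)] at h1
    linarith
  have hlogfi : Integrable (fun x => Real.log (f x)) ν := (integrable_congr hlogf).2
    (hllr.mono (by have := measurable_llr ν ρ; fun_prop)
      (Eventually.of_forall fun x => abs_clamp_le (Nat.cast_nonneg A)))
  have hlogφi : Integrable (fun x => Real.log (φ x)) ν := by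
    refine Integrable.of_bound (hφc.measurable.log.aestronglyMeasurable)
      (|Real.log δ| + |B| / δ) (Eventually.of_forall fun x => ?_)
    have h1 := abs_log_sub_log_le hδ (hφ0 x) le_rfl
    have h2 : |φ x - δ| ≤ |B| := by
      rw [abs_of_nonneg (sub_nonneg.2 (hφ0 x)), sub_le_iff_le_add]
      refine max_le (by have := abs_nonneg B; linarith) ?_
      have := (le_abs_self (ψ x)).trans ((hB x).trans (le_abs_self B))
      linarith
    have h3 := h1.trans (div_le_div_of_nonneg_right h2 hδ.le)
    have h4 := abs_sub_abs_le_abs_sub (Real.log (φ x)) (Real.log δ)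
    rw [Real.norm_eq_abs]
    linarith
  have hlogφ : ∫ x, Real.log (f x) ∂ν - ε / 4 ≤ ∫ x, Real.log (φ x) ∂ν := by
    have h1 : ∫ x, (Real.log (f x) - Real.log (φ x)) ∂ν ≤ ∫ x, ‖f x - ψ x‖ / δ ∂ν := by
      refine integral_mono (hlogfi.sub hlogφi) ((hsub ν).div_const _) fun x => ?_
      refine (le_abs_self _).trans ((abs_log_sub_log_le hδ (hf0 x) (hφ0 x)).trans ?_)
      exact div_le_div_of_nonneg_right (hφf x) hδ.le
    rw [integral_sub hlogfi hlogφi, integral_div] at h1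
    have h2 : (∫ x, ‖f x - ψ x‖ ∂ν) / δ ≤ ε / 4 := by
      rw [div_le_iff₀ hδ]
      linarith
    linarith
  have hψu : UniformContinuous ψ := hψs.uniformContinuous_of_continuous hψc
  obtain ⟨θ, hθ, hθψ⟩ := Metric.uniformContinuous_iff.1 hψu (δ * ε) (by positivity)
  have hB0 : 0 ≤ B := (norm_nonneg _).trans (hB 0)
  -- uniform continuity bounds the oscillation by `ε` at short distances, and the bound `B` makes it
  -- Lipschitz at long distances
  have hosc : ∀ x y, |Real.log (φ x) - Real.log (φ y)| ≤ ε + 2 * B / (δ * θ) * ‖x - y‖ := by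
    intro x y
    have h1 := abs_log_sub_log_le hδ (hφ0 x) (hφ0 y)
    have h2 : |φ x - φ y| ≤ |ψ x - ψ y| := by
      rw [hφ]
      simp only [max_comm δ]
      exact abs_max_sub_max_le_abs _ _ _
    have h3 := h1.trans (div_le_div_of_nonneg_right h2 hδ.le)
    rcases lt_or_ge (dist x y) θ with h4 | h4
    · have h5 := hθψ h4
      rw [Real.dist_eq] at h5
      have h6 : |ψ x - ψ y| / δ ≤ ε := by rw [div_le_iff₀ hδ]; linarith
      have h7 : 0 ≤ 2 * B / (δ * θ) * ‖x - y‖ := by positivity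
      linarith
    · rw [dist_eq_norm] at h4
      have h5 : |ψ x - ψ y| ≤ 2 * B := by
        have h6 := abs_sub (ψ x) (ψ y)
        have h7 := hB x
        have h8 := hB y
        rw [Real.norm_eq_abs] at h7 h8
        linarith
      have h6 : |ψ x - ψ y| / δ ≤ 2 * B / (δ * θ) * ‖x - y‖ := by
        calc |ψ x - ψ y| / δ ≤ 2 * B / δ := by gcongr
          _ = 2 * B / (δ * θ) * θ := by field_simp
          _ ≤ _ := by gcongr
      linarith
  set Z := ∫ x, Real.exp (w x) ∂m with hZdef
  have hZ : 0 < Z := integral_exp_pos hexp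
  have hden : 0 < 1 + δ + τ := by positivity
  refine ⟨fun x => -w x + Real.log Z - Real.log (φ x) + Real.log (1 + δ + τ),
    (Module.finrank ℝ E + 1 : ℝ) + 2 * B / (δ * θ), by positivity, ?_, ?_, ?_, ?_, ?_⟩
  · have h1 := hwc.measurable
    have h2 := hφc.measurable.log
    fun_prop
  · exact ((hw.neg.add (integrable_const _)).sub hlogφi).add (integrable_const _)
  · have h1 : ∀ x, ENNReal.ofReal (Real.exp (-(-w x + Real.log Z - Real.log (φ x) +
        Real.log (1 + δ + τ)))) = ENNReal.ofReal (Real.exp (w x) / Z) *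
        ENNReal.ofReal (φ x / (1 + δ + τ)) := by
      intro x
      rw [← ENNReal.ofReal_mul (by positivity)]
      congr 1
      rw [show -(-w x + Real.log Z - Real.log (φ x) + Real.log (1 + δ + τ)) =
        (w x - Real.log Z) + (Real.log (φ x) - Real.log (1 + δ + τ)) by ring, Real.exp_add,
        Real.exp_sub, Real.exp_sub, Real.exp_log hZ, Real.exp_log (hφpos x), Real.exp_log hden]
    simp_rw [h1]
    rw [← lintegral_tilted w fun x => ENNReal.ofReal (φ x / (1 + δ + τ)), ← hρ,
      ← ofReal_integral_eq_lintegral_ofReal (hφint.div_const _)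
        (Eventually.of_forall fun x => (div_pos (hφpos x) hden).le), integral_div]
    rw [ENNReal.ofReal_le_one]
    exact (div_le_one hden).2 hφρ
  · intro x y
    have h1 := abs_le.1 (abs_decayWeight_sub_le x y)
    have h2 := abs_le.1 (hosc x y)
    rw [← hwdef] at h1
    have h3 := h1.1
    have h4 := h2.1
    dsimp only
    rw [add_mul]
    linarith
  · have h1 : ∫ x, (-w x + Real.log Z - Real.log (φ x) + Real.log (1 + δ + τ)) ∂ν =
        -∫ x, w x ∂ν + Real.log Z - ∫ x, Real.log (φ x) ∂ν + Real.log (1 + δ + τ) := by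
      have hw' : Integrable (fun x => -w x) ν := hw.neg
      have i1 : Integrable (fun x => -w x + Real.log Z) ν := hw'.add (integrable_const _)
      have i2 : Integrable (fun x => -w x + Real.log Z - Real.log (φ x)) ν := i1.sub hlogφi
      rw [integral_add i2 (integrable_const _), integral_sub i1 hlogφi,
        integral_add hw' (integrable_const _), integral_neg]
      simp
    rw [h1]
    have h2 : Real.log (1 + δ + τ) ≤ δ + τ :=
      (Real.log_le_sub_one_of_pos hden).trans (by linarith)
    have h3 : τ ≤ ε / 4 := by
      rw [hτdef]
      nlinarith
    rw [integral_congr_ae hlogf] at hlogφ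
    rw [differentialEntropy]
    linarith

end NearlyLipschitz

section Renyi

variable {κ : Type*} [Fintype κ]

/-- The entropy of the cells at scale `a` is the differential entropy, up to `log a` times the
dimension. The volume of the cells gives the lower bound, a nearly Lipschitz code the upper bound. -/
theorem tendsto_shannon_cellOf_sub {ν : Measure (κ → ℝ)} [IsProbabilityMeasure ν]
    (h : HasFiniteEntropy volume ν) (hint : Integrable (fun x => ‖x‖) ν) :
    Tendsto (fun a : ℝ => (shannon (ν.map (cellOf a))).toReal - Fintype.card κ * Real.log a) atTop
      (𝓝 (differentialEntropy volume ν)) := by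
  have hup : ∀ ε > 0, ∃ K : ℝ, ∀ a : ℝ, 0 < a → shannon (ν.map (cellOf a)) ≠ ⊤ ∧
      (shannon (ν.map (cellOf a))).toReal - Fintype.card κ * Real.log a ≤
        differentialEntropy volume ν + 2 * ε + K / a := by
    intro ε hε
    obtain ⟨ℓ, K, hK, hm, hi, h1, h2, h3⟩ := h.exists_code hint hε
    refine ⟨K, fun a ha => ?_⟩
    have key := shannon_cellOf_le (P := ν) ha measurable_id h1 (L := fun x => ℓ x + (ε + K / a))
      (hi.add (integrable_const _)) (Eventually.of_forall fun x y hxy => ?_)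
    · rw [integral_add hi (integrable_const _)] at key
      simp only [integral_const, probReal_univ, smul_eq_mul, one_mul, id] at key
      refine ⟨ne_top_of_le_ne_top ENNReal.ofReal_ne_top key.2, ?_⟩
      have := ENNReal.toReal_le_of_le_ofReal key.1 key.2
      linarith
    · have h4 := dist_le_of_cellOf_eq ha hxy
      rw [dist_eq_norm] at h4
      have h5 : K * ‖y - x‖ ≤ K / a := by
        rw [div_eq_mul_one_div]
        exact mul_le_mul_of_nonneg_left h4 hK
      have := h2 y x
      linarith
  refine tendsto_order.2 ⟨fun c hc => ?_, fun c hc => ?_⟩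
  · obtain ⟨K, hK⟩ := hup 1 one_pos
    filter_upwards [eventually_gt_atTop 0] with a ha
    have h1 := h.le_shannon_map (measurable_cellOf a) (by positivity : 0 < a⁻¹ ^ Fintype.card κ)
      fun j => (volume_cellOf ha j).le
    rw [ENNReal.ofReal_le_iff_le_toReal (hK a ha).1, log_inv_pow] at h1
    linarith
  · obtain ⟨K, hK⟩ := hup ((c - differentialEntropy volume ν) / 4) (by linarith)
    have h1 : Tendsto (fun a : ℝ => K / a) atTop (𝓝 0) := tendsto_const_nhds.div_atTop tendsto_id
    filter_upwards [eventually_gt_atTop 0, h1.eventually_lt_const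
      (by linarith : 0 < (c - differentialEntropy volume ν) / 4)] with a ha h2
    have := (hK a ha).2
    linarith

end Renyi

/-! ### Randomized partitions -/

section Randomized

variable {k : ℕ} {d : Matrix (Fin k) (Fin k) ℕ} {r : Fin k} {o : Fin k → TreeVertex d r}
  {q : Fin k → ℝ}

theorem prod_star_eq {M : Type*} [CommMonoid M] (u : TreeVertex d r) (F : star u → M) :
    ∏ w, F w = F ⟨u, self_mem_star u⟩ *
      ∏ s : {v // v ∈ nbrs u}, F ⟨s.1, mem_star_of_mem_nbrs s.2⟩ := by
  classical
  let F' : TreeVertex d r → M := fun x => if h : x ∈ star u then F ⟨x, h⟩ else 1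
  have h1 : ∀ x (h : x ∈ star u), F ⟨x, h⟩ = F' x := fun x h => by simp [F', h]
  have h2 : ∏ w, F w = ∏ w : star u, F' w := Finset.prod_congr rfl fun w _ => h1 w.1 w.2
  simp_rw [h2, h1]
  rw [Finset.prod_coe_sort (star u) F', Finset.prod_coe_sort (nbrs u) F', star,
    Finset.prod_insert (notMem_nbrs_self u)]

theorem prod_edge_eq {M : Type*} [CommMonoid M] {u v : TreeVertex d r} (huv : v ∈ nbrs u)
    (F : edge u v → M) :
    ∏ w, F w = F ⟨u, mem_edge.2 (Or.inl rfl)⟩ * F ⟨v, mem_edge.2 (Or.inr rfl)⟩ := by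
  classical
  let F' : TreeVertex d r → M := fun x => if h : x ∈ edge u v then F ⟨x, h⟩ else 1
  have h1 : ∀ x (h : x ∈ edge u v), F ⟨x, h⟩ = F' x := fun x h => by simp [F', h]
  have h2 : ∏ w, F w = ∏ w : edge u v, F' w := Finset.prod_congr rfl fun w _ => h1 w.1 w.2
  have h3 : u ≠ v := fun h => notMem_nbrs_self u (by rw [← h] at huv; exact huv)
  rw [h2, h1, h1, Finset.prod_coe_sort (edge u v) F', edge, Finset.prod_pair h3]

variable {Y U B : Type} [MeasurableSpace Y] [MeasurableSpace U] [MeasurableSpace B]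
  {μ : Measure (TreeVertex d r → Y)} [IsProbabilityMeasure μ] {γ : Measure U}
  [IsProbabilityMeasure γ] {c : Y × U → B}

/-- The law on `Γ` of the process `c (X u, ξ u)`, where the `ξ u` are independent random
variables with law `γ`. -/
noncomputable def randomizedMarginal (c : Y × U → B) (γ : Measure U)
    (μ : Measure (TreeVertex d r → Y)) (Γ : Finset (TreeVertex d r)) : Measure (Γ → B) :=
  (μ.prod (Measure.pi fun _ : Γ => γ)).map fun p w => c (p.1 w, p.2 w)

theorem measurable_randomized (hc : Measurable c) (Γ : Finset (TreeVertex d r)) :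
    Measurable fun (p : (TreeVertex d r → Y) × (Γ → U)) (w : Γ) => c (p.1 w, p.2 w) :=
  measurable_pi_lambda _ fun _ => hc.comp (((measurable_pi_apply _).comp measurable_fst).prodMk
    ((measurable_pi_apply _).comp measurable_snd))

theorem randomizedMarginal_singleton [Countable B] [MeasurableSingletonClass B] (hc : Measurable c)
    (Γ : Finset (TreeVertex d r)) (j : Γ → B) : randomizedMarginal c γ μ Γ {j} =
      ∫⁻ X, ∏ w : Γ, γ {u | c (X w, u) = j w} ∂μ := by
  have hm := measurable_randomized hc Γ
  rw [randomizedMarginal, Measure.map_apply hm (measurableSet_singleton j),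
    Measure.prod_apply (hm (measurableSet_singleton j))]
  refine lintegral_congr fun X => ?_
  rw [← Measure.pi_pi]
  congr 1
  ext u
  simp [funext_iff]

/-- The probability that the randomized label of `y` is `b`. -/
noncomputable def randomizedChannel (c : Y × U → B) (γ : Measure U) (b : B) (y : Y) : ℝ :=
  γ.real {u | c (y, u) = b}

theorem ofReal_randomizedChannel (b : B) (y : Y) :
    ENNReal.ofReal (randomizedChannel c γ b y) = γ {u | c (y, u) = b} := ofReal_measureReal

theorem measurable_randomizedChannel [MeasurableSingletonClass B] (hc : Measurable c) (b : B) :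
    Measurable (randomizedChannel c γ b) :=
  (measurable_measure_prodMk_left (hc (measurableSet_singleton b))).ennreal_toReal

theorem randomizedChannel_nonneg (b : B) (y : Y) : 0 ≤ randomizedChannel c γ b y :=
  measureReal_nonneg

theorem shannon_randomized_eq [MeasurableSingletonClass B] (hc : Measurable c) (y : Y) :
    shannon (γ.map fun u => c (y, u)) =
      ∑' b, ENNReal.ofReal (Real.negMulLog (randomizedChannel c γ b y)) := by
  have hm : Measurable fun u => c (y, u) := hc.comp measurable_prodMk_left
  refine tsum_congr fun b => ?_
  rw [measureReal_def, Measure.map_apply hm (measurableSet_singleton b)]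
  rfl

theorem hasSum_randomizedChannel [Countable B] [MeasurableSingletonClass B] (hc : Measurable c)
    (y : Y) : HasSum (fun b => randomizedChannel c γ b y) 1 := by
  have hm : Measurable fun u => c (y, u) := hc.comp measurable_prodMk_left
  have := Measure.isProbabilityMeasure_map (μ := γ) hm.aemeasurable
  have h1 := tsum_measure_singleton_eq_one (ν := γ.map fun u => c (y, u)) Set.countable_univ
    (by simp)
  have h2 : ∀ b, (γ.map fun u => c (y, u)) {b} = ENNReal.ofReal (randomizedChannel c γ b y) :=
    fun b => by
      rw [Measure.map_apply hm (measurableSet_singleton b), ofReal_randomizedChannel]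
      rfl
  simp_rw [h2] at h1
  have h3 : Summable fun b => randomizedChannel c γ b y := by
    have := ENNReal.summable_toReal (f := fun b => ENNReal.ofReal (randomizedChannel c γ b y))
      (by rw [h1]; exact ENNReal.one_ne_top)
    simpa only [ENNReal.toReal_ofReal (randomizedChannel_nonneg _ _)] using this
  rw [← ENNReal.ofReal_tsum_of_nonneg (fun b => randomizedChannel_nonneg b y) h3,
    ENNReal.ofReal_eq_one] at h1
  rw [← h1]
  exact h3.hasSum

variable [Countable B] [MeasurableSingletonClass B]

theorem tsum_outputLaw_eq (hc : Measurable c) (i : Fin k) :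
    ∑' b, ENNReal.ofReal (Real.negMulLog (outputLaw μ o (randomizedChannel c γ) i b)) =
      shannon (randomizedMarginal c γ μ (star (o i))) := by
  have hW1 := countable_channel_le_one (W := randomizedChannel c γ) randomizedChannel_nonneg
    (hasSum_randomizedChannel hc)
  rw [shannon_eq_tsum, ← (starEquiv (o i) B).tsum_eq]
  refine tsum_congr fun j => ?_
  have h0 : 0 ≤ outputLaw μ o (randomizedChannel c γ) i (starEquiv (o i) B j) :=
    integral_nonneg fun X => starWeight_nonneg randomizedChannel_nonneg _ _
  rw [← atomEntropy_ofReal h0, ofReal_outputLaw (measurable_randomizedChannel hc)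
    randomizedChannel_nonneg hW1, randomizedMarginal_singleton hc]
  congr 1
  refine lintegral_congr fun X => ?_
  rw [ofReal_starWeight randomizedChannel_nonneg, prod_star_eq]
  simp only [ofReal_randomizedChannel]
  rfl

theorem shannon_randomizedMarginal_edge_le (hc : Measurable c) (i : Fin k) (s : Slots o i) :
    shannon (randomizedMarginal c γ μ (edge (o i) s.1)) ≤
      ∑' b, ENNReal.ofReal (Real.negMulLog (outputEdgeLaw μ o (randomizedChannel c γ) i s b)) := by
  have hW1 := countable_channel_le_one (W := randomizedChannel c γ) randomizedChannel_nonneg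
    (hasSum_randomizedChannel hc)
  have hm := measurable_randomizedChannel (γ := γ) hc
  let φ : (edge (o i) s.1 → B) → B × B := fun j =>
    (j ⟨o i, mem_edge.2 (Or.inl rfl)⟩, j ⟨s.1, mem_edge.2 (Or.inr rfl)⟩)
  have hφ : Function.Injective φ := by
    intro j j' h
    obtain ⟨h1, h2⟩ := Prod.ext_iff.1 h
    funext w
    obtain ⟨w, hw⟩ := w
    rcases mem_edge.1 hw with rfl | rfl
    · exact h1
    · exact h2
  refine le_trans (le_of_eq ?_) (ENNReal.tsum_comp_le_tsum_of_injective hφ _)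
  rw [shannon_eq_tsum]
  refine tsum_congr fun j => ?_
  have hnn : ∀ X : TreeVertex d r → Y, 0 ≤ randomizedChannel c γ (φ j).1 (X (o i)) *
      randomizedChannel c γ (φ j).2 (X s.1) := fun X =>
    mul_nonneg (randomizedChannel_nonneg _ _) (randomizedChannel_nonneg _ _)
  have h0 : 0 ≤ outputEdgeLaw μ o (randomizedChannel c γ) i s (φ j) := integral_nonneg hnn
  rw [← atomEntropy_ofReal h0, outputEdgeLaw, ofReal_integral_eq_lintegral_ofReal _
    (Eventually.of_forall hnn), randomizedMarginal_singleton hc]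
  · congr 1
    refine lintegral_congr fun X => ?_
    rw [ENNReal.ofReal_mul (randomizedChannel_nonneg _ _), prod_edge_eq s.2]
    simp only [ofReal_randomizedChannel]
    rfl
  · refine Integrable.of_bound (((hm _).comp (measurable_pi_apply _)).mul
      ((hm _).comp (measurable_pi_apply _))).aestronglyMeasurable 1
      (Eventually.of_forall fun X => ?_)
    rw [Real.norm_of_nonneg (hnn X)]
    exact mul_le_one₀ (hW1 _ _) (randomizedChannel_nonneg _ _) (hW1 _ _)

variable [TopologicalSpace Y] [SecondCountableTopology Y] [TopologicalSpace.MetrizableSpace Y]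
  [BorelSpace Y]

/-- The entropy inequality for a randomized countable partition of the label space. The entropy
of the randomization at the root is gained on the left. -/
theorem IsTypical.sum_randomized_edge_le_sum_star (hμ : IsTypical μ)
    (hd : IsExpandingDegreeMatrix d) (hq : IsRootLaw d q) (ho : ∀ i, (o i).type = i)
    (hc : Measurable c) :
    ∑ i, ENNReal.ofReal (q i) * (∫⁻ X, shannon (γ.map fun u => c (X (o i), u)) ∂μ +
        2⁻¹ * ∑ v ∈ nbrs (o i), shannon (randomizedMarginal c γ μ (edge (o i) v))) ≤
      ∑ i, ENNReal.ofReal (q i) * shannon (randomizedMarginal c γ μ (star (o i))) := by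
  have h := hμ.core_countable hd hq ho (measurable_randomizedChannel (γ := γ) hc)
    randomizedChannel_nonneg (hasSum_randomizedChannel hc)
  simp only [tsum_outputLaw_eq hc, ← shannon_randomized_eq hc] at h
  refine le_trans (Finset.sum_le_sum fun i _ => ?_) h
  gcongr
  rw [← Finset.sum_coe_sort (nbrs (o i))]
  exact Finset.sum_le_sum fun s _ => shannon_randomizedMarginal_edge_le hc i s

end Randomized

/-! ### Gaussian noise -/

section Gaussian

/-- The differential entropy of the standard Gaussian law. -/
noncomputable def gaussianEntropy : ℝ := Real.log √(2 * Real.pi) + 1 / 2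

theorem neg_log_gaussianPDFReal {v : NNReal} (hv : v ≠ 0) (x : ℝ) :
    -Real.log (gaussianPDFReal 0 v x) = Real.log √(2 * Real.pi * v) + x ^ 2 / (2 * v) := by
  have hv' : (0:ℝ) < v := NNReal.coe_pos.2 (pos_iff_ne_zero.2 hv)
  have hpi := Real.pi_pos
  rw [gaussianPDFReal, Real.log_mul (by positivity) (Real.exp_pos _).ne', Real.log_inv,
    Real.log_exp, sub_zero]
  ring

theorem integrable_sq_gaussianReal : Integrable (fun x : ℝ => x ^ 2) (gaussianReal 0 1) :=
  (memLp_id_gaussianReal 2).integrable_sq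

theorem integral_sq_gaussianReal : ∫ x : ℝ, x ^ 2 ∂(gaussianReal 0 1) = 1 := by
  have h := variance_of_integral_eq_zero (X := (id : ℝ → ℝ)) (μ := gaussianReal 0 1)
    measurable_id.aemeasurable (by simp)
  rw [variance_id_gaussianReal] at h
  simpa using h.symm

theorem integrable_abs_gaussianReal : Integrable (fun x : ℝ => |x|) (gaussianReal 0 1) :=
  ((memLp_id_gaussianReal 1).integrable le_rfl).abs

theorem llr_gaussianReal : llr (gaussianReal 0 1) volume =ᵐ[gaussianReal 0 1]
    fun x => -(Real.log √(2 * Real.pi) + x ^ 2 / 2) := by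
  have h := (gaussianReal_absolutelyContinuous 0 one_ne_zero).ae_le (rnDeriv_gaussianReal 0 1)
  filter_upwards [h] with x hx
  rw [llr, hx, toReal_gaussianPDF, ← neg_neg (Real.log _), neg_log_gaussianPDFReal one_ne_zero]
  simp

theorem hasFiniteEntropy_gaussianReal : HasFiniteEntropy volume (gaussianReal 0 1) :=
  ⟨gaussianReal_absolutelyContinuous 0 one_ne_zero, (integrable_congr llr_gaussianReal).2
    ((integrable_const _).add (integrable_sq_gaussianReal.div_const 2)).neg⟩

theorem differentialEntropy_gaussianReal :
    differentialEntropy volume (gaussianReal 0 1) = gaussianEntropy := by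
  rw [differentialEntropy, integral_congr_ae llr_gaussianReal, integral_neg, neg_neg,
    integral_add (integrable_const _) (integrable_sq_gaussianReal.div_const 2), integral_div,
    integral_sq_gaussianReal]
  simp [gaussianEntropy]

/-- The integer part of `a (x + η u)`. -/
noncomputable def noisyCell (a η : ℝ) (p : ℝ × ℝ) : ℤ := ⌊a * (p.1 + η * p.2)⌋

theorem measurable_noisyCell (a η : ℝ) : Measurable (noisyCell a η) := by
  have : Measurable fun p : ℝ × ℝ => a * (p.1 + η * p.2) := by fun_prop
  exact Int.measurable_floor.comp this

/-- The entropy of the noise, given the label: the noise in one cell is in an interval of length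
`1 / (a η)`. -/
theorem le_shannon_noisyCell {a η : ℝ} (ha : 0 < a) (hη : 0 < η) (x : ℝ) :
    ENNReal.ofReal (Real.log a + Real.log η + gaussianEntropy) ≤
      shannon ((gaussianReal 0 1).map fun u => noisyCell a η (x, u)) := by
  have h := hasFiniteEntropy_gaussianReal.le_shannon_map (c := fun u => noisyCell a η (x, u))
    ((measurable_noisyCell a η).comp measurable_prodMk_left) (by positivity : 0 < (a * η)⁻¹)
    fun j => ?_
  · rwa [differentialEntropy_gaussianReal, Real.log_inv, neg_neg,
      Real.log_mul ha.ne' hη.ne'] at h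
  · have h2 : (fun u => noisyCell a η (x, u)) ⁻¹' {j} =
        Set.Ico ((j / a - x) / η) (((j + 1) / a - x) / η) := by
      ext u
      simp only [Set.mem_preimage, Set.mem_singleton_iff, noisyCell, Int.floor_eq_iff, Set.mem_Ico]
      rw [div_le_iff₀ hη, lt_div_iff₀ hη, sub_le_iff_le_add, lt_sub_iff_add_lt, div_le_iff₀ ha,
        lt_div_iff₀ ha]
      constructor <;> rintro ⟨h1, h2⟩ <;> constructor <;> linarith
    rw [h2, Real.volume_Ico]
    refine ENNReal.ofReal_le_ofReal (le_of_eq ?_)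
    field_simp
    ring

variable {κ : Type*} [Fintype κ]

theorem integrable_eval_gaussian {f : ℝ → ℝ} (hf : Integrable f (gaussianReal 0 1)) (w : κ) :
    Integrable (fun u : κ → ℝ => f (u w)) (Measure.pi fun _ : κ => gaussianReal 0 1) :=
  (measurePreserving_eval (fun _ : κ => gaussianReal 0 1) w).integrable_comp_of_integrable hf

theorem integral_sum_abs_gaussian :
    ∫ u : κ → ℝ, ∑ w, |u w| ∂(Measure.pi fun _ : κ => gaussianReal 0 1) =
      Fintype.card κ * ∫ x, |x| ∂(gaussianReal 0 1) := by
  rw [integral_finsetSum _ fun w _ => integrable_eval_gaussian integrable_abs_gaussianReal w]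
  have h : ∀ w : κ, ∫ u : κ → ℝ, |u w| ∂(Measure.pi fun _ : κ => gaussianReal 0 1) =
      ∫ x, |x| ∂(gaussianReal 0 1) := fun w => by
    have h1 := measurePreserving_eval (fun _ : κ => gaussianReal 0 1) w
    conv_rhs => rw [← h1.map_eq, integral_map h1.measurable.aemeasurable (by fun_prop)]
  simp [h]

theorem memLp_inner_gaussian (e : EuclideanSpace ℝ κ) :
    MemLp (fun u : κ → ℝ => inner ℝ e (WithLp.toLp 2 u)) 2
      (Measure.pi fun _ : κ => gaussianReal 0 1) := by
  have h : (fun u : κ → ℝ => inner ℝ e (WithLp.toLp 2 u)) = fun u => ∑ w, e w * u w := by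
    funext u
    rw [PiLp.inner_apply]
    exact Finset.sum_congr rfl fun w _ => by simp [mul_comm]
  rw [h]
  refine memLp_finsetSum _ fun w _ => MemLp.const_mul ?_ (e w)
  exact (memLp_id_gaussianReal 2).comp_measurePreserving
    (measurePreserving_eval (fun _ : κ => gaussianReal 0 1) w)

theorem integral_inner_sq_gaussian {e : EuclideanSpace ℝ κ} (he : ‖e‖ = 1) :
    ∫ u : κ → ℝ, (inner ℝ e (WithLp.toLp 2 u)) ^ 2 ∂(Measure.pi fun _ : κ => gaussianReal 0 1) =
      1 := by
  have hm : Measurable (WithLp.toLp 2 : (κ → ℝ) → EuclideanSpace ℝ κ) := WithLp.measurable_toLp 2 _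
  have h0 : AEStronglyMeasurable (fun x : EuclideanSpace ℝ κ => innerSL ℝ e x ^ 2)
      ((Measure.pi fun _ : κ => gaussianReal 0 1).map (WithLp.toLp 2)) :=
    ((innerSL ℝ e).continuous.pow 2).measurable.aestronglyMeasurable
  have h1 := variance_dual_stdGaussian (innerSL ℝ e)
  rw [innerSL_apply_norm, he, one_pow, variance_of_integral_eq_zero
    (innerSL ℝ e).continuous.measurable.aemeasurable (integral_strongDual_stdGaussian _),
    ← map_pi_eq_stdGaussian, integral_map hm.aemeasurable h0] at h1
  exact h1

theorem abs_inner_le_sum {e : EuclideanSpace ℝ κ} (he : ‖e‖ = 1) (y : κ → ℝ) :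
    |inner ℝ e (WithLp.toLp 2 y)| ≤ ∑ w, |y w| := by
  rw [PiLp.inner_apply]
  refine (Finset.abs_sum_le_sum_abs _ _).trans (Finset.sum_le_sum fun w _ => ?_)
  have h1 : |e w| ≤ 1 := by
    have := PiLp.norm_apply_le e w
    rwa [he, Real.norm_eq_abs] at this
  have h2 : inner ℝ (e w) ((WithLp.toLp 2 y : EuclideanSpace ℝ κ) w) = y w * e w := rfl
  rw [h2, abs_mul]
  exact mul_le_of_le_one_right (abs_nonneg _) h1

theorem measurePreserving_inner {ι : Type*} [Fintype ι]
    (β : OrthonormalBasis ι ℝ (EuclideanSpace ℝ κ)) :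
    MeasurePreserving (fun (y : κ → ℝ) (i : ι) => inner ℝ (β i) (WithLp.toLp 2 y)) := by
  have h := ((PiLp.volume_preserving_ofLp ι).comp β.measurePreserving_repr).comp
    (PiLp.volume_preserving_toLp κ)
  convert h using 1
  funext y i
  exact (β.repr_apply_apply _ i).symm

end Gaussian

section Noise

variable {k : ℕ} {d : Matrix (Fin k) (Fin k) ℕ} {r : Fin k} {lam : ℝ}
  {μ : Measure (TreeVertex d r → ℝ)} [IsProbabilityMeasure μ] (b : EigenBases d r lam)
  {Γ : Finset (TreeVertex d r)}

theorem continuous_ofCoords : Continuous (ofCoords b Γ) :=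
  continuous_finsetSum _ fun j _ => (continuous_apply j).smul continuous_const

/-- Noise does not decrease the entropy of the cells on `Γ`, if there are no constraints in `Γ`: given
the noise, the cells are a translate of the cubes of side `1 / a`. -/
theorem le_shannon_randomizedMarginal (hΓ : eigenSpace lam Γ = ⊤)
    (h : HasFiniteEntropy volume (μ.map (eigenCoords b Γ))) {a : ℝ} (ha : 0 < a) (η : ℝ) :
    ENNReal.ofReal (Γ.card * Real.log a + differentialEntropy volume (μ.map (eigenCoords b Γ))) ≤
      shannon (randomizedMarginal (noisyCell a η) (gaussianReal 0 1) μ Γ) := by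
  have hm := measurable_eigenCoords b Γ
  have := Measure.isProbabilityMeasure_map (μ := μ) hm.aemeasurable
  let c : (Fin (Module.finrank ℝ (eigenSpace lam Γ)) → ℝ) × (Γ → ℝ) → Γ → ℤ :=
    fun p => cellOf a fun w => ofCoords b Γ p.1 w + η * p.2 w
  have hc : Measurable c := by
    refine (measurable_cellOf a).comp (measurable_pi_lambda _ fun w => ?_)
    have h1 : Continuous fun z => ofCoords b Γ z w :=
      (EuclideanSpace.proj w).continuous.comp (continuous_ofCoords b)
    have h2 : Measurable fun p : (Fin (Module.finrank ℝ (eigenSpace lam Γ)) → ℝ) × (Γ → ℝ) =>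
        p.2 w := (measurable_pi_apply w).comp measurable_snd
    exact (h1.measurable.comp measurable_fst).add (h2.const_mul η)
  have hβ : ∃ β : OrthonormalBasis (Fin (Module.finrank ℝ (eigenSpace lam Γ))) ℝ
      (EuclideanSpace ℝ Γ), ∀ i, β i = (b Γ i : eigenSpace lam Γ) :=
    ⟨(b Γ).map (LinearIsometryEquiv.ofTop _ _ hΓ), fun i => rfl⟩
  obtain ⟨β, hβ⟩ := hβ
  have hT := measurePreserving_inner β
  have key := h.le_shannon_map_prod (Measure.pi fun _ : Γ => gaussianReal 0 1) hc
    (by positivity : 0 < a⁻¹ ^ Fintype.card Γ) fun u j => ?_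
  · rw [log_inv_pow, neg_neg, Fintype.card_coe] at key
    refine key.trans (le_of_eq ?_)
    congr 1
    have h1 : (μ.map (eigenCoords b Γ)).prod (Measure.pi fun _ : Γ => gaussianReal 0 1) =
        (μ.prod (Measure.pi fun _ : Γ => gaussianReal 0 1)).map (Prod.map (eigenCoords b Γ) id) := by
      rw [← Measure.map_prod_map _ _ hm measurable_id, Measure.map_id]
    rw [h1, Measure.map_map hc (hm.prodMap measurable_id), randomizedMarginal]
    congr 1
    funext p w
    have h2 := ofCoords_eigenCoords b (Γ := Γ) (X := p.1) (by rw [hΓ]; exact Submodule.mem_top)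
    simp only [Function.comp, Prod.map, c, h2]
    rfl
  · have h1 : MeasurableSet {z | c (z, u) = j} :=
      (hc.comp measurable_prodMk_right) (measurableSet_singleton j)
    rw [← hT.measure_preimage h1.nullMeasurableSet]
    have h2 : (fun (y : Γ → ℝ) i => inner ℝ (β i) (WithLp.toLp 2 y)) ⁻¹' {z | c (z, u) = j} =
        (fun y => y + fun w => η * u w) ⁻¹' (cellOf a ⁻¹' {j}) := by
      ext y
      have h3 : (fun i => inner ℝ (β i) (WithLp.toLp 2 y)) = coordsOf b Γ y := by
        funext i
        rw [hβ]
        rfl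
      simp only [Set.mem_preimage, Set.mem_ofPred_eq, Set.mem_singleton_iff, h3, c,
        ofCoords_coordsOf b (Γ := Γ) (x := y) (by rw [hΓ]; exact Submodule.mem_top)]
      rfl
    rw [h2, measure_preimage_add_right, volume_cellOf ha]

/-- On a set of vertices with a single constraint, the code for the coordinates and the Gaussian
code for the noise in the direction normal to the constraint give a code for the noisy cells. -/
theorem shannon_randomizedMarginal_le (hΓ : Γ.card = Module.finrank ℝ (eigenSpace lam Γ) + 1)
    (hX : ∀ᵐ X ∂μ, restrictTo Γ X ∈ eigenSpace lam Γ)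
    {ℓ : (Fin (Module.finrank ℝ (eigenSpace lam Γ)) → ℝ) → ℝ} {K ε : ℝ} (hK : 0 ≤ K)
    (hℓm : Measurable ℓ) (hℓ : Integrable ℓ (μ.map (eigenCoords b Γ)))
    (hℓ1 : (∫⁻ x, ENNReal.ofReal (Real.exp (-ℓ x))) ≤ 1)
    (hosc : ∀ x y, ℓ x ≤ ℓ y + ε + K * ‖x - y‖) {a η : ℝ} (ha : 0 < a) (hη : 0 < η) :
    ∃ x : ℝ, 0 ≤ x ∧
      shannon (randomizedMarginal (noisyCell a η) (gaussianReal 0 1) μ Γ) ≤ ENNReal.ofReal x ∧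
      x = Γ.card * Real.log a + Real.log η + gaussianEntropy + ∫ z, ℓ z ∂(μ.map (eigenCoords b Γ)) +
        ε + (K * η + Γ.card / (a * η)) * (Γ.card * ∫ t, |t| ∂(gaussianReal 0 1)) +
        K * (Γ.card / a) + (Γ.card / (a * η)) ^ 2 / 2 := by
  classical
  have hm := measurable_eigenCoords b Γ
  set N : ℝ := (Γ.card : ℝ) with hN
  have hN0 : 0 ≤ N := Nat.cast_nonneg _
  let n := Module.finrank ℝ (eigenSpace lam Γ)
  -- an orthonormal basis of `ℝ^Γ` that extends the chosen one by a normal vector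
  let χ : Fin n → EuclideanSpace ℝ Γ := fun j => ((b Γ j : eigenSpace lam Γ) : EuclideanSpace ℝ Γ)
  have hχ : Orthonormal ℝ χ := (b Γ).orthonormal.comp_linearIsometry (eigenSpace lam Γ).subtypeₗᵢ
  obtain ⟨β, hβ⟩ : ∃ β : OrthonormalBasis (Fin (n + 1)) ℝ (EuclideanSpace ℝ Γ),
      ∀ j : Fin n, β j.succ = χ j := by
    have h1 : Orthonormal ℝ (({i : Fin (n + 1) | i ≠ 0} : Set (Fin (n + 1))).domRestrict
        (Fin.cons 0 χ : Fin (n + 1) → EuclideanSpace ℝ Γ)) := by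
      have h2 := hχ.comp (fun i : ({i : Fin (n + 1) | i ≠ 0} : Set (Fin (n + 1))) =>
        i.1.pred i.2) fun i j hij => Subtype.ext (Fin.pred_inj.1 hij)
      convert h2 using 1
      funext i
      obtain ⟨i, hi⟩ := i
      obtain ⟨j, rfl⟩ := Fin.exists_succ_eq.2 hi
      simp
    obtain ⟨β, hβ⟩ := h1.exists_orthonormalBasis_extension_of_card_eq
      (by rw [finrank_euclideanSpace, Fintype.card_coe, Fintype.card_fin, hΓ])
    exact ⟨β, fun j => by rw [hβ j.succ (Fin.succ_ne_zero j)]; simp⟩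
  have hT := measurePreserving_inner β
  set e := β 0 with he
  have he1 : ‖e‖ = 1 := β.orthonormal.1 0
  have hχ1 : ∀ j, ‖χ j‖ = 1 := hχ.1
  have hperp : ∀ x ∈ eigenSpace lam Γ, inner ℝ e x = 0 := by
    intro x hx
    have h1 : ofCoords b Γ (coordsOf b Γ x) = x := ofCoords_coordsOf b (x := x.ofLp) hx
    rw [← h1, ofCoords, inner_sum]
    refine Finset.sum_eq_zero fun j _ => ?_
    rw [inner_smul_right]
    have h2 : inner ℝ (β 0) (β j.succ) = 0 := β.orthonormal.2 (Fin.succ_ne_zero j).symm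
    rw [hβ] at h2
    rw [he]
    exact mul_eq_zero_of_right _ h2
  -- the code for the normal component, which is Gaussian with variance `η ^ 2` without rounding
  let v : NNReal := ⟨η ^ 2, by positivity⟩
  have hv : v ≠ 0 := fun h => (pow_pos hη 2).ne' (congrArg NNReal.toReal h)
  let g : ℝ → ℝ := gaussianPDFReal 0 v
  have hg : ∀ t, -Real.log (g t) = Real.log η + Real.log √(2 * Real.pi) + t ^ 2 / (2 * η ^ 2) := by
    intro t
    have h1 := neg_log_gaussianPDFReal hv t
    have h2 : (v : ℝ) = η ^ 2 := rfl
    rw [h2, Real.sqrt_mul (by positivity), Real.sqrt_sq hη.le, Real.log_mul (by positivity) hη.ne']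
      at h1
    rw [h1]
    ring
  let ℓ' : (Γ → ℝ) → ℝ := fun y => ℓ (coordsOf b Γ y) - Real.log (g (inner ℝ e (WithLp.toLp 2 y)))
  -- in the orthonormal coordinates `e^{-ℓ'}` is a product of two densities
  have hint : (∫⁻ y, ENNReal.ofReal (Real.exp (-ℓ' y))) ≤ 1 := by
    let G : (Fin (n + 1) → ℝ) → ℝ≥0∞ := fun z =>
      ENNReal.ofReal (g (z 0)) * ENNReal.ofReal (Real.exp (-ℓ fun j => z j.succ))
    have hGm : Measurable G := by
      have h1 : Measurable g := measurable_gaussianPDFReal 0 v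
      have h2 : Measurable fun (z : Fin (n + 1) → ℝ) (j : Fin n) => z j.succ := by fun_prop
      have h3 := hℓm.comp h2
      exact (h1.comp (measurable_pi_apply 0)).ennreal_ofReal.mul h3.neg.exp.ennreal_ofReal
    have h1 : ∀ y, ENNReal.ofReal (Real.exp (-ℓ' y)) =
        G fun i => inner ℝ (β i) (WithLp.toLp 2 y) := by
      intro y
      have h2 : (fun j : Fin n => inner ℝ (β j.succ) (WithLp.toLp 2 y)) = coordsOf b Γ y := by
        funext j
        rw [hβ]
        rfl
      have h3 : 0 < g (inner ℝ e (WithLp.toLp 2 y)) := gaussianPDFReal_pos 0 v _ hv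
      simp only [G]
      rw [← ENNReal.ofReal_mul h3.le]
      congr 1
      simp only [ℓ']
      rw [neg_sub, sub_eq_add_neg, Real.exp_add, Real.exp_log h3]
      exact congrArg (fun z => g (inner ℝ e (WithLp.toLp 2 y)) * Real.exp (-ℓ z)) h2.symm
    simp_rw [h1]
    rw [hT.lintegral_comp hGm]
    have h4 := (volume_preserving_piFinSuccAbove (fun _ : Fin (n + 1) => ℝ) 0).symm
    rw [← h4.lintegral_comp hGm]
    have h5 : ∀ p : ℝ × (Fin n → ℝ), G ((MeasurableEquiv.piFinSuccAbove (fun _ => ℝ) 0).symm p) =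
        ENNReal.ofReal (g p.1) * ENNReal.ofReal (Real.exp (-ℓ p.2)) := by
      intro p
      simp [G, MeasurableEquiv.piFinSuccAbove]
    simp_rw [h5]
    have h6 : Measurable g := measurable_gaussianPDFReal 0 v
    have h8 := lintegral_prod_mul (μ := volume) (ν := volume) (f := fun t => ENNReal.ofReal (g t))
      (g := fun z => ENNReal.ofReal (Real.exp (-ℓ z))) h6.ennreal_ofReal.aemeasurable
      hℓm.neg.exp.ennreal_ofReal.aemeasurable
    rw [Measure.volume_eq_prod, h8]
    have h7 : ∫⁻ x, ENNReal.ofReal (g x) = 1 := lintegral_gaussianPDFReal_eq_one 0 hv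
    rw [h7, one_mul]
    exact hℓ1
  let P := μ.prod (Measure.pi fun _ : Γ => gaussianReal 0 1)
  let s : (Γ → ℝ) → ℝ := fun u => ∑ w, |u w|
  let t : (Γ → ℝ) → ℝ := fun u => inner ℝ e (WithLp.toLp 2 u)
  have hs : Integrable s (Measure.pi fun _ : Γ => gaussianReal 0 1) :=
    integrable_finsetSum _ fun w _ => integrable_eval_gaussian integrable_abs_gaussianReal w
  have ht : Integrable (fun u => t u ^ 2) (Measure.pi fun _ : Γ => gaussianReal 0 1) :=
    (memLp_inner_gaussian e).integrable_sq
  let C : ℝ := Real.log η + Real.log √(2 * Real.pi) + ε + K * (N / a) + (N / (a * η)) ^ 2 / 2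
  have i1 : Integrable (fun p : (TreeVertex d r → ℝ) × (Γ → ℝ) => ℓ (eigenCoords b Γ p.1)) P :=
    (hℓ.comp_measurable hm).comp_fst _
  have i2 : Integrable (fun p : (TreeVertex d r → ℝ) × (Γ → ℝ) =>
      (K * η + N / (a * η)) * s p.2) P := (hs.const_mul _).comp_snd _
  have i3 : Integrable (fun p : (TreeVertex d r → ℝ) × (Γ → ℝ) => t p.2 ^ 2 / 2) P :=
    (ht.div_const 2).comp_snd _
  have hZ : Measurable fun (p : (TreeVertex d r → ℝ) × (Γ → ℝ)) (w : Γ) => p.1 w + η * p.2 w := by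
    fun_prop
  have i12 : Integrable (fun p : (TreeVertex d r → ℝ) × (Γ → ℝ) => ℓ (eigenCoords b Γ p.1) +
      (K * η + N / (a * η)) * s p.2) P := i1.add i2
  have i123 : Integrable (fun p : (TreeVertex d r → ℝ) × (Γ → ℝ) => ℓ (eigenCoords b Γ p.1) +
      (K * η + N / (a * η)) * s p.2 + t p.2 ^ 2 / 2) P := i12.add i3
  have key := shannon_cellOf_le (P := P) ha hZ hint
    (L := fun p => ℓ (eigenCoords b Γ p.1) + (K * η + N / (a * η)) * s p.2 + t p.2 ^ 2 / 2 + C)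
    (i123.add (integrable_const C)) ?_
  · refine ⟨_, key.1, key.2, ?_⟩
    rw [integral_add i123 (integrable_const C), integral_add i12 i3, integral_add i1 i2]
    have e1 : ∫ p, ℓ (eigenCoords b Γ p.1) ∂P = ∫ z, ℓ z ∂(μ.map (eigenCoords b Γ)) := by
      rw [integral_map hm.aemeasurable hℓ.1]
      simpa using integral_fun_fst (μ := μ) (ν := Measure.pi fun _ : Γ => gaussianReal 0 1)
        fun X => ℓ (eigenCoords b Γ X)
    have e2 : ∫ p, (K * η + N / (a * η)) * s p.2 ∂P =
        (K * η + N / (a * η)) * (N * ∫ t, |t| ∂(gaussianReal 0 1)) := by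
      have h1 := integral_fun_snd (μ := μ) (ν := Measure.pi fun _ : Γ => gaussianReal 0 1)
        s
      have h2 := integral_sum_abs_gaussian (κ := Γ)
      rw [probReal_univ, one_smul] at h1
      rw [Fintype.card_coe] at h2
      rw [integral_const_mul]
      exact congrArg _ (h1.trans h2)
    have e3 : ∫ p, t p.2 ^ 2 / 2 ∂P = 1 / 2 := by
      have h1 := integral_fun_snd (μ := μ) (ν := Measure.pi fun _ : Γ => gaussianReal 0 1)
        fun u => t u ^ 2
      rw [probReal_univ, one_smul] at h1
      rw [integral_div]
      exact congrArg (· / 2) (h1.trans (integral_inner_sq_gaussian he1))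
    rw [e1, e2, e3, Fintype.card_coe]
    simp only [integral_const, probReal_univ, smul_eq_mul, one_mul, C, gaussianEntropy]
    ring
  · have hXP : ∀ᵐ p ∂P, restrictTo Γ p.1 ∈ eigenSpace lam Γ := Measure.quasiMeasurePreserving_fst.ae hX
    filter_upwards [hXP] with p hp y hy
    obtain ⟨X, u⟩ := p
    dsimp only at hp hy ⊢
    have hd : ∀ w, |y w - (X w + η * u w)| ≤ 1 / a := fun w => by
      have := (dist_le_pi_dist y (fun w => X w + η * u w) w).trans (dist_le_of_cellOf_eq ha hy)
      rwa [Real.dist_eq] at this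
    have hsum1 : ∑ w : Γ, |y w - (X w + η * u w)| ≤ N / a := by
      refine (Finset.sum_le_sum fun w _ => hd w).trans (le_of_eq ?_)
      simp [hN, div_eq_mul_inv]
    have hsum2 : ∑ w : Γ, |y w - X w| ≤ N / a + η * s u := by
      calc ∑ w : Γ, |y w - X w| ≤ ∑ w : Γ, (|y w - (X w + η * u w)| + η * |u w|) := by
            refine Finset.sum_le_sum fun w _ => ?_
            have h1 := abs_add_le (y w - (X w + η * u w)) (η * u w)
            rw [abs_mul, abs_of_pos hη] at h1
            rwa [show y w - (X w + η * u w) + η * u w = y w - X w by ring] at h1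
        _ ≤ _ := by
            rw [Finset.sum_add_distrib, ← Finset.mul_sum]
            exact add_le_add_left hsum1 _
    have hcoord : ‖coordsOf b Γ y - eigenCoords b Γ X‖ ≤ N / a + η * s u := by
      have h0 : 0 ≤ N / a + η * s u := (Finset.sum_nonneg fun w _ => abs_nonneg _).trans hsum2
      refine (pi_norm_le_iff_of_nonneg h0).2 fun j => ?_
      have h1 : (coordsOf b Γ y - eigenCoords b Γ X) j =
          inner ℝ (χ j) (WithLp.toLp 2 fun w : Γ => y w - X w) := by
        rw [Pi.sub_apply, coordsOf, eigenCoords, ← inner_sub_right]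
        rfl
      rw [h1]
      exact (abs_inner_le_sum (hχ1 j) _).trans hsum2
    have h1 := hosc (coordsOf b Γ y) (eigenCoords b Γ X)
    have h2 := mul_le_mul_of_nonneg_left hcoord hK
    -- the normal component of a point `y` in the cell: the process itself has none
    set δ := inner ℝ e (WithLp.toLp 2 fun w : Γ => y w - (X w + η * u w)) with hδ
    have hδ1 : |δ| ≤ N / a := (abs_inner_le_sum he1 _).trans hsum1
    have hy : inner ℝ e (WithLp.toLp 2 y) = η * t u + δ := by
      have h3 : (WithLp.toLp 2 y : EuclideanSpace ℝ Γ) = restrictTo Γ X + η • WithLp.toLp 2 u +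
          WithLp.toLp 2 fun w : Γ => y w - (X w + η * u w) := by
        ext w
        simp [restrictTo]
      rw [h3, inner_add_right, inner_add_right, hperp _ hp, inner_smul_right, zero_add]
    have htu : |t u| ≤ s u := abs_inner_le_sum he1 u
    have h4 : (η * t u + δ) ^ 2 / (2 * η ^ 2) ≤
        t u ^ 2 / 2 + N / (a * η) * s u + (N / (a * η)) ^ 2 / 2 := by
      have h5 : t u * δ ≤ s u * (N / a) := by
        refine (le_abs_self _).trans ?_
        rw [abs_mul]
        exact mul_le_mul htu hδ1 (abs_nonneg _) ((abs_nonneg _).trans htu)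
      have h6 : δ ^ 2 ≤ (N / a) ^ 2 := by rw [← sq_abs]; exact pow_le_pow_left₀ (abs_nonneg _) hδ1 2
      have h7 : N / (a * η) = N / a / η := by rw [div_div]
      rw [h7, div_le_iff₀ (by positivity)]
      have h8 : (t u ^ 2 / 2 + N / a / η * s u + (N / a / η) ^ 2 / 2) * (2 * η ^ 2) =
          (η * t u) ^ 2 + 2 * η * (s u * (N / a)) + (N / a) ^ 2 := by
        field_simp
      rw [h8]
      have h9 := mul_le_mul_of_nonneg_left h5 (by positivity : 0 ≤ 2 * η)
      nlinarith
    show ℓ (coordsOf b Γ y) - Real.log (g (inner ℝ e (WithLp.toLp 2 y))) ≤ _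
    have h10 := hg (inner ℝ e (WithLp.toLp 2 y))
    rw [hy] at h10 ⊢
    simp only [C]
    linarith

end Noise

/-! ### Eigenvector processes with a density -/

section Density

variable {k : ℕ} {d : Matrix (Fin k) (Fin k) ℕ} {r : Fin k} {o : Fin k → TreeVertex d r}
  {lam : ℝ} {q : Fin k → ℝ} {μ : Measure (TreeVertex d r → ℝ)} [IsProbabilityMeasure μ]
  (b : EigenBases d r lam)

theorem card_edge {u v : TreeVertex d r} (huv : v ∈ nbrs u) : (edge u v).card = 2 := by
  classical
  have h : u ≠ v := fun h => notMem_nbrs_self u (by rw [← h] at huv; exact huv)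
  rw [edge, Finset.card_pair h]

theorem integrable_norm_eigenCoords (hμ : IsEigenvectorLaw lam μ) (Γ : Finset (TreeVertex d r)) :
    Integrable (fun z => ‖z‖) (μ.map (eigenCoords b Γ)) := by
  have hm := measurable_eigenCoords b Γ
  refine (integrable_map_measure (by fun_prop) hm.aemeasurable).2 ?_
  have h : Integrable (fun X : TreeVertex d r → ℝ => ∑ u : Γ, |X u|) μ :=
    integrable_finsetSum _ fun u _ => ((hμ.memLp u).integrable one_le_two).abs
  refine h.mono' hm.norm.aestronglyMeasurable (Eventually.of_forall fun X => ?_)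
  rw [Function.comp, norm_norm]
  refine (pi_norm_le_iff_of_nonneg (Finset.sum_nonneg fun u _ => abs_nonneg _)).2 fun j => ?_
  have h1 : ‖((b Γ j : eigenSpace lam Γ) : EuclideanSpace ℝ Γ)‖ = 1 := (b Γ).orthonormal.1 j
  exact abs_inner_le_sum h1 _

theorem ofCoords_add {Γ : Finset (TreeVertex d r)}
    (y z : Fin (Module.finrank ℝ (eigenSpace lam Γ)) → ℝ) :
    ofCoords b Γ (y + z) = ofCoords b Γ y + ofCoords b Γ z := by
  simp [ofCoords, add_smul, Finset.sum_add_distrib]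

theorem ofCoords_smul {Γ : Finset (TreeVertex d r)} (t : ℝ)
    (z : Fin (Module.finrank ℝ (eigenSpace lam Γ)) → ℝ) :
    ofCoords b Γ (t • z) = t • ofCoords b Γ z := by
  simp [ofCoords, mul_smul, Finset.smul_sum]

/-- The coordinates on an edge, as a linear function of the coordinates on the star. -/
noncomputable def edgeOfStarLinear (u v : TreeVertex d r) (hv : v ∈ nbrs u) :
    (Fin (Module.finrank ℝ (eigenSpace lam (star u))) → ℝ) →ₗ[ℝ]
      (Fin (Module.finrank ℝ (eigenSpace lam (edge u v))) → ℝ) where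
  toFun := edgeOfStar b u v hv
  map_add' y z := by
    funext j
    rw [Pi.add_apply, edgeOfStar, edgeOfStar, edgeOfStar, coordsOf, coordsOf, coordsOf,
      ← inner_add_right]
    congr 1
    ext w
    simp [ofCoords_add]
  map_smul' t z := by
    funext j
    rw [Pi.smul_apply, edgeOfStar, edgeOfStar, coordsOf, coordsOf, RingHom.id_apply, smul_eq_mul,
      ← inner_smul_right]
    congr 1
    ext w
    simp [ofCoords_smul]

/-- Arbitrary values at the endpoints of an edge extend to a local solution on the star, because
the centre has another neighbour. -/
theorem surjective_edgeOfStar (hd : IsExpandingDegreeMatrix d) (ho : ∀ i, (o i).type = i)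
    {u v : TreeVertex d r} (hv : v ∈ nbrs u) : Function.Surjective (edgeOfStar b u v hv) := by
  classical
  intro z
  obtain ⟨w, hw, hwv⟩ := exists_mem_nbrs_ne hd ho u v
  have huv : v ≠ u := fun h => notMem_nbrs_self u (by rw [h] at hv; exact hv)
  have huw : w ≠ u := fun h => notMem_nbrs_self u (by rw [h] at hw; exact hw)
  let y := ofCoords b (edge u v) z
  let s : ℝ := y ⟨u, mem_edge.2 (Or.inl rfl)⟩
  let t : ℝ := y ⟨v, mem_edge.2 (Or.inr rfl)⟩
  let X : TreeVertex d r → ℝ := fun x =>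
    if x = u then s else if x = v then t else if x = w then lam * s - t else 0
  have hXu : X u = s := if_pos rfl
  have hXv : X v = t := by simp [X, huv]
  have hsum : lam * X u = ∑ x ∈ nbrs u, X x := by
    have h1 : ∀ x ∈ nbrs u, X x = (if x = v then t else 0) + if x = w then lam * s - t else 0 := by
      intro x hx
      have h2 : x ≠ u := fun h => notMem_nbrs_self u (by rw [h] at hx; exact hx)
      rcases eq_or_ne x v with rfl | h3
      · simp [X, h2, hwv.symm]
      · simp [X, h2, h3]
    rw [Finset.sum_congr rfl h1, Finset.sum_add_distrib, Finset.sum_ite_eq', Finset.sum_ite_eq',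
      if_pos hv, if_pos hw, hXu]
    ring
  refine ⟨eigenCoords b (star u) X, ?_⟩
  rw [← eigenCoords_edge_eq b hv (restrictTo_mem_eigenSpace_star hd ho hsum)]
  have h1 : restrictTo (edge u v) X = y := by
    ext x
    obtain ⟨x, hx⟩ := x
    rcases mem_edge.1 hx with rfl | rfl
    · exact hXu
    · exact hXv
  funext j
  have h2 : eigenCoords b (edge u v) X j =
      inner ℝ ((b (edge u v) j : eigenSpace lam (edge u v)) : EuclideanSpace ℝ (edge u v)) y := by
    rw [← h1]
    rfl
  rw [h2]
  simp only [y, ofCoords, inner_sum, inner_smul_right, ← Submodule.coe_inner]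
  have h3 := orthonormal_iff_ite.1 (b (edge u v)).orthonormal
  simp [h3]

/-- The law on an edge is a linear image of the law on the star, and has finite entropy as well. -/
theorem hasFiniteEntropy_edge (hd : IsExpandingDegreeMatrix d) (ho : ∀ i, (o i).type = i)
    (hμ : IsEigenvectorLaw lam μ) {u v : TreeVertex d r} (hv : v ∈ nbrs u)
    (h : HasFiniteEntropy volume (μ.map (eigenCoords b (star u)))) :
    HasFiniteEntropy volume (μ.map (eigenCoords b (edge u v))) := by
  have hm := measurable_eigenCoords b (star u)
  have := Measure.isProbabilityMeasure_map (μ := μ) hm.aemeasurable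
  have h1 := h.map_linear (n := volume) (integrable_norm_eigenCoords b hμ _)
    (M := edgeOfStarLinear b u v hv) (surjective_edgeOfStar b hd ho hv)
  have hM : Measurable (edgeOfStarLinear b u v hv) :=
    (LinearMap.continuous_of_finiteDimensional _).measurable
  rw [Measure.map_map hM hm] at h1
  have h2 : μ.map (eigenCoords b (edge u v)) =
      μ.map (edgeOfStarLinear b u v hv ∘ eigenCoords b (star u)) :=
    Measure.map_congr ((ae_restrictTo_mem_eigenSpace_star hd ho hμ u).mono fun X hX =>
      eigenCoords_edge_eq b hv hX)
  rwa [h2]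

theorem ofReal_sum_le {ι : Type*} (s : Finset ι) (f : ι → ℝ) :
    ENNReal.ofReal (∑ i ∈ s, f i) ≤ ∑ i ∈ s, ENNReal.ofReal (f i) :=
  Finset.le_sum_of_subadditive _ ENNReal.ofReal_zero.le (fun _ _ => ENNReal.ofReal_add_le) _ _

/-- The entropy inequality for noisy cells, in terms of codes for the stars and of the differential
entropies of the edges. At a root of degree `D` the star contributes `(D + 1) log a + log η`, the
`D` edges contribute `D log a` after division by `2`, and the noise at the root `log a + log η`:
these terms cancel. -/
theorem IsTypical.code_nonneg (hμ : IsTypical μ) (hd : IsExpandingDegreeMatrix d)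
    (hq : IsRootLaw d q) (ho : ∀ i, (o i).type = i) (heig : IsEigenvectorLaw lam μ)
    (hfin : ∀ i, HasFiniteEntropy volume (μ.map (eigenCoords b (star (o i)))))
    {ℓ : ∀ i, (Fin (Module.finrank ℝ (eigenSpace lam (star (o i)))) → ℝ) → ℝ} {K : Fin k → ℝ}
    {ε : ℝ} (hK : ∀ i, 0 ≤ K i) (hℓm : ∀ i, Measurable (ℓ i))
    (hℓ : ∀ i, Integrable (ℓ i) (μ.map (eigenCoords b (star (o i)))))
    (hℓ1 : ∀ i, (∫⁻ x, ENNReal.ofReal (Real.exp (-ℓ i x))) ≤ 1)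
    (hosc : ∀ i x y, ℓ i x ≤ ℓ i y + ε + K i * ‖x - y‖) {a η : ℝ} (ha : 0 < a) (hη : 0 < η) :
    0 ≤ ∑ i, q i * (∫ z, ℓ i z ∂(μ.map (eigenCoords b (star (o i)))) + ε +
      (K i * η + (star (o i)).card / (a * η)) *
        ((star (o i)).card * ∫ t, |t| ∂(gaussianReal 0 1)) +
      K i * ((star (o i)).card / a) + ((star (o i)).card / (a * η)) ^ 2 / 2 -
      1 / 2 * ∑ v ∈ nbrs (o i), differentialEntropy volume (μ.map (eigenCoords b (edge (o i) v)))) := by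
  have hstar := fun i => shannon_randomizedMarginal_le b
    (by rw [card_star, finrank_eigenSpace_star hd ho])
    (ae_restrictTo_mem_eigenSpace_star hd ho heig (o i)) (hK i) (hℓm i) (hℓ i) (hℓ1 i) (hosc i) ha hη
  choose x hx0 hx hxeq using hstar
  have hedge : ∀ i, ∀ v ∈ nbrs (o i), ENNReal.ofReal (2 * Real.log a +
      differentialEntropy volume (μ.map (eigenCoords b (edge (o i) v)))) ≤
      shannon (randomizedMarginal (noisyCell a η) (gaussianReal 0 1) μ (edge (o i) v)) := by
    intro i v hv
    have h := le_shannon_randomizedMarginal b (eigenSpace_edge hd ho hv)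
      (hasFiniteEntropy_edge b hd ho heig hv (hfin i)) ha η
    rwa [card_edge hv, Nat.cast_ofNat] at h
  have hcond : ∀ i, ENNReal.ofReal (Real.log a + Real.log η + gaussianEntropy) ≤
      ∫⁻ X, shannon ((gaussianReal 0 1).map fun u => noisyCell a η (X (o i), u)) ∂μ := fun i => by
    calc ENNReal.ofReal (Real.log a + Real.log η + gaussianEntropy)
        = ∫⁻ _, ENNReal.ofReal (Real.log a + Real.log η + gaussianEntropy) ∂μ := by simp
      _ ≤ _ := lintegral_mono fun X => le_shannon_noisyCell ha hη _
  have key := hμ.sum_randomized_edge_le_sum_star (γ := gaussianReal 0 1) hd hq ho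
    (measurable_noisyCell a η)
  set y : Fin k → ℝ := fun i => Real.log a + Real.log η + gaussianEntropy +
    1 / 2 * ∑ v ∈ nbrs (o i), (2 * Real.log a +
      differentialEntropy volume (μ.map (eigenCoords b (edge (o i) v)))) with hy
  have hlow : ENNReal.ofReal (∑ i, q i * y i) ≤ ENNReal.ofReal (∑ i, q i * x i) := by
    rw [ENNReal.ofReal_sum_of_nonneg fun i _ => mul_nonneg (hq.nonneg i) (hx0 i)]
    refine (ofReal_sum_le _ _).trans (le_trans ?_ (key.trans ?_))
    · refine Finset.sum_le_sum fun i _ => ?_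
      rw [ENNReal.ofReal_mul (hq.nonneg i)]
      gcongr
      refine ENNReal.ofReal_add_le.trans (add_le_add (hcond i) ?_)
      rw [ENNReal.ofReal_mul (by norm_num), show ENNReal.ofReal (1 / 2) = 2⁻¹ by
        rw [one_div, ENNReal.ofReal_inv_of_pos two_pos, ENNReal.ofReal_ofNat]]
      gcongr
      exact (ofReal_sum_le _ _).trans (Finset.sum_le_sum fun v hv => hedge i v hv)
    · refine Finset.sum_le_sum fun i _ => ?_
      rw [ENNReal.ofReal_mul (hq.nonneg i)]
      gcongr
      exact hx i
  rw [ENNReal.ofReal_le_ofReal_iff (Finset.sum_nonneg fun i _ =>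
    mul_nonneg (hq.nonneg i) (hx0 i))] at hlow
  rw [← sub_nonneg, ← Finset.sum_sub_distrib] at hlow
  refine hlow.trans (le_of_eq (Finset.sum_congr rfl fun i _ => ?_))
  rw [hxeq i, hy, ← mul_sub]
  congr 1
  simp only [Finset.sum_add_distrib, Finset.sum_const, nsmul_eq_mul]
  have h1 : ((star (o i)).card : ℝ) = (nbrs (o i)).card + 1 := by
    rw [card_star]; push_cast; rfl
  have h2 : ((star (o i)).card : ℝ) * Real.log a = (nbrs (o i)).card * Real.log a + Real.log a := by
    rw [h1]; ring
  rw [h2]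
  ring

/-- The limit of the entropy defect, for eigenvector processes whose laws on stars have a density: it
is the defect of the differential entropies, because a star of degree `D` has dimension `D` and an
edge has dimension `2`. -/
theorem IsTypical.exists_tendsto_of_density (hμ : IsTypical μ) (hd : IsExpandingDegreeMatrix d)
    (hq : IsRootLaw d q) (ho : ∀ i, (o i).type = i) (heig : IsEigenvectorLaw lam μ)
    (hdens : ∀ i, HasFiniteDifferentialEntropy (μ.map (eigenCoords b (star (o i))))) :
    ∃ L : ℝ, 0 ≤ L ∧ Tendsto (fun a : ℝ => entropyDefect q o
      (fun Γ => shannon (scaleMarginal b a μ Γ))) atTop (𝓝 L) := by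
  have hprob : ∀ Γ, IsProbabilityMeasure (μ.map (eigenCoords b Γ)) := fun Γ =>
    Measure.isProbabilityMeasure_map (measurable_eigenCoords b Γ).aemeasurable
  have hint := integrable_norm_eigenCoords b heig
  have hfin := fun i => hasFiniteEntropy_of_negMulLog (hdens i)
  have hedge := fun i v (hv : v ∈ nbrs (o i)) => hasFiniteEntropy_edge b hd ho heig hv (hfin i)
  let h : Finset (TreeVertex d r) → ℝ := fun Γ => differentialEntropy volume (μ.map (eigenCoords b Γ))
  refine ⟨∑ i, q i * (h (star (o i)) - 1 / 2 * ∑ v ∈ nbrs (o i), h (edge (o i) v)), ?_, ?_⟩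
  · have hE : ∀ ε > 0, 0 ≤ ∑ i, q i * (h (star (o i)) + 2 * ε -
        1 / 2 * ∑ v ∈ nbrs (o i), h (edge (o i) v)) := by
      intro ε hε
      choose ℓ K hK hℓm hℓ hℓ1 hosc hle using fun i => (hfin i).exists_code (hint (star (o i))) hε
      let N : Fin k → ℝ := fun i => (star (o i)).card
      let m1 := ∫ t, |t| ∂(gaussianReal 0 1)
      -- the scale `a = η⁻²` makes all the error terms vanish as `η → 0`
      let f : ℝ → ℝ := fun η => ∑ i, q i * (∫ z, ℓ i z ∂(μ.map (eigenCoords b (star (o i)))) + ε +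
        (K i * η + N i * η) * (N i * m1) + K i * (N i * η ^ 2) + (N i * η) ^ 2 / 2 -
        1 / 2 * ∑ v ∈ nbrs (o i), h (edge (o i) v))
      have hf : ∀ η > 0, 0 ≤ f η := by
        intro η hη
        have h1 := hμ.code_nonneg b hd hq ho heig hfin hK hℓm hℓ hℓ1 hosc
          (by positivity : 0 < (η ^ 2)⁻¹) hη
        have h2 : (η ^ 2)⁻¹ * η = η⁻¹ := by field_simp
        simp only [h2, div_inv_eq_mul] at h1
        exact h1
      have hcont : Continuous f := by fun_prop
      have h0 : 0 ≤ f 0 := by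
        refine ge_of_tendsto ((hcont.tendsto 0).mono_left nhdsWithin_le_nhds)
          (f := f) (x := 𝓝[>] 0) ?_
        filter_upwards [self_mem_nhdsWithin] with η hη using hf η hη
      refine h0.trans (Finset.sum_le_sum fun i _ => mul_le_mul_of_nonneg_left ?_ (hq.nonneg i))
      have := hle i
      simp only [h]
      simp only [mul_zero, add_zero, zero_mul, ne_eq, OfNat.ofNat_ne_zero, not_false_eq_true,
        zero_pow, zero_div]
      linarith
    let F : ℝ → ℝ := fun ε => ∑ i, q i * (h (star (o i)) + 2 * ε -
      1 / 2 * ∑ v ∈ nbrs (o i), h (edge (o i) v))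
    have hF : Continuous F := by fun_prop
    have h0 : 0 ≤ F 0 := by
      refine ge_of_tendsto (f := F) (x := 𝓝[>] 0) ((hF.tendsto 0).mono_left nhdsWithin_le_nhds) ?_
      filter_upwards [self_mem_nhdsWithin] with ε hε using hE ε hε
    simpa [F] using h0
  · have hs : ∀ i, Tendsto (fun a : ℝ => (shannon (scaleMarginal b a μ (star (o i)))).toReal -
        (nbrs (o i)).card * Real.log a) atTop (𝓝 (h (star (o i)))) := by
      intro i
      refine (tendsto_shannon_cellOf_sub (hfin i) (hint _)).congr' ?_
      filter_upwards [eventually_gt_atTop 0] with a ha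
      have h1 : (Module.finrank ℝ (eigenSpace lam (star (o i))) : ℝ) = (nbrs (o i)).card := by
        rw [finrank_eigenSpace_star hd ho]
      rw [shannon_scaleMarginal b ha, Fintype.card_fin, h1]
    have he : ∀ i, ∀ v ∈ nbrs (o i), Tendsto (fun a : ℝ =>
        (shannon (scaleMarginal b a μ (edge (o i) v))).toReal - 2 * Real.log a) atTop
        (𝓝 (h (edge (o i) v))) := by
      intro i v hv
      refine (tendsto_shannon_cellOf_sub (hedge i v hv) (hint _)).congr' ?_
      filter_upwards [eventually_gt_atTop 0] with a ha
      have h1 : (Module.finrank ℝ (eigenSpace lam (edge (o i) v)) : ℝ) = 2 := by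
        rw [finrank_eigenSpace_edge hd ho hv, Nat.cast_ofNat]
      rw [shannon_scaleMarginal b ha, Fintype.card_fin, h1]
    refine (tendsto_finsetSum Finset.univ fun i _ => ((hs i).sub ((tendsto_finsetSum
      (nbrs (o i)) fun v hv => he i v hv).const_mul (1 / 2))).const_mul (q i)).congr fun a => ?_
    unfold entropyDefect
    refine Finset.sum_congr rfl fun i _ => ?_
    rw [Finset.sum_sub_distrib, Finset.sum_const, nsmul_eq_mul]
    ring

end Density

end ConfigModel

theorem mainTheorem6 {k : ℕ} (d : Matrix (Fin k) (Fin k) ℕ)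
    (hd : ConfigModel.IsExpandingDegreeMatrix d)
    -- the type of the base vertex of the universal cover
    (r : Fin k)
    -- the law of the type of the root, and a vertex of each type
    (q : Fin k → ℝ) (hq : ConfigModel.IsRootLaw d q)
    (o : Fin k → ConfigModel.TreeVertex d r) (ho : ∀ i, (o i).type = i) :
    -- general label spaces, discretized by an arbitrary countable Borel partition
    (∀ (Y : Type*) [TopologicalSpace Y] [TopologicalSpace.SeparableSpace Y]
      [TopologicalSpace.MetrizableSpace Y] [MeasurableSpace Y] [BorelSpace Y]
      (μ : Measure (ConfigModel.TreeVertex d r → Y)) [IsProbabilityMeasure μ],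
      ConfigModel.IsTypical μ →
      ∀ c : Y → ℕ, Measurable c →
        (∀ u, ConfigModel.shannon (μ.map fun X => c (X u)) ≠ ⊤) →
        0 ≤ ConfigModel.entropyDefect q o
          (fun Γ => ConfigModel.shannon (ConfigModel.partitionMarginal c μ Γ))) ∧
    -- eigenvector processes, discretized at scale `a → ∞` in the space of local solutions
    (∀ (lam : ℝ) (b : ConfigModel.EigenBases d r lam)
      (μ : Measure (ConfigModel.TreeVertex d r → ℝ)) [IsProbabilityMeasure μ],
      ConfigModel.IsTypical μ →
      ConfigModel.IsEigenvectorLaw lam μ →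
      ((∀ i, ConfigModel.HasFiniteDifferentialEntropy
          (μ.map (ConfigModel.eigenCoords b (ConfigModel.star (o i))))) ∨
        (∀ i, ConfigModel.IsDiscreteWithFiniteEntropy
          (μ.map (ConfigModel.eigenCoords b (ConfigModel.star (o i)))))) →
      ∃ L : ℝ, 0 ≤ L ∧
        Tendsto (fun a : ℝ => ConfigModel.entropyDefect q o
          (fun Γ => ConfigModel.shannon (ConfigModel.scaleMarginal b a μ Γ))) atTop (𝓝 L)) := by
  refine ⟨?_, ?_⟩
  · intro Y _ _ _ _ _ μ _ hμ c hc hfin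
    let _ := TopologicalSpace.metrizableSpaceMetric Y
    have : SecondCountableTopology Y := UniformSpace.secondCountable_of_separable Y
    exact hμ.entropyDefect_partition_nonneg hd hq ho hc fun i u _ => hfin u
  · rintro lam b μ _ hμ heig (hdens | hdisc)
    · exact hμ.exists_tendsto_of_density b hd hq ho heig hdens
    · exact hμ.exists_tendsto_of_discrete b hd hq ho heig hdisc
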